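/- **Setting.** Let $n\ge 1$. All series are formal power series in $(z,\bar z,u)$, $z\in\mathbb C^n$, $u\in\mathbb R$, with complex coefficients; $\overline{p}$ denotes the conjugate series (coefficients conjugated, $z$ and $\bar z$ exchanged), and $p$ is real if $\overline p=p$. For a series $p$ let $p_{z^a\bar z^bu^c}$ denote the multihomogeneous polynomial $\sum p_{z_{i_1}\cdots z_{i_a}\bar z_{j_1}\cdots\bar z_{j_b}u^c}(0)\,z_{i_1}\cdots z_{i_a}\bar z_{j_1}\cdots\bar z_{j_b}u^c$ (sum over all collections of indices). A *formal almost CR structure (of hypersurface type)* on $\mathbb C^n\times\mathbb R$ is a formal power series map $L=(L^{\bar z},L^w)(z,\bar z,u)\colon\mathbb C^n_z\to\mathbb C^n_{\bar z}\times\mathbb C_w$ without constant terms; its bundle $H^{1,0}$ is the graph of $L$, spanned by the fields $X_\xi=(\xi,L\xi)$, $\xi\in\mathbb C^n$ constant, where $\mathbb C_w$ is the complexified $\partial/\partial u$-direction. Thus $H_0=\mathbb C^n\times\{0\}$. Its Levi form and the transversal part of its non-integrability tensor at $0$ are $\mathcal L(\xi,\eta)=\frac1{2i}\,[\overline{X_\xi},X_\eta]^w(0)$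 and $\mathcal N^w(\xi,\eta)=[X_\xi,X_\eta]^w(0)$. The structure is *strongly nondegenerate* if $\mathcal L(\xi,\cdot)=0$ only for $\xi=0$, and $6i\,\mathcal L(\xi,\cdot)+\mathcal N^w(\xi,\cdot)=0$ only for $\xi=0$. Put $\widetilde L=(\widetilde L^{\bar z},\widetilde L^w)=L\,e$ with the Euler field $e=\sum_j z_j\frac{\partial}{\partial z_j}$. Let $\mathbf{tr}=\sum_{j,k}c^{jk}\frac{\partial^2}{\partial\bar z_j\partial z_k}$ be the trace operator of the Levi form $\sum c_{jk}\bar z_jz_k$ of the structure at $0$, where $\sum_k c^{jk}c_{lk}=\delta_{jl}$ (when $\mathcal L$ is $\sum_j\varepsilon_j|z_j|^2$, this is $\sum_j\varepsilon_j\frac{\partial^2}{\partial z_j\partial\bar z_j}$). Fix $s$ and put $\varepsilon_j=-1$ for $j\le s$, $\varepsilon_j=1$ for $j>s$. An *extended adapted frame* of $L$ at $0$ consists of a $\mathbb C$-basis $v_1,\dots,v_n$ of $H_0\cong\mathbb C^n$, a vector $v_{n+1}\in T_0\setminus H_0$, $T_0=\mathbb C^n\times\mathbb R$, such that $\mathcal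 L(v_j,v_k)=\varepsilon_j\delta_{jk}[v_{n+1}]$ in $\mathbb C\otimes (T_0/H_0)$, and a class $[\Lambda]$ of $2$-jets of curves $\gamma\colon(\mathbb R,0)\to(\mathbb C^n\times\mathbb R,0)$ with $\gamma'(0)=v_{n+1}$, two such jets being equivalent if their second derivatives at $0$ differ by an element of $H_0$. The *standard* extended adapted frame is $\frac{\partial}{\partial x_1},\dots,\frac{\partial}{\partial x_n},\frac{\partial}{\partial u}$ ($z=x+iy$) with the class of $\gamma(t)=(0,t)$. A *formal map* is a series $h=(f,g)(z,\bar z,u)$ without constant terms, with $f$ valued in $\mathbb C^n$ and $g$ real. It *transforms $L$ into $L'$* if $h_*X_\xi$ lies in the graph of $L'\circ h$ for all $\xi$. * $L'$ is in *intrinsic normal form* if for all $a,b,c\ge0$ $$\widetilde L'^{\bar z}_{z^a\bar z^bu^c}=0,\quad \widetilde L'^{w}_{z^a\bar z^bu^c}+\overline{\widetilde L'^{w}_{z^b\bar z^au^c}}=0,\quad \widetilde L'^{w}_{z\bar zu^{c+1}}=0,\quad \widetilde L'^{w}_{z^{a+2}\bar zu^{c}}=0,$$ $$\mathbf{tr}\,\widetilde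 L'^{w}_{z^2\bar z^2u^c}=0,\quad \mathbf{tr}^2\,\widetilde L'^{w}_{z^3\bar z^2u^c}=0,\quad \mathbf{tr}^3\,\widetilde L'^{w}_{z^3\bar z^3u^c}=0 .$$ * $h$ *realizes a normalized quasi CR embedding* of $L$ as the hypersurface $\operatorname{Im}w'=\varphi(z',\bar z',\operatorname{Re}w')$ if it transforms $L$ into some structure $L'$, $\varphi$ is a real series without constant and linear terms, $\widetilde L'=\widetilde{L_\varphi}$ for the structure $L_\varphi$ induced on the hypersurface by its embedding in $\mathbb C^{n+1}$ (with $z'$ and $u'=\operatorname{Re}w'$ as intrinsic coordinates), and for all $a,c\ge0$ $$\varphi_{z^au^c}=0,\quad\varphi_{z\bar zu^{c+1}}=0,\quad\varphi_{z^{a+2}\bar zu^c}=0,\quad\mathbf{tr}\,\varphi_{z^2\bar z^2u^c}=0,\quad\mathbf{tr}^2\varphi_{z^3\bar z^2u^c}=0,\quad\mathbf{tr}^3\varphi_{z^3\bar z^3u^c}=0,$$ with $\mathbf{tr}$ taken with respect to the Levi form of $L'$. **Theorem.** Let $L$ be a strongly nondegenerate formal almost CR structure of hypersurface type on $\mathbb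 C^n\times\mathbb R$, $n\ge1$, with a given extended adapted frame at $0$. Then: (i) There exists a unique formal map $h$ that transforms the given extended adapted frame into the standard one and $L$ into a structure $L'$ in intrinsic normal form. (ii) There exists a unique formal map $h$ that transforms the given extended adapted frame into the standard one and realizes a normalized quasi CR embedding of $L$ as a hypersurface $\operatorname{Im}w'=\varphi(z',\bar z',\operatorname{Re}w')$. Furthermore, in each of (i) and (ii), each partial derivative at $0$ of $h$ and $L'$ (and of $\varphi$ in (ii)) is given by a universal real-analytic function of finitely many partial derivatives of $L$ at $0$ and of the components of the extended adapted frame (the components of $v_1,\dots,v_{n+1}$ and the common $u$-component of $\gamma''(0)$ for the jets in $[\Lambda]$). That is: for given $n$, $s$ and order of derivative there is one such function for all $L$ and all frames, and it is real-analytic on a neighbourhood of the set of all values of these data at strongly nondegenerate structures with extended adapted frames. -/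

import Mathlib

open scoped ComplexConjugate

noncomputable section

namespace AlmostCR

/-! ### Formal power series in `(z, z̄, u)` -/

/-- The variables `z₁, …, zₙ`, `z̄₁, …, z̄ₙ`, `u`. -/
abbrev Var (n : ℕ) : Type := Fin n ⊕ Fin n ⊕ Unit

/-- The variable `z_j`. -/
abbrev zv {n : ℕ} (j : Fin n) : Var n := Sum.inl j

/-- The variable `z̄_j`. -/
abbrev zbv {n : ℕ} (j : Fin n) : Var n := Sum.inr (Sum.inl j)

/-- The variable `u`. -/
abbrev uv {n : ℕ} : Var n := Sum.inr (Sum.inr ())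

/-- Complex-valued formal power series in `(z, z̄, u)` on `ℂⁿ × ℝ`. -/
abbrev Ser (n : ℕ) : Type := MvPowerSeries (Var n) ℂ

/-- The involution exchanging `z_j` and `z̄_j` and fixing `u`. -/
def conjVar (n : ℕ) : Var n ≃ Var n where
  toFun
    | Sum.inl j => Sum.inr (Sum.inl j)
    | Sum.inr (Sum.inl j) => Sum.inl j
    | Sum.inr (Sum.inr t) => Sum.inr (Sum.inr t)
  invFun
    | Sum.inl j => Sum.inr (Sum.inl j)
    | Sum.inr (Sum.inl j) => Sum.inl j
    | Sum.inr (Sum.inr t) => Sum.inr (Sum.inr t)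
  left_inv := by rintro (j | j | j) <;> rfl
  right_inv := by rintro (j | j | j) <;> rfl

/-- The complex conjugate of a formal power series: coefficients are conjugated and the roles of
`z` and `z̄` are exchanged (the real variable `u` is kept). -/
def Ser.bar {n : ℕ} (p : Ser n) : Ser n :=
  fun m => conj (MvPowerSeries.coeff (m.equivMapDomain (conjVar n)) p)

/-- Real-valued formal power series. -/
def Ser.IsReal {n : ℕ} (p : Ser n) : Prop := p.bar = p

/-- The partial derivative at `0` of multi-order `m`. -/
def Ser.partialAt {n : ℕ} (m : Var n →₀ ℕ) (p : Ser n) : ℂ :=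
  (m.prod fun _ k => (Nat.factorial k : ℂ)) * MvPowerSeries.coeff m p

/-- The multihomogeneous polynomial `p_{z^a z̄^b u^c}` in `(z, z̄, u)` given by the derivative at `0`
of order `a` in `z`, `b` in `z̄` and `c` in `u`, i.e. the sum over all collections of indices of
`p_{z_{i₁} … z_{i_a} z̄_{j₁} … z̄_{j_b} u^c}(0) z_{i₁} ⋯ z_{i_a} z̄_{j₁} ⋯ z̄_{j_b} u^c`.
It equals `a! b! c!` times the component of `p` of multidegree `(a, b, c)`. -/
def Ser.hder {n : ℕ} (a b c : ℕ) (p : Ser n) : Ser n :=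
  fun m =>
    if (∑ j, m (zv j)) = a ∧ (∑ j, m (zbv j)) = b ∧ m uv = c then
      ((Nat.factorial a * Nat.factorial b * Nat.factorial c : ℕ) : ℂ) * MvPowerSeries.coeff m p
    else 0

/-! ### Formal complex vector fields -/

/-- Formal complex vector fields, through their components along
`∂/∂z_j`, `∂/∂z̄_j`, `∂/∂u`. -/
abbrev VF (n : ℕ) : Type := Var n → Ser n

/-- The derivative `X p` of a series `p` along the vector field `X`. -/
def VF.app {n : ℕ} (X : VF n) (p : Ser n) : Ser n :=
  ∑ i, X i * MvPowerSeries.pderiv ℂ i p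

/-- The Lie bracket `[X, Y]`. -/
def VF.bracket {n : ℕ} (X Y : VF n) : VF n := fun i => X.app (Y i) - Y.app (X i)

/-- The complex conjugate vector field. -/
def VF.bar {n : ℕ} (X : VF n) : VF n := fun i => (X (conjVar n i)).bar

/-! ### Formal almost CR structures of hypersurface type -/

/-- A formal almost CR structure on `ℂⁿ × ℝ` of hypersurface type (CR dimension `n`), given by a
formal map `L(z, z̄, u) : ℂⁿ_z → ℂⁿ_z̄ × ℂ_w` without constant terms whose graph is `H^{1,0}`.
`zbar k j` is the `z̄_k`-component and `w j` the `w`-component of `L(∂/∂z_j)`. -/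
@[ext]
structure FormalACR (n : ℕ) where
  zbar : Fin n → Fin n → Ser n
  w : Fin n → Ser n
  zbar_zero : ∀ k j, MvPowerSeries.constantCoeff (zbar k j) = 0
  w_zero : ∀ j, MvPowerSeries.constantCoeff (w j) = 0

namespace FormalACR

variable {n : ℕ}

/-- The `(1,0)` vector field `(ξ, L ξ)` for a constant vector `ξ ∈ ℂⁿ`. -/
def field (L : FormalACR n) (ξ : Fin n → ℂ) : VF n
  | Sum.inl j => MvPowerSeries.C (ξ j)
  | Sum.inr (Sum.inl k) => ∑ j, MvPowerSeries.C (ξ j) * L.zbar k j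
  | Sum.inr (Sum.inr _) => ∑ j, MvPowerSeries.C (ξ j) * L.w j

/-- The Levi form at `0`: `𝓛(ξ, η) = (1/2i) π [X̄, Y]` with `X = (ξ, L ξ)`, `Y = (η, L η)` and `π`
the projection of `ℂT₀` to `ℂT₀ / ℂH₀ = ℂ_w`.  It is conjugate-linear in `ξ` and linear in `η`;
the vector `ξ ∈ ℂⁿ ≅ H₀` corresponds to `∑ ξ_j ∂/∂z_j ∈ H^{1,0}₀`. -/
def levi (L : FormalACR n) (ξ η : Fin n → ℂ) : ℂ :=
  (1 / (2 * Complex.I)) *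
    MvPowerSeries.constantCoeff (VF.bracket (VF.bar (L.field ξ)) (L.field η) uv)

/-- The transversal (`w`-)component at `0` of the non-integrability tensor:
`𝓝^w(ξ, η) = π [X, Y]` with `X = (ξ, L ξ)`, `Y = (η, L η)`. -/
def nonintW (L : FormalACR n) (ξ η : Fin n → ℂ) : ℂ :=
  MvPowerSeries.constantCoeff (VF.bracket (L.field ξ) (L.field η) uv)

/-- Strong nondegeneracy (at `0`): both the Levi form and `6i𝓛 + 𝓝^w` are nondegenerate. -/
def StronglyNondegenerate (L : FormalACR n) : Prop :=
  (∀ ξ, (∀ η, L.levi ξ η = 0) → ξ = 0) ∧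
  (∀ ξ, (∀ η, 6 * Complex.I * L.levi ξ η + L.nonintW ξ η = 0) → ξ = 0)

/-- The `z̄`-component of the evaluation `L̃ = L e(z)` along the Euler field `e = ∑ z_j ∂/∂z_j`. -/
def eulerZbar (L : FormalACR n) (k : Fin n) : Ser n :=
  ∑ j, MvPowerSeries.X (zv j) * L.zbar k j

/-- The `w`-component of the evaluation `L̃ = L e(z)` along the Euler field. -/
def eulerW (L : FormalACR n) : Ser n :=
  ∑ j, MvPowerSeries.X (zv j) * L.w j

/-- Two structures coincide along the Euler vector field. -/
def CoincideAlongEuler (L L' : FormalACR n) : Prop :=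
  L.eulerZbar = L'.eulerZbar ∧ L.eulerW = L'.eulerW

/-- The matrix of the Levi form at `0`: `leviMatrix j k` is the coefficient of `z̄_j z_k`. -/
def leviMatrix (L : FormalACR n) : Matrix (Fin n) (Fin n) ℂ :=
  Matrix.of fun j k => L.levi (Pi.single j 1) (Pi.single k 1)

/-- The trace operator `tr = ∑ c^{jk} ∂²/∂z̄_j∂z_k` associated with the Levi form
`∑ c_{jk} z̄_j z_k` at `0`, where `∑_k c^{jk} c_{lk} = δ_{jl}`. -/
def tr (L : FormalACR n) (p : Ser n) : Ser n :=
  ∑ j, ∑ k, MvPowerSeries.C (L.leviMatrix⁻¹ k j) *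
    MvPowerSeries.pderiv ℂ (zbv j) (MvPowerSeries.pderiv ℂ (zv k) p)

/-- The intrinsic normal form. -/
def IsIntrinsicNormal (L : FormalACR n) : Prop :=
  ∀ a b c : ℕ,
    (∀ k, (L.eulerZbar k).hder a b c = 0) ∧
    L.eulerW.hder a b c + (L.eulerW.hder b a c).bar = 0 ∧
    L.eulerW.hder 1 1 (c + 1) = 0 ∧
    L.eulerW.hder (a + 2) 1 c = 0 ∧
    L.tr (L.eulerW.hder 2 2 c) = 0 ∧
    L.tr (L.tr (L.eulerW.hder 3 2 c)) = 0 ∧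
    L.tr (L.tr (L.tr (L.eulerW.hder 3 3 c))) = 0

/-- `L` is the structure induced on the real hypersurface `Im w = φ(z, z̄, Re w)` of `ℂⁿ⁺¹`, with
`(z, u = Re w)` as intrinsic coordinates: the `(1,0)` fields of `L` are mapped by the embedding
`(z, u) ↦ (z, w) = (z, u + iφ)` to `(1,0)` fields of `ℂⁿ⁺¹`, i.e. they annihilate
the conjugates of the functions `z_k` and `w`. -/
def IsInducedByGraph (L : FormalACR n) (φ : Ser n) : Prop :=
  ∀ ξ, (∀ k, (L.field ξ).app (Ser.bar (MvPowerSeries.X (zv k))) = 0) ∧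
    (L.field ξ).app (Ser.bar (MvPowerSeries.X uv + MvPowerSeries.C Complex.I * φ)) = 0

/-- The Chern–Moser normalization of the function `φ`, with traces taken with respect to the Levi
form of `L`. -/
def IsChernMoser (L : FormalACR n) (φ : Ser n) : Prop :=
  ∀ a c : ℕ,
    φ.hder a 0 c = 0 ∧
    φ.hder 1 1 (c + 1) = 0 ∧
    φ.hder (a + 2) 1 c = 0 ∧
    L.tr (φ.hder 2 2 c) = 0 ∧
    L.tr (L.tr (φ.hder 3 2 c)) = 0 ∧
    L.tr (L.tr (L.tr (φ.hder 3 3 c))) = 0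

end FormalACR

/-! ### Jets of curves and extended adapted frames -/

/-- The tangent space of `ℂⁿ × ℝ` at `0`. -/
abbrev Tangent (n : ℕ) : Type := (Fin n → ℂ) × ℝ

/-- The subspace `H₀ = ℂⁿ × {0}` (the same for all structures `L` without constant terms). -/
def H0 (n : ℕ) : Submodule ℝ (Tangent n) :=
  LinearMap.ker (LinearMap.snd ℝ (Fin n → ℂ) ℝ)

/-- A tangent vector `(ζ, t)` in the coordinates `(z, z̄, u)`: `(ζ, ζ̄, t)`. -/
def Tangent.coords {n : ℕ} (v : Tangent n) : Var n → ℂ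
  | Sum.inl j => v.1 j
  | Sum.inr (Sum.inl j) => conj (v.1 j)
  | Sum.inr (Sum.inr _) => (v.2 : ℂ)

/-- The `2`-jet at `0 ∈ ℝ` of a curve `γ` in `ℂⁿ × ℝ` with `γ(0) = 0`: the pair
`(γ'(0), γ''(0))`. -/
@[ext]
structure CurveJet (n : ℕ) where
  vel : Tangent n
  acc : Tangent n

/-- `H`-equivalence: the same `1`-jet, and the difference of the second derivatives lies in `H₀`. -/
def hSetoid (n : ℕ) : Setoid (CurveJet n) where
  r Λ₁ Λ₂ := Λ₁.vel = Λ₂.vel ∧ Λ₁.acc - Λ₂.acc ∈ H0 n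
  iseqv :=
    { refl := fun Λ => ⟨rfl, by rw [sub_self]; exact (H0 n).zero_mem⟩
      symm := by
        rintro Λ₁ Λ₂ ⟨h, h'⟩
        exact ⟨h.symm, by rw [← neg_sub]; exact (H0 n).neg_mem h'⟩
      trans := by
        rintro Λ₁ Λ₂ Λ₃ ⟨h₁, h₁'⟩ ⟨h₂, h₂'⟩
        exact ⟨h₁.trans h₂, by
          rw [← sub_add_sub_cancel Λ₁.acc Λ₂.acc Λ₃.acc]
          exact (H0 n).add_mem h₁' h₂'⟩ }

/-- `H`-equivalence classes of `2`-jets of curves. -/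
abbrev JetClass (n : ℕ) : Type := Quotient (hSetoid n)

/-- The class of a jet. -/
def CurveJet.toClass {n : ℕ} (Λ : CurveJet n) : JetClass n := Quotient.mk (hSetoid n) Λ

/-- The common velocity of the jets in a class. -/
def JetClass.vel {n : ℕ} (κ : JetClass n) : Tangent n :=
  Quotient.lift (fun Λ : CurveJet n => Λ.vel) (fun _ _ (h : _ ∧ _) => h.1) κ

/-- The common `u`-component of the second derivatives of the jets in a class. -/
def JetClass.accU {n : ℕ} (κ : JetClass n) : ℝ :=
  Quotient.lift (fun Λ : CurveJet n => Λ.acc.2) (fun _ _ (h : _ ∧ _) => sub_eq_zero.mp h.2) κ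

/-- `ε_j = -1` for the first `s` indices and `1` for the others. -/
def eps {n : ℕ} (s : ℕ) (j : Fin n) : ℝ := if j.val < s then -1 else 1

/-- An extended adapted frame at `0` of the structure `L`, of signature `s`: a complex basis
`v₁, …, vₙ` of `H₀ ≅ ℂⁿ`, a vector `v_{n+1} = last` in `T₀ ∖ H₀` with
`𝓛(v_j, v_k) = ε_j δ_{jk} [v_{n+1}]`, and an `H`-equivalence class of `2`-jets of curves with velocity
`v_{n+1}`. -/
structure ExtFrame {n : ℕ} (L : FormalACR n) (s : ℕ) where
  v : Fin n → Fin n → ℂ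
  last : Tangent n
  cls : JetClass n
  linearIndependent : LinearIndependent ℂ v
  last_notMem : last ∉ H0 n
  levi_orthonormal : ∀ j k, L.levi (v j) (v k) = if j = k then (eps s j * last.2 : ℝ) else 0
  cls_vel : cls.vel = last

/-! ### Formal maps -/

/-- A formal map `h = (f, g)(z, z̄, u) ∈ ℂⁿ × ℝ` without constant terms. -/
@[ext]
structure FormalMap (n : ℕ) where
  f : Fin n → Ser n
  g : Ser n
  f_zero : ∀ k, MvPowerSeries.constantCoeff (f k) = 0
  g_zero : MvPowerSeries.constantCoeff g = 0
  g_real : g.IsReal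

namespace FormalMap

variable {n : ℕ}

/-- The components `(f, f̄, g)` of the map, in the coordinates `(z', z̄', u')` of the target. -/
def comp (h : FormalMap n) : Var n → Ser n
  | Sum.inl k => h.f k
  | Sum.inr (Sum.inl k) => (h.f k).bar
  | Sum.inr (Sum.inr _) => h.g

/-- `h` transforms `L` into `L'`: for every `(1,0)` field `X` of `L`, the vector `h_* X`, with
components `(X f, X f̄, X g)`, lies in the graph of `L' ∘ h`. -/
def Transforms (h : FormalMap n) (L L' : FormalACR n) : Prop :=
  ∀ ξ,
    (∀ k, (L.field ξ).app (h.f k).bar =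
      ∑ l, MvPowerSeries.subst h.comp (L'.zbar k l) * (L.field ξ).app (h.f l)) ∧
    (L.field ξ).app h.g =
      ∑ l, MvPowerSeries.subst h.comp (L'.w l) * (L.field ξ).app (h.f l)

/-- First derivative at `0` of a series along a tangent vector. -/
def d1 (p : Ser n) (v : Tangent n) : ℂ :=
  ∑ i, MvPowerSeries.constantCoeff (MvPowerSeries.pderiv ℂ i p) * v.coords i

/-- Second derivative at `0` of a series along a tangent vector. -/
def d2 (p : Ser n) (v : Tangent n) : ℂ :=
  ∑ i, ∑ j, MvPowerSeries.constantCoeff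
    (MvPowerSeries.pderiv ℂ i (MvPowerSeries.pderiv ℂ j p)) * v.coords i * v.coords j

/-- The differential of `h` at `0` (the `u`-component is real since `g` is). -/
def push (h : FormalMap n) (v : Tangent n) : Tangent n :=
  (fun k => d1 (h.f k) v, (d1 h.g v).re)

/-- The induced action on `2`-jets of curves: `(h ∘ γ)' = dh γ'` and
`(h ∘ γ)'' = d²h(γ', γ') + dh γ''` at `0`. -/
def pushJet (h : FormalMap n) (Λ : CurveJet n) : CurveJet n where
  vel := h.push Λ.vel
  acc := (fun k => d2 (h.f k) Λ.vel, (d2 h.g Λ.vel).re) + h.push Λ.acc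

/-- `h` transforms the extended adapted frame into the standard one, which consists of
`∂/∂x₁, …, ∂/∂xₙ`, `∂/∂u` and the class of the curve `t ↦ (0, t)`. -/
def MapsToStandard (h : FormalMap n) {L : FormalACR n} {s : ℕ} (F : ExtFrame L s) : Prop :=
  (∀ j, h.push (F.v j, 0) = (Pi.single j 1, 0)) ∧
  h.push F.last = (0, 1) ∧
  ∀ Λ : CurveJet n, Λ.toClass = F.cls →
    (h.pushJet Λ).toClass = (CurveJet.mk (0, 1) 0).toClass

end FormalMap

/-- `h` transforms the frame into the standard one, and `L` into the structure `L'` in intrinsic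
normal form. -/
def IsIntrinsicNormalization {n s : ℕ} {L : FormalACR n} (F : ExtFrame L s)
    (h : FormalMap n) (L' : FormalACR n) : Prop :=
  h.MapsToStandard F ∧ h.Transforms L L' ∧ L'.IsIntrinsicNormal

/-- `h` transforms the frame into the standard one and realizes a quasi CR embedding of `L` as the
hypersurface `Im w' = φ(z', z̄', Re w')`: the transformed structure `L'` coincides along the Euler
field with the structure induced by the embedding.  Here `φ` is real, has no constant and linear
terms and satisfies the Chern–Moser normalization. -/
def IsExtrinsicNormalization {n s : ℕ} {L : FormalACR n} (F : ExtFrame L s)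
    (h : FormalMap n) (L' : FormalACR n) (φ : Ser n) : Prop :=
  h.MapsToStandard F ∧ h.Transforms L L' ∧
  φ.IsReal ∧ MvPowerSeries.constantCoeff φ = 0 ∧
  (∀ i, MvPowerSeries.coeff (Finsupp.single i 1) φ = 0) ∧
  (∃ Lφ : FormalACR n, Lφ.IsInducedByGraph φ ∧ L'.CoincideAlongEuler Lφ) ∧
  L'.IsChernMoser φ

/-! ### Analytic dependence -/

/-- The space of values of the partial derivatives of `L` of the multi-orders in `S`, together with
the components of an extended frame. -/
abbrev DataSpace (n : ℕ) (S : Finset (Var n →₀ ℕ)) : Type :=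
  ((S → Fin n → Fin n → ℂ) × (S → Fin n → ℂ)) × ((Fin n → Fin n → ℂ) × Tangent n × ℝ)

/-- The partial derivatives at `0` of `L` of the multi-orders in `S`, and the components
of the frame. -/
def dataOf {n s : ℕ} (S : Finset (Var n →₀ ℕ)) {L : FormalACR n} (F : ExtFrame L s) :
    DataSpace n S :=
  ((fun m k j => (L.zbar k j).partialAt m, fun m j => (L.w j).partialAt m),
    (F.v, F.last, F.cls.accU))

/-- The data of all strongly nondegenerate structures with an extended adapted frame of
signature `s`. -/
def admissibleData (n s : ℕ) (S : Finset (Var n →₀ ℕ)) : Set (DataSpace n S) :=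
  {x | ∃ L : FormalACR n, L.StronglyNondegenerate ∧ ∃ F : ExtFrame L s, dataOf S F = x}

/-- The partial derivatives at `0` of multi-order `m` of the components of `h`. -/
def FormalMap.partials {n : ℕ} (m : Var n →₀ ℕ) (h : FormalMap n) : (Fin n → ℂ) × ℂ :=
  (fun k => (h.f k).partialAt m, h.g.partialAt m)

/-- The partial derivatives at `0` of multi-order `m` of the components of `L`. -/
def FormalACR.partials {n : ℕ} (m : Var n →₀ ℕ) (L : FormalACR n) :
    (Fin n → Fin n → ℂ) × (Fin n → ℂ) :=
  (fun k j => (L.zbar k j).partialAt m, fun j => (L.w j).partialAt m)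

end AlmostCR

end

/-! Existence, uniqueness and analytic dependence all come from one fixed-point problem for formal
series, filtered by the weights 1, 1, 2 of z, z̄, u.

Preparation. A quadratic polynomial map q, whose jet at 0 is the given frame, pulls L back to a
model M (`exists_model`). The linear part of the w-component of M consists, up to multiples of u, of
Σ_k B_kl z_k + iε_l z̄_l with B antisymmetric. Second derivatives of the last component of q absorb
everything except the two invariants, the Levi form and N^w. In these coordinates the second half of
strong nondegeneracy says that η ↦ 3iε η̄ - Bη is injective (`Nondeg`). A normalizing map h
corresponds to k = (h ∘ q)⁻¹ = id + (f, g). All normalization conditions concern only the evaluation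
of L' along the Euler field, so it suffices that k maps the single field (z, 0, w-component of L'e)
into the graph of M (`rel_iff`); L' itself is then the transport of L by h. Write φ = ρ + ψ with ρ =
Σ ε_j |z_j|², where φ = -i(L'e)^w in the intrinsic case. Both problems take the form D̄ f =
remainder, D g + i Tψ = Qf + remainder, where D = Σ z_j ∂/∂z_j + iρ ∂/∂u, D̄ is its conjugate, T is
the identity (intrinsic) or D (extrinsic), and Q is `qop`.

Linear problem. A solution of D̄f = 0 is a formal CR function on the quadric, given by its
components f_{a0} of bidegree (a, 0) in (z, z̄). For fixed f and g_{00} the second equation has a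
solution with g, ψ real and ψ_{a0} = 0, and the normalization of ψ is a condition on the right-hand
side alone, the same one for both choices of T (`cond_iff`). These conditions form a triangular
system. Bidegree (1,1) gives the real part of Σ ε_l f_{10,l} z̄_l, and (2,2) the u-derivative of its
imaginary part. Bidegree (2,1) gives f_{20}, and (a,1) with a ≥ 3 gives f_{a0}. Bidegree (3,2) gives
the second u-derivative of f_{00} through the operator of `Nondeg`, and (3,3) the third u-derivative
of g_{00}. Traces strip off powers of ρ because the commutator of trace and ρ is a degree operator
(`trc_rho_mul`). The constants of integration, namely f_{00} modulo u², f_{10} at u = 0 and g_{00}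
modulo u³, are exactly what the extended frame fixes. This gives `lin_unique` and `exists_linSol`.

Nonlinear problem. The linear operators are homogeneous, so by uniqueness a solution has at least
the weight of its right-hand side (`LinSol.mem_wIdeal`). The remainders gain one weight
(`rhsF_sub_mem`, `rhsG_sub_mem`). Hence the iteration converges weight by weight to a unique fixed
point.

Analytic dependence. Every construction is carried out for families whose coefficients lie in an
algebra of functions on the parameter set, closed under conjugation and under inversion of nowhere
vanishing functions (`CoeffAlg`). Taking all framed structures as parameters, and as algebra the
functions that are real-analytic in finitely many data (`univAlg`), existence already contains the
universal formulas. Uniqueness transfers them to every normalization. -/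

open scoped ComplexConjugate

noncomputable section

namespace AlmostCR

open MvPowerSeries

/-- The derivative in `u`. -/
local notation "∂ᵤ" => MvPowerSeries.pderiv ℂ uv

section

/-! ### Weight filtrations of power series and formal substitution -/

section Filtration

variable {σ τ : Type*}

/-- The ideal of all series without monomials of weight less than `k`. -/
def wIdeal (w : σ → ℕ) (k : ℕ) : Ideal (MvPowerSeries σ ℂ) where
  carrier := {p | ∀ m, Finsupp.weight w m < k → coeff m p = 0}
  add_mem' := by
    intro p q hp hq m hm
    rw [map_add, hp m hm, hq m hm, add_zero]
  zero_mem' := by intro m _; exact map_zero _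
  smul_mem' := by
    classical
    intro c p hp m hm
    rw [smul_eq_mul, coeff_mul]
    refine Finset.sum_eq_zero fun x hx => ?_
    rw [Finset.HasAntidiagonal.mem_antidiagonal] at hx
    rw [hp x.2 (lt_of_le_of_lt ?_ hm), mul_zero]
    rw [← hx, map_add]
    exact Nat.le_add_left _ _

variable {w : σ → ℕ} {k l : ℕ} {p q : MvPowerSeries σ ℂ}

theorem wIdeal_mono (h : l ≤ k) (hp : p ∈ wIdeal w k) : p ∈ wIdeal w l :=
  fun m hm => hp m (hm.trans_le h)

theorem mem_wIdeal_zero (p : MvPowerSeries σ ℂ) : p ∈ wIdeal w 0 :=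
  fun _ hm => absurd hm (Nat.not_lt_zero _)

theorem mul_mem_wIdeal (hp : p ∈ wIdeal w k) (hq : q ∈ wIdeal w l) : p * q ∈ wIdeal w (k + l) := by
  classical
  intro m hm
  rw [coeff_mul]
  refine Finset.sum_eq_zero fun x hx => ?_
  rw [Finset.HasAntidiagonal.mem_antidiagonal] at hx
  rw [← hx, map_add] at hm
  by_cases h : Finsupp.weight w x.1 < k
  · rw [hp _ h, zero_mul]
  · rw [hq _ (by omega), mul_zero]

theorem eq_zero_of_forall_mem_wIdeal (h : ∀ k, p ∈ wIdeal w k) : p = 0 := by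
  ext m
  exact h _ m (Nat.lt_succ_self _)

theorem pderiv_mem_wIdeal (i : σ) (hp : p ∈ wIdeal w (k + w i)) :
    pderiv ℂ i p ∈ wIdeal w k := by
  intro m hm
  rw [coeff_pderiv, hp, zero_mul]
  rw [map_add, Finsupp.weight_single, one_smul]
  omega

theorem X_mem_wIdeal (i : σ) : (X i : MvPowerSeries σ ℂ) ∈ wIdeal w (w i) := by
  classical
  intro m hm
  rw [coeff_X, if_neg]
  rintro rfl
  rw [Finsupp.weight_single, one_smul] at hm
  exact lt_irrefl _ hm

theorem mem_wIdeal_one (hw : ∀ i, 1 ≤ w i) (h : constantCoeff p = 0) : p ∈ wIdeal w 1 := by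
  intro m hm
  rw [Nat.lt_one_iff] at hm
  have : m = 0 := by
    ext i
    by_contra hi
    have := Finsupp.le_weight_of_ne_zero' w hi
    have := hw i
    omega
  rw [this, coeff_zero_eq_constantCoeff_apply, h]

theorem constantCoeff_eq_zero_of_mem (h : p ∈ wIdeal w 1) : constantCoeff p = 0 := by
  rw [← coeff_zero_eq_constantCoeff_apply]
  exact h 0 (by simp)

theorem pow_mem_wIdeal (hp : p ∈ wIdeal w k) (e : ℕ) : p ^ e ∈ wIdeal w (e * k) := by
  induction e with
  | zero => rw [zero_mul]; exact mem_wIdeal_zero _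
  | succ e ih =>
    rw [pow_succ, Nat.succ_mul]
    exact mul_mem_wIdeal ih hp

theorem pow_sub_pow_mem_wIdeal {ν : ℕ} (hp : p ∈ wIdeal w k) (hq : q ∈ wIdeal w k)
    (h : p - q ∈ wIdeal w (k + ν)) (e : ℕ) : p ^ e - q ^ e ∈ wIdeal w (e * k + ν) := by
  induction e with
  | zero => simp
  | succ e ih =>
    have : p ^ (e + 1) - q ^ (e + 1) = p ^ e * (p - q) + (p ^ e - q ^ e) * q := by ring
    rw [this]
    refine add_mem (wIdeal_mono ?_ (mul_mem_wIdeal (pow_mem_wIdeal hp e) h))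
      (wIdeal_mono ?_ (mul_mem_wIdeal ih hq)) <;> rw [Nat.succ_mul] <;> omega

theorem prod_mem_wIdeal {ι : Type*} (s : Finset ι) (a : ι → MvPowerSeries σ ℂ) (c : ι → ℕ)
    (ha : ∀ i ∈ s, a i ∈ wIdeal w (c i)) : ∏ i ∈ s, a i ∈ wIdeal w (∑ i ∈ s, c i) := by
  classical
  induction s using Finset.induction_on with
  | empty => exact mem_wIdeal_zero _
  | insert i s hi ih =>
    rw [Finset.prod_insert hi, Finset.sum_insert hi]
    exact mul_mem_wIdeal (ha i (Finset.mem_insert_self _ _))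
      (ih fun j hj => ha j (Finset.mem_insert_of_mem hj))

theorem prod_sub_prod_mem_wIdeal {ι : Type*} {ν : ℕ} (s : Finset ι) (a b : ι → MvPowerSeries σ ℂ)
    (c : ι → ℕ) (ha : ∀ i ∈ s, a i ∈ wIdeal w (c i)) (hb : ∀ i ∈ s, b i ∈ wIdeal w (c i))
    (h : ∀ i ∈ s, a i - b i ∈ wIdeal w (c i + ν)) :
    ∏ i ∈ s, a i - ∏ i ∈ s, b i ∈ wIdeal w (∑ i ∈ s, c i + ν) := by
  classical
  induction s using Finset.induction_on with
  | empty => simp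
  | insert i s hi ih =>
    rw [Finset.prod_insert hi, Finset.prod_insert hi, Finset.sum_insert hi]
    have hs := ih (fun j hj => ha j (Finset.mem_insert_of_mem hj))
      (fun j hj => hb j (Finset.mem_insert_of_mem hj))
      (fun j hj => h j (Finset.mem_insert_of_mem hj))
    have hb' := prod_mem_wIdeal s b c (fun j hj => hb j (Finset.mem_insert_of_mem hj))
    have : a i * ∏ j ∈ s, a j - b i * ∏ j ∈ s, b j
        = a i * (∏ j ∈ s, a j - ∏ j ∈ s, b j) + (a i - b i) * ∏ j ∈ s, b j := by ring
    rw [this]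
    exact add_mem
      (wIdeal_mono (by omega) (mul_mem_wIdeal (ha i (Finset.mem_insert_self _ _)) hs))
      (wIdeal_mono (by omega) (mul_mem_wIdeal (h i (Finset.mem_insert_self _ _)) hb'))

variable {v : τ → ℕ} {a b : σ → MvPowerSeries τ ℂ}

theorem weight_eq_support_sum (d : σ →₀ ℕ) : Finsupp.weight w d = ∑ i ∈ d.support, d i * w i := by
  rw [Finsupp.weight_apply, Finsupp.sum]; rfl

theorem monomial_prod_mem_wIdeal (ha : ∀ i, a i ∈ wIdeal v (w i)) (d : σ →₀ ℕ) :
    d.prod (fun i e => a i ^ e) ∈ wIdeal v (Finsupp.weight w d) := by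
  rw [weight_eq_support_sum]
  exact prod_mem_wIdeal _ _ _ fun i _ => pow_mem_wIdeal (ha i) _

theorem subst_mem_wIdeal (hs : HasSubst a) (ha : ∀ i, a i ∈ wIdeal v (w i))
    (hp : p ∈ wIdeal w k) : subst a p ∈ wIdeal v k := by
  intro m hm
  rw [coeff_subst hs]
  refine finsum_eq_zero_of_forall_eq_zero fun d => ?_
  by_cases hd : Finsupp.weight w d < k
  · rw [hp d hd, zero_smul]
  · rw [monomial_prod_mem_wIdeal ha d m (by omega), smul_zero]

/-- Source of all contraction estimates. If two families of substituted series agree up to ν weights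
beyond the weights of the variables, telescoping each monomial product shows that the results agree
ν weights further than the weight of the substituted series. -/
theorem subst_sub_subst_mem_wIdeal {ν : ℕ} (hsa : HasSubst a) (hsb : HasSubst b)
    (ha : ∀ i, a i ∈ wIdeal v (w i)) (hb : ∀ i, b i ∈ wIdeal v (w i))
    (h : ∀ i, a i - b i ∈ wIdeal v (w i + ν)) (hp : p ∈ wIdeal w k) :
    subst a p - subst b p ∈ wIdeal v (k + ν) := by
  intro m hm
  rw [map_sub, coeff_subst hsa, coeff_subst hsb,
    ← finsum_sub_distrib (coeff_subst_finite hsa p m) (coeff_subst_finite hsb p m)]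
  refine finsum_eq_zero_of_forall_eq_zero fun d => ?_
  by_cases hd : Finsupp.weight w d < k
  · rw [hp d hd, zero_smul, zero_smul, sub_zero]
  · rw [← smul_sub, ← map_sub]
    have := prod_sub_prod_mem_wIdeal (w := v) (ν := ν) d.support (fun i => a i ^ d i)
      (fun i => b i ^ d i) (fun i => d i * w i) (fun i _ => pow_mem_wIdeal (ha i) _)
      (fun i _ => pow_mem_wIdeal (hb i) _)
      (fun i _ => pow_sub_pow_mem_wIdeal (ha i) (hb i) (h i) _)
    rw [← weight_eq_support_sum] at this
    rw [show coeff m (d.prod (fun i e => a i ^ e) - d.prod (fun i e => b i ^ e)) = 0 from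
      this m (by omega), smul_zero]

theorem hasSubst_of_mem [Finite σ] (h : ∀ i, constantCoeff (a i) = 0) : HasSubst a :=
  hasSubst_of_constantCoeff_zero h

theorem mem_wIdeal_one_const {a : σ → MvPowerSeries τ ℂ} (h : ∀ i, constantCoeff (a i) = 0) (i : σ) :
    a i ∈ wIdeal (fun _ : τ => 1) 1 :=
  mem_wIdeal_one (fun _ => le_refl _) (h i)

/-- Chain rule for formal substitutions. -/
theorem pderiv_subst [Fintype σ] [Finite τ] (h : ∀ i, constantCoeff (a i) = 0) (t : τ)
    (p : MvPowerSeries σ ℂ) :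
    pderiv ℂ t (subst a p) = ∑ j, subst a (pderiv ℂ j p) * pderiv ℂ t (a j) := by
  classical
  have hs : HasSubst a := hasSubst_of_mem h
  have hpoly : ∀ P : MvPolynomial σ ℂ, pderiv ℂ t (subst a (P : MvPowerSeries σ ℂ)) =
      ∑ j, subst a (pderiv ℂ j (P : MvPowerSeries σ ℂ)) * pderiv ℂ t (a j) := by
    intro P
    simp only [pderiv_coe, subst_coe]
    induction P using MvPolynomial.induction_on with
    | C c => simp [← MvPowerSeries.c_eq_algebraMap]
    | add P Q hP hQ => simp only [map_add, hP, hQ, add_mul, Finset.sum_add_distrib]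
    | mul_X P i hP =>
      simp only [map_mul, Derivation.leibniz, hP, smul_eq_mul, MvPolynomial.aeval_X, map_add,
        add_mul, Finset.sum_add_distrib, Finset.mul_sum, MvPolynomial.pderiv_X]
      congr 1
      · rw [Finset.sum_eq_single i]
        · simp
        · intro j _ hj
          simp [hj.symm]
        · simp
      · exact Finset.sum_congr rfl fun j _ => by ring
  rw [← sub_eq_zero]
  refine eq_zero_of_forall_mem_wIdeal (w := fun _ => 1) fun N => ?_
  -- The rule is known for polynomials (`hpoly`). The remainder of order at least N + 1 contributes
  -- to both sides only in order at least N, one order being lost to the derivative.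
  set P := truncTotal (N + 1) p
  have hr : p - P ∈ wIdeal (fun _ : σ => 1) (N + 1) := by
    intro m hm
    have hm' : Finsupp.degree m < N + 1 := by rwa [Finsupp.degree_eq_weight_one]
    rw [map_sub, MvPolynomial.coeff_coe, coeff_truncTotal _ hm', sub_self]
  have hsplit : p = (p - P) + P := by ring
  rw [hsplit]
  simp only [map_add, subst_add hs, add_mul, Finset.sum_add_distrib, hpoly]
  rw [add_sub_add_right_eq_sub]
  refine sub_mem ?_ (Submodule.sum_mem _ fun j _ => Ideal.mul_mem_right _ _ ?_)
  · exact pderiv_mem_wIdeal _ (subst_mem_wIdeal hs (mem_wIdeal_one_const h) hr)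
  · exact subst_mem_wIdeal hs (mem_wIdeal_one_const h) (pderiv_mem_wIdeal _ hr)

end Filtration

/-! ### Homogeneous components for weights in a monoid -/

section Grading

variable {σ M : Type*} [AddCancelCommMonoid M] [DecidableEq M]

/-- The component of weight `d` of a series, for weights of the variables in a monoid. -/
def gr (w : σ → M) (d : M) : MvPowerSeries σ ℂ →ₗ[ℂ] MvPowerSeries σ ℂ where
  toFun p := fun m => if Finsupp.weight w m = d then coeff m p else 0
  map_add' p q := by
    ext m
    change (if _ then _ else _ : ℂ) = (if _ then _ else _ : ℂ) + (if _ then _ else _ : ℂ)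
    split_ifs <;> simp
  map_smul' c p := by
    ext m
    change (if _ then _ else _ : ℂ) = c * (if _ then _ else _ : ℂ)
    split_ifs <;> simp

variable {w : σ → M} {d e : M} {p q : MvPowerSeries σ ℂ}

theorem coeff_gr (m : σ →₀ ℕ) :
    coeff m (gr w d p) = if Finsupp.weight w m = d then coeff m p else 0 := rfl

theorem ext_gr (h : ∀ d, gr w d p = gr w d q) : p = q := by
  ext m
  have := congrArg (coeff m) (h (Finsupp.weight w m))
  simpa [coeff_gr] using this

theorem gr_gr_self : gr w d (gr w d p) = gr w d p := by
  ext m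
  simp only [coeff_gr]
  split_ifs <;> rfl

theorem gr_gr_of_ne (h : d ≠ e) : gr w d (gr w e p) = 0 := by
  ext m
  simp only [coeff_gr]
  split_ifs with h1 h2
  · exact absurd (h1.symm.trans h2) h
  · rfl
  · rfl

theorem gr_comm {M' : Type*} [AddCancelCommMonoid M'] [DecidableEq M'] (w' : σ → M') (d' : M') :
    gr w d (gr w' d' p) = gr w' d' (gr w d p) := by
  ext m
  simp only [coeff_gr]
  split_ifs <;> rfl

theorem gr_pderiv (i : σ) : gr w d (pderiv ℂ i p) = pderiv ℂ i (gr w (d + w i) p) := by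
  ext m
  simp only [coeff_gr, coeff_pderiv, map_add, Finsupp.weight_single, one_smul, add_left_inj]
  split_ifs <;> simp

theorem gr_X_mul (i : σ) : gr w (d + w i) (X i * p) = X i * gr w d p := by
  classical
  ext m
  rw [coeff_gr, X, coeff_monomial_mul, coeff_monomial_mul]
  by_cases h : Finsupp.single i 1 ≤ m
  · obtain ⟨m', rfl⟩ := exists_add_of_le h
    rw [if_pos h, if_pos h, add_tsub_cancel_left, map_add, Finsupp.weight_single, one_smul,
      add_comm, coeff_gr]
    simp
  · simp [h]

theorem gr_X_mul_eq_zero (i : σ) (h : ∀ e, e + w i ≠ d) : gr w d (X i * p) = 0 := by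
  classical
  ext m
  rw [coeff_gr, X, coeff_monomial_mul]
  split_ifs with h1 h2
  · obtain ⟨m', rfl⟩ := exists_add_of_le h2
    rw [map_add, Finsupp.weight_single, one_smul, add_comm] at h1
    exact absurd h1 (h _)
  · rfl
  · rfl

theorem gr_C_mul (c : ℂ) : gr w d (C c * p) = C c * gr w d p := by
  rw [← smul_eq_C_mul, map_smul, smul_eq_C_mul]

end Grading

/-! ### Limits in the weight filtration -/

section Limits

variable {σ : Type*} {w : σ → ℕ}

/-- The limit of a sequence of series that stabilizes weight by weight. -/
def limSer (w : σ → ℕ) (P : ℕ → MvPowerSeries σ ℂ) : MvPowerSeries σ ℂ :=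
  fun m => coeff m (P (Finsupp.weight w m + 1))

theorem coeff_limSer (P : ℕ → MvPowerSeries σ ℂ) (m : σ →₀ ℕ) :
    coeff m (limSer w P) = coeff m (P (Finsupp.weight w m + 1)) := rfl

/-- From index `weight m + 1` on, all increments have weight larger than that of m, so the
coefficient of m is already stationary at the index where `limSer` reads it. -/
theorem limSer_sub_mem (P : ℕ → MvPowerSeries σ ℂ) (c : ℕ)
    (h : ∀ k, P (k + 1) - P k ∈ wIdeal w (c + k)) (k : ℕ) :
    limSer w P - P k ∈ wIdeal w (c + k) := by
  have hstep : ∀ k j, P (k + j) - P k ∈ wIdeal w (c + k) := by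
    intro k j
    induction j with
    | zero => simp
    | succ j ih =>
      have : P (k + (j + 1)) - P k = (P (k + j + 1) - P (k + j)) + (P (k + j) - P k) := by
        rw [← add_assoc]; ring
      rw [this]
      exact add_mem (wIdeal_mono (by omega) (h _)) ih
  intro m hm
  rw [map_sub, sub_eq_zero, coeff_limSer]
  rcases le_total (Finsupp.weight w m + 1) k with hk | hk
  · obtain ⟨j, rfl⟩ := Nat.exists_eq_add_of_le hk
    have := hstep (Finsupp.weight w m + 1) j m (by omega)
    rw [map_sub, sub_eq_zero] at this
    exact this.symm
  · obtain ⟨j, hj⟩ := Nat.exists_eq_add_of_le hk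
    have := hstep k j m hm
    rw [map_sub, sub_eq_zero, ← hj] at this
    exact this

end Limits

end

/-! ### Families of series with coefficients in an algebra of functions -/

section

/-- An algebra of complex-valued functions closed under conjugation and under inversion of
nowhere vanishing functions. -/
structure CoeffAlg (𝒳 : Type*) where
  carrier : Subalgebra ℂ (𝒳 → ℂ)
  conj_mem : ∀ {f : 𝒳 → ℂ}, f ∈ carrier → (fun x => conj (f x)) ∈ carrier
  inv_mem : ∀ {f : 𝒳 → ℂ}, f ∈ carrier → (∀ x, f x ≠ 0) → (fun x => (f x)⁻¹) ∈ carrier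

namespace CoeffAlg

variable {𝒳 : Type*} (A : CoeffAlg 𝒳) {σ τ ι : Type*}

/-- A family of scalars in the algebra. -/
def Sc (f : 𝒳 → ℂ) : Prop := f ∈ A.carrier

/-- A family of power series with coefficients in the algebra. -/
def IsSer (P : 𝒳 → MvPowerSeries σ ℂ) : Prop := ∀ m, A.Sc fun x => coeff m (P x)

variable {A} {f g : 𝒳 → ℂ} {P Q : 𝒳 → MvPowerSeries σ ℂ}

theorem Sc.const (c : ℂ) : A.Sc fun _ => c := A.carrier.algebraMap_mem c

theorem Sc.add (hf : A.Sc f) (hg : A.Sc g) : A.Sc fun x => f x + g x := A.carrier.add_mem hf hg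

theorem Sc.mul (hf : A.Sc f) (hg : A.Sc g) : A.Sc fun x => f x * g x := A.carrier.mul_mem hf hg

theorem Sc.neg (hf : A.Sc f) : A.Sc fun x => -f x := A.carrier.neg_mem hf

theorem Sc.sub (hf : A.Sc f) (hg : A.Sc g) : A.Sc fun x => f x - g x := A.carrier.sub_mem hf hg

theorem Sc.conj (hf : A.Sc f) : A.Sc fun x => conj (f x) := A.conj_mem hf

theorem Sc.inv (hf : A.Sc f) (h : ∀ x, f x ≠ 0) : A.Sc fun x => (f x)⁻¹ := A.inv_mem hf h

theorem Sc.div (hf : A.Sc f) (hg : A.Sc g) (h : ∀ x, g x ≠ 0) : A.Sc fun x => f x / g x := by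
  simp only [div_eq_mul_inv]
  exact hf.mul (hg.inv h)

theorem Sc.sum {s : Finset ι} {F : ι → 𝒳 → ℂ} (h : ∀ i ∈ s, A.Sc (F i)) :
    A.Sc fun x => ∑ i ∈ s, F i x := by
  have := A.carrier.sum_mem h
  unfold Sc
  convert this using 1
  ext x
  rw [Finset.sum_apply]

theorem Sc.prod {s : Finset ι} {F : ι → 𝒳 → ℂ} (h : ∀ i ∈ s, A.Sc (F i)) :
    A.Sc fun x => ∏ i ∈ s, F i x := by
  have := A.carrier.prod_mem h
  unfold Sc
  convert this using 1
  ext x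
  rw [Finset.prod_apply]

theorem Sc.ite (p : Prop) [Decidable p] (hf : A.Sc f) (hg : A.Sc g) :
    A.Sc fun x => if p then f x else g x := by
  split_ifs <;> assumption

theorem IsSer.const (p : MvPowerSeries σ ℂ) : A.IsSer fun _ => p := fun _ => Sc.const _

theorem IsSer.C (hf : A.Sc f) : A.IsSer fun x => (C (f x) : MvPowerSeries σ ℂ) := by
  classical
  intro m
  simp only [coeff_C]
  exact Sc.ite _ hf (Sc.const 0)

theorem IsSer.add (hP : A.IsSer P) (hQ : A.IsSer Q) : A.IsSer fun x => P x + Q x :=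
  fun m => (hP m).add (hQ m)

theorem IsSer.sub (hP : A.IsSer P) (hQ : A.IsSer Q) : A.IsSer fun x => P x - Q x :=
  fun m => (hP m).sub (hQ m)

theorem IsSer.neg (hP : A.IsSer P) : A.IsSer fun x => -P x := fun m => (hP m).neg

theorem IsSer.mul (hP : A.IsSer P) (hQ : A.IsSer Q) : A.IsSer fun x => P x * Q x := by
  classical
  intro m
  simp only [coeff_mul]
  exact Sc.sum fun i _ => (hP _).mul (hQ _)

theorem IsSer.C_mul (hf : A.Sc f) (hP : A.IsSer P) :
    A.IsSer fun x => MvPowerSeries.C (f x) * P x := (IsSer.C hf).mul hP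

theorem IsSer.pow (hP : A.IsSer P) (e : ℕ) : A.IsSer fun x => P x ^ e := by
  induction e with
  | zero => simpa using IsSer.const (A := A) (1 : MvPowerSeries σ ℂ)
  | succ e ih => simpa only [pow_succ] using ih.mul hP

theorem IsSer.sum {s : Finset ι} {F : ι → 𝒳 → MvPowerSeries σ ℂ} (h : ∀ i ∈ s, A.IsSer (F i)) :
    A.IsSer fun x => ∑ i ∈ s, F i x := by
  intro m
  simp only [map_sum]
  exact Sc.sum fun i hi => h i hi m

theorem IsSer.prod {s : Finset ι} {F : ι → 𝒳 → MvPowerSeries σ ℂ} (h : ∀ i ∈ s, A.IsSer (F i)) :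
    A.IsSer fun x => ∏ i ∈ s, F i x := by
  classical
  induction s using Finset.induction_on with
  | empty => simpa using IsSer.const (A := A) (1 : MvPowerSeries σ ℂ)
  | insert i s hi ih =>
    simp only [Finset.prod_insert hi]
    exact (h i (Finset.mem_insert_self _ _)).mul
      (ih fun j hj => h j (Finset.mem_insert_of_mem hj))

theorem IsSer.pderiv (i : σ) (hP : A.IsSer P) :
    A.IsSer fun x => MvPowerSeries.pderiv ℂ i (P x) := by
  intro m
  simp only [coeff_pderiv]
  exact (hP _).mul (Sc.const _)

theorem IsSer.gr {M : Type*} [AddCancelCommMonoid M] [DecidableEq M] (w : σ → M) (d : M)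
    (hP : A.IsSer P) : A.IsSer fun x => gr w d (P x) := by
  intro m
  simp only [coeff_gr]
  exact Sc.ite _ (hP m) (Sc.const 0)

theorem IsSer.limSer (w : σ → ℕ) {S : ℕ → 𝒳 → MvPowerSeries σ ℂ} (h : ∀ k, A.IsSer (S k)) :
    A.IsSer fun x => limSer w fun k => S k x := fun m => h _ m

theorem IsSer.constantCoeff (hP : A.IsSer P) : A.Sc fun x => MvPowerSeries.constantCoeff (P x) :=
  hP 0

/-- In the recursion for the coefficients of the inverse, the constant coefficient is the only
quantity that is ever inverted. -/
theorem IsSer.inv (hP : A.IsSer P) (h : ∀ x, MvPowerSeries.constantCoeff (P x) ≠ 0) :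
    A.IsSer fun x => (P x)⁻¹ := by
  classical
  intro m
  induction m using WellFoundedLT.induction with
  | ind m ih =>
    have hc : ∀ x, coeff m (P x)⁻¹ = _ := fun x => coeff_inv m (P x)
    simp only [hc]
    split_ifs with hm
    · exact hP.constantCoeff.inv h
    · refine (hP.constantCoeff.inv h).neg.mul (Sc.sum fun d _ => ?_)
      split_ifs with hd
      · exact (hP _).mul (ih _ hd)
      · exact Sc.const 0

theorem IsSer.subst [Finite σ] [Finite τ] {a : 𝒳 → σ → MvPowerSeries τ ℂ}
    (h0 : ∀ x i, MvPowerSeries.constantCoeff (a x i) = 0) (ha : ∀ i, A.IsSer fun x => a x i)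
    (hP : A.IsSer P) : A.IsSer fun x => MvPowerSeries.subst (a x) (P x) := by
  classical
  intro m
  -- The substituted series have no constant terms, so only exponents of degree at most that of m
  -- contribute. This range is finite and does not depend on x.
  have key : ∀ x, coeff m (MvPowerSeries.subst (a x) (P x)) =
      ∑ d ∈ (Finsupp.finite_of_degree_le (σ := σ) m.degree).toFinset,
        coeff d (P x) * coeff m (d.prod fun i e => a x i ^ e) := by
    intro x
    rw [coeff_subst (hasSubst_of_mem (h0 x)), finsum_eq_sum_of_support_subset]
    · rfl
    · intro d hd
      rw [Set.Finite.coe_toFinset, Set.mem_ofPred_eq]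
      by_contra hlt
      refine hd ?_
      beta_reduce
      rw [monomial_prod_mem_wIdeal (w := fun _ => 1) (v := fun _ => 1)
        (mem_wIdeal_one_const (h0 x)) d m ?_, smul_zero]
      rw [Finsupp.degree_eq_weight_one, Finsupp.degree_eq_weight_one] at hlt
      exact not_le.mp hlt
  simp only [key]
  refine Sc.sum fun d _ => (hP d).mul ?_
  exact IsSer.prod (fun i _ => (ha i).pow _) m

section Matrices

variable [Fintype ι] [DecidableEq ι]

theorem Sc.det {M : 𝒳 → Matrix ι ι ℂ} (h : ∀ i j, A.Sc fun x => M x i j) :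
    A.Sc fun x => (M x).det := by
  simp only [Matrix.det_apply']
  exact Sc.sum fun e _ => (Sc.const _).mul (Sc.prod fun i _ => h _ _)

theorem IsSer.det {M : 𝒳 → Matrix ι ι (MvPowerSeries σ ℂ)} (h : ∀ i j, A.IsSer fun x => M x i j) :
    A.IsSer fun x => (M x).det := by
  simp only [Matrix.det_apply']
  exact IsSer.sum fun e _ => (IsSer.const _).mul (IsSer.prod fun i _ => h _ _)

/-- Cramer's rule: the entries are polynomials in the entries of the matrix, divided by the
determinant. -/
theorem Sc.matrix_inv {M : 𝒳 → Matrix ι ι ℂ} (h : ∀ i j, A.Sc fun x => M x i j)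
    (h0 : ∀ x, (M x).det ≠ 0) (i j : ι) : A.Sc fun x => (M x)⁻¹ i j := by
  simp only [Matrix.inv_def, Matrix.smul_apply, Ring.inverse_eq_inv, smul_eq_mul,
    Matrix.adjugate_apply]
  refine ((Sc.det h).inv h0).mul (Sc.det fun k l => ?_)
  simp only [Matrix.updateRow_apply]
  exact Sc.ite _ (Sc.const _) (h _ _)

theorem IsSer.adjugate {M : 𝒳 → Matrix ι ι (MvPowerSeries σ ℂ)}
    (h : ∀ i j, A.IsSer fun x => M x i j) (i j : ι) : A.IsSer fun x => (M x).adjugate i j := by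
  simp only [Matrix.adjugate_apply]
  refine IsSer.det fun k l => ?_
  simp only [Matrix.updateRow_apply]
  split_ifs
  · exact IsSer.const _
  · exact h _ _

end Matrices

end CoeffAlg

/-! ### The formal inverse mapping theorem in families -/

section Inverse

variable {𝒳 σ : Type*} [Fintype σ] [DecidableEq σ] {A : CoeffAlg 𝒳}

/-- The Jacobian matrix at the origin. -/
def jac (k : σ → MvPowerSeries σ ℂ) : Matrix σ σ ℂ :=
  Matrix.of fun i j => constantCoeff (pderiv ℂ j (k i))

theorem constantCoeff_pderiv {σ : Type*} (i : σ) (p : MvPowerSeries σ ℂ) :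
    constantCoeff (pderiv ℂ i p) = coeff (Finsupp.single i 1) p := by
  rw [← coeff_zero_eq_constantCoeff_apply, coeff_pderiv]
  simp

theorem subst_C_eq {σ τ : Type*} {a : σ → MvPowerSeries τ ℂ} (ha : HasSubst a) (c : ℂ) :
    subst a (C c) = C c := by
  rw [← coe_substAlgHom ha, MvPowerSeries.c_eq_algebraMap, MvPowerSeries.c_eq_algebraMap]
  exact AlgHom.commutes _ _

theorem constantCoeff_subst_of_zero {σ τ : Type*} [Finite σ] {a : σ → MvPowerSeries τ ℂ}
    (h : ∀ i, constantCoeff (a i) = 0) (p : MvPowerSeries σ ℂ) :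
    constantCoeff (subst a p) = constantCoeff p := by
  have hs := hasSubst_of_mem h
  have hp : p = (p - C (constantCoeff p)) + C (constantCoeff p) := by ring
  rw [hp, subst_add hs, map_add, map_add, constantCoeff_subst_eq_zero hs h (by simp)]
  rw [subst_C_eq hs, zero_add]
  simp

theorem jac_subst {k h : σ → MvPowerSeries σ ℂ} (hh : ∀ i, constantCoeff (h i) = 0) :
    jac (fun i => subst h (k i)) = jac k * jac h := by
  ext i j
  simp only [jac, Matrix.of_apply, Matrix.mul_apply, pderiv_subst hh, map_sum, map_mul,
    constantCoeff_subst_of_zero hh]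

theorem jac_X : jac (X : σ → MvPowerSeries σ ℂ) = 1 := by
  ext i j
  rw [jac, Matrix.of_apply, pderiv_X, Matrix.one_apply]
  split_ifs <;> simp_all

theorem sub_linear_mem_wIdeal (p : MvPowerSeries σ ℂ) (h0 : constantCoeff p = 0) :
    p - ∑ j, C (coeff (Finsupp.single j 1) p) * X j ∈ wIdeal (fun _ : σ => 1) 2 := by
  intro m hm
  have hdeg : m.degree < 2 := by
    rw [Finsupp.degree_eq_weight_one]; exact hm
  rw [map_sub, map_sum, sub_eq_zero]
  simp only [coeff_C_mul, coeff_X]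
  rcases Nat.lt_or_ge m.degree 1 with h | h
  · have : m = 0 := by rw [← Finsupp.degree_eq_zero_iff]; omega
    subst this
    rw [coeff_zero_eq_constantCoeff_apply, h0, Finset.sum_eq_zero]
    intro j _
    rw [if_neg, mul_zero]
    exact fun h => by simpa using (DFunLike.congr_fun h j).symm
  · obtain ⟨i, rfl⟩ : ∃ i, m = Finsupp.single i 1 := by
      have : m ∈ {d : σ →₀ ℕ | d.degree = 1} := by simp only [Set.mem_ofPred_eq]; omega
      rw [← Finsupp.range_single_one] at this
      obtain ⟨i, hi⟩ := this
      exact ⟨i, hi.symm⟩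
    rw [Finset.sum_eq_single i]
    · simp
    · intro j _ hj
      rw [if_neg, mul_zero]
      intro h
      exact hj (Finsupp.single_left_injective one_ne_zero h).symm
    · simp

/-- Formal inverse mapping theorem, with control of the coefficients in families. -/
theorem exists_formal_inverse (k : 𝒳 → σ → MvPowerSeries σ ℂ)
    (h0 : ∀ x i, constantCoeff (k x i) = 0) (hdet : ∀ x, (jac (k x)).det ≠ 0)
    (hk : ∀ i, A.IsSer fun x => k x i) :
    ∃ h : 𝒳 → σ → MvPowerSeries σ ℂ, (∀ i, A.IsSer fun x => h x i) ∧
      ∀ x, (∀ i, constantCoeff (h x i) = 0) ∧ ∀ i, subst (h x) (k x i) = X i := by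
  set R : 𝒳 → σ → MvPowerSeries σ ℂ := fun x i =>
    k x i - ∑ j, C (coeff (Finsupp.single j 1) (k x i)) * X j with hR
  have hRmem : ∀ x i, R x i ∈ wIdeal (fun _ : σ => 1) 2 :=
    fun x i => sub_linear_mem_wIdeal _ (h0 x i)
  -- With k = J X + R and R of order two, the equation k ∘ h = X reads h = J⁻¹ (X - R ∘ h).
  set Φ : 𝒳 → (σ → MvPowerSeries σ ℂ) → (σ → MvPowerSeries σ ℂ) := fun x h j =>
    ∑ i, C ((jac (k x))⁻¹ j i) * (X i - subst h (R x i)) with hΦ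
  obtain ⟨P, hP0, hPs⟩ : ∃ P : ℕ → 𝒳 → σ → MvPowerSeries σ ℂ, (∀ x i, P 0 x i = 0) ∧
      ∀ e x, P (e + 1) x = Φ x (P e x) :=
    ⟨fun e x => (Φ x)^[e] 0, fun _ _ => rfl, fun e x => Function.iterate_succ_apply' _ _ _⟩
  have hconst : ∀ x (h : σ → MvPowerSeries σ ℂ), (∀ i, h i ∈ wIdeal (fun _ : σ => 1) 1) →
      ∀ i, Φ x h i ∈ wIdeal (fun _ : σ => 1) 1 := by
    intro x h hh i
    refine Submodule.sum_mem _ fun j _ => Ideal.mul_mem_left _ _ (sub_mem (X_mem_wIdeal _) ?_)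
    exact wIdeal_mono one_le_two (subst_mem_wIdeal
      (hasSubst_of_mem fun i => constantCoeff_eq_zero_of_mem (hh i)) hh (hRmem x j))
  have hP1 : ∀ e x i, P e x i ∈ wIdeal (fun _ : σ => 1) 1 := by
    intro e x
    induction e with
    | zero => intro i; rw [hP0]; exact zero_mem _
    | succ e ih => rw [hPs]; exact hconst x _ ih
  -- Since R starts in order two, agreement of the arguments improves by one order.
  have hcontr : ∀ x (h h' : σ → MvPowerSeries σ ℂ) (ν : ℕ),
      (∀ i, h i ∈ wIdeal (fun _ : σ => 1) 1) → (∀ i, h' i ∈ wIdeal (fun _ : σ => 1) 1) →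
      (∀ i, h i - h' i ∈ wIdeal (fun _ : σ => 1) (1 + ν)) →
      ∀ i, Φ x h i - Φ x h' i ∈ wIdeal (fun _ : σ => 1) (1 + (ν + 1)) := by
    intro x h h' ν hh hh' hd i
    rw [hΦ]
    simp only
    rw [← Finset.sum_sub_distrib]
    refine Submodule.sum_mem _ fun j _ => ?_
    rw [← mul_sub, sub_sub_sub_cancel_left]
    refine Ideal.mul_mem_left _ _ ?_
    rw [← neg_sub]
    refine neg_mem (wIdeal_mono ?_ (subst_sub_subst_mem_wIdeal
      (hasSubst_of_mem fun i => constantCoeff_eq_zero_of_mem (hh i))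
      (hasSubst_of_mem fun i => constantCoeff_eq_zero_of_mem (hh' i)) hh hh' hd (hRmem x j)))
    omega
  have hstep : ∀ x e i, P (e + 1) x i - P e x i ∈ wIdeal (fun _ : σ => 1) (1 + e) := by
    intro x e
    induction e with
    | zero => exact fun i => sub_mem (hP1 _ x i) (hP1 _ x i)
    | succ e ih =>
      intro i
      have := hcontr x (P (e + 1) x) (P e x) e (hP1 _ x) (hP1 _ x) ih i
      rwa [← hPs, ← hPs] at this
  obtain ⟨H, hH⟩ : ∃ H : 𝒳 → σ → MvPowerSeries σ ℂ,
      ∀ x i, H x i = limSer (fun _ => 1) fun e => P e x i := ⟨_, fun _ _ => rfl⟩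
  have hHP : ∀ x i e, H x i - P e x i ∈ wIdeal (fun _ : σ => 1) (1 + e) :=
    fun x i e => by rw [hH]; exact limSer_sub_mem _ 1 (fun e => hstep x e i) e
  have hH1 : ∀ x i, H x i ∈ wIdeal (fun _ : σ => 1) 1 := fun x i => by
    simpa using add_mem (hHP x i 0) (hP1 0 x i)
  have hH0 : ∀ x i, constantCoeff (H x i) = 0 := fun x i =>
    constantCoeff_eq_zero_of_mem (hH1 x i)
  have hfix : ∀ x, Φ x (H x) = H x := by
    intro x
    ext1 i
    rw [← sub_eq_zero]
    refine eq_zero_of_forall_mem_wIdeal (w := fun _ => 1) fun e => ?_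
    have h1 := hcontr x _ _ e (hH1 x) (hP1 e x) (fun i => hHP x i e) i
    have h2 := hHP x i (e + 1)
    rw [hPs] at h2
    have := sub_mem h1 h2
    rw [sub_sub_sub_cancel_right] at this
    exact wIdeal_mono (by omega) this
  refine ⟨H, ?_, fun x => ⟨hH0 x, ?_⟩⟩
  -- The iterates arise from k and J⁻¹ by ring operations and substitutions, and each coefficient of
  -- the limit is a coefficient of one iterate.
  · have hRser : ∀ i, A.IsSer fun x => R x i := fun i =>
      (hk i).sub (CoeffAlg.IsSer.sum fun j _ => (CoeffAlg.IsSer.C (hk i _)).mul (.const _))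
    have hJ : ∀ i j, A.Sc fun x => (jac (k x))⁻¹ i j :=
      CoeffAlg.Sc.matrix_inv (fun i j => ((hk i).pderiv j).constantCoeff) hdet
    have hPser : ∀ e i, A.IsSer fun x => P e x i := by
      intro e
      induction e with
      | zero => intro i; simp only [hP0]; exact .const _
      | succ e ih =>
        intro i
        simp only [hPs]
        exact CoeffAlg.IsSer.sum fun j _ => (CoeffAlg.IsSer.C (hJ _ _)).mul
          ((CoeffAlg.IsSer.const _).sub (CoeffAlg.IsSer.subst
            (fun x i => constantCoeff_eq_zero_of_mem (hP1 e x i)) ih (hRser j)))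
    intro i
    simp only [hH]
    exact CoeffAlg.IsSer.limSer _ fun e => hPser e i
  · have hs := hasSubst_of_mem (hH0 x)
    have hsub : ∀ i, subst (H x) (k x i) = subst (H x) (R x i) +
        ∑ j, C (jac (k x) i j) * H x j := by
      intro i
      have : k x i = R x i + ∑ j, C (coeff (Finsupp.single j 1) (k x i)) * X j := by
        rw [hR]; ring
      conv_lhs => rw [this]
      rw [subst_add hs, ← coe_substAlgHom hs]
      simp only [map_sum, map_mul, substAlgHom_X hs]
      simp only [jac, Matrix.of_apply, constantCoeff_pderiv, coe_substAlgHom, subst_C_eq hs]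
    intro i
    have hv : ∀ j, ∑ i, C ((jac (k x))⁻¹ j i) * (X i - subst (H x) (R x i)) = H x j :=
      fun j => congrFun (hfix x) j
    rw [hsub]
    have hinv : jac (k x) * (jac (k x))⁻¹ = 1 :=
      Matrix.mul_nonsing_inv _ (isUnit_iff_ne_zero.mpr (hdet x))
    have : ∑ j, C (jac (k x) i j) * H x j = X i - subst (H x) (R x i) := by
      simp only [← hv, Finset.mul_sum, ← mul_assoc, ← map_mul]
      rw [Finset.sum_comm]
      simp only [← Finset.sum_mul, ← map_sum]
      have : ∀ l, ∑ j, jac (k x) i j * (jac (k x))⁻¹ j l = (1 : Matrix σ σ ℂ) i l := by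
        intro l; rw [← hinv, Matrix.mul_apply]
      simp only [this, Matrix.one_apply]
      rw [Finset.sum_eq_single i] <;> simp +contextual [eq_comm]
    rw [this]; ring

/-- The algebra of all functions. -/
def CoeffAlg.all (𝒳 : Type*) : CoeffAlg 𝒳 := ⟨⊤, fun _ => trivial, fun _ _ => trivial⟩

theorem subst_X_self (p : MvPowerSeries σ ℂ) : subst (X : σ → MvPowerSeries σ ℂ) p = p := by
  rw [subst_self]; rfl

/-- The right inverse h of k has a right inverse h' of its own, and then h' = k ∘ h ∘ h' = k, as in
a group. -/
theorem formal_inverse_symm {k h : σ → MvPowerSeries σ ℂ} (hh : ∀ i, constantCoeff (h i) = 0) (H : ∀ i, subst h (k i) = X i) (i : σ) :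
    subst k (h i) = X i := by
  have hJ : jac k * jac h = 1 := by
    rw [← jac_subst hh, ← jac_X]; congr 1; funext i; exact H i
  have hdet : (jac h).det ≠ 0 := fun h0 => by
    have := congrArg Matrix.det hJ
    rw [Matrix.det_mul, h0, mul_zero, Matrix.det_one] at this
    exact zero_ne_one this
  obtain ⟨h', -, hh'⟩ := exists_formal_inverse (A := CoeffAlg.all Unit) (fun _ => h)
    (fun _ => hh) (fun _ => hdet) (fun _ _ => trivial)
  obtain ⟨hh'0, hh'⟩ := hh' ()
  have : h' () = k := by
    funext i
    have h1 : subst (h' ()) (subst h (k i)) = h' () i := by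
      rw [H, subst_X (hasSubst_of_mem hh'0)]
    rw [subst_comp_subst_apply (hasSubst_of_mem hh) (hasSubst_of_mem hh'0)] at h1
    rw [← h1]
    simp only [hh']
    exact subst_X_self _
  rw [← this]
  exact hh' i

theorem formal_inverse_unique {k h h' : σ → MvPowerSeries σ ℂ} (hk : ∀ i, constantCoeff (k i) = 0)
    (hh : ∀ i, constantCoeff (h i) = 0) (hh' : ∀ i, constantCoeff (h' i) = 0)
    (H : ∀ i, subst h (k i) = X i) (H' : ∀ i, subst h' (k i) = X i) : h' = h := by
  funext j
  have h1 : subst h' (subst k (h j)) = h' j := by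
    rw [formal_inverse_symm hh H, subst_X (hasSubst_of_mem hh')]
  rw [← h1, subst_comp_subst_apply (hasSubst_of_mem hk) (hasSubst_of_mem hh')]
  simp only [H']
  exact subst_X_self _

end Inverse

end

/-! ### Algebra of series in (z, z̄, u): conjugation, bidegrees, trace, integration -/

section

variable {n : ℕ}

/-! ### Conjugation -/

@[simp] theorem conjVar_conjVar (i : Var n) : conjVar n (conjVar n i) = i := by
  rcases i with j | j | j <;> rfl

theorem conjVar_symm : (conjVar n).symm = conjVar n := by
  ext i; rcases i with j | j | j <;> rfl

@[simp] theorem conjVar_zv (j : Fin n) : conjVar n (zv j) = zbv j := rfl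
@[simp] theorem conjVar_zbv (j : Fin n) : conjVar n (zbv j) = zv j := rfl
@[simp] theorem conjVar_uv : conjVar n uv = uv := rfl

/-- The involution on exponents induced by conjugation. -/
def conjExp (m : Var n →₀ ℕ) : Var n →₀ ℕ := m.equivMapDomain (conjVar n)

theorem conjExp_apply (m : Var n →₀ ℕ) (i : Var n) : conjExp m i = m (conjVar n i) := by
  rw [conjExp, Finsupp.equivMapDomain_apply, conjVar_symm]

@[simp] theorem conjExp_conjExp (m : Var n →₀ ℕ) : conjExp (conjExp m) = m := by
  ext i; simp [conjExp_apply]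

@[simp] theorem conjExp_add (m m' : Var n →₀ ℕ) : conjExp (m + m') = conjExp m + conjExp m' := by
  ext i; simp [conjExp_apply]

@[simp] theorem conjExp_single (i : Var n) (c : ℕ) :
    conjExp (Finsupp.single i c) = Finsupp.single (conjVar n i) c :=
  Finsupp.equivMapDomain_single _ _ _

theorem conjExp_eq_iff (m m' : Var n →₀ ℕ) : conjExp m = m' ↔ m = conjExp m' :=
  ⟨fun h => by rw [← h, conjExp_conjExp], fun h => by rw [h, conjExp_conjExp]⟩

theorem coeff_bar (m : Var n →₀ ℕ) (p : Ser n) : coeff m p.bar = conj (coeff (conjExp m) p) := rfl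

theorem bar_C (c : ℂ) : Ser.bar (C c : Ser n) = C (conj c) := by
  classical
  ext m
  rw [coeff_bar, coeff_C, coeff_C]
  have : conjExp m = 0 ↔ m = 0 := by
    rw [conjExp_eq_iff]
    have : conjExp (0 : Var n →₀ ℕ) = 0 := by ext; simp [conjExp_apply]
    rw [this]
  simp only [this]
  split_ifs <;> simp

theorem bar_mul (p q : Ser n) : (p * q).bar = p.bar * q.bar := by
  classical
  ext m
  rw [coeff_bar, coeff_mul, coeff_mul, map_sum]
  refine Finset.sum_nbij' (fun x => (conjExp x.1, conjExp x.2))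
    (fun x => (conjExp x.1, conjExp x.2)) ?_ ?_ ?_ ?_ ?_
  · intro x hx
    rw [Finset.HasAntidiagonal.mem_antidiagonal] at hx ⊢
    simp only [← conjExp_add, hx, conjExp_conjExp]
  · intro x hx
    rw [Finset.HasAntidiagonal.mem_antidiagonal] at hx ⊢
    simp only [← conjExp_add, hx]
  · intro x _; simp
  · intro x _; simp
  · intro x _
    simp [coeff_bar]

/-- Conjugation as a ring homomorphism. -/
def barHom (n : ℕ) : Ser n →+* Ser n where
  toFun := Ser.bar
  map_one' := by rw [← map_one C, bar_C]; simp
  map_mul' := bar_mul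
  map_zero' := by ext m; simp [coeff_bar]
  map_add' p q := by ext m; simp [coeff_bar]

theorem barHom_apply (p : Ser n) : barHom n p = p.bar := rfl

theorem bar_add (p q : Ser n) : (p + q).bar = p.bar + q.bar := map_add (barHom n) p q
theorem bar_sub (p q : Ser n) : (p - q).bar = p.bar - q.bar := map_sub (barHom n) p q
theorem bar_neg (p : Ser n) : (-p).bar = -p.bar := map_neg (barHom n) p
@[simp] theorem bar_zero : (0 : Ser n).bar = 0 := map_zero (barHom n)
@[simp] theorem bar_one : (1 : Ser n).bar = 1 := map_one (barHom n)
theorem bar_sum {ι : Type*} (s : Finset ι) (P : ι → Ser n) :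
    (∑ i ∈ s, P i).bar = ∑ i ∈ s, (P i).bar := map_sum (barHom n) P s

@[simp] theorem bar_bar (p : Ser n) : p.bar.bar = p := by
  ext m; simp [coeff_bar]

theorem bar_X (i : Var n) : Ser.bar (X i : Ser n) = X (conjVar n i) := by
  classical
  ext m
  rw [coeff_bar, coeff_X, coeff_X]
  have : conjExp m = Finsupp.single i 1 ↔ m = Finsupp.single (conjVar n i) 1 := by
    rw [conjExp_eq_iff, conjExp_single]
  simp only [this]
  split_ifs <;> simp

theorem bar_pderiv (i : Var n) (p : Ser n) :
    Ser.bar (pderiv ℂ i p) = pderiv ℂ (conjVar n i) p.bar := by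
  ext m
  simp [coeff_bar, coeff_pderiv, conjExp_apply]

theorem constantCoeff_bar (p : Ser n) : constantCoeff p.bar = conj (constantCoeff p) := by
  rw [← coeff_zero_eq_constantCoeff_apply, coeff_bar, ← coeff_zero_eq_constantCoeff_apply]
  congr 2

theorem bar_subst {a : Var n → Ser n} (h0 : ∀ i, constantCoeff (a i) = 0)
    (p : Ser n) :
    Ser.bar (subst a p) = subst (fun i => Ser.bar (a (conjVar n i))) p.bar := by
  have hs := hasSubst_of_mem h0
  have hs' : HasSubst fun i => Ser.bar (a (conjVar n i)) :=
    hasSubst_of_mem fun i => by rw [constantCoeff_bar, h0, map_zero]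
  ext m
  rw [coeff_bar, coeff_subst hs, coeff_subst hs']
  have hfin := coeff_subst_finite hs p (conjExp m)
  have h1 := (starRingEnd ℂ).toAddMonoidHom.map_finsum hfin
  refine Eq.trans h1 ?_
  refine finsum_eq_of_bijective (fun d : Var n →₀ ℕ => conjExp d)
    (Function.Involutive.bijective conjExp_conjExp) fun d => ?_
  rw [coeff_bar, conjExp_conjExp]
  change conj (_ • _) = _
  rw [smul_eq_mul, smul_eq_mul, map_mul]
  congr 1
  rw [← coeff_bar, ← barHom_apply, Finsupp.prod_fintype _ _ (fun _ => pow_zero _),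
    Finsupp.prod_fintype _ _ (fun _ => pow_zero _), map_prod]
  simp only [map_pow, barHom_apply, conjExp_apply]
  congr 1
  exact Fintype.prod_equiv (conjVar n) _ _ fun i => by simp

/-! ### Weights and bidegrees -/

/-- The weights `1, 1, 2` of the variables `z, z̄, u`. -/
def hwt (n : ℕ) : Var n → ℕ
  | Sum.inl _ => 1
  | Sum.inr (Sum.inl _) => 1
  | Sum.inr (Sum.inr _) => 2

/-- The bidegrees of the variables in `(z, z̄)`. -/
def bwt (n : ℕ) : Var n → ℕ × ℕ
  | Sum.inl _ => (1, 0)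
  | Sum.inr (Sum.inl _) => (0, 1)
  | Sum.inr (Sum.inr _) => (0, 0)

/-- The component of bidegree `(a, b)` in `(z, z̄)`. -/
def bi (a b : ℕ) : Ser n →ₗ[ℂ] Ser n := gr (bwt n) (a, b)

@[simp] theorem hwt_zv (j : Fin n) : hwt n (zv j) = 1 := rfl
@[simp] theorem hwt_zbv (j : Fin n) : hwt n (zbv j) = 1 := rfl

theorem one_le_hwt (i : Var n) : 1 ≤ hwt n i := by rcases i with j | j | j <;> simp [hwt]

theorem sum_var {M : Type*} [AddCommMonoid M] (F : Var n → M) :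
    ∑ i, F i = ∑ j, F (zv j) + (∑ j, F (zbv j) + F uv) := by
  rw [Fintype.sum_sum_type, Fintype.sum_sum_type]
  congr 2
  exact Fintype.sum_unique _

theorem weight_bwt (m : Var n →₀ ℕ) :
    Finsupp.weight (bwt n) m = (∑ j, m (zv j), ∑ j, m (zbv j)) := by
  rw [Finsupp.weight_eq_sum, sum_var]
  simp [bwt, Prod.ext_iff, Prod.fst_sum, Prod.snd_sum]

theorem weight_hwt (m : Var n →₀ ℕ) :
    Finsupp.weight (hwt n) m = ∑ j, m (zv j) + (∑ j, m (zbv j) + 2 * m uv) := by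
  rw [Finsupp.weight_eq_sum, sum_var]
  simp [hwt, mul_comm]

theorem coeff_bi (a b : ℕ) (p : Ser n) (m : Var n →₀ ℕ) :
    coeff m (bi a b p) = if (∑ j, m (zv j)) = a ∧ (∑ j, m (zbv j)) = b then coeff m p else 0 := by
  rw [bi, coeff_gr, weight_bwt]
  simp only [Prod.mk.injEq]

theorem ext_bi {p q : Ser n} (h : ∀ a b, bi a b p = bi a b q) : p = q :=
  ext_gr (w := bwt n) fun d => h d.1 d.2

@[simp] theorem bi_bi_self (a b : ℕ) (p : Ser n) : bi a b (bi a b p) = bi a b p := gr_gr_self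

theorem bi_bi_of_ne {a b a' b' : ℕ} (h : ¬(a = a' ∧ b = b')) (p : Ser n) :
    bi a b (bi a' b' p) = 0 := gr_gr_of_ne (by simpa using h)

theorem bi_X_zv_mul (a b : ℕ) (j : Fin n) (p : Ser n) :
    bi (a + 1) b (X (zv j) * p) = X (zv j) * bi a b p :=
  gr_X_mul (w := bwt n) (d := (a, b)) (zv j)

theorem bi_zero_X_zv_mul (b : ℕ) (j : Fin n) (p : Ser n) : bi 0 b (X (zv j) * p) = 0 :=
  gr_X_mul_eq_zero (w := bwt n) (d := (0, b)) (zv j) (by simp [bwt, Prod.ext_iff])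

theorem bi_X_zbv_mul (a b : ℕ) (j : Fin n) (p : Ser n) :
    bi a (b + 1) (X (zbv j) * p) = X (zbv j) * bi a b p :=
  gr_X_mul (w := bwt n) (d := (a, b)) (zbv j)

theorem bi_zero_X_zbv_mul (a : ℕ) (j : Fin n) (p : Ser n) : bi a 0 (X (zbv j) * p) = 0 :=
  gr_X_mul_eq_zero (w := bwt n) (d := (a, 0)) (zbv j) (by simp [bwt, Prod.ext_iff])

theorem bi_C_mul (a b : ℕ) (c : ℂ) (p : Ser n) : bi a b (C c * p) = C c * bi a b p := gr_C_mul c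

theorem bi_pderiv_zv (a b : ℕ) (j : Fin n) (p : Ser n) :
    bi a b (pderiv ℂ (zv j) p) = pderiv ℂ (zv j) (bi (a + 1) b p) := gr_pderiv (w := bwt n) (zv j)

theorem bi_pderiv_zbv (a b : ℕ) (j : Fin n) (p : Ser n) :
    bi a b (pderiv ℂ (zbv j) p) = pderiv ℂ (zbv j) (bi a (b + 1) p) :=
  gr_pderiv (w := bwt n) (zbv j)

theorem bi_pderiv_uv (a b : ℕ) (p : Ser n) :
    bi a b (pderiv ℂ uv p) = pderiv ℂ uv (bi a b p) := gr_pderiv (w := bwt n) uv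

theorem bi_bar (a b : ℕ) (p : Ser n) : bi a b p.bar = (bi b a p).bar := by
  ext m
  rw [coeff_bar, coeff_bi, coeff_bi, coeff_bar]
  simp only [conjExp_apply, conjVar_zv, conjVar_zbv]
  by_cases h1 : ∑ j, m (zv j) = a <;> by_cases h2 : ∑ j, m (zbv j) = b <;> simp [h1, h2]

theorem bar_mem_wIdeal {k : ℕ} {p : Ser n} (hp : p ∈ wIdeal (hwt n) k) :
    p.bar ∈ wIdeal (hwt n) k := by
  intro m hm
  rw [coeff_bar, hp, map_zero]
  rw [weight_hwt] at hm ⊢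
  simp only [conjExp_apply, conjVar_zv, conjVar_zbv, conjVar_uv]
  omega

/-! ### The Euler fields, `⟨z, z⟩` and the trace -/

/-- The derivation `∑ z_j ∂/∂z_j`. -/
def eul (n : ℕ) : Derivation ℂ (Ser n) (Ser n) := ∑ j, (X (zv j) : Ser n) • pderiv ℂ (zv j)

/-- The derivation `∑ z̄_j ∂/∂z̄_j`. -/
def eulb (n : ℕ) : Derivation ℂ (Ser n) (Ser n) := ∑ j, (X (zbv j) : Ser n) • pderiv ℂ (zbv j)

theorem eul_apply (p : Ser n) : eul n p = ∑ j, X (zv j) * pderiv ℂ (zv j) p := by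
  change Derivation.coeFnAddMonoidHom (eul n) p = _
  rw [eul, map_sum, Finset.sum_apply]; rfl

theorem eulb_apply (p : Ser n) : eulb n p = ∑ j, X (zbv j) * pderiv ℂ (zbv j) p := by
  change Derivation.coeFnAddMonoidHom (eulb n) p = _
  rw [eulb, map_sum, Finset.sum_apply]; rfl

theorem coeff_X_mul_pderiv {σ : Type*} (i : σ) (p : MvPowerSeries σ ℂ) (m : σ →₀ ℕ) :
    coeff m (X i * pderiv ℂ i p) = m i * coeff m p := by
  classical
  rw [X, coeff_monomial_mul]
  split_ifs with h
  · obtain ⟨m', rfl⟩ := exists_add_of_le h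
    rw [add_tsub_cancel_left, coeff_pderiv, add_comm m']
    simp
    ring
  · have : m i = 0 := by
      by_contra h0
      exact h (by simpa using Nat.one_le_iff_ne_zero.mpr h0)
    simp [this]

theorem coeff_eul (p : Ser n) (m : Var n →₀ ℕ) :
    coeff m (eul n p) = ((∑ j, m (zv j) : ℕ) : ℂ) * coeff m p := by
  rw [eul_apply, map_sum]
  simp only [coeff_X_mul_pderiv, Nat.cast_sum, Finset.sum_mul]

theorem coeff_eulb (p : Ser n) (m : Var n →₀ ℕ) :
    coeff m (eulb n p) = ((∑ j, m (zbv j) : ℕ) : ℂ) * coeff m p := by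
  rw [eulb_apply, map_sum]
  simp only [coeff_X_mul_pderiv, Nat.cast_sum, Finset.sum_mul]

theorem bi_eul (a b : ℕ) (p : Ser n) : bi a b (eul n p) = C (a : ℂ) * bi a b p := by
  ext m
  rw [coeff_bi, coeff_C_mul, coeff_bi, coeff_eul]
  split_ifs with h
  · rw [h.1]
  · rw [mul_zero]

theorem bi_eulb (a b : ℕ) (p : Ser n) : bi a b (eulb n p) = C (b : ℂ) * bi a b p := by
  ext m
  rw [coeff_bi, coeff_C_mul, coeff_bi, coeff_eulb]
  split_ifs with h
  · rw [h.2]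
  · rw [mul_zero]

theorem eul_bi (a b : ℕ) (p : Ser n) : eul n (bi a b p) = C (a : ℂ) * bi a b p := by
  ext m
  rw [coeff_C_mul, coeff_bi, coeff_eul, coeff_bi]
  split_ifs with h
  · rw [h.1]
  · rw [mul_zero, mul_zero]

theorem eulb_bi (a b : ℕ) (p : Ser n) : eulb n (bi a b p) = C (b : ℂ) * bi a b p := by
  ext m
  rw [coeff_C_mul, coeff_bi, coeff_eulb, coeff_bi]
  split_ifs with h
  · rw [h.2]
  · rw [mul_zero, mul_zero]

theorem bar_eul (p : Ser n) : (eul n p).bar = eulb n p.bar := by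
  rw [eul_apply, eulb_apply, bar_sum]
  simp only [bar_mul, bar_X, bar_pderiv, conjVar_zv]

/-- The sign `ε_j` as a complex number. -/
def sg (s : ℕ) (j : Fin n) : ℂ := (eps s j : ℝ)

theorem sg_mul_self (s : ℕ) (j : Fin n) : sg s j * sg s j = 1 := by
  unfold sg eps; split_ifs <;> simp

@[simp] theorem conj_sg (s : ℕ) (j : Fin n) : conj (sg s j) = sg s j := Complex.conj_ofReal _

/-- The Hermitian form `∑ ε_j z_j z̄_j`. -/
def rho (n s : ℕ) : Ser n := ∑ j, C (sg s j) * (X (zv j) * X (zbv j))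

variable {s : ℕ}

@[simp] theorem bar_rho : (rho n s).bar = rho n s := by
  simp only [rho, bar_sum, bar_mul, bar_C, bar_X, conj_sg, conjVar_zv, conjVar_zbv, mul_comm]

theorem pderiv_X_ne {i j : Var n} (h : i ≠ j) : pderiv ℂ i (X j : Ser n) = 0 :=
  pderiv_X_of_ne (Ne.symm h)

@[simp] theorem pderiv_uv_zv (j : Fin n) : pderiv ℂ uv (X (zv j) : Ser n) = 0 :=
  pderiv_X_ne (by simp)
@[simp] theorem pderiv_uv_zbv (j : Fin n) : pderiv ℂ uv (X (zbv j) : Ser n) = 0 :=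
  pderiv_X_ne (by simp)
theorem pderiv_zv_zv (i j : Fin n) :
    pderiv ℂ (zv i) (X (zv j) : Ser n) = if i = j then 1 else 0 := by
  split_ifs with h
  · rw [h, pderiv_X_self]
  · exact pderiv_X_ne (by simpa using h)
theorem pderiv_zbv_zbv (i j : Fin n) :
    pderiv ℂ (zbv i) (X (zbv j) : Ser n) = if i = j then 1 else 0 := by
  split_ifs with h
  · rw [h, pderiv_X_self]
  · exact pderiv_X_ne (by simpa using h)

theorem pderiv_C_mul {σ : Type*} (i : σ) (c : ℂ) (p : MvPowerSeries σ ℂ) :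
    pderiv ℂ i (C c * p) = C c * pderiv ℂ i p := by
  rw [← smul_eq_C_mul, ← smul_eq_C_mul, Derivation.map_smul]

theorem pderiv_mul {σ : Type*} (i : σ) (p q : MvPowerSeries σ ℂ) :
    pderiv ℂ i (p * q) = pderiv ℂ i p * q + p * pderiv ℂ i q := by
  rw [Derivation.leibniz, smul_eq_mul, smul_eq_mul]; ring

@[simp] theorem pderiv_uv_rho : pderiv ℂ uv (rho n s) = 0 := by
  rw [rho, map_sum]
  simp only [pderiv_mul]
  simp

theorem pderiv_uv_rho_mul (p : Ser n) : pderiv ℂ uv (rho n s * p) = rho n s * pderiv ℂ uv p := by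
  rw [pderiv_mul, pderiv_uv_rho, zero_mul, zero_add]

theorem pderiv_zv_rho (j : Fin n) : pderiv ℂ (zv j) (rho n s) = C (sg s j) * X (zbv j) := by
  rw [rho, map_sum]
  simp only [pderiv_mul]
  simp [pderiv_zv_zv]

theorem pderiv_zbv_rho (j : Fin n) : pderiv ℂ (zbv j) (rho n s) = C (sg s j) * X (zv j) := by
  rw [rho, map_sum]
  simp only [pderiv_mul]
  simp [pderiv_zbv_zbv]

theorem bi_rho_mul (a b : ℕ) (p : Ser n) :
    bi (a + 1) (b + 1) (rho n s * p) = rho n s * bi a b p := by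
  simp only [rho, Finset.sum_mul, map_sum, mul_assoc, bi_C_mul, bi_X_zv_mul, bi_X_zbv_mul]

@[simp] theorem bi_zero_left_rho_mul (b : ℕ) (p : Ser n) : bi 0 b (rho n s * p) = 0 := by
  simp only [rho, Finset.sum_mul, map_sum, mul_assoc, bi_C_mul, bi_zero_X_zv_mul, mul_zero,
    Finset.sum_const_zero]

@[simp] theorem bi_zero_right_rho_mul (a : ℕ) (p : Ser n) : bi a 0 (rho n s * p) = 0 := by
  have : ∀ q : Ser n, ∀ j, X (zv j) * (X (zbv j) * q) = X (zbv j) * (X (zv j) * q) :=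
    fun q j => by ring
  simp only [rho, Finset.sum_mul, map_sum, mul_assoc, bi_C_mul, this, bi_zero_X_zbv_mul, mul_zero,
    Finset.sum_const_zero]

/-- The trace operator of the Hermitian form `rho`. -/
def trc (n s : ℕ) : Ser n →ₗ[ℂ] Ser n :=
  ∑ j, sg s j • ((pderiv ℂ (zbv j)).toLinearMap ∘ₗ (pderiv ℂ (zv j)).toLinearMap)

theorem trc_apply (p : Ser n) :
    trc n s p = ∑ j, C (sg s j) * pderiv ℂ (zbv j) (pderiv ℂ (zv j) p) := by
  simp [trc, smul_eq_C_mul]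

theorem pderiv_comm {σ : Type*} (i j : σ) (p : MvPowerSeries σ ℂ) :
    pderiv ℂ i (pderiv ℂ j p) = pderiv ℂ j (pderiv ℂ i p) := by
  classical
  ext m
  simp only [coeff_pderiv, Finsupp.add_apply, add_right_comm m (Finsupp.single i 1)]
  by_cases h : i = j
  · rw [h]
  · have h' : ¬ j = i := fun e => h e.symm
    simp [h, h']
    ring

/-- The commutator of the trace with multiplication by ρ is the total degree in (z, z̄) plus n, as
in the sl₂-relations for a Laplacian and a quadratic form. It makes all traces of powers of ρ
computable. -/
theorem trc_rho_mul (p : Ser n) :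
    trc n s (rho n s * p) = rho n s * trc n s p + eul n p + eulb n p + C (n : ℂ) * p := by
  have hC : ∀ j : Fin n, (C (sg s j) * C (sg s j) : Ser n) = 1 := fun j => by
    rw [← map_mul, sg_mul_self, map_one]
  have hterm : ∀ j : Fin n, C (sg s j) * pderiv ℂ (zbv j) (pderiv ℂ (zv j) (rho n s * p)) =
      rho n s * (C (sg s j) * pderiv ℂ (zbv j) (pderiv ℂ (zv j) p)) +
        X (zv j) * pderiv ℂ (zv j) p + X (zbv j) * pderiv ℂ (zbv j) p + p := by
    intro j
    rw [pderiv_mul, map_add, pderiv_mul, pderiv_mul, pderiv_zv_rho, pderiv_zbv_rho, pderiv_C_mul,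
      pderiv_X_self]
    linear_combination (p + X (zbv j) * pderiv ℂ (zbv j) p + X (zv j) * pderiv ℂ (zv j) p) * hC j
  simp only [trc_apply, hterm, Finset.sum_add_distrib, eul_apply, eulb_apply, Finset.mul_sum,
    Finset.sum_const, Finset.card_univ, Fintype.card_fin, nsmul_eq_mul, map_natCast]

theorem bi_trc (a b : ℕ) (p : Ser n) : bi a b (trc n s p) = trc n s (bi (a + 1) (b + 1) p) := by
  simp only [trc_apply, map_sum, bi_C_mul, bi_pderiv_zv, bi_pderiv_zbv]

theorem trc_C_mul (c : ℂ) (p : Ser n) : trc n s (C c * p) = C c * trc n s p := by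
  rw [← smul_eq_C_mul, map_smul, smul_eq_C_mul]

theorem bar_trc (p : Ser n) : (trc n s p).bar = trc n s p.bar := by
  simp only [trc_apply, bar_sum, bar_mul, bar_C, bar_pderiv, conj_sg, conjVar_zv, conjVar_zbv]
  exact Finset.sum_congr rfl fun j _ => by rw [pderiv_comm]

theorem trc_bi_zero_right (a : ℕ) (p : Ser n) : trc n s (bi a 0 p) = 0 := by
  rw [trc_apply]
  refine Finset.sum_eq_zero fun j _ => ?_
  have : pderiv ℂ (zbv j) (bi a 0 p) = 0 := by
    ext m
    rw [coeff_pderiv, coeff_bi, if_neg, zero_mul, map_zero]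
    rintro ⟨-, h⟩
    rw [Finset.sum_eq_zero_iff] at h
    simpa using h j (Finset.mem_univ _)
  rw [pderiv_comm, this, map_zero, mul_zero]

/-! ### Integration in `u` -/

/-- The primitive in `u` without terms of order `0` in `u`. -/
def uint (p : Ser n) : Ser n :=
  fun m => if m uv = 0 then 0 else coeff (m - Finsupp.single (uv : Var n) 1) p / (m uv : ℂ)

theorem coeff_uint (p : Ser n) (m : Var n →₀ ℕ) :
    coeff m (uint p) = if m uv = 0 then 0 else coeff (m - Finsupp.single (uv : Var n) 1) p / (m uv : ℂ) :=
  rfl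

@[simp] theorem pderiv_uint (p : Ser n) : pderiv ℂ uv (uint p) = p := by
  ext m
  rw [coeff_pderiv, coeff_uint, if_neg (by simp), add_tsub_cancel_right]
  have : (m uv : ℂ) + 1 ≠ 0 := Nat.cast_add_one_ne_zero _
  simp [div_mul_cancel₀ _ this]

theorem sub_single_uv_zv (m : Var n →₀ ℕ) (j : Fin n) :
    (m - Finsupp.single (uv : Var n) 1 : Var n →₀ ℕ) (zv j) = m (zv j) := by simp
theorem sub_single_uv_zbv (m : Var n →₀ ℕ) (j : Fin n) :
    (m - Finsupp.single (uv : Var n) 1 : Var n →₀ ℕ) (zbv j) = m (zbv j) := by simp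

theorem bi_uint (a b : ℕ) (p : Ser n) : bi a b (uint p) = uint (bi a b p) := by
  ext m
  simp only [coeff_uint, coeff_bi, sub_single_uv_zv, sub_single_uv_zbv]
  split_ifs <;> simp

theorem bar_uint (p : Ser n) : (uint p).bar = uint p.bar := by
  ext m
  rw [coeff_bar, coeff_uint, coeff_uint, coeff_bar, conjExp_apply, conjVar_uv]
  have : conjExp (m - Finsupp.single (uv : Var n) 1) = conjExp m - Finsupp.single (uv : Var n) 1 := by
    ext i
    rw [conjExp_apply, Finsupp.tsub_apply, Finsupp.tsub_apply, conjExp_apply]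
    congr 1
    rcases i with j | j | j
    · simp
    · simp
    · rfl
  rw [this]
  split_ifs <;> simp

theorem CoeffAlg.IsSer.uint {𝒳 : Type*} {A : CoeffAlg 𝒳} {P : 𝒳 → Ser n} (hP : A.IsSer P) :
    A.IsSer fun x => uint (P x) := by
  intro m
  simp only [coeff_uint]
  refine Sc.ite _ (Sc.const 0) ?_
  simp only [div_eq_mul_inv]
  exact (hP _).mul (Sc.const _)

theorem CoeffAlg.IsSer.bar {𝒳 : Type*} {A : CoeffAlg 𝒳} {P : 𝒳 → Ser n} (hP : A.IsSer P) :
    A.IsSer fun x => (P x).bar := fun m => (hP _).conj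

theorem CoeffAlg.IsSer.bi {𝒳 : Type*} {A : CoeffAlg 𝒳} {P : 𝒳 → Ser n} (hP : A.IsSer P)
    (a b : ℕ) : A.IsSer fun x => bi a b (P x) := hP.gr _ _

theorem CoeffAlg.IsSer.eul {𝒳 : Type*} {A : CoeffAlg 𝒳} {P : 𝒳 → Ser n} (hP : A.IsSer P) :
    A.IsSer fun x => eul n (P x) := by
  simp only [eul_apply]
  exact .sum fun j _ => (IsSer.const _).mul (hP.pderiv _)

theorem CoeffAlg.IsSer.trc {𝒳 : Type*} {A : CoeffAlg 𝒳} {P : 𝒳 → Ser n} (hP : A.IsSer P) :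
    A.IsSer fun x => trc n s (P x) := by
  simp only [trc_apply]
  exact .sum fun j _ => (IsSer.const _).mul ((hP.pderiv _).pderiv _)

theorem eq_zero_of_pderiv_uv {p : Ser n} (h : pderiv ℂ uv p = 0)
    (h0 : ∀ m, m uv = 0 → coeff m p = 0) : p = 0 := by
  ext m
  by_cases hm : m uv = 0
  · rw [h0 m hm, map_zero]
  · have h1 : m = (m - Finsupp.single (uv : Var n) 1) + Finsupp.single (uv : Var n) 1 := by
      refine (tsub_add_cancel_of_le ?_).symm
      simpa using Nat.one_le_iff_ne_zero.mpr hm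
    have h2 := congrArg (coeff (m - Finsupp.single (uv : Var n) 1)) h
    rw [coeff_pderiv, ← h1, map_zero, mul_eq_zero] at h2
    rcases h2 with h2 | h2
    · rw [h2, map_zero]
    · exact absurd h2 (Nat.cast_add_one_ne_zero _)

/-! ### Gluing of bihomogeneous components -/

/-- The series with prescribed bihomogeneous components. -/
def glue (P : ℕ → ℕ → Ser n) : Ser n :=
  fun m => coeff m (P (∑ j, m (zv j)) (∑ j, m (zbv j)))

theorem bi_glue (P : ℕ → ℕ → Ser n) (a b : ℕ) : bi a b (glue P) = bi a b (P a b) := by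
  ext m
  rw [coeff_bi, coeff_bi]
  split_ifs with h
  · rw [← h.1, ← h.2]; rfl
  · rfl

theorem CoeffAlg.IsSer.glue {𝒳 : Type*} {A : CoeffAlg 𝒳} {P : 𝒳 → ℕ → ℕ → Ser n}
    (hP : ∀ a b, A.IsSer fun x => P x a b) : A.IsSer fun x => glue (P x) := fun m => hP _ _ m

/-! ### Series divisible by `z` -/

/-- The ideal of the series vanishing along `z = 0`. -/
def zIdeal (n : ℕ) : Ideal (Ser n) where
  carrier := {p | ∀ m, (∀ j, m (zv j) = 0) → coeff m p = 0}
  add_mem' := by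
    intro p q hp hq m hm
    rw [map_add, hp m hm, hq m hm, add_zero]
  zero_mem' := by intro m _; exact map_zero _
  smul_mem' := by
    classical
    intro c p hp m hm
    rw [smul_eq_mul, coeff_mul]
    refine Finset.sum_eq_zero fun x hx => ?_
    rw [Finset.HasAntidiagonal.mem_antidiagonal] at hx
    rw [hp x.2 fun j => ?_, mul_zero]
    have := hm j
    rw [← hx] at this
    exact (Nat.add_eq_zero_iff.mp this).2

theorem mem_zIdeal {p : Ser n} : p ∈ zIdeal n ↔ ∀ b, bi 0 b p = 0 := by
  constructor
  · intro h b
    ext m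
    rw [coeff_bi]
    split_ifs with hm
    · refine h m fun j => ?_
      exact Finset.sum_eq_zero_iff.mp hm.1 j (Finset.mem_univ _)
    · rfl
  · intro h m hm
    have := congrArg (coeff m) (h (∑ j, m (zbv j)))
    rwa [coeff_bi, if_pos ⟨Finset.sum_eq_zero fun j _ => hm j, rfl⟩] at this

theorem X_zv_mem_zIdeal (j : Fin n) : (X (zv j) : Ser n) ∈ zIdeal n := by
  rw [mem_zIdeal]
  intro b
  simpa using bi_zero_X_zv_mul b j 1

theorem eul_mem_zIdeal (p : Ser n) : eul n p ∈ zIdeal n := by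
  rw [eul_apply]
  exact Submodule.sum_mem _ fun j _ => Ideal.mul_mem_right _ _ (X_zv_mem_zIdeal j)

theorem rho_mem_zIdeal : rho n s ∈ zIdeal n :=
  Submodule.sum_mem _ fun j _ =>
    Ideal.mul_mem_left _ _ (Ideal.mul_mem_right _ _ (X_zv_mem_zIdeal j))

end

/-! ### Linear theory: what each normalization condition sees of f -/

section

variable {n s : ℕ}

/-! ### The linearized equations: bihomogeneous components -/

/-- The imaginary unit as a series. -/
abbrev cI : Ser n := C Complex.I

theorem cI_mul_self : (cI * cI : Ser n) = -1 := by
  rw [← map_mul, Complex.I_mul_I, map_neg, map_one]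

@[simp] theorem bar_cI : (cI : Ser n).bar = -cI := by rw [bar_C, Complex.conj_I, map_neg]

@[simp] theorem bar_natCast (a : ℕ) : (a : Ser n).bar = a := map_natCast (barHom n) a

theorem bar_two : (2 : Ser n).bar = 2 := map_ofNat (barHom n) 2
theorem bar_three : (3 : Ser n).bar = 3 := map_ofNat (barHom n) 3
theorem bar_four : (4 : Ser n).bar = 4 := map_ofNat (barHom n) 4
theorem bar_five : (5 : Ser n).bar = 5 := map_ofNat (barHom n) 5

theorem bar_du (p : Ser n) : Ser.bar (∂ᵤ p) = ∂ᵤ p.bar := bar_pderiv _ _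

@[simp] theorem du_cI_mul (p : Ser n) : ∂ᵤ (cI * p) = cI * ∂ᵤ p := pderiv_C_mul _ _ _

@[simp] theorem du_rho_mul (p : Ser n) : ∂ᵤ (rho n s * p) = rho n s * ∂ᵤ p := pderiv_uv_rho_mul _

theorem du_natCast_mul (a : ℕ) (p : Ser n) : ∂ᵤ ((a : Ser n) * p) = (a : Ser n) * ∂ᵤ p := by
  rw [pderiv_mul, Derivation.map_natCast, zero_mul, zero_add]

theorem du_cI : ∂ᵤ (cI : Ser n) = 0 := pderiv_C

theorem du_two : ∂ᵤ (2 : Ser n) = 0 := by exact_mod_cast Derivation.map_natCast (∂ᵤ) 2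

theorem du_three : ∂ᵤ (3 : Ser n) = 0 := by exact_mod_cast Derivation.map_natCast (∂ᵤ) 3

theorem bi_natCast_mul (a b c : ℕ) (p : Ser n) : bi a b ((c : Ser n) * p) = (c : Ser n) * bi a b p := by
  rw [← map_natCast (C : ℂ →+* Ser n), bi_C_mul]

theorem bi_cI_mul (a b : ℕ) (p : Ser n) : bi a b (cI * p) = cI * bi a b p := bi_C_mul _ _ _ _

theorem bi_eul' (a b : ℕ) (p : Ser n) : bi a b (eul n p) = (a : Ser n) * bi a b p := by
  rw [bi_eul, map_natCast]

theorem bi_eulb' (a b : ℕ) (p : Ser n) : bi a b (eulb n p) = (b : Ser n) * bi a b p := by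
  rw [bi_eulb, map_natCast]

theorem natCast_mul_cancel {a : ℕ} (ha : a ≠ 0) {p q : Ser n} (h : (a : Ser n) * p = a * q) :
    p = q := by
  have h1 : (C ((a : ℂ)⁻¹) : Ser n) * a = 1 := by
    rw [← map_natCast (C : ℂ →+* Ser n), ← map_mul, inv_mul_cancel₀ (by exact_mod_cast ha), map_one]
  linear_combination C ((a : ℂ)⁻¹) * h - (p - q) * h1

theorem natCast_mul_eq_zero {a : ℕ} (ha : a ≠ 0) {p : Ser n} (h : (a : Ser n) * p = 0) : p = 0 :=
  natCast_mul_cancel ha (by rw [h, mul_zero])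

theorem C_inv_mul_natCast {a : ℕ} (ha : a ≠ 0) : (C ((a : ℂ)⁻¹) : Ser n) * a = 1 := by
  rw [← map_natCast (C : ℂ →+* Ser n), ← map_mul, inv_mul_cancel₀ (by exact_mod_cast ha), map_one]

/-- The operator `∑ z_j ∂/∂z_j + i⟨z, z⟩ ∂/∂u`. -/
def DD (n s : ℕ) : Ser n →ₗ[ℂ] Ser n where
  toFun p := eul n p + cI * (rho n s * ∂ᵤ p)
  map_add' p q := by simp only [map_add, mul_add]; ring
  map_smul' c p := by
    simp only [Derivation.map_smul, RingHom.id_apply]; simp only [smul_eq_C_mul]; ring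

/-- The operator `∑ z̄_j ∂/∂z̄_j - i⟨z, z⟩ ∂/∂u`. -/
def DDb (n s : ℕ) : Ser n →ₗ[ℂ] Ser n where
  toFun p := eulb n p - cI * (rho n s * ∂ᵤ p)
  map_add' p q := by simp only [map_add, mul_add]; ring
  map_smul' c p := by
    simp only [Derivation.map_smul, RingHom.id_apply]; simp only [smul_eq_C_mul]; ring

theorem DD_apply (p : Ser n) : DD n s p = eul n p + cI * (rho n s * ∂ᵤ p) := rfl
theorem DDb_apply (p : Ser n) : DDb n s p = eulb n p - cI * (rho n s * ∂ᵤ p) := rfl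

theorem bar_DD (p : Ser n) : (DD n s p).bar = DDb n s p.bar := by
  rw [DD_apply, DDb_apply, bar_add, bar_mul, bar_mul, bar_eul, bar_du, bar_cI, bar_rho]; ring

theorem bar_DDb (p : Ser n) : (DDb n s p).bar = DD n s p.bar := by
  rw [← bar_bar (DD n s p.bar), bar_DD, bar_bar]

/-- As ρ has bidegree (1, 1), bidegree (a+1, b+1) is coupled only with (a, b). All recursions below
run along these diagonals. -/
theorem bi_DD_succ (a b : ℕ) (p : Ser n) : bi (a + 1) (b + 1) (DD n s p) =
    ((a : Ser n) + 1) * bi (a + 1) (b + 1) p + cI * (rho n s * ∂ᵤ (bi a b p)) := by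
  rw [DD_apply, map_add, bi_eul', bi_cI_mul, bi_rho_mul, bi_pderiv_uv]
  push_cast; ring

theorem bi_DD_right_zero (a : ℕ) (p : Ser n) : bi a 0 (DD n s p) = (a : Ser n) * bi a 0 p := by
  rw [DD_apply, map_add, bi_eul', bi_cI_mul, bi_zero_right_rho_mul]; ring

theorem bi_DD_left_zero (b : ℕ) (p : Ser n) : bi 0 b (DD n s p) = 0 := by
  rw [DD_apply, map_add, bi_eul', bi_cI_mul, bi_zero_left_rho_mul]; push_cast; ring

theorem bi_DDb_succ (a b : ℕ) (p : Ser n) : bi (a + 1) (b + 1) (DDb n s p) =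
    ((b : Ser n) + 1) * bi (a + 1) (b + 1) p - cI * (rho n s * ∂ᵤ (bi a b p)) := by
  rw [DDb_apply, map_sub, bi_eulb', bi_cI_mul, bi_rho_mul, bi_pderiv_uv]
  push_cast; ring

theorem bi_DDb_right_zero (a : ℕ) (p : Ser n) : bi a 0 (DDb n s p) = 0 := by
  rw [DDb_apply, map_sub, bi_eulb', bi_cI_mul, bi_zero_right_rho_mul]; push_cast; ring

theorem bi_DDb_left_zero (b : ℕ) (p : Ser n) : bi 0 b (DDb n s p) = (b : Ser n) * bi 0 b p := by
  rw [DDb_apply, map_sub, bi_eulb', bi_cI_mul, bi_zero_left_rho_mul]; ring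

/-- The function `∑ ε_l f_l z̄_l`. -/
def herm (s : ℕ) (f : Fin n → Ser n) : Ser n := ∑ l, C (sg s l) * (X (zbv l) * f l)

/-- The function `∑ B_{kl} z_k f_l`. -/
def nz (B : Fin n → Fin n → ℂ) (f : Fin n → Ser n) : Ser n :=
  ∑ k, ∑ l, C (B k l) * (X (zv k) * f l)

/-- The linear part of the transformation rule of the `w`-component. -/
def qop (s : ℕ) (B : Fin n → Fin n → ℂ) (f : Fin n → Ser n) : Ser n :=
  nz B (fun l => DD n s (f l) - f l) + cI * (herm s f).bar + cI * herm s (fun l => DD n s (f l))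

theorem herm_add (f g : Fin n → Ser n) : herm s (f + g) = herm s f + herm s g := by
  simp only [herm, Pi.add_apply, mul_add, Finset.sum_add_distrib]

theorem nz_add (B : Fin n → Fin n → ℂ) (f g : Fin n → Ser n) : nz B (f + g) = nz B f + nz B g := by
  simp only [nz, Pi.add_apply, mul_add, Finset.sum_add_distrib]

theorem herm_zero : herm s (0 : Fin n → Ser n) = 0 := by simp [herm]

theorem nz_zero (B : Fin n → Fin n → ℂ) : nz B (0 : Fin n → Ser n) = 0 := by simp [nz]

theorem qop_add (B : Fin n → Fin n → ℂ) (f g : Fin n → Ser n) :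
    qop s B (f + g) = qop s B f + qop s B g := by
  have h1 : (fun l => DD n s ((f + g) l) - (f + g) l) =
      (fun l => DD n s (f l) - f l) + fun l => DD n s (g l) - g l := by
    funext l; simp only [Pi.add_apply, map_add]; ring
  have h2 : (fun l => DD n s ((f + g) l)) = (fun l => DD n s (f l)) + fun l => DD n s (g l) := by
    funext l; simp only [Pi.add_apply, map_add]
  rw [qop, h1, h2, nz_add, herm_add, herm_add, bar_add, qop, qop]; ring

theorem bi_herm_succ (a b : ℕ) (f : Fin n → Ser n) :
    bi a (b + 1) (herm s f) = herm s fun l => bi a b (f l) := by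
  simp only [herm, map_sum, bi_C_mul, bi_X_zbv_mul]

theorem bi_herm_zero (a : ℕ) (f : Fin n → Ser n) : bi a 0 (herm s f) = 0 := by
  simp only [herm, map_sum, bi_C_mul, bi_zero_X_zbv_mul, mul_zero, Finset.sum_const_zero]

theorem bi_nz_succ (B : Fin n → Fin n → ℂ) (a b : ℕ) (f : Fin n → Ser n) :
    bi (a + 1) b (nz B f) = nz B fun l => bi a b (f l) := by
  simp only [nz, map_sum, bi_C_mul, bi_X_zv_mul]

theorem bi_nz_zero (B : Fin n → Fin n → ℂ) (b : ℕ) (f : Fin n → Ser n) : bi 0 b (nz B f) = 0 := by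
  simp only [nz, map_sum, bi_C_mul, bi_zero_X_zv_mul, mul_zero, Finset.sum_const_zero]

/-- The left-hand side of the condition that determines the map in terms of the right-hand side of
the linearized equation, for the component of bidegree `(1, 1)`. -/
def obs11 (W : Ser n) : Ser n := bi 1 1 W - (bi 1 1 W).bar

/-- The condition for the components of bidegree `(a + 1, 1)`, `a ≥ 1`. -/
def obsSucc (s a : ℕ) (W : Ser n) : Ser n :=
  (a : Ser n) * (bi (a + 1) 1 W - ((a : Ser n) + 1) * (bi 1 (a + 1) W).bar) -
    ((a : Ser n) + 2) * (cI * (rho n s * ∂ᵤ (bi a 0 W)))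

/-- The condition for the component of bidegree `(2, 2)`. -/
def obs22 (s : ℕ) (W : Ser n) : Ser n :=
  bi 2 2 W - (bi 2 2 W).bar - cI * (rho n s * ∂ᵤ (bi 1 1 W + (bi 1 1 W).bar))

/-- The condition for the component of bidegree `(3, 2)`. -/
def obs32 (s : ℕ) (W : Ser n) : Ser n :=
  2 * bi 3 2 W - 3 * (bi 2 3 W).bar -
    5 * (cI * (rho n s * ∂ᵤ ((bi 1 2 W).bar + cI * (rho n s * ∂ᵤ (bi 1 0 W)))))

/-- The condition for the component of bidegree `(3, 3)`. -/
def obs33 (s : ℕ) (W : Ser n) : Ser n :=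
  2 * (bi 3 3 W - (bi 3 3 W).bar) - cI * (rho n s * ∂ᵤ (bi 2 2 W + (bi 2 2 W).bar))

theorem obs11_add (W W' : Ser n) : obs11 (W + W') = obs11 W + obs11 W' := by
  simp only [obs11, map_add, bar_add]; ring
theorem obsSucc_add (a : ℕ) (W W' : Ser n) : obsSucc s a (W + W') = obsSucc s a W + obsSucc s a W' := by
  simp only [obsSucc, map_add, bar_add]; ring
theorem obs22_add (W W' : Ser n) : obs22 s (W + W') = obs22 s W + obs22 s W' := by
  simp only [obs22, map_add, bar_add]; ring
theorem obs32_add (W W' : Ser n) : obs32 s (W + W') = obs32 s W + obs32 s W' := by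
  simp only [obs32, map_add, bar_add, mul_add]; ring
theorem obs33_add (W W' : Ser n) : obs33 s (W + W') = obs33 s W + obs33 s W' := by
  simp only [obs33, map_add, bar_add]; ring

theorem du_herm (g : Fin n → Ser n) : ∂ᵤ (herm s g) = herm s fun l => ∂ᵤ (g l) := by
  simp only [herm, map_sum, pderiv_mul, pderiv_C, pderiv_uv_zbv, zero_mul, zero_add]

theorem du_nz (B : Fin n → Fin n → ℂ) (g : Fin n → Ser n) : ∂ᵤ (nz B g) = nz B fun l => ∂ᵤ (g l) := by
  simp only [nz, map_sum, pderiv_mul, pderiv_C, pderiv_uv_zv, zero_mul, zero_add]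

section Values

variable {B : Fin n → Fin n → ℂ} {f : Fin n → Ser n} (hf : ∀ l, DDb n s (f l) = 0)
include hf

/-- On the kernel of `DDb` the term iρ∂/∂u acts as Σ z̄_j ∂/∂z̄_j, so `DD` multiplies by the total
degree in (z, z̄). -/
theorem bi_DD_of_DDb (a b : ℕ) (l : Fin n) :
    bi a b (DD n s (f l)) = ((a : Ser n) + b) * bi a b (f l) := by
  have h : DD n s (f l) = eul n (f l) + eulb n (f l) := by
    have := hf l
    rw [DDb_apply] at this
    rw [DD_apply]; linear_combination -this
  rw [h, map_add, bi_eul', bi_eulb']; ring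

/-- Together with `f_zero_succ` this identifies the kernel of `DDb` with the formal CR functions on
the quadric Im w = ρ: they are determined by their components of bidegree (a, 0). -/
theorem f_rec (a b : ℕ) (l : Fin n) :
    ((b : Ser n) + 1) * bi (a + 1) (b + 1) (f l) = cI * (rho n s * ∂ᵤ (bi a b (f l))) := by
  have := congrArg (bi (a + 1) (b + 1)) (hf l)
  rw [bi_DDb_succ, map_zero] at this
  linear_combination this

theorem f_zero_succ (b : ℕ) (l : Fin n) : bi 0 (b + 1) (f l) = 0 := by
  have := congrArg (bi 0 (b + 1)) (hf l)
  rw [bi_DDb_left_zero, map_zero] at this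
  exact natCast_mul_eq_zero (Nat.succ_ne_zero _) this

/-- In bidegree (a, b) the products z_k f_l and z̄_l f_l involve f_l in total degree a + b - 1. By
`bi_DD_of_DDb`, `DD` becomes multiplication by this number. -/
theorem bi_qop (a b : ℕ) : bi a b (qop s B f) = ((a : Ser n) + (b : Ser n) - 2) * bi a b (nz B f) +
    cI * (bi b a (herm s f)).bar + cI * (((a : Ser n) + (b : Ser n) - 1) * bi a b (herm s f)) := by
  rw [qop, map_add, map_add, bi_cI_mul, bi_cI_mul, bi_bar]
  congr 1
  · congr 1
    rcases a with _ | a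
    · rw [bi_nz_zero, bi_nz_zero, mul_zero]
    · rw [bi_nz_succ, bi_nz_succ]
      simp only [map_sub, bi_DD_of_DDb hf, nz, Finset.mul_sum]
      refine Finset.sum_congr rfl fun k _ => Finset.sum_congr rfl fun l _ => ?_
      push_cast; ring
  · congr 1
    rcases b with _ | b
    · rw [bi_herm_zero, bi_herm_zero, mul_zero]
    · rw [bi_herm_succ, bi_herm_succ]
      simp only [bi_DD_of_DDb hf, herm, Finset.mul_sum]
      refine Finset.sum_congr rfl fun l _ => ?_
      push_cast; ring

theorem herm_rec (a b : ℕ) : (b : Ser n) * bi (a + 1) (b + 1) (herm s f) =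
    cI * (rho n s * ∂ᵤ (bi a b (herm s f))) := by
  rcases b with _ | b
  · rw [bi_herm_zero]; simp
  · rw [bi_herm_succ, bi_herm_succ, du_herm]
    simp only [herm, Finset.mul_sum]
    refine Finset.sum_congr rfl fun l _ => ?_
    have := f_rec hf a b l
    push_cast
    linear_combination C (sg s l) * X (zbv l) * this

theorem herm_zero_succ (b : ℕ) : bi 0 (b + 2) (herm s f) = 0 := by
  rw [bi_herm_succ]
  simp only [f_zero_succ hf, herm, mul_zero, Finset.sum_const_zero]

theorem nz_rec (a b : ℕ) : ((b : Ser n) + 1) * bi (a + 1) (b + 1) (nz B f) =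
    cI * (rho n s * ∂ᵤ (bi a b (nz B f))) := by
  rcases a with _ | a
  · rw [bi_nz_zero, bi_nz_succ]
    simp only [f_zero_succ hf, nz, mul_zero, Finset.sum_const_zero, map_zero]
  · rw [bi_nz_succ, bi_nz_succ, du_nz]
    simp only [nz, Finset.mul_sum]
    refine Finset.sum_congr rfl fun k _ => Finset.sum_congr rfl fun l _ => ?_
    have := f_rec hf a b l
    linear_combination C (B k l) * X (zv k) * this

/-- A CR function on the quadric has no components with more factors z̄ than z; the additional
factor z_k shifts this bound by one. -/
theorem nz_diag (a b : ℕ) (h : a ≤ b) : bi a b (nz B f) = 0 := by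
  induction a generalizing b with
  | zero => exact bi_nz_zero _ _ _
  | succ a ih =>
    obtain ⟨b, rfl⟩ : ∃ b', b = b' + 1 := ⟨b - 1, by omega⟩
    have := nz_rec hf (B := B) a b
    rw [ih b (by omega), map_zero, mul_zero, mul_zero] at this
    exact natCast_mul_eq_zero (Nat.succ_ne_zero b) (by push_cast; exact this)

/-- This and the next five formulas show which part of f each solvability condition controls. Here
it is the real part of Σ ε_l z̄_l f_{10,l}. -/
theorem obs11_qop : obs11 (qop s B f) = 2 * cI * (bi 1 1 (herm s f) + (bi 1 1 (herm s f)).bar) := by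
  have w : bi 1 1 (qop s B f) = cI * (bi 1 1 (herm s f)).bar + cI * bi 1 1 (herm s f) := by
    rw [bi_qop hf, nz_diag hf 1 1 le_rfl]; push_cast; ring
  rw [obs11, w]
  simp only [bar_add, bar_mul, bar_bar, bar_cI]
  ring

/-- Determines f_{20} in terms of the u-derivative of f_{00}, which is all that the last two terms
contain. -/
theorem obsSucc_one_qop : obsSucc s 1 (qop s B f) = 4 * cI * bi 2 1 (herm s f) +
    4 * cI * (rho n s * ∂ᵤ (bi 1 0 (nz B f))) + 8 * (rho n s * ∂ᵤ (bi 0 1 (herm s f)).bar) := by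
  have hI := cI_mul_self (n := n)
  have e1 : bi 2 1 (nz B f) = cI * (rho n s * ∂ᵤ (bi 1 0 (nz B f))) := by
    simpa using nz_rec hf (B := B) 1 0
  have e2 : bi 1 2 (herm s f) = cI * (rho n s * ∂ᵤ (bi 0 1 (herm s f))) := by
    simpa using herm_rec hf 0 1
  have w21 : bi 2 1 (qop s B f) = bi 2 1 (nz B f) + cI * (bi 1 2 (herm s f)).bar +
      2 * cI * bi 2 1 (herm s f) := by
    rw [bi_qop hf]; push_cast; ring
  have w12 : bi 1 2 (qop s B f) = cI * (bi 2 1 (herm s f)).bar + 2 * cI * bi 1 2 (herm s f) := by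
    rw [bi_qop hf, nz_diag hf 1 2 (by omega)]; push_cast; ring
  have w10 : bi 1 0 (qop s B f) = -bi 1 0 (nz B f) + cI * (bi 0 1 (herm s f)).bar := by
    rw [bi_qop hf, bi_herm_zero]; push_cast; ring
  rw [obsSucc, w21, w12, w10, e1, e2]
  simp only [bar_add, bar_mul, bar_bar, bar_cI, bar_two, bar_du, bar_rho, map_add, map_neg,
    du_cI_mul]
  push_cast
  linear_combination (-8 * (rho n s * ∂ᵤ (bi 0 1 (herm s f)).bar)) * hI

/-- Determines f_{a+3,0} from f_{a+1,0}, the only part of f in the last term. The constants do not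
vanish, so this recursion has no exceptional degrees. -/
theorem obsSucc_qop (a : ℕ) : obsSucc s (a + 2) (qop s B f) =
    2 * ((a : Ser n) + 2) * ((a : Ser n) + 3) * cI * bi (a + 3) 1 (herm s f) +
      4 * cI * (rho n s * ∂ᵤ (bi (a + 2) 0 (nz B f))) := by
  have e1 : bi (a + 3) 1 (nz B f) = cI * (rho n s * ∂ᵤ (bi (a + 2) 0 (nz B f))) := by
    simpa using nz_rec hf (B := B) (a + 2) 0
  have e2 : bi 1 (a + 3) (herm s f) = 0 := by
    have := herm_rec hf 0 (a + 2)
    rw [herm_zero_succ hf, map_zero, mul_zero, mul_zero] at this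
    exact natCast_mul_eq_zero (by omega) this
  have w1 : bi (a + 3) 1 (qop s B f) = ((a : Ser n) + 2) * bi (a + 3) 1 (nz B f) +
      ((a : Ser n) + 3) * cI * bi (a + 3) 1 (herm s f) := by
    rw [bi_qop hf, e2, bar_zero]; push_cast; ring
  have w2 : bi 1 (a + 3) (qop s B f) = cI * (bi (a + 3) 1 (herm s f)).bar := by
    rw [bi_qop hf, nz_diag hf 1 (a + 3) (by omega), e2]; push_cast; ring
  have w3 : bi (a + 2) 0 (qop s B f) = (a : Ser n) * bi (a + 2) 0 (nz B f) := by
    rw [bi_qop hf, bi_herm_zero, herm_zero_succ hf, bar_zero]; push_cast; ring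
  rw [obsSucc, w1, w2, w3, e1]
  simp only [bar_mul, bar_bar, bar_cI, du_natCast_mul]
  push_cast
  ring

/-- Complements `obs11_qop`: the u-derivative of the imaginary part of Σ ε_l z̄_l f_{10,l}. -/
theorem obs22_qop : obs22 s (qop s B f) =
    4 * (rho n s * ∂ᵤ ((bi 1 1 (herm s f)).bar - bi 1 1 (herm s f))) := by
  have hI := cI_mul_self (n := n)
  have e1 : bi 2 2 (herm s f) = cI * (rho n s * ∂ᵤ (bi 1 1 (herm s f))) := by
    simpa using herm_rec hf 1 1
  have w11 : bi 1 1 (qop s B f) = cI * (bi 1 1 (herm s f)).bar + cI * bi 1 1 (herm s f) := by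
    rw [bi_qop hf, nz_diag hf 1 1 le_rfl]; push_cast; ring
  have w22 : bi 2 2 (qop s B f) = cI * (bi 2 2 (herm s f)).bar + 3 * cI * bi 2 2 (herm s f) := by
    rw [bi_qop hf, nz_diag hf 2 2 le_rfl]; push_cast; ring
  rw [obs22, w11, w22, e1]
  simp only [bar_add, bar_mul, bar_bar, bar_cI, bar_neg, bar_three, bar_du, bar_rho, map_add, map_sub,
    map_neg, du_cI_mul, neg_mul, mul_neg]
  linear_combination (4 * (rho n s * (∂ᵤ (bi 1 1 (herm s f)) - ∂ᵤ (bi 1 1 (herm s f)).bar))) * hI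

/-- Eliminating f_{20} by the (2,1) condition of the homogeneous problem leaves 8ρ² (v'' - 3i w'')
with v = Σ B_kl z_k f_{00,l} and w = Σ ε_l z_l f̄_{00,l}. This is the origin of the coefficient 3i
in `Nondeg`, hence of 6i in strong nondegeneracy. -/
theorem obs32_qop : obs32 s (qop s B f) = -16 * (rho n s * ∂ᵤ (bi 2 1 (herm s f))) +
    8 * cI * (rho n s * (rho n s * ∂ᵤ (∂ᵤ (bi 0 1 (herm s f)).bar))) -
    8 * (rho n s * (rho n s * ∂ᵤ (∂ᵤ (bi 1 0 (nz B f))))) := by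
  have hI := cI_mul_self (n := n)
  have e1 : bi 2 1 (nz B f) = cI * (rho n s * ∂ᵤ (bi 1 0 (nz B f))) := by
    simpa using nz_rec hf (B := B) 1 0
  have e2 : 2 * bi 3 2 (nz B f) = cI * (rho n s * ∂ᵤ (bi 2 1 (nz B f))) := by
    have := nz_rec hf (B := B) 2 1
    push_cast at this; linear_combination this
  have e3 : bi 1 2 (herm s f) = cI * (rho n s * ∂ᵤ (bi 0 1 (herm s f))) := by
    simpa using herm_rec hf 0 1
  have e4 : 2 * bi 2 3 (herm s f) = cI * (rho n s * ∂ᵤ (bi 1 2 (herm s f))) := by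
    have := herm_rec hf 1 2
    push_cast at this; linear_combination this
  have e5 : bi 3 2 (herm s f) = cI * (rho n s * ∂ᵤ (bi 2 1 (herm s f))) := by
    simpa using herm_rec hf 2 1
  rw [e1, du_cI_mul, du_rho_mul] at e2
  rw [e3, du_cI_mul, du_rho_mul] at e4
  have e4' := congrArg Ser.bar e4
  have w32 : bi 3 2 (qop s B f) = 3 * bi 3 2 (nz B f) + cI * (bi 2 3 (herm s f)).bar +
      4 * cI * bi 3 2 (herm s f) := by
    rw [bi_qop hf]; push_cast; ring
  have w23 : bi 2 3 (qop s B f) = cI * (bi 3 2 (herm s f)).bar + 4 * cI * bi 2 3 (herm s f) := by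
    rw [bi_qop hf, nz_diag hf 2 3 (by omega)]; push_cast; ring
  have w12 : bi 1 2 (qop s B f) = cI * (bi 2 1 (herm s f)).bar + 2 * cI * bi 1 2 (herm s f) := by
    rw [bi_qop hf, nz_diag hf 1 2 (by omega)]; push_cast; ring
  have w10 : bi 1 0 (qop s B f) = -bi 1 0 (nz B f) + cI * (bi 0 1 (herm s f)).bar := by
    rw [bi_qop hf, bi_herm_zero]; push_cast; ring
  rw [obs32, w32, w23, w12, w10, e5, e3]
  simp only [bar_add, bar_mul, bar_bar, bar_cI, bar_neg, bar_two, bar_four, bar_du, bar_rho, map_add, map_neg,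
    pderiv_mul, du_cI, du_two, pderiv_uv_rho, zero_mul, zero_add, neg_mul, mul_neg, mul_add] at e4' ⊢
  linear_combination 3 * e2 + 7 * cI * e4' + (16 * (rho n s * ∂ᵤ (bi 2 1 (herm s f))) +
    8 * (rho n s * (rho n s * ∂ᵤ (∂ᵤ (bi 1 0 (nz B f))))) -
    8 * cI * (rho n s * (rho n s * ∂ᵤ (∂ᵤ (bi 0 1 (herm s f)).bar)))) * hI

/-- Only the real part controlled by the (1,1) condition enters. That condition replaces it by ρ
∂g_{00}/∂u plus known terms, which yields a third-order equation for g_{00}. -/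
theorem obs33_qop : obs33 s (qop s B f) =
    -4 * cI * (rho n s * (rho n s * ∂ᵤ (∂ᵤ (bi 1 1 (herm s f) + (bi 1 1 (herm s f)).bar)))) := by
  have hI := cI_mul_self (n := n)
  have e1 : bi 2 2 (herm s f) = cI * (rho n s * ∂ᵤ (bi 1 1 (herm s f))) := by
    simpa using herm_rec hf 1 1
  have e2 : 2 * bi 3 3 (herm s f) = cI * (rho n s * ∂ᵤ (bi 2 2 (herm s f))) := by
    have := herm_rec hf 2 2
    push_cast at this; linear_combination this
  rw [e1, du_cI_mul, du_rho_mul] at e2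
  have e2' := congrArg Ser.bar e2
  have w22 : bi 2 2 (qop s B f) = cI * (bi 2 2 (herm s f)).bar + 3 * cI * bi 2 2 (herm s f) := by
    rw [bi_qop hf, nz_diag hf 2 2 le_rfl]; push_cast; ring
  have w33 : bi 3 3 (qop s B f) = cI * (bi 3 3 (herm s f)).bar + 5 * cI * bi 3 3 (herm s f) := by
    rw [bi_qop hf, nz_diag hf 3 3 le_rfl]; push_cast; ring
  rw [obs33, w22, w33, e1]
  simp only [bar_add, bar_mul, bar_bar, bar_cI, bar_neg, bar_two, bar_three, bar_five, bar_du, bar_rho, map_add, map_neg,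
    pderiv_mul, du_cI, du_three, pderiv_uv_rho, zero_mul, zero_add, neg_mul, mul_neg, mul_add] at e2' ⊢
  linear_combination 6 * cI * (e2 + e2') + 4 * cI * (rho n s * (rho n s *
    (∂ᵤ (∂ᵤ (bi 1 1 (herm s f))) + ∂ᵤ (∂ᵤ (bi 1 1 (herm s f)).bar)))) * hI

end Values

end

/-! ### Linear theory: normalization of ψ as a condition on the right-hand side -/

section

variable {n s : ℕ}

/-! ### The linearized equation: solution for the normal form -/

/-- The Chern–Moser normalization. -/
structure IsNF (n s : ℕ) (ψ : Ser n) : Prop where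
  real : ψ.bar = ψ
  right_zero : ∀ a, bi a 0 ψ = 0
  one_one : bi 1 1 ψ = 0
  right_one : ∀ a, bi (a + 2) 1 ψ = 0
  two_two : trc n s (bi 2 2 ψ) = 0
  three_two : trc n s (trc n s (bi 3 2 ψ)) = 0
  three_three : trc n s (trc n s (trc n s (bi 3 3 ψ))) = 0

/-- The solvability conditions of the linearized equation, for a given real function `g₀(u)`. -/
structure Cond (s : ℕ) (W g₀ : Ser n) : Prop where
  eq11 : obs11 W = 2 * (cI * (rho n s * ∂ᵤ g₀))
  eqSucc : ∀ a, obsSucc s (a + 1) W = 0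
  eq22 : trc n s (obs22 s W) = 0
  eq32 : trc n s (trc n s (obs32 s W)) = 0
  eq33 : trc n s (trc n s (trc n s (obs33 s W))) = 0

/-- The operator applied to the defining function in the linearized equation, in the extrinsic
(`true`) and the intrinsic (`false`) setting. -/
def modeOp (n s : ℕ) (T : Bool) : Ser n →ₗ[ℂ] Ser n := bif T then DD n s else LinearMap.id

theorem natCast_cI_mul_eq_zero {c : ℕ} (hc : c ≠ 0) {p : Ser n}
    (h : (c : Ser n) * (cI * p) = 0) : p = 0 := by
  have h1 := natCast_mul_eq_zero hc h
  linear_combination -cI * h1 + p * cI_mul_self (n := n)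

theorem trc_natCast_cI_mul (c : ℕ) (p : Ser n) :
    trc n s ((c : Ser n) * (cI * p)) = (c : Ser n) * (cI * trc n s p) := by
  rw [← map_natCast (C : ℂ →+* Ser n), trc_C_mul, trc_C_mul]

/-- The `obs` combinations cancel the unknown g apart from its (0,0) component. They leave a nonzero
multiple of one component of ψ, plus u-derivatives of components in bidegrees (1,1) and (2,1); these
vanish by the earlier conditions, so the conditions can be treated in order. -/
theorem cond_iff_aux {W g ψ : Ser n} (κ : ℕ → ℕ) (hκ : ∀ a, κ (a + 1) ≠ 0) {a₃ a₄ a₅ b₄ b₅ : ℕ}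
    (h₃ : a₃ ≠ 0) (h₄ : a₄ ≠ 0) (h₅ : a₅ ≠ 0) (hψ : ψ.bar = ψ) (hψ0 : ∀ a, bi a 0 ψ = 0)
    (e1 : obs11 W = 2 * (cI * bi 1 1 ψ) + 2 * (cI * (rho n s * ∂ᵤ (bi 0 0 g))))
    (e2 : ∀ a, obsSucc s a W = (κ a : Ser n) * (cI * bi (a + 1) 1 ψ))
    (e3 : obs22 s W = (a₃ : Ser n) * (cI * bi 2 2 ψ))
    (e4 : obs32 s W = (a₄ : Ser n) * (cI * bi 3 2 ψ) - (b₄ : Ser n) * (rho n s * ∂ᵤ (bi 2 1 ψ)))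
    (e5 : obs33 s W = (a₅ : Ser n) * (cI * bi 3 3 ψ) +
      (b₅ : Ser n) * (cI * (rho n s * (rho n s * ∂ᵤ (∂ᵤ (bi 1 1 ψ)))))) :
    Cond s W (bi 0 0 g) ↔ IsNF n s ψ := by
  constructor
  · rintro ⟨c1, c2, c3, c4, c5⟩
    have h11 : bi 1 1 ψ = 0 := natCast_cI_mul_eq_zero (c := 2) two_ne_zero (by
      push_cast; linear_combination c1 - e1)
    have h21 : ∀ a, bi (a + 2) 1 ψ = 0 := fun a =>
      natCast_cI_mul_eq_zero (hκ a) ((e2 (a + 1)).symm.trans (c2 a))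
    rw [h21 0, map_zero, mul_zero, mul_zero, sub_zero] at e4
    rw [h11, map_zero, map_zero, mul_zero, mul_zero, mul_zero, mul_zero, add_zero] at e5
    rw [e3, trc_natCast_cI_mul] at c3
    rw [e4, trc_natCast_cI_mul, trc_natCast_cI_mul] at c4
    rw [e5, trc_natCast_cI_mul, trc_natCast_cI_mul, trc_natCast_cI_mul] at c5
    exact ⟨hψ, hψ0, h11, h21, natCast_cI_mul_eq_zero h₃ c3, natCast_cI_mul_eq_zero h₄ c4,
      natCast_cI_mul_eq_zero h₅ c5⟩
  · rintro ⟨-, -, h11, h21, h22, h32, h33⟩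
    rw [h21 0, map_zero, mul_zero, mul_zero, sub_zero] at e4
    rw [h11, map_zero, map_zero, mul_zero, mul_zero, mul_zero, mul_zero, add_zero] at e5
    refine ⟨?_, fun a => ?_, ?_, ?_, ?_⟩
    · rw [e1, h11]; ring
    · rw [e2, h21, mul_zero, mul_zero]
    · rw [e3, trc_natCast_cI_mul, h22, mul_zero, mul_zero]
    · rw [e4, trc_natCast_cI_mul, trc_natCast_cI_mul, h32, mul_zero, mul_zero]
    · rw [e5, trc_natCast_cI_mul, trc_natCast_cI_mul, trc_natCast_cI_mul, h33, mul_zero, mul_zero]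

theorem bar_bi_of_real {p : Ser n} (hp : p.bar = p) (a b : ℕ) : (bi a b p).bar = bi b a p := by
  conv_rhs => rw [← hp]
  rw [bi_bar]

/-- Since g and ψ are real, the components (a, b) and (b, a) of the right-hand side are two
expressions in the same components of g and ψ, and g can be eliminated between them. The two modes
differ only in nonzero factors, which is why the same conditions serve both parts of the theorem. -/
theorem cond_iff (T : Bool) {g ψ : Ser n} (hg : g.bar = g) (hψ : ψ.bar = ψ)
    (hψ0 : ∀ a, bi a 0 ψ = 0) :
    Cond s (DD n s g + cI * modeOp n s T ψ) (bi 0 0 g) ↔ IsNF n s ψ := by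
  have hI := cI_mul_self (n := n)
  have hψ0' : ∀ b, bi 0 b ψ = 0 := fun b => by rw [← bar_bi_of_real hψ, hψ0, bar_zero]
  cases T
  · have hW : ∀ a b, bi (a + 1) (b + 1) (DD n s g + cI * modeOp n s false ψ) =
        ((a : Ser n) + 1) * bi (a + 1) (b + 1) g + cI * (rho n s * ∂ᵤ (bi a b g)) +
          cI * bi (a + 1) (b + 1) ψ := fun a b => by
      rw [map_add, bi_DD_succ, bi_cI_mul]; rfl
    have hW0 : ∀ a, bi a 0 (DD n s g + cI * modeOp n s false ψ) = (a : Ser n) * bi a 0 g :=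
      fun a => by
        rw [map_add, bi_DD_right_zero, bi_cI_mul, modeOp, cond_false, LinearMap.id_apply, hψ0,
          mul_zero, add_zero]
    -- The factors count copies of ψ left by the elimination of g. In bidegree (a+1, 1) there is one
    -- from this component and a+1 from the conjugate of (1, a+1), all multiplied by a.
    refine cond_iff_aux (g := g) (κ := fun a => a * (a + 2)) (a₃ := 2) (a₄ := 5) (a₅ := 4) (b₄ := 5)
      (b₅ := 0) (fun a => by positivity) (by norm_num) (by norm_num) (by norm_num) hψ hψ0
      ?_ (fun a => ?_) ?_ ?_ ?_
    · rw [obs11, hW 0 0]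
      simp only [bar_add, bar_mul, bar_cI, bar_rho, bar_du, bar_bi_of_real hg, bar_bi_of_real hψ,
        bar_natCast, bar_one]
      push_cast; ring
    · rw [obsSucc, hW a 0, hW 0 a, hW0]
      simp only [bar_add, bar_mul, bar_cI, bar_rho, bar_du, bar_bi_of_real hg, bar_bi_of_real hψ,
        bar_natCast, bar_one, du_natCast_mul]
      push_cast; ring
    · rw [obs22, hW 1 1, hW 0 0]
      simp only [bar_add, bar_mul, bar_cI, bar_rho, bar_du, bar_bi_of_real hg, bar_bi_of_real hψ,
        bar_natCast, bar_one, map_add, pderiv_mul, du_cI, pderiv_uv_rho, Derivation.map_natCast,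
        Derivation.map_one_eq_zero, map_neg]
      push_cast; ring
    · rw [obs32, hW 2 1, hW 1 2, hW 0 1, hW0]
      simp only [bar_add, bar_mul, bar_cI, bar_rho, bar_du, bar_bi_of_real hg, bar_bi_of_real hψ,
        bar_natCast, bar_one, map_add, pderiv_mul, du_cI, pderiv_uv_rho, Derivation.map_natCast,
        Derivation.map_one_eq_zero, map_neg, map_zero]
      push_cast
      linear_combination (5 * (rho n s * ∂ᵤ (bi 2 1 ψ))) * hI
    · rw [obs33, hW 2 2, hW 1 1]
      simp only [bar_add, bar_mul, bar_cI, bar_rho, bar_du, bar_bi_of_real hg, bar_bi_of_real hψ,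
        bar_natCast, bar_one, map_add, pderiv_mul, du_cI, pderiv_uv_rho, Derivation.map_natCast,
        Derivation.map_one_eq_zero, map_neg]
      push_cast; ring
  · have hW : ∀ a b, bi (a + 1) (b + 1) (DD n s g + cI * modeOp n s true ψ) =
        ((a : Ser n) + 1) * bi (a + 1) (b + 1) g + cI * (rho n s * ∂ᵤ (bi a b g)) +
          cI * (((a : Ser n) + 1) * bi (a + 1) (b + 1) ψ + cI * (rho n s * ∂ᵤ (bi a b ψ))) :=
      fun a b => by
        rw [map_add, bi_DD_succ, bi_cI_mul, modeOp, cond_true, bi_DD_succ]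
    have hW0 : ∀ a, bi a 0 (DD n s g + cI * modeOp n s true ψ) = (a : Ser n) * bi a 0 g :=
      fun a => by
        rw [map_add, bi_DD_right_zero, bi_cI_mul, modeOp, cond_true, bi_DD_right_zero, hψ0,
          mul_zero, mul_zero, add_zero]
    -- Now the component of ψ in bidegree (a, b) enters with the additional factor a, and `DD`
    -- contributes terms ρ ∂/∂u of its lower components.
    refine cond_iff_aux (g := g) (κ := fun a => 2 * (a * (a + 1))) (a₃ := 4) (a₄ := 12) (a₅ := 12)
      (b₄ := 4) (b₅ := 2) (fun a => by positivity) (by norm_num) (by norm_num) (by norm_num) hψ hψ0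
      ?_ (fun a => ?_) ?_ ?_ ?_
    · rw [obs11, hW 0 0]
      simp only [bar_add, bar_mul, bar_cI, bar_rho, bar_du, bar_bi_of_real hg, bar_bi_of_real hψ,
        bar_natCast, bar_one, hψ0, map_zero, bar_zero]
      push_cast; ring
    · rw [obsSucc, hW a 0, hW 0 a, hW0]
      simp only [bar_add, bar_mul, bar_cI, bar_rho, bar_du, bar_bi_of_real hg, bar_bi_of_real hψ,
        bar_natCast, bar_one, du_natCast_mul, hψ0, hψ0', map_zero, bar_zero]
      push_cast; ring
    · rw [obs22, hW 1 1, hW 0 0]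
      simp only [bar_add, bar_mul, bar_cI, bar_rho, bar_du, bar_bi_of_real hg, bar_bi_of_real hψ,
        bar_natCast, bar_one, map_add, pderiv_mul, du_cI, pderiv_uv_rho, Derivation.map_natCast,
        Derivation.map_one_eq_zero, map_neg, hψ0, map_zero, bar_zero]
      push_cast; ring
    · rw [obs32, hW 2 1, hW 1 2, hW 0 1, hW0]
      simp only [bar_add, bar_mul, bar_cI, bar_rho, bar_du, bar_bi_of_real hg, bar_bi_of_real hψ,
        bar_natCast, bar_one, map_add, pderiv_mul, du_cI, pderiv_uv_rho, Derivation.map_natCast,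
        Derivation.map_one_eq_zero, map_neg, hψ0', map_zero, bar_zero]
      push_cast
      linear_combination (4 * (rho n s * ∂ᵤ (bi 2 1 ψ))) * hI
    · rw [obs33, hW 2 2, hW 1 1]
      simp only [bar_add, bar_mul, bar_cI, bar_rho, bar_du, bar_bi_of_real hg, bar_bi_of_real hψ,
        bar_natCast, bar_one, map_add, pderiv_mul, du_cI, pderiv_uv_rho, Derivation.map_natCast,
        Derivation.map_one_eq_zero, map_neg]
      push_cast
      linear_combination (-2 * cI * (rho n s * (rho n s * ∂ᵤ (∂ᵤ (bi 1 1 ψ))))) * hI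

/-! ### Solving for the defining function -/

section Families

variable {𝒳 : Type*} {A : CoeffAlg 𝒳}

theorem CoeffAlg.IsSer.DD {P : 𝒳 → Ser n} (hP : A.IsSer P) : A.IsSer fun x => DD n s (P x) :=
  hP.eul.add ((CoeffAlg.IsSer.const _).mul ((CoeffAlg.IsSer.const _).mul (hP.pderiv _)))

theorem CoeffAlg.IsSer.modeOp (T : Bool) {P : 𝒳 → Ser n} (hP : A.IsSer P) :
    A.IsSer fun x => modeOp n s T (P x) := by
  cases T
  · exact hP
  · exact hP.DD

theorem natCast_mul_C_inv {a : ℕ} (ha : a ≠ 0) (p : Ser n) :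
    (a : Ser n) * (C ((a : ℂ)⁻¹) * p) = p := by
  rw [← mul_assoc, mul_comm (a : Ser n), C_inv_mul_natCast ha, one_mul]

/-- The recursion for the solution of `DD A = W`. -/
def solveRec (s : ℕ) (W g₀ : Ser n) : ℕ → ℕ → Ser n
  | 0, 0 => g₀
  | a + 1, 0 => C (((a + 1 : ℕ) : ℂ)⁻¹) * bi (a + 1) 0 W
  | 0, b + 1 => C (((b + 1 : ℕ) : ℂ)⁻¹) * (bi (b + 1) 0 W).bar
  | a + 1, b + 1 => C (((a + 1 : ℕ) : ℂ)⁻¹) *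
      (bi (a + 1) (b + 1) W - cI * (rho n s * ∂ᵤ (bi a b (solveRec s W g₀ a b))))

theorem isSer_solveRec {W g₀ : 𝒳 → Ser n} (hW : A.IsSer W) (hg : A.IsSer g₀) (a b : ℕ) :
    A.IsSer fun x => solveRec s (W x) (g₀ x) a b := by
  induction a generalizing b with
  | zero =>
    rcases b with _ | b
    · exact hg
    · exact CoeffAlg.IsSer.C_mul (.const _) (hW.bi _ _).bar
  | succ a ih =>
    rcases b with _ | b
    · exact CoeffAlg.IsSer.C_mul (.const _) (hW.bi _ _)
    · exact CoeffAlg.IsSer.C_mul (.const _) ((hW.bi _ _).sub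
        ((CoeffAlg.IsSer.const _).mul ((CoeffAlg.IsSer.const _).mul (((ih b).bi _ _).pderiv _))))

/-- With Z = g + iψ this is the single equation `DD` Z = W, solved along diagonals. `DD` does not
see the components Z_{0b}: Z_{00} = g₀ is prescribed, and Z_{0b} is taken as the conjugate of
Z_{b0}, which makes the components ψ_{a0} of the imaginary part vanish. -/
theorem exists_solve_extrinsic {W g₀ : 𝒳 → Ser n} (hW : A.IsSer W) (hg₀ : A.IsSer g₀)
    (hW0 : ∀ x b, bi 0 b (W x) = 0) (hreal : ∀ x, (g₀ x).bar = g₀ x)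
    (hg00 : ∀ x, bi 0 0 (g₀ x) = g₀ x) :
    ∃ g ψ : 𝒳 → Ser n, A.IsSer g ∧ A.IsSer ψ ∧ ∀ x, (g x).bar = g x ∧ (ψ x).bar = ψ x ∧
      (∀ a, bi a 0 (ψ x) = 0) ∧ bi 0 0 (g x) = g₀ x ∧
      DD n s (g x) + cI * DD n s (ψ x) = W x := by
  set Z : 𝒳 → Ser n := fun x => glue (solveRec s (W x) (g₀ x)) with hZ
  have hZs : A.IsSer Z := CoeffAlg.IsSer.glue fun a b => isSer_solveRec hW hg₀ a b
  have hZ0 : ∀ x, bi 0 0 (Z x) = g₀ x := fun x => by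
    rw [hZ, bi_glue, solveRec, hg00]
  have hZa : ∀ x a, bi (a + 1) 0 (Z x) = C (((a + 1 : ℕ) : ℂ)⁻¹) * bi (a + 1) 0 (W x) :=
    fun x a => by rw [hZ, bi_glue, solveRec, bi_C_mul, bi_bi_self]
  have hZb : ∀ x b, bi 0 (b + 1) (Z x) = C (((b + 1 : ℕ) : ℂ)⁻¹) * (bi (b + 1) 0 (W x)).bar :=
    fun x a => by rw [hZ, bi_glue, solveRec, bi_C_mul, bi_bar, bi_bi_self]
  have hbar : ∀ x a, (bi 0 a (Z x)).bar = bi a 0 (Z x) := fun x a => by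
    rcases a with _ | a
    · rw [hZ0, hreal]
    · rw [hZb, hZa, bar_mul, bar_bar, bar_C, map_inv₀, Complex.conj_natCast]
  have hDD : ∀ x, DD n s (Z x) = W x := fun x => by
    refine ext_bi fun a b => ?_
    rcases a with _ | a
    · rw [bi_DD_left_zero, hW0]
    rcases b with _ | b
    · rw [bi_DD_right_zero, hZa, natCast_mul_C_inv a.succ_ne_zero]
    · have h : bi (a + 1) (b + 1) (Z x) = C (((a + 1 : ℕ) : ℂ)⁻¹) *
          (bi (a + 1) (b + 1) (W x) - cI * (rho n s * ∂ᵤ (bi a b (Z x)))) := by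
        simp only [hZ, bi_glue, solveRec]
        rw [bi_C_mul, map_sub, bi_bi_self, bi_cI_mul, bi_rho_mul, bi_pderiv_uv, bi_bi_self]
      have h2 := natCast_mul_C_inv a.succ_ne_zero
        (bi (a + 1) (b + 1) (W x) - cI * (rho n s * ∂ᵤ (bi a b (Z x))))
      rw [← h] at h2
      rw [bi_DD_succ]
      push_cast at h2
      linear_combination h2
  have h2 : (C (2⁻¹ : ℂ) : Ser n) * 2 = 1 := by
    have := C_inv_mul_natCast (n := n) two_ne_zero
    exact_mod_cast this
  have hh2 : conj (2⁻¹ : ℂ) = 2⁻¹ := by rw [map_inv₀, Complex.conj_ofNat]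
  refine ⟨fun x => C (2⁻¹ : ℂ) * (Z x + (Z x).bar), fun x => cI * (C (2⁻¹ : ℂ) * ((Z x).bar - Z x)),
    .C_mul (.const _) (hZs.add hZs.bar), (CoeffAlg.IsSer.const _).mul
      (.C_mul (.const _) (hZs.bar.sub hZs)), fun x => ⟨?_, ?_, fun a => ?_, ?_, ?_⟩⟩
  · rw [bar_mul, bar_add, bar_bar, bar_C, hh2]; ring
  · rw [bar_mul, bar_mul, bar_sub, bar_bar, bar_cI, bar_C, hh2]; ring
  · rw [bi_cI_mul, bi_C_mul, map_sub, bi_bar, hbar, sub_self, mul_zero, mul_zero]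
  · rw [bi_C_mul, map_add, bi_bar, hbar, hZ0]
    linear_combination g₀ x * h2
  · have : C (2⁻¹ : ℂ) * (Z x + (Z x).bar) = Z x - cI * (cI * (C (2⁻¹ : ℂ) * ((Z x).bar - Z x))) := by
      linear_combination Z x * h2 + (C (2⁻¹ : ℂ) * ((Z x).bar - Z x)) * cI_mul_self (n := n)
    beta_reduce
    rw [this, map_sub, hDD]
    have e : ∀ p : Ser n, DD n s (cI * p) = cI * DD n s p := fun p => by
      rw [← smul_eq_C_mul, map_smul, smul_eq_C_mul]
    rw [e, sub_add_cancel]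

/-- For real p the u-derivatives cancel. This decouples g from ψ in the intrinsic case. -/
theorem DD_add_bar_DD {p : Ser n} (hp : p.bar = p) :
    DD n s p + (DD n s p).bar = eul n p + eulb n p := by
  rw [bar_DD, hp, DD_apply, DDb_apply]; ring

/-- Adding the conjugate equation removes ψ and prescribes the total degree operator on g, which
fixes g outside bidegree (0, 0). Then ψ is read off and is real by construction; ψ_{a0} = 0 holds
because W has no components of bidegree (0, a). -/
theorem exists_solve_intrinsic {W g₀ : 𝒳 → Ser n} (hW : A.IsSer W) (hg₀ : A.IsSer g₀)
    (hW0 : ∀ x b, bi 0 b (W x) = 0) (hreal : ∀ x, (g₀ x).bar = g₀ x)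
    (hg00 : ∀ x, bi 0 0 (g₀ x) = g₀ x) :
    ∃ g ψ : 𝒳 → Ser n, A.IsSer g ∧ A.IsSer ψ ∧ ∀ x, (g x).bar = g x ∧ (ψ x).bar = ψ x ∧
      (∀ a, bi a 0 (ψ x) = 0) ∧ bi 0 0 (g x) = g₀ x ∧
      DD n s (g x) + cI * ψ x = W x := by
  set P : 𝒳 → ℕ → ℕ → Ser n := fun x a b =>
    if a + b = 0 then g₀ x else C (((a + b : ℕ) : ℂ)⁻¹) * (W x + (W x).bar) with hP
  set g : 𝒳 → Ser n := fun x => glue (P x) with hgdef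
  have hgs : A.IsSer g := CoeffAlg.IsSer.glue fun a b => by
    by_cases h : a + b = 0
    · simp only [hP, h, if_true]; exact hg₀
    · simp only [hP, h, if_false]; exact .C_mul (.const _) (hW.add hW.bar)
  have hg0 : ∀ x, bi 0 0 (g x) = g₀ x := fun x => by
    simp only [hgdef, bi_glue, hP, add_zero, if_true, hg00]
  have hgab : ∀ x a b, a + b ≠ 0 →
      bi a b (g x) = C (((a + b : ℕ) : ℂ)⁻¹) * (bi a b (W x) + (bi b a (W x)).bar) := fun x a b h => by
    simp only [hgdef, bi_glue, hP, h, if_false, bi_C_mul, map_add, bi_bar]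
  have hgr : ∀ x, (g x).bar = g x := fun x => by
    refine ext_bi fun a b => ?_
    rw [bi_bar]
    by_cases h : a + b = 0
    · obtain ⟨rfl, rfl⟩ : a = 0 ∧ b = 0 := by omega
      rw [hg0, hreal]
    · rw [hgab x a b h, hgab x b a (by omega), bar_mul, bar_add, bar_bar, bar_C, map_inv₀,
        Complex.conj_natCast, add_comm b a, add_comm (bi b a (W x)).bar]
  have hsum : ∀ x, DD n s (g x) + (DD n s (g x)).bar = W x + (W x).bar := fun x => by
    rw [DD_add_bar_DD (hgr x)]
    refine ext_bi fun a b => ?_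
    rw [map_add, bi_eul', bi_eulb', map_add, bi_bar]
    by_cases h : a + b = 0
    · obtain ⟨rfl, rfl⟩ : a = 0 ∧ b = 0 := by omega
      rw [hW0]; simp
    · rw [← add_mul, hgab x a b h, ← Nat.cast_add, natCast_mul_C_inv h]
  have hI := cI_mul_self (n := n)
  refine ⟨g, fun x => -cI * (W x - DD n s (g x)), hgs,
    (CoeffAlg.IsSer.const _).mul (hW.sub hgs.DD), fun x => ⟨hgr x, ?_, fun a => ?_, hg0 x, ?_⟩⟩
  · rw [bar_mul, bar_sub, bar_neg, bar_cI]
    linear_combination -cI * hsum x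
  · beta_reduce
    rw [neg_mul, map_neg, bi_cI_mul, map_sub, bi_DD_right_zero]
    rcases a with _ | a
    · rw [hW0]; simp
    · rw [hgab x _ _ (by omega), hW0, bar_zero, add_zero, add_zero,
        natCast_mul_C_inv a.succ_ne_zero, sub_self, mul_zero, neg_zero]
  · linear_combination -(W x - DD n s (g x)) * hI

theorem exists_solve (T : Bool) {W g₀ : 𝒳 → Ser n} (hW : A.IsSer W) (hg₀ : A.IsSer g₀)
    (hW0 : ∀ x b, bi 0 b (W x) = 0) (hreal : ∀ x, (g₀ x).bar = g₀ x)
    (hg00 : ∀ x, bi 0 0 (g₀ x) = g₀ x) (hc : ∀ x, Cond s (W x) (g₀ x)) :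
    ∃ g ψ : 𝒳 → Ser n, A.IsSer g ∧ A.IsSer ψ ∧ ∀ x, (g x).bar = g x ∧ IsNF n s (ψ x) ∧
      bi 0 0 (g x) = g₀ x ∧ DD n s (g x) + cI * modeOp n s T (ψ x) = W x := by
  have : ∃ g ψ : 𝒳 → Ser n, A.IsSer g ∧ A.IsSer ψ ∧ ∀ x, (g x).bar = g x ∧ (ψ x).bar = ψ x ∧
      (∀ a, bi a 0 (ψ x) = 0) ∧ bi 0 0 (g x) = g₀ x ∧
      DD n s (g x) + cI * modeOp n s T (ψ x) = W x := by
    cases T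
    · exact exists_solve_intrinsic hW hg₀ hW0 hreal hg00
    · exact exists_solve_extrinsic hW hg₀ hW0 hreal hg00
  obtain ⟨g, ψ, hg, hψ, h⟩ := this
  refine ⟨g, ψ, hg, hψ, fun x => ?_⟩
  obtain ⟨h1, h2, h3, h4, h5⟩ := h x
  refine ⟨h1, (cond_iff T h1 h2 h3).1 ?_, h4, h5⟩
  rw [h5, h4]; exact hc x

end Families

end

/-! ### Linear theory: traces and uniqueness -/

section

variable {n s : ℕ}

/-! ### The linearized equation: the map -/

/-- All terms have order at least `k` in `u`. -/
def UOrd (k : ℕ) (p : Ser n) : Prop := ∀ m, m uv < k → coeff m p = 0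

theorem UOrd.du {k : ℕ} {p : Ser n} (h : UOrd (k + 1) p) : UOrd k (∂ᵤ p) := fun m hm => by
  rw [coeff_pderiv, h _ (by simpa using hm), zero_mul]

theorem UOrd.uint {k : ℕ} {p : Ser n} (h : UOrd k p) : UOrd (k + 1) (uint p) := fun m hm => by
  rw [coeff_uint]
  split_ifs with h0
  · rfl
  · rw [h _ (by simp; omega), zero_div]

theorem uOrd_zero (p : Ser n) : UOrd 0 p := fun _ hm => absurd hm (Nat.not_lt_zero _)

theorem UOrd.mono {k l : ℕ} {p : Ser n} (h : UOrd k p) (hl : l ≤ k) : UOrd l p :=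
  fun m hm => h m (hm.trans_le hl)

theorem UOrd.add {k : ℕ} {p q : Ser n} (hp : UOrd k p) (hq : UOrd k q) : UOrd k (p + q) :=
  fun m hm => by rw [map_add, hp m hm, hq m hm, add_zero]

theorem UOrd.neg {k : ℕ} {p : Ser n} (hp : UOrd k p) : UOrd k (-p) :=
  fun m hm => by rw [map_neg, hp m hm, neg_zero]

theorem UOrd.sub {k : ℕ} {p q : Ser n} (hp : UOrd k p) (hq : UOrd k q) : UOrd k (p - q) :=
  fun m hm => by rw [map_sub, hp m hm, hq m hm, sub_zero]

theorem UOrd.mul_left {k : ℕ} {p : Ser n} (hp : UOrd k p) (q : Ser n) : UOrd k (q * p) := by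
  classical
  intro m hm
  rw [coeff_mul]
  refine Finset.sum_eq_zero fun x hx => ?_
  rw [Finset.HasAntidiagonal.mem_antidiagonal] at hx
  rw [hp x.2, mul_zero]
  rw [← hx] at hm
  exact lt_of_le_of_lt (Nat.le_add_left _ _) hm

theorem UOrd.bar {k : ℕ} {p : Ser n} (hp : UOrd k p) : UOrd k p.bar := fun m hm => by
  rw [coeff_bar, hp _ (by rwa [conjExp_apply]), map_zero]

theorem UOrd.pderiv_zbv {k : ℕ} {p : Ser n} (hp : UOrd k p) (j : Fin n) :
    UOrd k (pderiv ℂ (zbv j) p) := fun m hm => by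
  rw [coeff_pderiv, hp _ (by simpa using hm), zero_mul]

theorem UOrd.sum {ι : Type*} {t : Finset ι} {k : ℕ} {P : ι → Ser n} (h : ∀ i ∈ t, UOrd k (P i)) :
    UOrd k (∑ i ∈ t, P i) := fun m hm => by
  rw [map_sum]; exact Finset.sum_eq_zero fun i hi => h i hi m hm

theorem UOrd.eq_zero {p : Ser n} (h : UOrd 1 p) (hd : ∂ᵤ p = 0) : p = 0 :=
  eq_zero_of_pderiv_uv hd fun m hm => h m (by omega)

/-- The initial conditions making the solution of the linearized equation unique. -/
structure InitZero (f : Fin n → Ser n) (g : Ser n) : Prop where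
  f00 : ∀ l, UOrd 2 (bi 0 0 (f l))
  f10 : ∀ l, UOrd 1 (bi 1 0 (f l))
  g00 : UOrd 3 (bi 0 0 g)

theorem pderiv_zbv_bi_zero (a : ℕ) (j : Fin n) (p : Ser n) : pderiv ℂ (zbv j) (bi a 0 p) = 0 := by
  ext m
  rw [coeff_pderiv, coeff_bi, if_neg, zero_mul, map_zero]
  rintro ⟨-, h⟩
  rw [Finset.sum_eq_zero_iff] at h
  simpa using h j (Finset.mem_univ _)

theorem pderiv_zv_bi_zero (b : ℕ) (j : Fin n) (p : Ser n) : pderiv ℂ (zv j) (bi 0 b p) = 0 := by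
  ext m
  rw [coeff_pderiv, coeff_bi, if_neg, zero_mul, map_zero]
  rintro ⟨h, -⟩
  rw [Finset.sum_eq_zero_iff] at h
  simpa using h j (Finset.mem_univ _)

theorem C_sg_mul_self (j : Fin n) : (C (sg s j) * C (sg s j) : Ser n) = 1 := by
  rw [← map_mul, sg_mul_self, map_one]

theorem pderiv_zbv_herm {a : ℕ} {F : Fin n → Ser n} (hF : ∀ l, bi a 0 (F l) = F l) (j : Fin n) :
    pderiv ℂ (zbv j) (herm s F) = C (sg s j) * F j := by
  have h0 : ∀ l, pderiv ℂ (zbv j) (F l) = 0 := fun l => by rw [← hF l, pderiv_zbv_bi_zero]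
  simp only [herm, map_sum, pderiv_mul, h0, mul_zero, add_zero, pderiv_zbv_zbv]
  rw [Finset.sum_eq_single j]
  · simp
  · intro l _ hl; simp [hl.symm]
  · simp

theorem eq_zero_of_herm {a : ℕ} {F : Fin n → Ser n} (hF : ∀ l, bi a 0 (F l) = F l)
    (h : herm s F = 0) (l : Fin n) : F l = 0 := by
  have := pderiv_zbv_herm (s := s) hF l
  rw [h, map_zero] at this
  linear_combination -C (sg s l) * this - F l * C_sg_mul_self (s := s) l

/-- The vector of series of bidegree `(a, 0)` with given `herm`. -/
def unherm (s : ℕ) (p : Ser n) (l : Fin n) : Ser n := C (sg s l) * pderiv ℂ (zbv l) p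

theorem herm_unherm {a : ℕ} {p : Ser n} (hp : bi a 1 p = p) : herm s (unherm s p) = p := by
  have : herm s (unherm s p) = eulb n p := by
    rw [eulb_apply, herm]
    refine Finset.sum_congr rfl fun l _ => ?_
    rw [unherm]
    linear_combination (X (zbv l) * pderiv ℂ (zbv l) p) * C_sg_mul_self (s := s) l
  rw [this, ← hp, eulb_bi]; simp

theorem bi_unherm {a : ℕ} {p : Ser n} (hp : bi a 1 p = p) (l : Fin n) :
    bi a 0 (unherm s p l) = unherm s p l := by
  rw [unherm, bi_C_mul, bi_pderiv_zbv, hp]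

theorem pderiv_zv_nz {B : Fin n → Fin n → ℂ} {F : Fin n → Ser n} (hF : ∀ l, bi 0 0 (F l) = F l)
    (j : Fin n) : pderiv ℂ (zv j) (nz B F) = ∑ l, C (B j l) * F l := by
  have h0 : ∀ l, pderiv ℂ (zv j) (F l) = 0 := fun l => by rw [← hF l, pderiv_zv_bi_zero]
  simp only [nz, map_sum, pderiv_mul, h0, mul_zero, add_zero, pderiv_zv_zv]
  rw [Finset.sum_eq_single j]
  · simp
  · intro l _ hl; simp [hl.symm]
  · simp

theorem trc_rho_mul_bi {a b : ℕ} {q : Ser n} (hq : bi a b q = q) :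
    trc n s (rho n s * q) = rho n s * trc n s q + ((a : Ser n) + b + n) * q := by
  rw [trc_rho_mul, ← hq, eul_bi, eulb_bi, map_natCast, map_natCast, map_natCast]; ring

theorem trc_of_right_zero {a : ℕ} {q : Ser n} (hq : bi a 0 q = q) : trc n s q = 0 := by
  rw [← hq, trc_bi_zero_right]

theorem bi_rho_mul_of {a b : ℕ} {q : Ser n} (hq : bi a b q = q) :
    bi (a + 1) (b + 1) (rho n s * q) = rho n s * q := by rw [bi_rho_mul, hq]

theorem trc_natCast_mul (c : ℕ) (p : Ser n) : trc n s ((c : Ser n) * p) = (c : Ser n) * trc n s p := by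
  rw [← map_natCast (C : ℂ →+* Ser n), trc_C_mul]

/-- Each trace strips one factor ρ, with factors 3n+6, 2n+2 and n for ρ³, ρ² and ρ. Their product is
nonzero exactly when n ≥ 1. -/
theorem trc_three_rho {q : Ser n} (hq : bi 0 0 q = q) :
    trc n s (trc n s (trc n s (rho n s * (rho n s * (rho n s * q))))) =
      (((3 * n + 6) * ((2 * n + 2) * n) : ℕ) : Ser n) * q := by
  have h1 : trc n s (rho n s * q) = (n : Ser n) * q := by
    rw [trc_rho_mul_bi hq, trc_of_right_zero hq]; push_cast; ring
  have h2 : trc n s (rho n s * (rho n s * q)) = ((2 * n + 2 : ℕ) : Ser n) * (rho n s * q) := by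
    rw [trc_rho_mul_bi (bi_rho_mul_of hq), h1]; push_cast; ring
  have h3 : trc n s (rho n s * (rho n s * (rho n s * q))) =
      ((3 * n + 6 : ℕ) : Ser n) * (rho n s * (rho n s * q)) := by
    rw [trc_rho_mul_bi (bi_rho_mul_of (bi_rho_mul_of hq)), h2]; push_cast; ring
  rw [h3, trc_natCast_mul, h2, trc_natCast_mul, trc_natCast_mul, h1]; push_cast; ring

theorem trc_two_rho {q : Ser n} (hq : bi 1 0 q = q) :
    trc n s (trc n s (rho n s * (rho n s * q))) = (((2 * n + 4) * (n + 1) : ℕ) : Ser n) * q := by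
  have h1 : trc n s (rho n s * q) = ((n + 1 : ℕ) : Ser n) * q := by
    rw [trc_rho_mul_bi hq, trc_of_right_zero hq]; push_cast; ring
  have h2 : trc n s (rho n s * (rho n s * q)) = ((2 * n + 4 : ℕ) : Ser n) * (rho n s * q) := by
    rw [trc_rho_mul_bi (bi_rho_mul_of hq), h1]; push_cast; ring
  rw [h2, trc_natCast_mul, h1]; push_cast; ring

/-- The hypothesis reads ρ tr q + (n+2) q = 0. Another trace gives (2n+2) tr q = 0, hence tr q = 0
and then q = 0. -/
theorem eq_zero_of_trc_rho {q : Ser n} (hq : bi 1 1 q = q) (h : trc n s (rho n s * q) = 0) :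
    q = 0 := by
  have ht : bi 0 0 (trc n s q) = trc n s q := by rw [bi_trc, hq]
  have e := trc_rho_mul_bi (s := s) hq
  rw [h] at e
  have e2 := congrArg (trc n s) e
  rw [map_zero, map_add, trc_rho_mul_bi ht, trc_of_right_zero ht,
    show ((1 : ℕ) : Ser n) + (1 : ℕ) + n = ((n + 2 : ℕ) : Ser n) by push_cast; ring,
    trc_natCast_mul] at e2
  have e3 : trc n s q = 0 := natCast_mul_eq_zero (a := 2 * n + 2) (by omega) (by
    push_cast at e2 ⊢; linear_combination -e2)
  rw [e3] at e
  exact natCast_mul_eq_zero (a := n + 2) (by omega) (by push_cast at e ⊢; linear_combination -e)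

/-- Explicit inverse of q ↦ tr(ρq) in bidegree (1, 1), found by splitting off the multiple of ρ with
the computation of `eq_zero_of_trc_rho`. -/
theorem exists_trc_rho (q : Ser n) (hq : bi 1 1 q = q) :
    trc n s (rho n s * (C (((n + 2 : ℕ) : ℂ)⁻¹) *
      (q - C (((2 * n + 2 : ℕ) : ℂ)⁻¹) * (rho n s * trc n s q)))) = q := by
  have ht : bi 0 0 (trc n s q) = trc n s q := by rw [bi_trc, hq]
  have hr : bi 1 1 (C (((2 * n + 2 : ℕ) : ℂ)⁻¹) * (rho n s * trc n s q)) =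
      C (((2 * n + 2 : ℕ) : ℂ)⁻¹) * (rho n s * trc n s q) := by
    rw [bi_C_mul, bi_rho_mul_of ht]
  set c := (C (((n + 2 : ℕ) : ℂ)⁻¹) : Ser n)
  set d := (C (((2 * n + 2 : ℕ) : ℂ)⁻¹) : Ser n) with hd
  have hc1 : c * ((n + 2 : ℕ) : Ser n) = 1 := C_inv_mul_natCast (by omega)
  have hd1 : d * ((2 * n + 2 : ℕ) : Ser n) = 1 := C_inv_mul_natCast (by omega)
  have h11 : bi 1 1 (c * (q - d * (rho n s * trc n s q))) = c * (q - d * (rho n s * trc n s q)) := by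
    rw [bi_C_mul, map_sub, hq, hr]
  have hct : ∀ p, trc n s (c * p) = c * trc n s p := trc_C_mul _
  have hdt : ∀ p, trc n s (d * p) = d * trc n s p := trc_C_mul _
  rw [trc_rho_mul_bi h11, hct, map_sub, hdt, trc_rho_mul_bi ht, trc_of_right_zero ht]
  clear_value c d
  push_cast at hc1 hd1 ⊢
  linear_combination (q - d * (rho n s * trc n s q)) * hc1 + (-(c * rho n s * trc n s q)) * hd1 + d * rho n s * trc n s q * hc1

/-! ### Bidegrees -/

theorem bi_obs11 (W : Ser n) : bi 1 1 (obs11 W) = obs11 W := by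
  rw [obs11, map_sub, bi_bi_self, bi_bar, bi_bi_self]

theorem bi_obsSucc (a : ℕ) (W : Ser n) : bi (a + 1) 1 (obsSucc s a W) = obsSucc s a W := by
  have h : bi (a + 1) 1 (rho n s * ∂ᵤ (bi a 0 W)) = rho n s * ∂ᵤ (bi a 0 W) :=
    bi_rho_mul_of (by rw [bi_pderiv_uv, bi_bi_self])
  have e : ∀ p : Ser n, bi (a + 1) 1 (((a : Ser n) + 1) * p) = ((a : Ser n) + 1) * bi (a + 1) 1 p :=
    fun p => by
      have := bi_natCast_mul (a + 1) 1 (a + 1) p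
      push_cast at this; exact this
  have e2 : ∀ p : Ser n, bi (a + 1) 1 (((a : Ser n) + 2) * p) = ((a : Ser n) + 2) * bi (a + 1) 1 p :=
    fun p => by
      have := bi_natCast_mul (a + 1) 1 (a + 2) p
      push_cast at this; exact this
  rw [obsSucc, map_sub, bi_natCast_mul, map_sub, bi_bi_self, e, bi_bar, bi_bi_self, e2, bi_cI_mul, h]

theorem bi_obs22 (W : Ser n) : bi 2 2 (obs22 s W) = obs22 s W := by
  rw [obs22, map_sub, map_sub, bi_bi_self, bi_bar, bi_bi_self, bi_cI_mul,
    bi_rho_mul_of (a := 1) (b := 1)]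
  rw [bi_pderiv_uv, map_add, bi_bar, bi_bi_self]

theorem bi_two_mul (a b : ℕ) (p : Ser n) : bi a b (2 * p) = 2 * bi a b p := by
  exact_mod_cast bi_natCast_mul a b 2 p

theorem bi_three_mul (a b : ℕ) (p : Ser n) : bi a b (3 * p) = 3 * bi a b p := by
  exact_mod_cast bi_natCast_mul a b 3 p

theorem bi_obs32 (W : Ser n) : bi 3 2 (obs32 s W) = obs32 s W := by
  have e : bi 3 2 (5 * (cI * (rho n s * ∂ᵤ ((bi 1 2 W).bar + cI * (rho n s * ∂ᵤ (bi 1 0 W)))))) =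
      5 * (cI * (rho n s * ∂ᵤ ((bi 1 2 W).bar + cI * (rho n s * ∂ᵤ (bi 1 0 W))))) := by
    have h5 : ∀ p : Ser n, bi 3 2 (5 * p) = 5 * bi 3 2 p := fun p => by
      exact_mod_cast bi_natCast_mul 3 2 5 p
    rw [h5, bi_cI_mul, bi_rho_mul_of (a := 2) (b := 1)]
    rw [bi_pderiv_uv, map_add, bi_bar, bi_bi_self, bi_cI_mul, bi_rho_mul_of (a := 1) (b := 0)]
    rw [bi_pderiv_uv, bi_bi_self]
  rw [obs32, map_sub, map_sub, e, bi_two_mul, bi_three_mul, bi_bi_self, bi_bar, bi_bi_self]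

theorem bi_obs33 (W : Ser n) : bi 3 3 (obs33 s W) = obs33 s W := by
  rw [obs33, map_sub, bi_two_mul, map_sub, bi_bi_self, bi_bar, bi_bi_self, bi_cI_mul,
    bi_rho_mul_of (a := 2) (b := 2)]
  rw [bi_pderiv_uv, map_add, bi_bar, bi_bi_self]

theorem bar_obs11 (W : Ser n) : (obs11 W).bar = -obs11 W := by
  rw [obs11, bar_sub, bar_bar]; ring

theorem bar_obs22 (W : Ser n) : (obs22 s W).bar = -obs22 s W := by
  rw [obs22]
  simp only [bar_sub, bar_mul, bar_add, bar_bar, bar_cI, bar_rho, bar_du]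
  rw [add_comm (bi 1 1 W).bar]; ring

theorem bar_obs33 (W : Ser n) : (obs33 s W).bar = -obs33 s W := by
  rw [obs33]
  simp only [bar_sub, bar_mul, bar_add, bar_bar, bar_cI, bar_rho, bar_du, bar_two]
  rw [add_comm (bi 2 2 W).bar]; ring

/-! ### Uniqueness -/

/-- The second part of strong nondegeneracy, in normalized coordinates. -/
def Nondeg (s : ℕ) (B : Fin n → Fin n → ℂ) : Prop :=
  ∀ ξ : Fin n → ℂ, (∀ k, 3 * Complex.I * sg s k * conj (ξ k) - ∑ l, B k l * ξ l = 0) → ξ = 0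

theorem bar_eq_of_coeff {p : Ser n} (hp : bi 0 0 p = p) (m : Var n →₀ ℕ) :
    coeff m p.bar = conj (coeff m p) := by
  rw [coeff_bar]
  by_cases h : m = conjExp m
  · rw [← h]
  · rw [← hp, coeff_bi, coeff_bi, if_neg, if_neg]
    · rintro ⟨h1, h2⟩
      apply h
      rw [Finset.sum_eq_zero_iff] at h1 h2
      ext i
      rw [conjExp_apply]
      rcases i with j | j | j
      · rw [conjVar_zv, h1 j (Finset.mem_univ _), h2 j (Finset.mem_univ _)]
      · rw [conjVar_zbv, h1 j (Finset.mem_univ _), h2 j (Finset.mem_univ _)]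
      · rfl
    · rintro ⟨h1, h2⟩
      apply h
      simp only [conjExp_apply, conjVar_zv, conjVar_zbv] at h1 h2
      rw [Finset.sum_eq_zero_iff] at h1 h2
      ext i
      rw [conjExp_apply]
      rcases i with j | j | j
      · rw [conjVar_zv, h1 j (Finset.mem_univ _), h2 j (Finset.mem_univ _)]
      · rw [conjVar_zbv, h1 j (Finset.mem_univ _), h2 j (Finset.mem_univ _)]
      · rfl

/-- The η_l are series in u alone, so conjugation acts on single coefficients and the system
decouples into one numerical system for each power of u. -/
theorem Nondeg.eq_zero {B : Fin n → Fin n → ℂ} (hB : Nondeg s B) {η : Fin n → Ser n}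
    (hη : ∀ l, bi 0 0 (η l) = η l)
    (h : ∀ k, C (3 * Complex.I * sg s k) * (η k).bar - ∑ l, C (B k l) * η l = 0) (l : Fin n) :
    η l = 0 := by
  ext m
  have := hB (fun l => coeff m (η l)) fun k => by
    have := congrArg (coeff m) (h k)
    rw [map_sub, coeff_C_mul, bar_eq_of_coeff (hη k), map_sum, map_zero] at this
    simpa only [coeff_C_mul] using this
  rw [map_zero]; exact congrFun this l

theorem rho_du_bi (a b : ℕ) (p : Ser n) :
    bi (a + 1) (b + 1) (rho n s * ∂ᵤ (bi a b p)) = rho n s * ∂ᵤ (bi a b p) :=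
  bi_rho_mul_of (by rw [bi_pderiv_uv, bi_bi_self])

/-- The conditions of `Cond` hold with right-hand side `qop` f and are solved in the order g_{00},
f_{10}, f_{00}, f_{20}, f_{a0}. Each is an algebraic equation or a pure derivative in u, annihilated
by the corresponding condition in `InitZero`. Then f = 0, and g and ψ vanish by reality. -/
theorem lin_unique (hn : 1 ≤ n) (T : Bool) {B : Fin n → Fin n → ℂ} (hB : Nondeg s B)
    {f : Fin n → Ser n} {g ψ : Ser n} (hf : ∀ l, DDb n s (f l) = 0)
    (h : DD n s g + cI * modeOp n s T ψ = qop s B f) (hg : g.bar = g) (hψ : IsNF n s ψ)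
    (hi : InitZero f g) : (∀ l, f l = 0) ∧ g = 0 ∧ ψ = 0 := by
  have hI := cI_mul_self (n := n)
  have hcond : Cond s (qop s B f) (bi 0 0 g) := by
    rw [← h]; exact (cond_iff T hg hψ.real hψ.right_zero).2 hψ
  obtain ⟨c1, c2, c3, c4, c5⟩ := hcond
  rw [obs11_qop hf] at c1
  rw [obs22_qop hf] at c3
  rw [obs33_qop hf] at c5
  rw [obs32_qop hf] at c4
  have c2' := c2 0
  rw [zero_add, obsSucc_one_qop hf] at c2'
  set u11 := bi 1 1 (herm s f) with hu11
  set u21 := bi 2 1 (herm s f) with hu21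
  have hu : u11 + u11.bar = rho n s * ∂ᵤ (bi 0 0 g) := by
    refine sub_eq_zero.1 (natCast_cI_mul_eq_zero (c := 2) two_ne_zero ?_)
    push_cast; linear_combination c1
  -- the function `g₀`
  have hg3 : ∂ᵤ (∂ᵤ (∂ᵤ (bi 0 0 g))) = 0 := by
    rw [hu, du_rho_mul, du_rho_mul] at c5
    have := trc_three_rho (s := s) (q := ∂ᵤ (∂ᵤ (∂ᵤ (bi 0 0 g)))) (by
      rw [bi_pderiv_uv, bi_pderiv_uv, bi_pderiv_uv, bi_bi_self])
    rw [show -4 * cI = (C (-4 * Complex.I) : Ser n) by rw [map_mul, map_neg, map_ofNat], trc_C_mul,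
      trc_C_mul, trc_C_mul, this] at c5
    refine natCast_mul_eq_zero (a := (3 * n + 6) * ((2 * n + 2) * n)) (by positivity) ?_
    exact (mul_eq_zero.1 c5).resolve_left (by
      intro h0
      have := congrArg constantCoeff h0
      simp at this)
  have hg0 : bi 0 0 g = 0 := by
    have h1 := hi.g00.du.du.eq_zero hg3
    have h2 := (hi.g00.du.mono (l := 1) (by norm_num)).eq_zero h1
    exact (hi.g00.mono (by norm_num)).eq_zero h2
  rw [hg0, map_zero, mul_zero] at hu
  -- bidegree `(1, 0)`
  have e11 : u11 = herm s fun l => bi 1 0 (f l) := bi_herm_succ 1 0 f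
  -- With g_{00} = 0 the (1,1) condition makes u11 skew, so the (2,2) condition involves u11 alone,
  -- and multiplication by ρ followed by the trace is injective.
  have hu11' : ∂ᵤ u11 = 0 := by
    refine eq_zero_of_trc_rho (s := s) (by rw [bi_pderiv_uv, hu11, bi_bi_self]) ?_
    refine natCast_mul_eq_zero (a := 8) (by norm_num) ?_
    have e : 4 * (rho n s * ∂ᵤ (u11.bar - u11)) = -(((8 : ℕ) : Ser n) * (rho n s * ∂ᵤ u11)) := by
      rw [eq_neg_of_add_eq_zero_right hu, map_sub, map_neg]; push_cast; ring
    rwa [e, map_neg, trc_natCast_mul, neg_eq_zero] at c3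
  have hF1 : ∀ l, bi 1 0 (f l) = 0 := fun l => by
    rw [e11, du_herm] at hu11'
    exact (hi.f10 l).eq_zero
      (eq_zero_of_herm (a := 1) (fun l => by rw [bi_pderiv_uv, bi_bi_self]) hu11' l)
  -- bidegree `(0, 0)`
  set v := bi 1 0 (nz B f) with hv
  set w := (bi 0 1 (herm s f)).bar with hw
  have ev : v = nz B fun l => bi 0 0 (f l) := bi_nz_succ B 0 0 f
  have ew : w = (herm s fun l => bi 0 0 (f l)).bar := by rw [hw, bi_herm_succ]
  have e21 : u21 = -(rho n s * ∂ᵤ v) + 2 * (cI * (rho n s * ∂ᵤ w)) := by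
    refine natCast_mul_cancel (a := 4) (by norm_num) ?_
    push_cast
    linear_combination -cI * c2' + (4 * u21 + 4 * (rho n s * ∂ᵤ v)) * hI
  have hq : ∂ᵤ (∂ᵤ v) - 3 * (cI * ∂ᵤ (∂ᵤ w)) = 0 := by
    have hbi : bi 1 0 (∂ᵤ (∂ᵤ v) - 3 * (cI * ∂ᵤ (∂ᵤ w))) =
        ∂ᵤ (∂ᵤ v) - 3 * (cI * ∂ᵤ (∂ᵤ w)) := by
      rw [map_sub, bi_three_mul, bi_cI_mul, bi_pderiv_uv, bi_pderiv_uv, bi_pderiv_uv, bi_pderiv_uv,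
        hv, hw, bi_bi_self, bi_bar, bi_bi_self]
    have e : -16 * (rho n s * ∂ᵤ u21) + 8 * cI * (rho n s * (rho n s * ∂ᵤ (∂ᵤ w))) -
        8 * (rho n s * (rho n s * ∂ᵤ (∂ᵤ v))) =
        ((8 : ℕ) : Ser n) * (rho n s * (rho n s * (∂ᵤ (∂ᵤ v) - 3 * (cI * ∂ᵤ (∂ᵤ w))))) := by
      rw [e21, map_add, map_neg, du_rho_mul, pderiv_mul, du_two, du_cI_mul, du_rho_mul]
      push_cast; ring
    rw [e, trc_natCast_mul, trc_natCast_mul, trc_two_rho hbi] at c4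
    exact natCast_mul_eq_zero (by positivity) (natCast_mul_eq_zero (a := 8) (by norm_num) c4)
  have hF0 : ∀ l, bi 0 0 (f l) = 0 := fun l => by
    have hbi : ∀ l, bi 0 0 (∂ᵤ (∂ᵤ (bi 0 0 (f l)))) = ∂ᵤ (∂ᵤ (bi 0 0 (f l))) := fun l => by
      rw [bi_pderiv_uv, bi_pderiv_uv, bi_bi_self]
    -- The equation `hq` is linear in z; its coefficient at z_k is the k-th equation of the system
    -- in `Nondeg`.
    have hη := hB.eq_zero hbi (fun k => by
      have := congrArg (pderiv ℂ (zv k)) hq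
      rw [ev, ew, du_nz, du_nz, ← bar_du, ← bar_du, du_herm, du_herm, map_sub, pderiv_zv_nz hbi,
        map_zero, pderiv_mul, pderiv_C_mul, ← conjVar_zbv, ← bar_pderiv, pderiv_zbv_herm hbi,
        bar_mul, bar_C, conj_sg] at this
      have h3 : pderiv ℂ (conjVar n (zbv k)) (3 : Ser n) = 0 := by
        exact_mod_cast Derivation.map_natCast (pderiv ℂ (conjVar n (zbv k))) 3
      rw [h3] at this
      rw [map_mul, map_mul, map_ofNat]
      linear_combination -this) l
    have h1 := (hi.f00 l).du.eq_zero hη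
    exact ((hi.f00 l).mono (by norm_num)).eq_zero h1
  have v0 : v = 0 := by rw [ev]; simp only [hF0]; exact nz_zero B
  have w0 : w = 0 := by rw [ew]; simp only [hF0]; exact (congrArg _ herm_zero).trans bar_zero
  rw [v0, w0, map_zero, mul_zero, mul_zero, mul_zero, neg_zero, add_zero, hu21, bi_herm_succ] at e21
  have hF2 : ∀ l, bi 2 0 (f l) = 0 := eq_zero_of_herm (fun l => bi_bi_self _ _ _) e21
  have hF : ∀ a l, bi a 0 (f l) = 0 := fun a => by
    induction a using Nat.strong_induction_on with
    | _ a ih =>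
      rcases a with _ | _ | _ | a
      · exact hF0
      · exact hF1
      · exact hF2
      · have e := c2 (a + 1)
        rw [show a + 1 + 1 = a + 2 by rfl, obsSucc_qop hf, bi_nz_succ] at e
        simp only [ih (a + 1) (by omega)] at e
        rw [show (fun _ : Fin n => (0 : Ser n)) = 0 by rfl, nz_zero, map_zero, mul_zero, mul_zero,
          add_zero] at e
        have e' : herm s (fun l => bi (a + 3) 0 (f l)) = 0 := by
          rw [← bi_herm_succ]
          refine natCast_cI_mul_eq_zero (c := 2 * (a + 2) * (a + 3)) (by positivity) ?_
          push_cast; linear_combination e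
        exact eq_zero_of_herm (fun l => bi_bi_self _ _ _) e'
  have hf0 : ∀ l, f l = 0 := fun l => by
    refine ext_bi fun a b => ?_
    rw [map_zero]
    induction b generalizing a with
    | zero => exact hF a l
    | succ b ih =>
      rcases a with _ | a
      · exact f_zero_succ hf b l
      · have := f_rec hf a b l
        rw [ih, map_zero, mul_zero, mul_zero] at this
        exact natCast_mul_eq_zero b.succ_ne_zero (by push_cast; exact this)
  refine ⟨hf0, ?_⟩
  have hq0 : qop s B f = 0 := by
    rw [show f = 0 from funext hf0]
    have := qop_add (s := s) B 0 0
    rw [add_zero] at this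
    linear_combination -this
  rw [hq0] at h
  -- In the intrinsic mode the conjugate equation is added, leaving the degree operator on g. In the
  -- extrinsic mode g + iψ lies in the kernel of `DD`; its components (a, 0) are those of g and
  -- vanish, by reality so do the components (0, b), and the rest follows along diagonals.
  have hgab : ∀ a b, bi a b g = 0 := by
    cases T
    · have hb := congrArg Ser.bar h
      change DD n s g + cI * ψ = 0 at h
      change (DD n s g + cI * ψ).bar = Ser.bar 0 at hb
      rw [bar_add, bar_mul, bar_cI, hψ.real, bar_zero] at hb
      have e : eul n g + eulb n g = 0 := by
        rw [← DD_add_bar_DD (s := s) hg]; linear_combination h + hb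
      intro a b
      by_cases hab : a + b = 0
      · obtain ⟨rfl, rfl⟩ : a = 0 ∧ b = 0 := by omega
        exact hg0
      · refine natCast_mul_eq_zero hab ?_
        have := congrArg (bi a b) e
        rw [map_add, bi_eul', bi_eulb', map_zero] at this
        push_cast; linear_combination this
    · change DD n s g + cI * DD n s ψ = 0 at h
      have e : DD n s (g + cI * ψ) = 0 := by
        rw [map_add, ← smul_eq_C_mul, map_smul, smul_eq_C_mul]; exact h
      have hr : ∀ a, bi a 0 (g + cI * ψ) = bi a 0 g := fun a => by
        rw [map_add, bi_cI_mul, hψ.right_zero, mul_zero, add_zero]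
      have hA0 : ∀ a, bi a 0 g = 0 := fun a => by
        rcases a with _ | a
        · exact hg0
        · have := congrArg (bi (a + 1) 0) e
          rw [bi_DD_right_zero, hr, map_zero] at this
          exact natCast_mul_eq_zero a.succ_ne_zero this
      have hA : ∀ a b, bi a b (g + cI * ψ) = 0 := fun a b => by
        induction a generalizing b with
        | zero =>
          rw [map_add, bi_cI_mul, ← bar_bi_of_real hg, hA0, ← bar_bi_of_real hψ.real,
            hψ.right_zero, bar_zero, mul_zero, add_zero]
        | succ a ih =>
          rcases b with _ | b
          · rw [hr, hA0]
          · have := congrArg (bi (a + 1) (b + 1)) e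
            rw [bi_DD_succ, ih, map_zero, map_zero, mul_zero, mul_zero, add_zero] at this
            exact natCast_mul_eq_zero a.succ_ne_zero (by push_cast; exact this)
      intro a b
      have h1 := hA a b
      have h2 := congrArg Ser.bar (hA b a)
      rw [map_add, bi_cI_mul] at h1 h2
      rw [bar_add, bar_mul, bar_cI, bar_bi_of_real hg, bar_bi_of_real hψ.real, bar_zero] at h2
      refine natCast_mul_eq_zero (a := 2) two_ne_zero ?_
      push_cast; linear_combination h1 + h2
  have hg' : g = 0 := ext_bi fun a b => by rw [hgab, map_zero]
  refine ⟨hg', ?_⟩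
  rw [hg', map_zero, zero_add] at h
  have h' : modeOp n s T ψ = 0 := by
    refine natCast_cI_mul_eq_zero (c := 1) one_ne_zero ?_
    rw [Nat.cast_one, one_mul, h]
  cases T
  · exact h'
  · have h' : DD n s ψ = 0 := h'
    refine ext_bi fun a b => ?_
    rw [map_zero]
    induction a generalizing b with
    | zero => rw [← bar_bi_of_real hψ.real, hψ.right_zero, bar_zero]
    | succ a ih =>
      rcases b with _ | b
      · exact hψ.right_zero _
      · have := congrArg (bi (a + 1) (b + 1)) h'
        rw [bi_DD_succ, ih, map_zero, map_zero, mul_zero, mul_zero, add_zero] at this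
        exact natCast_mul_eq_zero a.succ_ne_zero (by push_cast; exact this)

end

/-! ### Linear theory: existence of the map -/

section

variable {n s : ℕ} {𝒳 : Type*} {A : CoeffAlg 𝒳}

/-! ### The linearized equation: existence -/

theorem CoeffAlg.IsSer.cI_mul {P : 𝒳 → Ser n} (hP : A.IsSer P) : A.IsSer fun x => cI * P x :=
  (IsSer.const _).mul hP

theorem CoeffAlg.IsSer.rho_mul {P : 𝒳 → Ser n} (hP : A.IsSer P) :
    A.IsSer fun x => rho n s * P x := (IsSer.const _).mul hP

theorem CoeffAlg.IsSer.const_mul (c : Ser n) {P : 𝒳 → Ser n} (hP : A.IsSer P) :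
    A.IsSer fun x => c * P x := (IsSer.const _).mul hP

theorem isSer_herm {f : Fin n → 𝒳 → Ser n} (hf : ∀ l, A.IsSer (f l)) :
    A.IsSer fun x => herm s fun l => f l x :=
  .sum fun l _ => .const_mul _ (.const_mul _ (hf l))

theorem isSer_nz {B : 𝒳 → Fin n → Fin n → ℂ} (hB : ∀ k l, A.Sc fun x => B x k l)
    {f : Fin n → 𝒳 → Ser n} (hf : ∀ l, A.IsSer (f l)) :
    A.IsSer fun x => nz (B x) fun l => f l x :=
  .sum fun k _ => .sum fun l _ => .C_mul (hB k l) (.const_mul _ (hf l))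

theorem isSer_qop {B : 𝒳 → Fin n → Fin n → ℂ} (hB : ∀ k l, A.Sc fun x => B x k l)
    {f : Fin n → 𝒳 → Ser n} (hf : ∀ l, A.IsSer (f l)) :
    A.IsSer fun x => qop s (B x) fun l => f l x :=
  ((isSer_nz hB fun l => ((hf l).DD).sub (hf l)).add (isSer_herm hf).bar.cI_mul).add
    (isSer_herm fun l => (hf l).DD).cI_mul

theorem isSer_obs11 {W : 𝒳 → Ser n} (hW : A.IsSer W) : A.IsSer fun x => obs11 (W x) :=
  (hW.bi _ _).sub (hW.bi _ _).bar

theorem isSer_obsSucc (a : ℕ) {W : 𝒳 → Ser n} (hW : A.IsSer W) : A.IsSer fun x => obsSucc s a (W x) :=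
  (((hW.bi _ _).sub ((hW.bi _ _).bar.const_mul _)).const_mul _).sub
    (((hW.bi _ _).pderiv _).rho_mul.cI_mul.const_mul _)

theorem isSer_obs22 {W : 𝒳 → Ser n} (hW : A.IsSer W) : A.IsSer fun x => obs22 s (W x) :=
  ((hW.bi _ _).sub (hW.bi _ _).bar).sub (((hW.bi _ _).add (hW.bi _ _).bar).pderiv _).rho_mul.cI_mul

theorem isSer_obs32 {W : 𝒳 → Ser n} (hW : A.IsSer W) : A.IsSer fun x => obs32 s (W x) :=
  (((hW.bi _ _).const_mul _).sub ((hW.bi _ _).bar.const_mul _)).sub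
    ((((hW.bi _ _).bar.add ((hW.bi _ _).pderiv _).rho_mul.cI_mul).pderiv _).rho_mul.cI_mul.const_mul _)

theorem isSer_obs33 {W : 𝒳 → Ser n} (hW : A.IsSer W) : A.IsSer fun x => obs33 s (W x) :=
  (((hW.bi _ _).sub (hW.bi _ _).bar).const_mul _).sub
    (((hW.bi _ _).add (hW.bi _ _).bar).pderiv _).rho_mul.cI_mul

theorem isSer_unherm {p : 𝒳 → Ser n} (hp : A.IsSer p) (l : Fin n) :
    A.IsSer fun x => unherm s (p x) l := (hp.pderiv _).const_mul _

/-- The recursion for the solution of `DDb f = r` with given components of bidegree `(a, 0)`. -/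
def solveDDbRec (s : ℕ) (r : Ser n) (F : ℕ → Ser n) : ℕ → ℕ → Ser n
  | a, 0 => F a
  | 0, b + 1 => C (((b + 1 : ℕ) : ℂ)⁻¹) * bi 0 (b + 1) r
  | a + 1, b + 1 => C (((b + 1 : ℕ) : ℂ)⁻¹) *
      (bi (a + 1) (b + 1) r + cI * (rho n s * ∂ᵤ (bi a b (solveDDbRec s r F a b))))

/-- `DDb` annihilates bidegree (a, 0). Hence r must have no such components, while those of f can be
prescribed freely; all others follow along diagonals. -/
theorem exists_solve_DDb {r : 𝒳 → Ser n} {F : ℕ → 𝒳 → Ser n} (hr : A.IsSer r)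
    (hF : ∀ a, A.IsSer (F a)) (hr0 : ∀ x a, bi a 0 (r x) = 0) (hF0 : ∀ a x, bi a 0 (F a x) = F a x) :
    ∃ f : 𝒳 → Ser n, A.IsSer f ∧ ∀ x, DDb n s (f x) = r x ∧ ∀ a, bi a 0 (f x) = F a x := by
  set f : 𝒳 → Ser n := fun x => glue (solveDDbRec s (r x) fun a => F a x) with hf
  have hz : ∀ x a, bi a 0 (f x) = F a x := fun x a => by
    rw [hf, bi_glue]; rcases a with _ | a <;> rw [solveDDbRec, hF0]
  refine ⟨f, CoeffAlg.IsSer.glue fun a b => ?_, fun x => ⟨?_, hz x⟩⟩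
  · induction b generalizing a with
    | zero => rcases a with _ | a <;> simp only [solveDDbRec] <;> exact hF _
    | succ b ih =>
      rcases a with _ | a
      · exact CoeffAlg.IsSer.C_mul (.const _) (hr.bi _ _)
      · exact CoeffAlg.IsSer.C_mul (.const _) ((hr.bi _ _).add (((ih a).bi _ _).pderiv _).rho_mul.cI_mul)
  · refine ext_bi fun a b => ?_
    rcases b with _ | b
    · rw [bi_DDb_right_zero, hr0]
    rcases a with _ | a
    · rw [bi_DDb_left_zero, hf, bi_glue, solveDDbRec, bi_C_mul, bi_bi_self,
        natCast_mul_C_inv b.succ_ne_zero]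
    · have h : bi (a + 1) (b + 1) (f x) = C (((b + 1 : ℕ) : ℂ)⁻¹) *
          (bi (a + 1) (b + 1) (r x) + cI * (rho n s * ∂ᵤ (bi a b (f x)))) := by
        simp only [hf, bi_glue, solveDDbRec]
        rw [bi_C_mul, map_add, bi_bi_self, bi_cI_mul, rho_du_bi]
      have h2 := natCast_mul_C_inv b.succ_ne_zero
        (bi (a + 1) (b + 1) (r x) + cI * (rho n s * ∂ᵤ (bi a b (f x))))
      rw [← h] at h2
      rw [bi_DDb_succ]
      push_cast at h2
      linear_combination h2

/-- The matrix of the real-linear system `3iε_k η̄_k - ∑ B_kl η_l = ζ_k` in `(η, η̄)`. -/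
def nondegMatrix (s : ℕ) (B : Fin n → Fin n → ℂ) : Matrix (Fin n ⊕ Fin n) (Fin n ⊕ Fin n) ℂ :=
  Matrix.fromBlocks (Matrix.of fun k l => -B k l) (Matrix.diagonal fun k => 3 * Complex.I * sg s k)
    (Matrix.diagonal fun k => -(3 * Complex.I * sg s k)) (Matrix.of fun k l => -conj (B k l))

theorem nondegMatrix_mulVec_inl (B : Fin n → Fin n → ℂ) (x y : Fin n → ℂ) (k : Fin n) :
    (nondegMatrix s B).mulVec (Sum.elim x y) (Sum.inl k) =
      3 * Complex.I * sg s k * y k - ∑ l, B k l * x l := by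
  rw [nondegMatrix, Matrix.fromBlocks_mulVec]
  simp [Matrix.diagonal_apply, Matrix.mulVec, dotProduct]
  ring

theorem nondegMatrix_mulVec_inr (B : Fin n → Fin n → ℂ) (x y : Fin n → ℂ) (k : Fin n) :
    (nondegMatrix s B).mulVec (Sum.elim x y) (Sum.inr k) =
      -(3 * Complex.I * sg s k * x k) - ∑ l, conj (B k l) * y l := by
  rw [nondegMatrix, Matrix.fromBlocks_mulVec]
  simp [Matrix.diagonal_apply, Matrix.mulVec, dotProduct]
  ring

theorem conj_nondeg_eq (B : Fin n → Fin n → ℂ) (x y : Fin n → ℂ) (k : Fin n) :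
    conj (3 * Complex.I * sg s k * y k - ∑ l, B k l * x l) =
      -(3 * Complex.I * sg s k * conj (y k)) - ∑ l, conj (B k l) * conj (x l) := by
  simp only [map_sub, map_mul, map_sum, conj_sg, Complex.conj_I, Complex.conj_ofNat]; ring

theorem conj_nondeg_eq' (B : Fin n → Fin n → ℂ) (x y : Fin n → ℂ) (k : Fin n) :
    conj (-(3 * Complex.I * sg s k * x k) - ∑ l, conj (B k l) * y l) =
      3 * Complex.I * sg s k * conj (x k) - ∑ l, B k l * conj (y l) := by
  simp only [map_sub, map_mul, map_neg, map_sum, conj_sg, Complex.conj_I, Complex.conj_ofNat,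
    Complex.conj_conj]; ring

/-- A kernel vector (x, y) of the complexified system provides the two solutions x + ȳ and i(x - ȳ)
of the original real-linear one. -/
theorem Nondeg.det_ne_zero {B : Fin n → Fin n → ℂ} (hB : Nondeg s B) :
    (nondegMatrix s B).det ≠ 0 := by
  intro h
  obtain ⟨v, hv, hv0⟩ := Matrix.exists_mulVec_eq_zero_iff.2 h
  obtain ⟨x, y, rfl⟩ : ∃ x y, v = Sum.elim x y := ⟨v ∘ Sum.inl, v ∘ Sum.inr, by simp⟩
  have e1 : ∀ k, 3 * Complex.I * sg s k * y k - ∑ l, B k l * x l = 0 := fun k => by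
    rw [← nondegMatrix_mulVec_inl, hv0]; rfl
  have e2 : ∀ k, 3 * Complex.I * sg s k * conj (x k) - ∑ l, B k l * conj (y l) = 0 := fun k => by
    rw [← conj_nondeg_eq', ← nondegMatrix_mulVec_inr, hv0]; simp
  have h1 := hB (fun l => x l + conj (y l)) fun k => by
    simp only [map_add, Complex.conj_conj, mul_add, Finset.sum_add_distrib]
    linear_combination e1 k + e2 k
  have h2 := hB (fun l => Complex.I * (x l - conj (y l))) fun k => by
    simp only [map_sub, map_mul, Complex.conj_I, Complex.conj_conj, mul_sub, Finset.sum_sub_distrib]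
    have f1 : ∑ l, B k l * (Complex.I * x l) = Complex.I * ∑ l, B k l * x l := by
      rw [Finset.mul_sum]; exact Finset.sum_congr rfl fun _ _ => by ring
    have f2 : ∑ l, B k l * (Complex.I * conj (y l)) = Complex.I * ∑ l, B k l * conj (y l) := by
      rw [Finset.mul_sum]; exact Finset.sum_congr rfl fun _ _ => by ring
    rw [f1, f2]
    linear_combination Complex.I * e1 k - Complex.I * e2 k
  apply hv
  have hx : ∀ l, x l = 0 ∧ y l = 0 := fun l => by
    have a1 : x l + conj (y l) = 0 := congrFun h1 l
    have a2 : Complex.I * (x l - conj (y l)) = 0 := congrFun h2 l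
    have a3 := (mul_eq_zero.1 a2).resolve_left Complex.I_ne_zero
    have hx : x l = 0 := by linear_combination (a1 + a3) / 2
    refine ⟨hx, ?_⟩
    rw [hx, zero_add] at a1
    simpa using congrArg conj a1
  funext i
  rcases i with l | l
  · exact (hx l).1
  · exact (hx l).2

/-- Solution of the real-linear system defining strong nondegeneracy, for series. -/
theorem exists_solve_nondeg {B : 𝒳 → Fin n → Fin n → ℂ} (hBs : ∀ k l, A.Sc fun x => B x k l)
    (hB : ∀ x, Nondeg s (B x)) {Z : Fin n → 𝒳 → Ser n} (hZ : ∀ k, A.IsSer (Z k))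
    (hZ0 : ∀ k x, bi 0 0 (Z k x) = Z k x) :
    ∃ η : Fin n → 𝒳 → Ser n, (∀ l, A.IsSer (η l)) ∧ (∀ l x, bi 0 0 (η l x) = η l x) ∧
      ∀ x k, C (3 * Complex.I * sg s k) * (η k x).bar - ∑ l, C (B x k l) * η l x = Z k x := by
  set M : 𝒳 → Matrix (Fin n ⊕ Fin n) (Fin n ⊕ Fin n) ℂ := fun x => nondegMatrix s (B x) with hM
  have hdet : ∀ x, IsUnit (M x).det := fun x => (hB x).det_ne_zero.isUnit
  have hMs : ∀ i j, A.Sc fun x => M x i j := by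
    rintro (i | i) (j | j)
    · exact (hBs i j).neg
    · exact .const _
    · exact .const _
    · exact (hBs i j).conj.neg
  have hinv : ∀ i j, A.Sc fun x => (M x)⁻¹ i j := CoeffAlg.Sc.matrix_inv hMs fun x => (hdet x).ne_zero
  set η : Fin n → 𝒳 → Ser n := fun l x =>
    ∑ k, (C ((M x)⁻¹ (Sum.inl l) (Sum.inl k)) * Z k x +
      C ((M x)⁻¹ (Sum.inl l) (Sum.inr k)) * (Z k x).bar) with hη
  have hηbi : ∀ l x, bi 0 0 (η l x) = η l x := fun l x => by
    simp only [hη, map_sum, map_add, bi_C_mul, hZ0, bi_bar]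
  refine ⟨η, fun l => .sum fun k _ => (CoeffAlg.IsSer.C_mul (hinv _ _) (hZ k)).add
    (.C_mul (hinv _ _) (hZ k).bar), hηbi, fun x k => ?_⟩
  ext m
  rw [map_sub, map_sum]
  simp only [coeff_C_mul]
  rw [bar_eq_of_coeff (hηbi k x)]
  set ζ : Fin n → ℂ := fun k => coeff m (Z k x) with hζ
  have hcoef : ∀ l, coeff m (η l x) =
      (M x)⁻¹.mulVec (Sum.elim ζ fun k => conj (ζ k)) (Sum.inl l) := fun l => by
    simp only [hη, map_sum, map_add, coeff_C_mul, Matrix.mulVec, dotProduct, Fintype.sum_sum_type,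
      Sum.elim_inl, Sum.elim_inr, Finset.sum_add_distrib, bar_eq_of_coeff (hZ0 _ x), hζ]
  set v := (M x)⁻¹.mulVec (Sum.elim ζ fun k => conj (ζ k)) with hv
  have hMv : (M x).mulVec v = Sum.elim ζ fun k => conj (ζ k) := by
    rw [hv, Matrix.mulVec_mulVec, Matrix.mul_nonsing_inv _ (hdet x), Matrix.one_mulVec]
  have hvs : v = Sum.elim (v ∘ Sum.inl) (v ∘ Sum.inr) := by simp
  -- Exchanging and conjugating the two blocks of v gives another solution of the same system.
  -- Uniqueness then makes the second block the conjugate of the first, so v comes from a solution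
  -- of the real-linear system.
  have hMv' : (M x).mulVec (Sum.elim (fun l => conj (v (Sum.inr l))) fun l => conj (v (Sum.inl l))) =
      Sum.elim ζ fun k => conj (ζ k) := by
    funext i
    rcases i with i | i
    · have := congrFun hMv (Sum.inr i)
      rw [hvs, hM, nondegMatrix_mulVec_inr] at this
      have := congrArg conj this
      rw [conj_nondeg_eq'] at this
      rw [hM, nondegMatrix_mulVec_inl]
      simpa using this
    · have := congrFun hMv (Sum.inl i)
      rw [hvs, hM, nondegMatrix_mulVec_inl] at this
      have := congrArg conj this
      rw [conj_nondeg_eq] at this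
      rw [hM, nondegMatrix_mulVec_inr]
      simpa using this
  have hinj := Matrix.mulVec_injective_of_isUnit ((Matrix.isUnit_iff_isUnit_det _).2 (hdet x))
  have hsym := hinj (hMv'.trans hMv.symm)
  have hinl := congrFun hMv (Sum.inl k)
  rw [hvs, hM, nondegMatrix_mulVec_inl] at hinl
  have hr : v (Sum.inr k) = conj (v (Sum.inl k)) := (congrFun hsym (Sum.inr k)).symm
  simp only [Function.comp_apply, hr, Sum.elim_inl] at hinl
  simp only [hcoef]
  exact hinl

end

section

variable {n s : ℕ} {𝒳 : Type*} {A : CoeffAlg 𝒳}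

/-- The components of bidegree `(a, 0)` of the solution of the linearized equation. -/
def chainRec (s : ℕ) (B : Fin n → Fin n → ℂ) (P : ℕ → Ser n) (F₀ F₁ F₂ : Fin n → Ser n) :
    ℕ → Fin n → Ser n
  | 0 => F₀
  | 1 => F₁
  | 2 => F₂
  | a + 3 => unherm s (C (((2 * (a + 2) * (a + 3) : ℕ) : ℂ)⁻¹) *
      (cI * P a - 4 * (rho n s * ∂ᵤ (nz B (chainRec s B P F₀ F₁ F₂ (a + 1))))))

theorem isSer_chainRec {B : 𝒳 → Fin n → Fin n → ℂ} (hBs : ∀ k l, A.Sc fun x => B x k l)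
    {P : ℕ → 𝒳 → Ser n} {F₀ F₁ F₂ : Fin n → 𝒳 → Ser n} (hP : ∀ a, A.IsSer (P a))
    (h₀ : ∀ l, A.IsSer (F₀ l)) (h₁ : ∀ l, A.IsSer (F₁ l)) (h₂ : ∀ l, A.IsSer (F₂ l)) (a : ℕ)
    (l : Fin n) : A.IsSer fun x => chainRec s (B x) (fun a => P a x) (fun l => F₀ l x)
      (fun l => F₁ l x) (fun l => F₂ l x) a l := by
  induction a using Nat.strong_induction_on generalizing l with
  | _ a ih =>
    rcases a with _ | _ | _ | a
    · exact h₀ l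
    · exact h₁ l
    · exact h₂ l
    · exact isSer_unherm (.C_mul (.const _) ((hP a).cI_mul.sub (.const_mul _
        ((isSer_nz hBs fun l => ih (a + 1) (by omega) l).pderiv _).rho_mul))) l

theorem bi_chainRec (B : Fin n → Fin n → ℂ) {P : ℕ → Ser n} {F₀ F₁ F₂ : Fin n → Ser n}
    (hP : ∀ a, bi (a + 3) 1 (P a) = P a) (h₀ : ∀ l, bi 0 0 (F₀ l) = F₀ l)
    (h₁ : ∀ l, bi 1 0 (F₁ l) = F₁ l) (h₂ : ∀ l, bi 2 0 (F₂ l) = F₂ l) (a : ℕ) :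
    ∀ l, bi a 0 (chainRec s B P F₀ F₁ F₂ a l) = chainRec s B P F₀ F₁ F₂ a l := by
  induction a using Nat.strong_induction_on with
  | _ a ih =>
    rcases a with _ | _ | _ | a
    · exact h₀
    · exact h₁
    · exact h₂
    · intro l
      have e : ∀ p : Ser n, bi (a + 3) 1 (4 * p) = 4 * bi (a + 3) 1 p := fun p => by
        exact_mod_cast bi_natCast_mul (a + 3) 1 4 p
      refine bi_unherm ?_ l
      rw [bi_C_mul, map_sub, bi_cI_mul, hP, e, bi_rho_mul_of]
      rw [bi_pderiv_uv, bi_nz_succ]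
      simp only [ih (a + 1) (by omega)]

theorem herm_chainRec (B : Fin n → Fin n → ℂ) {P : ℕ → Ser n} {F₀ F₁ F₂ : Fin n → Ser n}
    (hP : ∀ a, bi (a + 3) 1 (P a) = P a) (h₀ : ∀ l, bi 0 0 (F₀ l) = F₀ l)
    (h₁ : ∀ l, bi 1 0 (F₁ l) = F₁ l) (h₂ : ∀ l, bi 2 0 (F₂ l) = F₂ l) (a : ℕ) :
    herm s (chainRec s B P F₀ F₁ F₂ (a + 3)) = C (((2 * (a + 2) * (a + 3) : ℕ) : ℂ)⁻¹) *
      (cI * P a - 4 * (rho n s * ∂ᵤ (nz B (chainRec s B P F₀ F₁ F₂ (a + 1))))) := by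
  have e : ∀ p : Ser n, bi (a + 3) 1 (4 * p) = 4 * bi (a + 3) 1 p := fun p => by
    exact_mod_cast bi_natCast_mul (a + 3) 1 4 p
  refine herm_unherm (a := a + 3) ?_
  rw [bi_C_mul, map_sub, bi_cI_mul, hP, e, bi_rho_mul_of]
  rw [bi_pderiv_uv, bi_nz_succ]
  simp only [bi_chainRec B hP h₀ h₁ h₂ (a + 1)]

theorem bar_C_natInv_mul (k : ℕ) (p : Ser n) :
    Ser.bar (C ((k : ℂ)⁻¹) * p) = C ((k : ℂ)⁻¹) * p.bar := by
  rw [bar_mul, bar_C, map_inv₀, Complex.conj_natCast]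

theorem herm_bar_eq (η : Fin n → Ser n) :
    (herm s η).bar = ∑ l, C (sg s l) * (X (zv l) * (η l).bar) := by
  simp only [herm, bar_sum, bar_mul, bar_C, conj_sg, bar_X, conjVar_zbv]

/-- Solvability of the linearized equation, by a map with `DDb f = 0`. -/
theorem exists_cond (hn : 1 ≤ n) {B : 𝒳 → Fin n → Fin n → ℂ} (hBs : ∀ k l, A.Sc fun x => B x k l)
    (hB : ∀ x, Nondeg s (B x)) {R : 𝒳 → Ser n} (hR : A.IsSer R)
    (hR1 : ∀ x, UOrd 1 (bi 1 1 (R x))) :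
    ∃ (f : Fin n → 𝒳 → Ser n) (g₀ : 𝒳 → Ser n), (∀ l, A.IsSer (f l)) ∧ A.IsSer g₀ ∧ ∀ x,
      (∀ l, DDb n s (f l x) = 0) ∧ (g₀ x).bar = g₀ x ∧ bi 0 0 (g₀ x) = g₀ x ∧
      InitZero (fun l => f l x) (g₀ x) ∧ Cond s (qop s (B x) (fun l => f l x) + R x) (g₀ x) := by
  have hI := cI_mul_self (n := n)
  have h2 : (C (((2 : ℕ) : ℂ)⁻¹) : Ser n) * ((2 : ℕ) : Ser n) = 1 := C_inv_mul_natCast two_ne_zero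
  have h4 : (C (((4 : ℕ) : ℂ)⁻¹) : Ser n) * ((4 : ℕ) : Ser n) = 1 := C_inv_mul_natCast (by norm_num)
  set N₃ := (3 * n + 6) * ((2 * n + 2) * n) with hN₃
  set N₂ := (2 * n + 4) * (n + 1) with hN₂
  have hN₃0 : 4 * N₃ ≠ 0 := by positivity
  have hN₂0 : 8 * N₂ ≠ 0 := by positivity
  -- the function `g₀`
  set t₃ : 𝒳 → Ser n := fun x => trc n s (trc n s (trc n s
    (2 * (rho n s * (rho n s * ∂ᵤ (∂ᵤ (obs11 (R x))))) + obs33 s (R x)))) with ht₃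
  set G : 𝒳 → Ser n := fun x => C (((4 * N₃ : ℕ) : ℂ)⁻¹) * (-(cI * t₃ x)) with hG
  have ht₃s : A.IsSer t₃ := ((((((isSer_obs11 hR).pderiv _).pderiv _).rho_mul.rho_mul.const_mul _).add
    (isSer_obs33 hR)).trc.trc.trc)
  have hGs : A.IsSer G := .C_mul (.const _) ht₃s.cI_mul.neg
  have ht₃r : ∀ x, (t₃ x).bar = -t₃ x := fun x => by
    simp only [ht₃, bar_trc, bar_add, bar_mul, bar_two, bar_rho, bar_du, bar_obs11, bar_obs33]
    rw [← map_neg, ← map_neg, ← map_neg]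
    congr 3
    rw [map_neg, map_neg]; ring
  have ht₃b : ∀ x, bi 0 0 (t₃ x) = t₃ x := fun x => by
    simp only [ht₃, bi_trc, zero_add, Nat.reduceAdd, map_add, bi_two_mul, bi_obs33]
    rw [bi_rho_mul_of (a := 2) (b := 2) (bi_rho_mul_of (a := 1) (b := 1) _)]
    rw [bi_pderiv_uv, bi_pderiv_uv, bi_obs11]
  -- Primitives without lower-order terms realize the initial conditions; likewise for f below.
  set g₀ : 𝒳 → Ser n := fun x => uint (uint (uint (G x))) with hg₀
  have hg₀s : A.IsSer g₀ := hGs.uint.uint.uint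
  have hg₀r : ∀ x, (g₀ x).bar = g₀ x := fun x => by
    simp only [hg₀, bar_uint, hG]
    rw [bar_C_natInv_mul, bar_neg, bar_mul, bar_cI, ht₃r, neg_mul_neg]
  have hg₀b : ∀ x, bi 0 0 (g₀ x) = g₀ x := fun x => by
    simp only [hg₀, bi_uint, hG, bi_C_mul, map_neg, ht₃b]
  have hg₀o : ∀ x, UOrd 3 (g₀ x) := fun x => (uOrd_zero _).uint.uint.uint
  -- bidegree `(1, 0)`
  set S : 𝒳 → Ser n := fun x => rho n s * ∂ᵤ (g₀ x) + C (((2 : ℕ) : ℂ)⁻¹) * (cI * obs11 (R x)) with hS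
  have hSs : A.IsSer S := (hg₀s.pderiv _).rho_mul.add (.C_mul (.const _) (isSer_obs11 hR).cI_mul)
  have hSr : ∀ x, (S x).bar = S x := fun x => by
    simp only [hS, bar_add, bar_mul, bar_rho, bar_du, hg₀r, bar_obs11, bar_C, map_inv₀,
      Complex.conj_natCast, Complex.conj_I, map_neg, neg_mul_neg]
  have hSb : ∀ x, bi 1 1 (S x) = S x := fun x => by
    simp only [hS, map_add, bi_C_mul, bi_obs11]
    rw [bi_rho_mul_of (a := 0) (b := 0)]
    rw [bi_pderiv_uv, hg₀b]
  have hSo : ∀ x, UOrd 1 (S x) := fun x =>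
    (((hg₀o x).du.mono (by norm_num)).mul_left _).add
      ((((hR1 x).sub (hR1 x).bar).mul_left _).mul_left _)
  -- The (2,2) condition becomes tr(ρU) = Y for the u-derivative U of u₁ - ū₁. U is obtained from
  -- `exists_trc_rho`, and u₁ is recovered from its real and imaginary parts.
  set Y : 𝒳 → Ser n := fun x => C (((4 : ℕ) : ℂ)⁻¹) * trc n s (obs22 s (R x)) with hY
  have hYs : A.IsSer Y := .C_mul (.const _) (isSer_obs22 hR).trc
  have hYb : ∀ x, bi 1 1 (Y x) = Y x := fun x => by
    simp only [hY, bi_C_mul, bi_trc, Nat.reduceAdd, bi_obs22]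
  have hYr : ∀ x, (Y x).bar = -Y x := fun x => by
    simp only [hY]
    rw [bar_C_natInv_mul, bar_trc, bar_obs22, map_neg, mul_neg]
  set U : 𝒳 → Ser n := fun x => C (((n + 2 : ℕ) : ℂ)⁻¹) *
    (Y x - C (((2 * n + 2 : ℕ) : ℂ)⁻¹) * (rho n s * trc n s (Y x))) with hU
  have hUs : A.IsSer U := .C_mul (.const _) (hYs.sub (.C_mul (.const _) hYs.trc.rho_mul))
  have hUt : ∀ x, trc n s (rho n s * U x) = Y x := fun x => exists_trc_rho (Y x) (hYb x)
  have hUb : ∀ x, bi 1 1 (U x) = U x := fun x => by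
    simp only [hU, bi_C_mul, map_sub, hYb]
    rw [bi_rho_mul_of (a := 0) (b := 0)]
    rw [bi_trc, hYb]
  have hUr : ∀ x, (U x).bar = -U x := fun x => by
    simp only [hU, bar_sub, bar_mul, bar_rho, bar_trc, hYr, map_neg, bar_C, map_inv₀,
      Complex.conj_natCast]
    ring
  set u₁ : 𝒳 → Ser n := fun x => C (((2 : ℕ) : ℂ)⁻¹) * (S x + uint (U x)) with hu₁
  have hu₁s : A.IsSer u₁ := .C_mul (.const _) (hSs.add hUs.uint)
  have hu₁b : ∀ x, bi 1 1 (u₁ x) = u₁ x := fun x => by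
    simp only [hu₁, bi_C_mul, map_add, hSb, bi_uint, hUb]
  have hu₁o : ∀ x, UOrd 1 (u₁ x) := fun x => ((hSo x).add (uOrd_zero _).uint).mul_left _
  have hu₁r : ∀ x, (u₁ x).bar = C (((2 : ℕ) : ℂ)⁻¹) * (S x - uint (U x)) := fun x => by
    have e : uint (-U x) = -uint (U x) := by
      ext m; rw [map_neg, coeff_uint, coeff_uint, map_neg]; split_ifs <;> simp [neg_div]
    simp only [hu₁]
    rw [bar_C_natInv_mul, bar_add, hSr, bar_uint, hUr, e, sub_eq_add_neg]
  -- bidegree `(0, 0)`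
  set Z : 𝒳 → Ser n := fun x => C (((8 * N₂ : ℕ) : ℂ)⁻¹) * trc n s (trc n s
    (obs32 s (R x) - 4 * (cI * (rho n s * ∂ᵤ (obsSucc s 1 (R x)))))) with hZ
  have hZs : A.IsSer Z := .C_mul (.const _) (((isSer_obs32 hR).sub
    (((isSer_obsSucc 1 hR).pderiv _).rho_mul.cI_mul.const_mul _)).trc.trc)
  have hZb : ∀ x, bi 1 0 (Z x) = Z x := fun x => by
    have e : ∀ p : Ser n, bi 3 2 (4 * p) = 4 * bi 3 2 p := fun p => by
      exact_mod_cast bi_natCast_mul 3 2 4 p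
    simp only [hZ, bi_C_mul, bi_trc, zero_add, Nat.reduceAdd, map_sub, bi_obs32, e]
    rw [bi_rho_mul_of (a := 2) (b := 1)]
    rw [bi_pderiv_uv, bi_obsSucc]
  -- As Z is linear in z, comparing coefficients of z_k gives the system of `Nondeg` for the second
  -- u-derivative η of f_{00}.
  obtain ⟨η, hηs, hηb, hη⟩ := exists_solve_nondeg hBs hB (Z := fun k x => pderiv ℂ (zv k) (Z x))
    (fun k => hZs.pderiv _) (fun k x => by rw [bi_pderiv_zv, hZb])
  set F₀ : Fin n → 𝒳 → Ser n := fun l x => uint (uint (η l x)) with hF₀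
  have hF₀s : ∀ l, A.IsSer (F₀ l) := fun l => (hηs l).uint.uint
  have hF₀b : ∀ l x, bi 0 0 (F₀ l x) = F₀ l x := fun l x => by
    simp only [hF₀, bi_uint, hηb]
  set v : 𝒳 → Ser n := fun x => nz (B x) fun l => F₀ l x with hv
  set w : 𝒳 → Ser n := fun x => (herm s fun l => F₀ l x).bar with hw
  have hvs : A.IsSer v := isSer_nz hBs hF₀s
  have hws : A.IsSer w := (isSer_herm hF₀s).bar
  have hvb : ∀ x, bi 1 0 (v x) = v x := fun x => by simp only [hv, bi_nz_succ, hF₀b]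
  have hwb : ∀ x, bi 1 0 (w x) = w x := fun x => by simp only [hw, bi_bar, bi_herm_succ, hF₀b]
  have hvw : ∀ x, ∂ᵤ (∂ᵤ (v x)) - 3 * (cI * ∂ᵤ (∂ᵤ (w x))) = -Z x := fun x => by
    have e1 : ∂ᵤ (∂ᵤ (v x)) = ∑ k, X (zv k) * ∑ l, C (B x k l) * η l x := by
      have : ∂ᵤ (∂ᵤ (v x)) = nz (B x) fun l => η l x := by simp only [hv, du_nz, hF₀, pderiv_uint]
      rw [this, nz]
      simp only [Finset.mul_sum]
      exact Finset.sum_congr rfl fun _ _ => Finset.sum_congr rfl fun _ _ => by ring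
    have e2 : 3 * (cI * ∂ᵤ (∂ᵤ (w x))) =
        ∑ k, X (zv k) * (C (3 * Complex.I * sg s k) * (η k x).bar) := by
      have : ∂ᵤ (∂ᵤ (w x)) = (herm s fun l => η l x).bar := by
        simp only [hw, ← bar_du, du_herm, hF₀, pderiv_uint]
      rw [this, herm_bar_eq]
      simp only [Finset.mul_sum]
      exact Finset.sum_congr rfl fun _ _ => by rw [map_mul, map_mul, map_ofNat]; ring
    have e3 : ∑ k, X (zv k) * pderiv ℂ (zv k) (Z x) = Z x := by
      rw [← eul_apply, ← hZb x, eul_bi]; simp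
    rw [e1, e2, ← Finset.sum_sub_distrib, ← e3, ← Finset.sum_neg_distrib]
    refine Finset.sum_congr rfl fun k _ => ?_
    rw [← hη x k]; ring
  -- bidegree `(2, 0)`
  set u₂ : 𝒳 → Ser n := fun x => -(rho n s * ∂ᵤ (v x)) + 2 * (cI * (rho n s * ∂ᵤ (w x))) +
    C (((4 : ℕ) : ℂ)⁻¹) * (cI * obsSucc s 1 (R x)) with hu₂
  have hu₂s : A.IsSer u₂ := ((hvs.pderiv _).rho_mul.neg.add
    ((hws.pderiv _).rho_mul.cI_mul.const_mul _)).add (.C_mul (.const _) (isSer_obsSucc 1 hR).cI_mul)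
  have hu₂b : ∀ x, bi 2 1 (u₂ x) = u₂ x := fun x => by
    simp only [hu₂, map_add, map_neg, bi_two_mul, bi_C_mul]
    rw [bi_rho_mul_of (a := 1) (b := 0), bi_rho_mul_of (a := 1) (b := 0), bi_obsSucc]
    · rw [bi_pderiv_uv, hwb]
    · rw [bi_pderiv_uv, hvb]
  -- the map
  have hPb : ∀ a x, bi (a + 3) 1 (obsSucc s (a + 2) (R x)) = obsSucc s (a + 2) (R x) :=
    fun a x => bi_obsSucc (a + 2) (R x)
  set F : ℕ → Fin n → 𝒳 → Ser n := fun a l x => chainRec s (B x) (fun a => obsSucc s (a + 2) (R x))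
    (fun l => F₀ l x) (unherm s (u₁ x)) (unherm s (u₂ x)) a l with hF
  have hFs : ∀ a l, A.IsSer (F a l) := fun a l => isSer_chainRec hBs (fun a => isSer_obsSucc _ hR) hF₀s
    (isSer_unherm hu₁s) (isSer_unherm hu₂s) a l
  have hFb : ∀ a l x, bi a 0 (F a l x) = F a l x := fun a l x =>
    bi_chainRec (B x) (fun a => hPb a x) (fun l => hF₀b l x) (bi_unherm (hu₁b x))
      (bi_unherm (hu₂b x)) a l
  choose f hfs hf using fun l => exists_solve_DDb (s := s) (r := fun _ => 0) (F := fun a => F a l)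
    (CoeffAlg.IsSer.const (A := A) (0 : Ser n)) (fun a => hFs a l) (fun x a => map_zero _)
    (fun a x => hFb a l x)
  have hf0 : ∀ x l, DDb n s (f l x) = 0 := fun x l => (hf l x).1
  have hfF : ∀ x a l, bi a 0 (f l x) = F a l x := fun x a l => (hf l x).2 a
  refine ⟨f, g₀, hfs, hg₀s, fun x => ⟨hf0 x, hg₀r x, hg₀b x, ⟨fun l => ?_, fun l => ?_, ?_⟩, ?_⟩⟩
  · rw [hfF]; exact (uOrd_zero _).uint.uint
  · rw [hfF]; exact ((hu₁o x).pderiv_zbv l).mul_left _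
  · rw [hg₀b]; exact hg₀o x
  have q11 : bi 1 1 (herm s fun l => f l x) = u₁ x := by
    rw [bi_herm_succ]; simp only [hfF]; exact herm_unherm (hu₁b x)
  have q21 : bi 2 1 (herm s fun l => f l x) = u₂ x := by
    rw [bi_herm_succ]; simp only [hfF]; exact herm_unherm (hu₂b x)
  have q10 : bi 1 0 (nz (B x) fun l => f l x) = v x := by
    rw [bi_nz_succ]; simp only [hfF]; rfl
  have q01 : (bi 0 1 (herm s fun l => f l x)).bar = w x := by
    rw [bi_herm_succ]; simp only [hfF]; rfl
  have hS1 : u₁ x + (u₁ x).bar = S x := by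
    rw [hu₁r]; push_cast at h2; linear_combination S x * h2
  refine ⟨?_, fun a => ?_, ?_, ?_, ?_⟩
  · rw [obs11_add, obs11_qop (hf0 x), q11, hS1]
    have : S x = rho n s * ∂ᵤ (g₀ x) + C (((2 : ℕ) : ℂ)⁻¹) * (cI * obs11 (R x)) := rfl
    push_cast at h2 this
    rw [this]
    linear_combination (obs11 (R x)) * hI + (cI * cI * obs11 (R x)) * h2
  · rw [obsSucc_add]
    rcases a with _ | a
    · rw [zero_add, obsSucc_one_qop (hf0 x), q21, q10, q01]
      have : u₂ x = -(rho n s * ∂ᵤ (v x)) + 2 * (cI * (rho n s * ∂ᵤ (w x))) +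
        C (((4 : ℕ) : ℂ)⁻¹) * (cI * obsSucc s 1 (R x)) := rfl
      push_cast at h4 this
      rw [this]
      linear_combination (obsSucc s 1 (R x) + 8 * (rho n s * ∂ᵤ (w x))) * hI +
        (cI * cI * obsSucc s 1 (R x)) * h4
    · rw [show a + 1 + 1 = a + 2 by rfl, obsSucc_qop (hf0 x), bi_herm_succ, bi_nz_succ]
      simp only [hfF]
      have e := herm_chainRec (s := s) (B x) (fun a => hPb a x) (fun l => hF₀b l x)
        (bi_unherm (s := s) (hu₁b x)) (bi_unherm (s := s) (hu₂b x)) a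
      change herm s (fun l => F (a + 3) l x) = _ * (_ - 4 * (rho n s * ∂ᵤ (nz (B x)
        fun l => F (a + 1) l x))) at e
      rw [e]
      have hN := C_inv_mul_natCast (n := n) (a := 2 * (a + 2) * (a + 3)) (by positivity)
      generalize C (((2 * (a + 2) * (a + 3) : ℕ) : ℂ)⁻¹) = c at hN
      push_cast at hN
      linear_combination (cI * (cI * obsSucc s (a + 2) (R x) -
        4 * (rho n s * ∂ᵤ (nz (B x) fun l => F (a + 1) l x)))) * hN + obsSucc s (a + 2) (R x) * hI
  · rw [obs22_add, obs22_qop (hf0 x), q11]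
    have e : 4 * (rho n s * ∂ᵤ ((u₁ x).bar - u₁ x)) = -(((4 : ℕ) : Ser n) * (rho n s * U x)) := by
      have : (u₁ x).bar - u₁ x = -uint (U x) := by
        rw [hu₁r]
        have : u₁ x = C (((2 : ℕ) : ℂ)⁻¹) * (S x + uint (U x)) := rfl
        push_cast at h2 this ⊢
        rw [this]; linear_combination -uint (U x) * h2
      rw [this, map_neg, pderiv_uint]; push_cast; ring
    rw [e, map_add, map_neg, trc_natCast_mul, hUt]
    have : Y x = C (((4 : ℕ) : ℂ)⁻¹) * trc n s (obs22 s (R x)) := rfl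
    rw [this]
    linear_combination -trc n s (obs22 s (R x)) * h4
  · rw [obs32_add, obs32_qop (hf0 x), q21, q10, q01]
    have d4 : ∂ᵤ (C (((4 : ℕ) : ℂ)⁻¹) * (cI * obsSucc s 1 (R x))) =
      C (((4 : ℕ) : ℂ)⁻¹) * (cI * ∂ᵤ (obsSucc s 1 (R x))) := by rw [pderiv_C_mul, du_cI_mul]
    have e : -16 * (rho n s * ∂ᵤ (u₂ x)) + 8 * cI * (rho n s * (rho n s * ∂ᵤ (∂ᵤ (w x)))) -
        8 * (rho n s * (rho n s * ∂ᵤ (∂ᵤ (v x)))) + obs32 s (R x) =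
        (obs32 s (R x) - 4 * (cI * (rho n s * ∂ᵤ (obsSucc s 1 (R x))))) -
          ((8 : ℕ) : Ser n) * (rho n s * (rho n s * Z x)) := by
      have : u₂ x = -(rho n s * ∂ᵤ (v x)) + 2 * (cI * (rho n s * ∂ᵤ (w x))) +
        C (((4 : ℕ) : ℂ)⁻¹) * (cI * obsSucc s 1 (R x)) := rfl
      rw [this, map_add, map_add, map_neg, du_rho_mul, pderiv_mul, du_two, du_cI_mul, du_rho_mul, d4]
      have hz := hvw x
      push_cast at h4 ⊢
      linear_combination (8 * (rho n s * rho n s)) * hz -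
        4 * (rho n s * (cI * ∂ᵤ (obsSucc s 1 (R x)))) * h4
    rw [e, map_sub, trc_natCast_mul, map_sub, trc_natCast_mul, trc_two_rho (hZb x)]
    have : ((8 * N₂ : ℕ) : Ser n) * Z x = trc n s (trc n s
      (obs32 s (R x) - 4 * (cI * (rho n s * ∂ᵤ (obsSucc s 1 (R x)))))) := natCast_mul_C_inv hN₂0 _
    rw [← this, hN₂]; push_cast; ring
  · rw [obs33_add, obs33_qop (hf0 x), q11, hS1]
    have d2 : ∂ᵤ (C (((2 : ℕ) : ℂ)⁻¹) * (cI * obs11 (R x))) =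
      C (((2 : ℕ) : ℂ)⁻¹) * (cI * ∂ᵤ (obs11 (R x))) := by rw [pderiv_C_mul, du_cI_mul]
    have d2' : ∂ᵤ (C (((2 : ℕ) : ℂ)⁻¹) * (cI * ∂ᵤ (obs11 (R x)))) =
      C (((2 : ℕ) : ℂ)⁻¹) * (cI * ∂ᵤ (∂ᵤ (obs11 (R x)))) := by rw [pderiv_C_mul, du_cI_mul]
    have d3 : ∂ᵤ (∂ᵤ (∂ᵤ (g₀ x))) = G x := by simp only [hg₀, pderiv_uint]
    have e : -4 * cI * (rho n s * (rho n s * ∂ᵤ (∂ᵤ (S x)))) + obs33 s (R x) =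
        (2 * (rho n s * (rho n s * ∂ᵤ (∂ᵤ (obs11 (R x))))) + obs33 s (R x)) -
          C Complex.I * (((4 : ℕ) : Ser n) * (rho n s * (rho n s * (rho n s * G x)))) := by
      have : S x = rho n s * ∂ᵤ (g₀ x) + C (((2 : ℕ) : ℂ)⁻¹) * (cI * obs11 (R x)) := rfl
      rw [this, map_add, du_rho_mul, d2, map_add, du_rho_mul, d2', d3]
      push_cast at h2 ⊢
      linear_combination (-2 * (cI * cI) * (rho n s * rho n s * ∂ᵤ (∂ᵤ (obs11 (R x))))) * h2 -
        2 * (rho n s * rho n s * ∂ᵤ (∂ᵤ (obs11 (R x)))) * hI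
    have hGb : bi 0 0 (G x) = G x := by simp only [hG, bi_C_mul, map_neg, ht₃b]
    rw [e, map_sub, trc_C_mul, trc_natCast_mul, map_sub, trc_C_mul, trc_natCast_mul, map_sub,
      trc_C_mul, trc_natCast_mul, trc_three_rho hGb]
    have : ((4 * N₃ : ℕ) : Ser n) * G x = -(cI * t₃ x) := natCast_mul_C_inv hN₃0 _
    change t₃ x - _ = 0
    rw [hN₃] at this
    clear_value G t₃
    push_cast at this ⊢
    linear_combination -cI * this + t₃ x * hI

end

/-! ### Linear theory: existence of solutions and homogeneity -/

section

variable {n s : ℕ} {𝒳 : Type*} {A : CoeffAlg 𝒳}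

/-- Solutions of the linearized equation. -/
structure LinSol (s : ℕ) (T : Bool) (B : Fin n → Fin n → ℂ) (r : Fin n → Ser n) (R : Ser n)
    (f : Fin n → Ser n) (g ψ : Ser n) : Prop where
  eq_f : ∀ l, DDb n s (f l) = r l
  eq_g : DD n s g + cI * modeOp n s T ψ = qop s B f + R
  real : g.bar = g
  nf : IsNF n s ψ
  init : InitZero f g

theorem qop_bi_zero (B : Fin n → Fin n → ℂ) (f : Fin n → Ser n) (b : ℕ) :
    bi 0 b (qop s B f) = 0 := by
  rw [qop, map_add, map_add, bi_nz_zero, bi_cI_mul, bi_cI_mul, bi_bar, bi_herm_zero, bar_zero]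
  rcases b with _ | b
  · rw [bi_herm_zero]; simp
  · rw [bi_herm_succ]; simp only [bi_DD_left_zero]
    rw [show (fun _ : Fin n => (0 : Ser n)) = 0 from rfl, herm_zero]; simp

/-- Existence of solutions of the linearized equation, in families. -/
theorem exists_linSol (hn : 1 ≤ n) (T : Bool) {B : 𝒳 → Fin n → Fin n → ℂ}
    (hBs : ∀ k l, A.Sc fun x => B x k l) (hB : ∀ x, Nondeg s (B x)) {r : Fin n → 𝒳 → Ser n}
    {R : 𝒳 → Ser n} (hr : ∀ l, A.IsSer (r l)) (hR : A.IsSer R)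
    (hr0 : ∀ l x a, bi a 0 (r l x) = 0) (hr1 : ∀ l x, UOrd 1 (bi 0 1 (r l x)))
    (hR0 : ∀ x b, bi 0 b (R x) = 0) (hR1 : ∀ x, UOrd 1 (bi 1 1 (R x))) :
    ∃ (f : Fin n → 𝒳 → Ser n) (g ψ : 𝒳 → Ser n), (∀ l, A.IsSer (f l)) ∧ A.IsSer g ∧ A.IsSer ψ ∧
      ∀ x, LinSol s T (B x) (fun l => r l x) (R x) (fun l => f l x) (g x) (ψ x) := by
  -- A particular solution of the first equation without components of bidegree (a, 0). Its
  -- contribution to the second equation is moved to R, and `exists_cond` supplies the correction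
  -- from the kernel of `DDb`.
  choose fr hfrs hfr using fun l => exists_solve_DDb (s := s) (r := r l) (F := fun _ _ => 0)
    (hr l) (fun _ => CoeffAlg.IsSer.const (A := A) (0 : Ser n)) (fun x a => hr0 l x a)
    (fun _ _ => map_zero _)
  -- `exists_cond` needs the (1,1) component to vanish at u = 0. The particular solution enters it
  -- only through its component (0, 1), which equals that of r.
  have hq11 : ∀ x, UOrd 1 (bi 1 1 (qop s (B x) (fun l => fr l x) + R x)) := fun x => by
    have hfr0 : ∀ l a, bi a 0 (fr l x) = 0 := fun l a => (hfr l x).2 a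
    have hz : herm s (fun l => bi 1 0 (fr l x)) = 0 := by
      simp only [hfr0]; exact herm_zero
    have hz' : herm s (fun l => bi 1 0 (DD n s (fr l x))) = 0 := by
      simp only [bi_DD_right_zero, hfr0, mul_zero]; exact herm_zero
    rw [map_add]
    refine UOrd.add ?_ (hR1 x)
    rw [qop, map_add, map_add, bi_cI_mul, bi_cI_mul, bi_bar, bi_herm_succ, bi_herm_succ, hz, hz',
      bi_nz_succ, bar_zero, mul_zero, add_zero, add_zero]
    refine UOrd.sum fun k _ => UOrd.sum fun l _ => (UOrd.mul_left (UOrd.mul_left ?_ _) _ : UOrd 1 _)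
    have e : bi 0 1 (fr l x) = bi 0 1 (r l x) := by
      rw [← (hfr l x).1, bi_DDb_left_zero]; simp
    beta_reduce
    rw [map_sub, bi_DD_left_zero, zero_sub, e]
    exact (hr1 l x).neg
  obtain ⟨f₁, g₀, hf₁s, hg₀s, h⟩ := exists_cond hn hBs hB (R := fun x =>
    qop s (B x) (fun l => fr l x) + R x) ((isSer_qop hBs hfrs).add hR) hq11
  obtain ⟨g, ψ, hg, hψ, h'⟩ := exists_solve T
    ((isSer_qop hBs hf₁s).add ((isSer_qop hBs hfrs).add hR)) hg₀s
    (fun x b => by rw [map_add, map_add, qop_bi_zero, qop_bi_zero, hR0, add_zero, add_zero])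
    (fun x => (h x).2.1) (fun x => (h x).2.2.1) (fun x => (h x).2.2.2.2)
  refine ⟨fun l x => f₁ l x + fr l x, g, ψ, fun l => (hf₁s l).add (hfrs l), hg, hψ, fun x => ?_⟩
  obtain ⟨e1, e2, e3, e4, e5⟩ := h x
  obtain ⟨e6, e7, e8, e9⟩ := h' x
  refine ⟨fun l => ?_, ?_, e6, e7, ⟨fun l => ?_, fun l => ?_, ?_⟩⟩
  · rw [map_add, e1, (hfr l x).1, zero_add]
  · rw [e9, ← add_assoc, ← qop_add]; rfl
  · rw [map_add, (hfr l x).2, add_zero]; exact e4.f00 l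
  · rw [map_add, (hfr l x).2, add_zero]; exact e4.f10 l
  · have := e4.g00; rwa [e3, ← e8] at this

/-! ### Weights -/

/-- The weights `1, 1, 2` of `z`, `z̄`, `u`, as integers. -/
def zwt (n : ℕ) (i : Var n) : ℤ := hwt n i

/-- The projection to the terms of weight `d`. -/
abbrev wp (d : ℤ) : Ser n →ₗ[ℂ] Ser n := gr (zwt n) d

theorem weight_zwt (m : Var n →₀ ℕ) :
    Finsupp.weight (zwt n) m = (Finsupp.weight (hwt n) m : ℕ) := by
  rw [Finsupp.weight_eq_sum, Finsupp.weight_eq_sum]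
  push_cast
  rfl

theorem mem_wIdeal_iff_wp {k : ℕ} {p : Ser n} :
    p ∈ wIdeal (hwt n) k ↔ ∀ d : ℕ, d < k → wp d p = 0 := by
  constructor
  · intro h d hd
    ext m
    rw [coeff_gr, weight_zwt]
    split_ifs with hm
    · exact h m (by rw [Nat.cast_inj.1 hm]; exact hd)
    · rfl
  · intro h m hm
    have := congrArg (coeff m) (h _ hm)
    rwa [coeff_gr, weight_zwt, if_pos rfl] at this

theorem wp_X_zv_mul (d : ℤ) (j : Fin n) (p : Ser n) :
    wp d (X (zv j) * p) = X (zv j) * wp (d - 1) p := by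
  have := gr_X_mul (w := zwt n) (d := d - 1) (p := p) (zv j)
  rwa [show d - 1 + zwt n (zv j) = d by simp [zwt]] at this

theorem wp_X_zbv_mul (d : ℤ) (j : Fin n) (p : Ser n) :
    wp d (X (zbv j) * p) = X (zbv j) * wp (d - 1) p := by
  have := gr_X_mul (w := zwt n) (d := d - 1) (p := p) (zbv j)
  rwa [show d - 1 + zwt n (zbv j) = d by simp [zwt]] at this

theorem wp_pderiv_zv (d : ℤ) (j : Fin n) (p : Ser n) :
    wp d (pderiv ℂ (zv j) p) = pderiv ℂ (zv j) (wp (d + 1) p) := gr_pderiv (w := zwt n) (zv j)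

theorem wp_pderiv_zbv (d : ℤ) (j : Fin n) (p : Ser n) :
    wp d (pderiv ℂ (zbv j) p) = pderiv ℂ (zbv j) (wp (d + 1) p) := gr_pderiv (w := zwt n) (zbv j)

theorem wp_du (d : ℤ) (p : Ser n) : wp d (∂ᵤ p) = ∂ᵤ (wp (d + 2) p) := gr_pderiv (w := zwt n) uv

theorem wp_C_mul (d : ℤ) (c : ℂ) (p : Ser n) : wp d (C c * p) = C c * wp d p := gr_C_mul c

theorem wp_bi (d : ℤ) (a b : ℕ) (p : Ser n) : bi a b (wp d p) = wp d (bi a b p) := gr_comm _ _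

theorem wp_bar (d : ℤ) (p : Ser n) : wp d p.bar = (wp d p).bar := by
  ext m
  have : Finsupp.weight (hwt n) (conjExp m) = Finsupp.weight (hwt n) m := by
    rw [weight_hwt, weight_hwt]
    simp only [conjExp_apply, conjVar_zv, conjVar_zbv, conjVar_uv]
    omega
  rw [coeff_gr, coeff_bar, coeff_bar, coeff_gr, weight_zwt, weight_zwt, this]
  split_ifs <;> simp

theorem wp_rho_mul (d : ℤ) (p : Ser n) : wp d (rho n s * p) = rho n s * wp (d - 2) p := by
  simp only [rho, Finset.sum_mul, map_sum, mul_assoc, wp_C_mul, wp_X_zv_mul, wp_X_zbv_mul]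
  simp only [show d - 1 - 1 = d - 2 by ring]

theorem wp_rho_du (d : ℤ) (p : Ser n) : wp d (rho n s * ∂ᵤ p) = rho n s * ∂ᵤ (wp d p) := by
  rw [wp_rho_mul, wp_du, sub_add_cancel]

theorem wp_DDb (d : ℤ) (p : Ser n) : wp d (DDb n s p) = DDb n s (wp d p) := by
  rw [DDb_apply, DDb_apply, map_sub, wp_C_mul, wp_rho_du, eulb_apply, eulb_apply, map_sum]
  simp only [wp_X_zbv_mul, wp_pderiv_zbv, sub_add_cancel]

theorem wp_DD (d : ℤ) (p : Ser n) : wp d (DD n s p) = DD n s (wp d p) := by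
  have := congrArg Ser.bar (wp_DDb (s := s) d p.bar)
  rwa [← wp_bar, bar_DDb, bar_DDb, ← wp_bar, bar_bar] at this

theorem wp_modeOp (T : Bool) (d : ℤ) (p : Ser n) :
    wp d (modeOp n s T p) = modeOp n s T (wp d p) := by
  cases T
  · rfl
  · exact wp_DD d p

theorem wp_herm (d : ℤ) (f : Fin n → Ser n) : wp d (herm s f) = herm s fun l => wp (d - 1) (f l) := by
  simp only [herm, map_sum, wp_C_mul, wp_X_zbv_mul]

theorem wp_nz (B : Fin n → Fin n → ℂ) (d : ℤ) (f : Fin n → Ser n) :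
    wp d (nz B f) = nz B fun l => wp (d - 1) (f l) := by
  simp only [nz, map_sum, wp_C_mul, wp_X_zv_mul]

theorem wp_qop (B : Fin n → Fin n → ℂ) (d : ℤ) (f : Fin n → Ser n) :
    wp d (qop s B f) = qop s B fun l => wp (d - 1) (f l) := by
  rw [qop, qop, map_add, map_add, wp_C_mul, wp_C_mul, wp_bar, wp_herm, wp_herm, wp_nz]
  simp only [map_sub, wp_DD]

theorem trc_wp (d : ℤ) (p : Ser n) : trc n s (wp d p) = wp (d - 2) (trc n s p) := by
  simp only [trc_apply, map_sum, wp_C_mul, wp_pderiv_zv, wp_pderiv_zbv]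
  simp only [show d - 2 + 1 + 1 = d by ring]

theorem UOrd.wp {k : ℕ} {p : Ser n} (h : UOrd k p) (d : ℤ) : UOrd k (wp d p) := fun m hm => by
  rw [coeff_gr, h m hm]; split_ifs <;> rfl

theorem IsNF.wp {ψ : Ser n} (h : IsNF n s ψ) (d : ℤ) : IsNF n s (wp d ψ) where
  real := by rw [← wp_bar, h.real]
  right_zero a := by rw [wp_bi, h.right_zero, map_zero]
  one_one := by rw [wp_bi, h.one_one, map_zero]
  right_one a := by rw [wp_bi, h.right_one, map_zero]
  two_two := by rw [wp_bi, trc_wp, h.two_two, map_zero]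
  three_two := by rw [wp_bi, trc_wp, trc_wp, h.three_two, map_zero]
  three_three := by rw [wp_bi, trc_wp, trc_wp, trc_wp, h.three_three, map_zero]

/-- Solutions of the linearized equation have at least the weight of the right-hand side. -/
theorem LinSol.mem_wIdeal (hn : 1 ≤ n) {T : Bool} {B : Fin n → Fin n → ℂ} (hB : Nondeg s B)
    {r f : Fin n → Ser n} {R g ψ : Ser n} (h : LinSol s T B r R f g ψ) {k : ℕ}
    (hr : ∀ l, r l ∈ wIdeal (hwt n) k) (hR : R ∈ wIdeal (hwt n) (k + 1)) :
    (∀ l, f l ∈ wIdeal (hwt n) k) ∧ g ∈ wIdeal (hwt n) (k + 1) ∧ ψ ∈ wIdeal (hwt n) (k + 1) := by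
  -- The weight-d part of f and the weight-(d+1) parts of g and ψ form a solution of the homogeneous
  -- problem, since all operators and normalizations respect weights.
  have key : ∀ d : ℕ, d < k → (∀ l, wp (d : ℤ) (f l) = 0) ∧ wp ((d + 1 : ℕ) : ℤ) g = 0 ∧
      wp ((d + 1 : ℕ) : ℤ) ψ = 0 := by
    intro d hd
    have e : ((d + 1 : ℕ) : ℤ) - 1 = d := by push_cast; ring
    refine lin_unique hn T hB (fun l => ?_) ?_ ?_ (h.nf.wp _) ⟨fun l => ?_, fun l => ?_, ?_⟩
    · rw [← wp_DDb, h.eq_f, mem_wIdeal_iff_wp.1 (hr l) d hd]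
    · have := congrArg (wp ((d + 1 : ℕ) : ℤ)) h.eq_g
      rwa [map_add, map_add, wp_C_mul, wp_DD, wp_modeOp, wp_qop, e,
        mem_wIdeal_iff_wp.1 hR (d + 1) (by omega), add_zero] at this
    · rw [← wp_bar, h.real]
    · rw [wp_bi]; exact (h.init.f00 l).wp _
    · rw [wp_bi]; exact (h.init.f10 l).wp _
    · rw [wp_bi]; exact h.init.g00.wp _
  -- The constant terms of g and ψ are not reached by `key`, which starts at weight 1 for them.
  have hzero : ∀ p : Ser n, bi 0 0 p = 0 ∨ UOrd 1 (bi 0 0 p) → wp 0 p = 0 := fun p hp => by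
    ext m
    rw [coeff_gr, weight_zwt, weight_hwt]
    split_ifs with hm
    · norm_cast at hm
      have h1 : ∑ j, m (zv j) = 0 := by omega
      have h2 : ∑ j, m (zbv j) = 0 := by omega
      have h3 : m uv = 0 := by omega
      have e : coeff m (bi 0 0 p) = coeff m p := by rw [coeff_bi, if_pos ⟨h1, h2⟩]
      rw [← e, map_zero]
      rcases hp with hp | hp
      · rw [hp, map_zero]
      · exact hp m (by omega)
    · rfl
  refine ⟨fun l => mem_wIdeal_iff_wp.2 fun d hd => (key d hd).1 l,
    mem_wIdeal_iff_wp.2 fun d hd => ?_, mem_wIdeal_iff_wp.2 fun d hd => ?_⟩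
  · rcases d with _ | d
    · exact hzero g (Or.inr (h.init.g00.mono (by norm_num)))
    · exact (key d (by omega)).2.1
  · rcases d with _ | d
    · exact hzero ψ (Or.inl (h.nf.right_zero 0))
    · exact (key d (by omega)).2.2

end

/-! ### Nonlinear theory: remainders and weight estimates -/

section

variable {n s : ℕ} {𝒳 : Type*} {A : CoeffAlg 𝒳}

/-! ### The nonlinear equations -/

/-- The deviation of the `w`-component from `i⟨z, z⟩`, for the deviation `ψ` of the defining
function from the quadric. -/
def pdev (n s : ℕ) (T : Bool) (ψ : Ser n) : Ser n :=
  cI * modeOp n s T ψ * (bif T then (1 - cI * ∂ᵤ ψ)⁻¹ else 1)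

/-- The components `(f, f̄, g)` of the map with deviation `(f, g)` from the identity. -/
def nearId (f : Fin n → Ser n) (g : Ser n) : Var n → Ser n
  | Sum.inl k => X (zv k) + f k
  | Sum.inr (Sum.inl k) => X (zbv k) + (f k).bar
  | Sum.inr (Sum.inr _) => X uv + g

/-- The derivative of the map along the Euler field. -/
def eulMap (s : ℕ) (T : Bool) (f : Fin n → Ser n) (ψ : Ser n) (l : Fin n) : Ser n :=
  X (zv l) + DD n s (f l) + pdev n s T ψ * ∂ᵤ (f l)

/-- The linear part of the `w`-component of the structure. -/
def linW (s : ℕ) (B : Fin n → Fin n → ℂ) (a b : Fin n → Ser n) (l : Fin n) : Ser n :=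
  ∑ k, C (B k l) * a k + C (Complex.I * sg s l) * b l

/-- The right-hand side of the equation for the `z`-components. -/
def rhsF (s : ℕ) (T : Bool) (Mz : Fin n → Fin n → Ser n) (f : Fin n → Ser n) (g ψ : Ser n)
    (m : Fin n) : Ser n :=
  Ser.bar (∑ l, subst (nearId f g) (Mz m l) * eulMap s T f ψ l - pdev n s T ψ * ∂ᵤ (f m).bar)

/-- The right-hand side of the equation for the `w`-component. -/
def rhsG (s : ℕ) (T : Bool) (B : Fin n → Fin n → ℂ) (N : Fin n → Ser n) (f : Fin n → Ser n)
    (g ψ : Ser n) : Ser n :=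
  ∑ l, (subst (nearId f g) (N l) * eulMap s T f ψ l +
      linW s B (fun k => X (zv k)) (fun k => X (zbv k)) l * (pdev n s T ψ * ∂ᵤ (f l)) +
      linW s B f (fun k => (f k).bar) l * (DD n s (f l) + pdev n s T ψ * ∂ᵤ (f l))) -
    pdev n s T ψ * ∂ᵤ g - (pdev n s T ψ - cI * modeOp n s T ψ)

/-- The domain of the nonlinear operators. -/
structure Dom (f : Fin n → Ser n) (g ψ : Ser n) : Prop where
  mem_f : ∀ l, f l ∈ wIdeal (hwt n) 2
  mem_g : g ∈ wIdeal (hwt n) 3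
  mem_ψ : ψ ∈ wIdeal (hwt n) 3
  mem_z : ψ ∈ zIdeal n

/-- Closeness of two elements of the domain. -/
structure Near (μ : ℕ) (f : Fin n → Ser n) (g ψ : Ser n) (f' : Fin n → Ser n) (g' ψ' : Ser n) :
    Prop where
  sub_f : ∀ l, f l - f' l ∈ wIdeal (hwt n) (μ + 2)
  sub_g : g - g' ∈ wIdeal (hwt n) (μ + 3)
  sub_ψ : ψ - ψ' ∈ wIdeal (hwt n) (μ + 3)

theorem mul_sub_mul_mem {σ : Type*} {w : σ → ℕ} {x x' y y' : MvPowerSeries σ ℂ} {a b c d e : ℕ}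
    (h₁ : x - x' ∈ wIdeal w a) (h₂ : y ∈ wIdeal w b) (h₃ : x' ∈ wIdeal w c)
    (h₄ : y - y' ∈ wIdeal w d) (h : e ≤ a + b) (h' : e ≤ c + d) :
    x * y - x' * y' ∈ wIdeal w e := by
  have : x * y - x' * y' = (x - x') * y + x' * (y - y') := by ring
  rw [this]
  exact add_mem (wIdeal_mono h (mul_mem_wIdeal h₁ h₂)) (wIdeal_mono h' (mul_mem_wIdeal h₃ h₄))

theorem const_mul_mem {σ : Type*} {w : σ → ℕ} {p : MvPowerSeries σ ℂ} {k : ℕ} (c : MvPowerSeries σ ℂ)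
    (h : p ∈ wIdeal w k) : c * p ∈ wIdeal w k := Ideal.mul_mem_left _ _ h

theorem DD_mem {k : ℕ} {p : Ser n} (h : p ∈ wIdeal (hwt n) k) : DD n s p ∈ wIdeal (hwt n) k := by
  rw [mem_wIdeal_iff_wp] at h ⊢
  intro d hd
  rw [wp_DD, h d hd, map_zero]

theorem modeOp_mem (T : Bool) {k : ℕ} {p : Ser n} (h : p ∈ wIdeal (hwt n) k) :
    modeOp n s T p ∈ wIdeal (hwt n) k := by
  cases T
  · exact h
  · exact DD_mem h

theorem du_mem {k : ℕ} {p : Ser n} (h : p ∈ wIdeal (hwt n) (k + 2)) : ∂ᵤ p ∈ wIdeal (hwt n) k :=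
  pderiv_mem_wIdeal uv h

theorem constantCoeff_eq_zero_of_hwt {k : ℕ} {p : Ser n} (h : p ∈ wIdeal (hwt n) (k + 1)) :
    constantCoeff p = 0 := by
  rw [← coeff_zero_eq_constantCoeff_apply]
  exact h 0 (by rw [map_zero]; omega)

theorem one_sub_du_inv {ψ : Ser n} (h : ψ ∈ wIdeal (hwt n) 3) :
    (1 - cI * ∂ᵤ ψ) * (1 - cI * ∂ᵤ ψ)⁻¹ = 1 := by
  refine MvPowerSeries.mul_inv_cancel _ ?_
  rw [map_sub, map_mul, constantCoeff_eq_zero_of_hwt (k := 0) (du_mem h), mul_zero, sub_zero, map_one]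
  exact one_ne_zero

/-- In the extrinsic mode `pdev` times 1 - i ∂ψ/∂u equals i `DD` ψ, so the difference from the
linear part is quadratic in ψ. In the intrinsic mode nothing is nonlinear. -/
theorem pdev_eq (T : Bool) {ψ : Ser n} (h : ψ ∈ wIdeal (hwt n) 3) :
    pdev n s T ψ - cI * modeOp n s T ψ = bif T then cI * ∂ᵤ ψ * pdev n s T ψ else 0 := by
  cases T
  · simp [pdev]
  · simp only [pdev, cond_true]
    linear_combination (cI * modeOp n s true ψ) * one_sub_du_inv h

theorem pdev_mem (T : Bool) {ψ : Ser n} {k : ℕ} (h : ψ ∈ wIdeal (hwt n) k) :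
    pdev n s T ψ ∈ wIdeal (hwt n) k :=
  Ideal.mul_mem_right _ _ (const_mul_mem _ (modeOp_mem T h))

theorem pdev_mem_zIdeal (T : Bool) {ψ : Ser n} (h : ψ ∈ zIdeal n) : pdev n s T ψ ∈ zIdeal n := by
  refine Ideal.mul_mem_right _ _ (Ideal.mul_mem_left _ _ ?_)
  cases T
  · exact h
  · exact add_mem (eul_mem_zIdeal _) (Ideal.mul_mem_left _ _ (Ideal.mul_mem_right _ _ rho_mem_zIdeal))

theorem pdev_sub_mem (T : Bool) {ψ ψ' : Ser n} {μ : ℕ} (h : ψ ∈ wIdeal (hwt n) 3)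
    (h' : ψ' ∈ wIdeal (hwt n) 3) (hs : ψ - ψ' ∈ wIdeal (hwt n) (μ + 3)) :
    pdev n s T ψ - pdev n s T ψ' ∈ wIdeal (hwt n) (μ + 3) := by
  cases T
  · have : pdev n s false ψ - pdev n s false ψ' = cI * (ψ - ψ') := by
      simp only [pdev, modeOp, cond_false, LinearMap.id_apply]; ring
    rw [this]; exact const_mul_mem _ hs
  · have e : pdev n s true ψ - pdev n s true ψ' = (1 - cI * ∂ᵤ ψ)⁻¹ *
        (cI * DD n s (ψ - ψ') + cI * (∂ᵤ (ψ - ψ') * pdev n s true ψ')) := by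
      have e1 := pdev_eq (s := s) true h
      have e2 := pdev_eq (s := s) true h'
      simp only [modeOp, cond_true] at e1 e2
      rw [map_sub, map_sub]
      linear_combination (1 - cI * ∂ᵤ ψ)⁻¹ * (e1 - e2) - (pdev n s true ψ - pdev n s true ψ') *
        one_sub_du_inv h
    rw [e]
    refine const_mul_mem _ (add_mem (const_mul_mem _ (DD_mem hs)) (const_mul_mem _ ?_))
    exact wIdeal_mono (by omega) (mul_mem_wIdeal (du_mem (k := μ + 1) hs) (pdev_mem true h'))

theorem pdev_sub_lin_mem (T : Bool) {ψ ψ' : Ser n} {μ : ℕ} (h : ψ ∈ wIdeal (hwt n) 3)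
    (h' : ψ' ∈ wIdeal (hwt n) 3) (hs : ψ - ψ' ∈ wIdeal (hwt n) (μ + 3)) :
    (pdev n s T ψ - cI * modeOp n s T ψ) - (pdev n s T ψ' - cI * modeOp n s T ψ') ∈
      wIdeal (hwt n) (μ + 4) := by
  rw [pdev_eq T h, pdev_eq T h']
  cases T
  · simp
  · have hp := pdev_sub_mem (s := s) true h h' hs
    simp only [cond_true, mul_assoc]
    rw [← mul_sub]
    refine const_mul_mem _ (mul_sub_mul_mem (a := μ + 1) (b := 3) (c := 1) (d := μ + 3) ?_
      (pdev_mem true h) (du_mem h') hp (by omega) (by omega))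
    rw [← map_sub]; exact du_mem hs

section Estimates

variable {f f' : Fin n → Ser n} {g g' ψ ψ' : Ser n} {μ : ℕ}

theorem nearId_mem (h : Dom f g ψ) (i : Var n) : nearId f g i ∈ wIdeal (hwt n) (hwt n i) := by
  rcases i with j | j | j
  · exact add_mem (X_mem_wIdeal (w := hwt n) (zv j)) (wIdeal_mono (by simp [hwt]) (h.mem_f j))
  · exact add_mem (X_mem_wIdeal (w := hwt n) (zbv j))
      (wIdeal_mono (by simp [hwt]) (bar_mem_wIdeal (h.mem_f j)))
  · exact add_mem (X_mem_wIdeal (w := hwt n) uv) (wIdeal_mono (by simp [hwt]) h.mem_g)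

theorem nearId_zero (h : Dom f g ψ) (i : Var n) : constantCoeff (nearId f g i) = 0 :=
  constantCoeff_eq_zero_of_hwt (k := 0) (wIdeal_mono (one_le_hwt i) (nearId_mem h i))

theorem nearId_sub_mem (h : Near μ f g ψ f' g' ψ') (i : Var n) :
    nearId f g i - nearId f' g' i ∈ wIdeal (hwt n) (hwt n i + (μ + 1)) := by
  rcases i with j | j | j
  · have : nearId f g (zv j) - nearId f' g' (zv j) = f j - f' j := by simp [nearId]
    rw [this]; exact wIdeal_mono (by simp [hwt]; omega) (h.sub_f j)
  · have : nearId f g (zbv j) - nearId f' g' (zbv j) = (f j - f' j).bar := by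
      simp [nearId, bar_sub]
    rw [this]; exact wIdeal_mono (by simp [hwt]; omega) (bar_mem_wIdeal (h.sub_f j))
  · have : nearId f g uv - nearId f' g' uv = g - g' := by simp [nearId]
    change nearId f g uv - nearId f' g' uv ∈ _
    rw [this]; exact wIdeal_mono (by simp [hwt]; omega) h.sub_g

theorem subst_mem (h : Dom f g ψ) {k : ℕ} {p : Ser n} (hp : p ∈ wIdeal (hwt n) k) :
    subst (nearId f g) p ∈ wIdeal (hwt n) k :=
  subst_mem_wIdeal (hasSubst_of_mem (nearId_zero h)) (nearId_mem h) hp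

theorem subst_sub_mem (h : Dom f g ψ) (h' : Dom f' g' ψ') (hn : Near μ f g ψ f' g' ψ') {k : ℕ}
    {p : Ser n} (hp : p ∈ wIdeal (hwt n) k) :
    subst (nearId f g) p - subst (nearId f' g') p ∈ wIdeal (hwt n) (k + (μ + 1)) :=
  subst_sub_subst_mem_wIdeal (hasSubst_of_mem (nearId_zero h)) (hasSubst_of_mem (nearId_zero h'))
    (nearId_mem h) (nearId_mem h') (nearId_sub_mem hn) hp

theorem pdev_du_mem (T : Bool) (h : Dom f g ψ) (l : Fin n) :
    pdev n s T ψ * ∂ᵤ (f l) ∈ wIdeal (hwt n) 3 :=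
  wIdeal_mono (by omega) (mul_mem_wIdeal (pdev_mem T h.mem_ψ) (du_mem (k := 0) (h.mem_f l)))

theorem pdev_du_sub_mem (T : Bool) (h : Dom f g ψ) (h' : Dom f' g' ψ') (hn : Near μ f g ψ f' g' ψ')
    (l : Fin n) : pdev n s T ψ * ∂ᵤ (f l) - pdev n s T ψ' * ∂ᵤ (f' l) ∈ wIdeal (hwt n) (μ + 3) :=
  mul_sub_mul_mem (a := μ + 3) (b := 0) (c := 3) (d := μ) (pdev_sub_mem T h.mem_ψ h'.mem_ψ hn.sub_ψ)
    (mem_wIdeal_zero _) (pdev_mem T h'.mem_ψ) (by rw [← map_sub]; exact du_mem (hn.sub_f l))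
    (by omega) (by omega)

theorem eulMap_mem (T : Bool) (h : Dom f g ψ) (l : Fin n) : eulMap s T f ψ l ∈ wIdeal (hwt n) 1 :=
  add_mem (add_mem (X_mem_wIdeal (w := hwt n) (zv l)) (wIdeal_mono (by omega) (DD_mem (h.mem_f l))))
    (wIdeal_mono (by omega) (pdev_du_mem T h l))

theorem eulMap_sub_mem (T : Bool) (h : Dom f g ψ) (h' : Dom f' g' ψ') (hn : Near μ f g ψ f' g' ψ')
    (l : Fin n) : eulMap s T f ψ l - eulMap s T f' ψ' l ∈ wIdeal (hwt n) (μ + 2) := by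
  have e : eulMap s T f ψ l - eulMap s T f' ψ' l = DD n s (f l - f' l) +
      (pdev n s T ψ * ∂ᵤ (f l) - pdev n s T ψ' * ∂ᵤ (f' l)) := by
    rw [eulMap, eulMap, map_sub]; ring
  rw [e]
  exact add_mem (DD_mem (hn.sub_f l)) (wIdeal_mono (by omega) (pdev_du_sub_mem T h h' hn l))

theorem linW_sub (B : Fin n → Fin n → ℂ) (a b a' b' : Fin n → Ser n) (l : Fin n) :
    linW s B a b l - linW s B a' b' l = linW s B (fun k => a k - a' k) (fun k => b k - b' k) l := by
  simp only [linW, mul_sub, Finset.sum_sub_distrib]; ring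

theorem linW_mem (B : Fin n → Fin n → ℂ) {a b : Fin n → Ser n} {k : ℕ}
    (ha : ∀ l, a l ∈ wIdeal (hwt n) k) (hb : ∀ l, b l ∈ wIdeal (hwt n) k) (l : Fin n) :
    linW s B a b l ∈ wIdeal (hwt n) k :=
  add_mem (Submodule.sum_mem _ fun j _ => const_mul_mem _ (ha j)) (const_mul_mem _ (hb l))

/-- Gain of one weight. The substituted coefficients have weight at least 1 and are multiplied by
the derivative of the map along the Euler field, again of weight at least 1. In the other term,
`pdev` ψ of weight at least 3 compensates the weight 2 lost by ∂/∂u. -/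
theorem rhsF_sub_mem (T : Bool) {Mz : Fin n → Fin n → Ser n}
    (hM : ∀ m l, Mz m l ∈ wIdeal (hwt n) 1) (h : Dom f g ψ) (h' : Dom f' g' ψ')
    (hn : Near μ f g ψ f' g' ψ') (m : Fin n) :
    rhsF s T Mz f g ψ m - rhsF s T Mz f' g' ψ' m ∈ wIdeal (hwt n) (μ + 3) := by
  rw [rhsF, rhsF, ← bar_sub]
  apply bar_mem_wIdeal
  rw [sub_sub_sub_comm, ← Finset.sum_sub_distrib]
  refine sub_mem (Submodule.sum_mem _ fun l _ => ?_) ?_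
  · exact mul_sub_mul_mem (subst_sub_mem h h' hn (hM m l)) (eulMap_mem T h l) (subst_mem h' (hM m l))
      (eulMap_sub_mem T h h' hn l) (by omega) (by omega)
  · refine mul_sub_mul_mem (a := μ + 3) (b := 0) (c := 3) (d := μ) (pdev_sub_mem T h.mem_ψ h'.mem_ψ hn.sub_ψ)
      (mem_wIdeal_zero _) (pdev_mem T h'.mem_ψ) ?_ (by omega) (by omega)
    rw [← map_sub, ← bar_sub]; exact du_mem (bar_mem_wIdeal (hn.sub_f m))

theorem rhsF_mem (T : Bool) {Mz : Fin n → Fin n → Ser n} (hM : ∀ m l, Mz m l ∈ wIdeal (hwt n) 1)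
    (h : Dom f g ψ) (m : Fin n) : rhsF s T Mz f g ψ m ∈ wIdeal (hwt n) 2 := by
  refine bar_mem_wIdeal (sub_mem (Submodule.sum_mem _ fun l _ => ?_) ?_)
  · exact mul_mem_wIdeal (subst_mem h (hM m l)) (eulMap_mem T h l)
  · exact wIdeal_mono (by omega)
      (mul_mem_wIdeal (pdev_mem T h.mem_ψ) (du_mem (k := 0) (bar_mem_wIdeal (h.mem_f m))))

/-- Gain of one weight: the coefficients N start in weight 2, and each remaining term is a product
of two deviations or of a deviation quadratic in the unknowns with a linear form in z, z̄. -/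
theorem rhsG_sub_mem (T : Bool) (B : Fin n → Fin n → ℂ) {N : Fin n → Ser n}
    (hN : ∀ l, N l ∈ wIdeal (hwt n) 2) (h : Dom f g ψ) (h' : Dom f' g' ψ')
    (hn : Near μ f g ψ f' g' ψ') :
    rhsG s T B N f g ψ - rhsG s T B N f' g' ψ' ∈ wIdeal (hwt n) (μ + 4) := by
  have comm (a b c a' b' c' : Ser n) :
      a - b - c - (a' - b' - c') = a - a' - (b - b') - (c - c') := by ring
  rw [rhsG, rhsG, comm, ← Finset.sum_sub_distrib]
  refine sub_mem (sub_mem (Submodule.sum_mem _ fun l _ => ?_) ?_) (pdev_sub_lin_mem T h.mem_ψ h'.mem_ψ hn.sub_ψ)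
  · rw [add_sub_add_comm, add_sub_add_comm]
    refine add_mem (add_mem ?_ ?_) ?_
    · exact mul_sub_mul_mem (subst_sub_mem h h' hn (hN l)) (eulMap_mem T h l) (subst_mem h' (hN l))
        (eulMap_sub_mem T h h' hn l) (by omega) (by omega)
    · rw [← mul_sub]
      refine wIdeal_mono (by omega) (mul_mem_wIdeal (k := 1) (linW_mem B (fun k => ?_) (fun k => ?_) l)
        (pdev_du_sub_mem T h h' hn l))
      · exact X_mem_wIdeal (w := hwt n) (zv k)
      · exact X_mem_wIdeal (w := hwt n) (zbv k)
    · refine mul_sub_mul_mem (a := μ + 2) (b := 2) (c := 2) (d := μ + 2) ?_ ?_ ?_ ?_ (by omega)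
        (by omega)
      · rw [linW_sub]
        exact linW_mem B hn.sub_f (fun k => by rw [← bar_sub]; exact bar_mem_wIdeal (hn.sub_f k)) l
      · exact add_mem (DD_mem (h.mem_f l)) (wIdeal_mono (by omega) (pdev_du_mem T h l))
      · exact linW_mem B h'.mem_f (fun k => bar_mem_wIdeal (h'.mem_f k)) l
      · rw [add_sub_add_comm, ← map_sub]
        exact add_mem (DD_mem (hn.sub_f l)) (wIdeal_mono (by omega) (pdev_du_sub_mem T h h' hn l))
  · refine mul_sub_mul_mem (a := μ + 3) (b := 1) (c := 3) (d := μ + 1) (pdev_sub_mem T h.mem_ψ h'.mem_ψ hn.sub_ψ)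
      (du_mem h.mem_g) (pdev_mem T h'.mem_ψ) ?_ (by omega) (by omega)
    rw [← map_sub]; exact du_mem hn.sub_g

theorem rhsG_mem (T : Bool) (B : Fin n → Fin n → ℂ) {N : Fin n → Ser n}
    (hN : ∀ l, N l ∈ wIdeal (hwt n) 2) (h : Dom f g ψ) :
    rhsG s T B N f g ψ ∈ wIdeal (hwt n) 3 := by
  refine sub_mem (sub_mem (Submodule.sum_mem _ fun l _ => add_mem (add_mem ?_ ?_) ?_) ?_) ?_
  · exact mul_mem_wIdeal (subst_mem h (hN l)) (eulMap_mem T h l)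
  · exact const_mul_mem _ (pdev_du_mem T h l)
  · exact wIdeal_mono (by omega) (mul_mem_wIdeal
      (linW_mem B h.mem_f (fun k => bar_mem_wIdeal (h.mem_f k)) l)
      (add_mem (DD_mem (h.mem_f l)) (wIdeal_mono (by omega) (pdev_du_mem T h l)) :
        _ ∈ wIdeal (hwt n) 2))
  · exact Ideal.mul_mem_right _ _ (pdev_mem T h.mem_ψ)
  · exact sub_mem (pdev_mem T h.mem_ψ) (const_mul_mem _ (modeOp_mem T h.mem_ψ))

theorem DD_mem_zIdeal (p : Ser n) : DD n s p ∈ zIdeal n :=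
  add_mem (eul_mem_zIdeal _) (Ideal.mul_mem_left _ _ (Ideal.mul_mem_right _ _ rho_mem_zIdeal))

theorem eulMap_mem_zIdeal (T : Bool) (h : ψ ∈ zIdeal n) (l : Fin n) :
    eulMap s T f ψ l ∈ zIdeal n :=
  add_mem (add_mem (X_zv_mem_zIdeal l) (DD_mem_zIdeal _))
    (Ideal.mul_mem_right _ _ (pdev_mem_zIdeal T h))

/-- Before conjugation every term carries a factor vanishing on z = 0, because the Euler field and ψ
vanish there. This is the compatibility condition of `exists_linSol`; `bi_rhsG` is its counterpart
for the second equation. -/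
theorem bi_rhsF (T : Bool) (Mz : Fin n → Fin n → Ser n) (h : ψ ∈ zIdeal n) (m : Fin n) (a : ℕ) :
    bi a 0 (rhsF s T Mz f g ψ m) = 0 := by
  rw [rhsF, bi_bar, mem_zIdeal.1, bar_zero]
  exact sub_mem (Submodule.sum_mem _ fun l _ => Ideal.mul_mem_left _ _ (eulMap_mem_zIdeal T h l))
    (Ideal.mul_mem_right _ _ (pdev_mem_zIdeal T h))

theorem bi_rhsG (T : Bool) (B : Fin n → Fin n → ℂ) (N : Fin n → Ser n) (h : ψ ∈ zIdeal n) (b : ℕ) :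
    bi 0 b (rhsG s T B N f g ψ) = 0 := by
  refine mem_zIdeal.1 (sub_mem (sub_mem (Submodule.sum_mem _ fun l _ => add_mem (add_mem ?_ ?_) ?_)
    ?_) ?_) b
  · exact Ideal.mul_mem_left _ _ (eulMap_mem_zIdeal T h l)
  · exact Ideal.mul_mem_left _ _ (Ideal.mul_mem_right _ _ (pdev_mem_zIdeal T h))
  · exact Ideal.mul_mem_left _ _
      (add_mem (DD_mem_zIdeal _) (Ideal.mul_mem_right _ _ (pdev_mem_zIdeal T h)))
  · exact Ideal.mul_mem_right _ _ (pdev_mem_zIdeal T h)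
  · refine sub_mem (pdev_mem_zIdeal T h) (Ideal.mul_mem_left _ _ ?_)
    cases T
    · exact h
    · exact DD_mem_zIdeal _

end Estimates

/-! ### Dependence on parameters -/

theorem isSer_pdev (T : Bool) {ψ : 𝒳 → Ser n} (h : A.IsSer ψ) (hψ : ∀ x, ψ x ∈ wIdeal (hwt n) 3) :
    A.IsSer fun x => pdev n s T (ψ x) := by
  refine (h.modeOp T).cI_mul.mul ?_
  cases T
  · exact .const _
  · refine CoeffAlg.IsSer.inv (P := fun x => 1 - cI * ∂ᵤ (ψ x))
      ((CoeffAlg.IsSer.const _).sub (h.pderiv _).cI_mul) fun x => ?_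
    rw [map_sub, map_mul, constantCoeff_eq_zero_of_hwt (k := 0) (du_mem (hψ x)), mul_zero, sub_zero,
      map_one]
    exact one_ne_zero

theorem isSer_nearId {f : Fin n → 𝒳 → Ser n} {g : 𝒳 → Ser n} (hf : ∀ l, A.IsSer (f l))
    (hg : A.IsSer g) (i : Var n) : A.IsSer fun x => nearId (fun l => f l x) (g x) i := by
  rcases i with j | j | j
  · exact (CoeffAlg.IsSer.const _).add (hf j)
  · exact (CoeffAlg.IsSer.const _).add (hf j).bar
  · exact (CoeffAlg.IsSer.const _).add hg

section Families

variable {B : 𝒳 → Fin n → Fin n → ℂ} {Mz : Fin n → Fin n → 𝒳 → Ser n} {N : Fin n → 𝒳 → Ser n}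
  {f : Fin n → 𝒳 → Ser n} {g ψ : 𝒳 → Ser n}

theorem isSer_eulMap (T : Bool) (hf : ∀ l, A.IsSer (f l)) (hψ : A.IsSer ψ)
    (hd : ∀ x, ψ x ∈ wIdeal (hwt n) 3) (l : Fin n) :
    A.IsSer fun x => eulMap s T (fun l => f l x) (ψ x) l :=
  ((CoeffAlg.IsSer.const _).add (hf l).DD).add ((isSer_pdev T hψ hd).mul ((hf l).pderiv _))

theorem isSer_linW (hB : ∀ k l, A.Sc fun x => B x k l) {a b : Fin n → 𝒳 → Ser n}
    (ha : ∀ l, A.IsSer (a l)) (hb : ∀ l, A.IsSer (b l)) (l : Fin n) :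
    A.IsSer fun x => linW s (B x) (fun k => a k x) (fun k => b k x) l :=
  (CoeffAlg.IsSer.sum fun k _ => .C_mul (hB k l) (ha k)).add (.const_mul _ (hb l))

theorem isSer_rhsF (T : Bool) (hM : ∀ m l, A.IsSer (Mz m l)) (hf : ∀ l, A.IsSer (f l))
    (hg : A.IsSer g) (hψ : A.IsSer ψ) (hd : ∀ x, Dom (fun l => f l x) (g x) (ψ x)) (m : Fin n) :
    A.IsSer fun x => rhsF s T (fun m l => Mz m l x) (fun l => f l x) (g x) (ψ x) m :=
  ((CoeffAlg.IsSer.sum fun l _ => (CoeffAlg.IsSer.subst (fun x => nearId_zero (hd x))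
    (isSer_nearId hf hg) (hM m l)).mul (isSer_eulMap T hf hψ (fun x => (hd x).mem_ψ) l)).sub
    ((isSer_pdev T hψ fun x => (hd x).mem_ψ).mul ((hf m).bar.pderiv _))).bar

theorem isSer_rhsG (T : Bool) (hB : ∀ k l, A.Sc fun x => B x k l) (hN : ∀ l, A.IsSer (N l))
    (hf : ∀ l, A.IsSer (f l)) (hg : A.IsSer g) (hψ : A.IsSer ψ)
    (hd : ∀ x, Dom (fun l => f l x) (g x) (ψ x)) :
    A.IsSer fun x => rhsG s T (B x) (fun l => N l x) (fun l => f l x) (g x) (ψ x) := by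
  have hp : A.IsSer fun x => pdev n s T (ψ x) := isSer_pdev T hψ fun x => (hd x).mem_ψ
  refine ((CoeffAlg.IsSer.sum fun l _ => (((CoeffAlg.IsSer.subst (fun x => nearId_zero (hd x))
    (isSer_nearId hf hg) (hN l)).mul (isSer_eulMap T hf hψ (fun x => (hd x).mem_ψ) l)).add ?_).add
    ?_).sub (hp.mul (hg.pderiv _))).sub (hp.sub (hψ.modeOp T).cI_mul)
  · exact (isSer_linW hB (fun k => CoeffAlg.IsSer.const _) (fun k => CoeffAlg.IsSer.const _) l).mul
      (hp.mul ((hf l).pderiv _))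
  · exact (isSer_linW hB hf (fun k => (hf k).bar) l).mul ((hf l).DD.add (hp.mul ((hf l).pderiv _)))

end Families

end

/-! ### Nonlinear theory: contraction in the weight filtration -/

section

variable {n s : ℕ} {𝒳 : Type*} {A : CoeffAlg 𝒳}

/-! ### The fixed point -/

theorem IsNF.sub {ψ ψ' : Ser n} (h : IsNF n s ψ) (h' : IsNF n s ψ') : IsNF n s (ψ - ψ') where
  real := by rw [bar_sub, h.real, h'.real]
  right_zero a := by rw [map_sub, h.right_zero, h'.right_zero, sub_zero]
  one_one := by rw [map_sub, h.one_one, h'.one_one, sub_zero]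
  right_one a := by rw [map_sub, h.right_one, h'.right_one, sub_zero]
  two_two := by rw [map_sub, map_sub, h.two_two, h'.two_two, sub_zero]
  three_two := by rw [map_sub, map_sub, map_sub, h.three_two, h'.three_two, sub_zero]
  three_three := by
    rw [map_sub, map_sub, map_sub, map_sub, h.three_three, h'.three_three, sub_zero]

theorem IsNF.mem_zIdeal {ψ : Ser n} (h : IsNF n s ψ) : ψ ∈ zIdeal n :=
  AlmostCR.mem_zIdeal.2 fun b => by rw [← h.real, bi_bar, h.right_zero, bar_zero]

theorem InitZero.sub {f f' : Fin n → Ser n} {g g' : Ser n} (h : InitZero f g)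
    (h' : InitZero f' g') : InitZero (fun l => f l - f' l) (g - g') where
  f00 l := by rw [map_sub]; exact (h.f00 l).sub (h'.f00 l)
  f10 l := by rw [map_sub]; exact (h.f10 l).sub (h'.f10 l)
  g00 := by rw [map_sub]; exact h.g00.sub h'.g00

theorem qop_sub (B : Fin n → Fin n → ℂ) (f f' : Fin n → Ser n) :
    qop s B (fun l => f l - f' l) = qop s B f - qop s B f' := by
  rw [eq_sub_iff_add_eq]
  have := qop_add (s := s) B (fun l => f l - f' l) f'
  simpa [Pi.add_def] using this.symm

theorem LinSol.sub {T : Bool} {B : Fin n → Fin n → ℂ} {r r' f f' : Fin n → Ser n}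
    {R R' g g' ψ ψ' : Ser n} (h : LinSol s T B r R f g ψ) (h' : LinSol s T B r' R' f' g' ψ') :
    LinSol s T B (fun l => r l - r' l) (R - R') (fun l => f l - f' l) (g - g') (ψ - ψ') where
  eq_f l := by rw [map_sub, h.eq_f, h'.eq_f]
  eq_g := by
    rw [map_sub, map_sub, qop_sub]
    linear_combination h.eq_g - h'.eq_g
  real := by rw [bar_sub, h.real, h'.real]
  nf := h.nf.sub h'.nf
  init := h.init.sub h'.init

theorem LinSol.near (hn : 1 ≤ n) {T : Bool} {B : Fin n → Fin n → ℂ} (hB : Nondeg s B)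
    {r r' f f' : Fin n → Ser n} {R R' g g' ψ ψ' : Ser n} (h : LinSol s T B r R f g ψ)
    (h' : LinSol s T B r' R' f' g' ψ') {μ : ℕ} (hr : ∀ l, r l - r' l ∈ wIdeal (hwt n) (μ + 2))
    (hR : R - R' ∈ wIdeal (hwt n) (μ + 3)) : Near μ f g ψ f' g' ψ' :=
  have := (h.sub h').mem_wIdeal hn hB hr hR
  ⟨this.1, this.2.1, this.2.2⟩

theorem LinSol.dom (hn : 1 ≤ n) {T : Bool} {B : Fin n → Fin n → ℂ} (hB : Nondeg s B)
    {r f : Fin n → Ser n} {R g ψ : Ser n} (h : LinSol s T B r R f g ψ)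
    (hr : ∀ l, r l ∈ wIdeal (hwt n) 2) (hR : R ∈ wIdeal (hwt n) 3) : Dom f g ψ :=
  have := h.mem_wIdeal hn hB hr hR
  ⟨this.1, this.2.1, this.2.2, h.nf.mem_zIdeal⟩

theorem Near.symm {μ : ℕ} {f f' : Fin n → Ser n} {g g' ψ ψ' : Ser n} (h : Near μ f g ψ f' g' ψ') :
    Near μ f' g' ψ' f g ψ where
  sub_f l := by rw [← neg_sub]; exact neg_mem (h.sub_f l)
  sub_g := by rw [← neg_sub]; exact neg_mem h.sub_g
  sub_ψ := by rw [← neg_sub]; exact neg_mem h.sub_ψ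

theorem Near.trans {μ : ℕ} {f f' f'' : Fin n → Ser n} {g g' g'' ψ ψ' ψ'' : Ser n}
    (h : Near μ f g ψ f' g' ψ') (h' : Near μ f' g' ψ' f'' g'' ψ'') : Near μ f g ψ f'' g'' ψ'' where
  sub_f l := by rw [← sub_add_sub_cancel]; exact add_mem (h.sub_f l) (h'.sub_f l)
  sub_g := by rw [← sub_add_sub_cancel]; exact add_mem h.sub_g h'.sub_g
  sub_ψ := by rw [← sub_add_sub_cancel]; exact add_mem h.sub_ψ h'.sub_ψ

theorem Near.mono {μ ν : ℕ} {f f' : Fin n → Ser n} {g g' ψ ψ' : Ser n}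
    (h : Near μ f g ψ f' g' ψ') (hν : ν ≤ μ) : Near ν f g ψ f' g' ψ' where
  sub_f l := wIdeal_mono (by omega) (h.sub_f l)
  sub_g := wIdeal_mono (by omega) h.sub_g
  sub_ψ := wIdeal_mono (by omega) h.sub_ψ

theorem Near.eq {f f' : Fin n → Ser n} {g g' ψ ψ' : Ser n}
    (h : ∀ μ, Near μ f g ψ f' g' ψ') : f = f' ∧ g = g' ∧ ψ = ψ' := by
  refine ⟨funext fun l => sub_eq_zero.1 ?_, sub_eq_zero.1 ?_, sub_eq_zero.1 ?_⟩
  · exact eq_zero_of_forall_mem_wIdeal fun k => wIdeal_mono (by omega) ((h k).sub_f l)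
  · exact eq_zero_of_forall_mem_wIdeal fun k => wIdeal_mono (by omega) (h k).sub_g
  · exact eq_zero_of_forall_mem_wIdeal fun k => wIdeal_mono (by omega) (h k).sub_ψ

/-- The solutions of the nonlinear equations. -/
def NonlinSol (s : ℕ) (T : Bool) (B : Fin n → Fin n → ℂ) (Mz : Fin n → Fin n → Ser n)
    (N : Fin n → Ser n) (f : Fin n → Ser n) (g ψ : Ser n) : Prop :=
  LinSol s T B (rhsF s T Mz f g ψ) (rhsG s T B N f g ψ) f g ψ

/-- Closeness of order μ of two solutions makes their right-hand sides close to order μ + 1; by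
linear uniqueness the same holds for the solutions, so they agree to every order. -/
theorem NonlinSol.unique (hn : 1 ≤ n) {T : Bool} {B : Fin n → Fin n → ℂ} (hB : Nondeg s B)
    {Mz : Fin n → Fin n → Ser n} {N : Fin n → Ser n} (hM : ∀ m l, Mz m l ∈ wIdeal (hwt n) 1)
    (hN : ∀ l, N l ∈ wIdeal (hwt n) 2) {f f' : Fin n → Ser n} {g g' ψ ψ' : Ser n}
    (h : NonlinSol s T B Mz N f g ψ) (h' : NonlinSol s T B Mz N f' g' ψ') (hd : Dom f g ψ)
    (hd' : Dom f' g' ψ') : f = f' ∧ g = g' ∧ ψ = ψ' := by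
  refine Near.eq fun μ => ?_
  induction μ with
  | zero =>
    exact ⟨fun l => sub_mem (hd.mem_f l) (hd'.mem_f l), sub_mem hd.mem_g hd'.mem_g,
      sub_mem hd.mem_ψ hd'.mem_ψ⟩
  | succ μ ih =>
    exact LinSol.near hn hB h h' (fun l => rhsF_sub_mem T hM hd hd' ih l)
      (rhsG_sub_mem T B hN hd hd' ih)

theorem limSer_sub_mem_right {σ : Type*} {w : σ → ℕ} (P : ℕ → MvPowerSeries σ ℂ) (c : ℕ)
    (h : ∀ k, P (k + 1) - P k ∈ wIdeal w (k + c)) (k : ℕ) :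
    limSer w P - P k ∈ wIdeal w (k + c) := by
  rw [add_comm]
  exact limSer_sub_mem P c (fun k => by rw [add_comm]; exact h k) k

theorem uOrd_of_mem_two {p : Ser n} (h : p ∈ wIdeal (hwt n) 2) : UOrd 1 (bi 0 1 p) := fun m hm => by
  rw [coeff_bi]
  split_ifs with h'
  · refine h m ?_
    rw [weight_hwt]; omega
  · rfl

theorem uOrd_of_mem_three {p : Ser n} (h : p ∈ wIdeal (hwt n) 3) : UOrd 1 (bi 1 1 p) :=
  fun m hm => by
  rw [coeff_bi]
  split_ifs with h'
  · refine h m ?_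
    rw [weight_hwt]; omega
  · rfl

/-- Solve the linear equation with the remainder evaluated at the previous iterate. The gain of one
weight makes the iterates stabilize, and the domain conditions pass to the limit. -/
theorem exists_nonlinSol (hn : 1 ≤ n) (T : Bool) {B : 𝒳 → Fin n → Fin n → ℂ}
    (hBs : ∀ k l, A.Sc fun x => B x k l) (hB : ∀ x, Nondeg s (B x))
    {Mz : Fin n → Fin n → 𝒳 → Ser n} {N : Fin n → 𝒳 → Ser n} (hMs : ∀ m l, A.IsSer (Mz m l))
    (hNs : ∀ l, A.IsSer (N l)) (hM : ∀ m l x, Mz m l x ∈ wIdeal (hwt n) 1)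
    (hN : ∀ l x, N l x ∈ wIdeal (hwt n) 2) :
    ∃ (f : Fin n → 𝒳 → Ser n) (g ψ : 𝒳 → Ser n), (∀ l, A.IsSer (f l)) ∧ A.IsSer g ∧ A.IsSer ψ ∧
      ∀ x, Dom (fun l => f l x) (g x) (ψ x) ∧
        NonlinSol s T (B x) (fun m l => Mz m l x) (fun l => N l x) (fun l => f l x) (g x) (ψ x) := by
  -- Iterates are entire families over 𝒳, so that each step uses `exists_linSol` in families and the
  -- limit inherits coefficients in the algebra.
  let Y := {y : (Fin n → 𝒳 → Ser n) × (𝒳 → Ser n) × (𝒳 → Ser n) //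
    ((∀ l, A.IsSer (y.1 l)) ∧ A.IsSer y.2.1 ∧ A.IsSer y.2.2) ∧
      ∀ x, Dom (fun l => y.1 l x) (y.2.1 x) (y.2.2 x)}
  have step : ∀ y : Y, ∃ y' : Y, ∀ x, LinSol s T (B x)
      (rhsF s T (fun m l => Mz m l x) (fun l => y.1.1 l x) (y.1.2.1 x) (y.1.2.2 x))
      (rhsG s T (B x) (fun l => N l x) (fun l => y.1.1 l x) (y.1.2.1 x) (y.1.2.2 x))
      (fun l => y'.1.1 l x) (y'.1.2.1 x) (y'.1.2.2 x) := by
    rintro ⟨⟨f, g, ψ⟩, ⟨hf, hg, hψ⟩, hd⟩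
    have mF := fun l x => rhsF_mem (s := s) T (fun m l => hM m l x) (hd x) l
    have mG := fun x => rhsG_mem (s := s) T (B x) (fun l => hN l x) (hd x)
    obtain ⟨f', g', ψ', hf', hg', hψ', h⟩ := exists_linSol hn T hBs hB
      (isSer_rhsF T hMs hf hg hψ hd) (isSer_rhsG T hBs hNs hf hg hψ hd)
      (fun l x a => bi_rhsF T _ (hd x).mem_z l a) (fun l x => uOrd_of_mem_two (mF l x))
      (fun x b => bi_rhsG T _ _ (hd x).mem_z b) (fun x => uOrd_of_mem_three (mG x))
    exact ⟨⟨⟨f', g', ψ'⟩, ⟨hf', hg', hψ'⟩, fun x =>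
      (h x).dom hn (hB x) (fun l => mF l x) (mG x)⟩, h⟩
  choose F hF using step
  let y₀ : Y := ⟨⟨fun _ _ => 0, fun _ => 0, fun _ => 0⟩,
    ⟨fun _ => .const _, .const _, .const _⟩,
    fun _ => ⟨fun _ => zero_mem _, zero_mem _, zero_mem _, zero_mem _⟩⟩
  have contr : ∀ (y y' : Y) (μ : ℕ) (x : 𝒳),
      Near μ (fun l => y.1.1 l x) (y.1.2.1 x) (y.1.2.2 x) (fun l => y'.1.1 l x) (y'.1.2.1 x)
        (y'.1.2.2 x) →
      Near (μ + 1) (fun l => (F y).1.1 l x) ((F y).1.2.1 x) ((F y).1.2.2 x)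
        (fun l => (F y').1.1 l x) ((F y').1.2.1 x) ((F y').1.2.2 x) := fun y y' μ x h =>
    (hF y x).near hn (hB x) (hF y' x)
      (fun l => rhsF_sub_mem T (fun m l => hM m l x) (y.2.2 x) (y'.2.2 x) h l)
      (rhsG_sub_mem T (B x) (fun l => hN l x) (y.2.2 x) (y'.2.2 x) h)
  obtain ⟨y, ys⟩ : ∃ y : ℕ → Y, ∀ k, y (k + 1) = F (y k) :=
    ⟨fun k => F^[k] y₀, fun k => Function.iterate_succ_apply' F k y₀⟩
  have cau (x : 𝒳) (k : ℕ) : Near k (fun l => (y (k + 1)).1.1 l x) ((y (k + 1)).1.2.1 x)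
      ((y (k + 1)).1.2.2 x) (fun l => (y k).1.1 l x) ((y k).1.2.1 x) ((y k).1.2.2 x) := by
    induction k with
    | zero =>
      have h := (y (0 + 1)).2.2 x
      have h' := (y 0).2.2 x
      exact ⟨fun l => sub_mem (h.mem_f l) (h'.mem_f l), sub_mem h.mem_g h'.mem_g,
        sub_mem h.mem_ψ h'.mem_ψ⟩
    | succ k ih =>
      have := contr _ _ _ _ ih
      rwa [← ys, ← ys] at this
  let f : Fin n → 𝒳 → Ser n := fun l x => limSer (hwt n) fun k => (y k).1.1 l x
  let g : 𝒳 → Ser n := fun x => limSer (hwt n) fun k => (y k).1.2.1 x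
  let ψ : 𝒳 → Ser n := fun x => limSer (hwt n) fun k => (y k).1.2.2 x
  have lim (x : 𝒳) (k : ℕ) : Near k (fun l => f l x) (g x) (ψ x)
      (fun l => (y k).1.1 l x) ((y k).1.2.1 x) ((y k).1.2.2 x) :=
    ⟨fun l => limSer_sub_mem_right _ 2 (fun k => (cau x k).sub_f l) k,
      limSer_sub_mem_right _ 3 (fun k => (cau x k).sub_g) k,
      limSer_sub_mem_right _ 3 (fun k => (cau x k).sub_ψ) k⟩
  have hd (x : 𝒳) : Dom (fun l => f l x) (g x) (ψ x) := by
    refine ⟨fun l => ?_, ?_, ?_, AlmostCR.mem_zIdeal.2 fun b => ?_⟩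
    · simpa using add_mem ((lim x 0).sub_f l) (((y 0).2.2 x).mem_f l)
    · simpa using add_mem (lim x 0).sub_g ((y 0).2.2 x).mem_g
    · simpa using add_mem (lim x 0).sub_ψ ((y 0).2.2 x).mem_ψ
    · ext m
      have := congrArg (coeff m) (AlmostCR.mem_zIdeal.1
        ((y (Finsupp.weight (hwt n) m + 1)).2.2 x).mem_z b)
      rw [coeff_bi] at this ⊢
      exact this
  let ylim : Y := ⟨⟨f, g, ψ⟩, ⟨fun l => .limSer _ fun k => (y k).2.1.1 l,
    .limSer _ fun k => (y k).2.1.2.1, .limSer _ fun k => (y k).2.1.2.2⟩, hd⟩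
  -- For every μ the limit, its image and the μ-th iterate agree to order μ, so the limit is a fixed
  -- point.
  have fixed (x : 𝒳) := Near.eq fun μ => (((contr ylim (y μ) μ x (lim x μ)).mono
    (Nat.le_succ μ)).trans (by rw [← ys]; exact cau x μ)).trans (lim x μ).symm
  refine ⟨f, g, ψ, ylim.2.1.1, ylim.2.1.2.1, ylim.2.1.2.2, fun x => ⟨hd x, ?_⟩⟩
  have h := hF ylim x
  rw [(fixed x).1, (fixed x).2.1, (fixed x).2.2] at h
  exact h

end

/-! ### Composition of formal maps and transport of structures -/

section

variable {n s : ℕ} {𝒳 : Type*} {A : CoeffAlg 𝒳}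

/-! ### Formal maps and vector fields -/

namespace VF

theorem app_sum_mul {ι : Type*} [Fintype ι] (a : ι → Ser n) (X : ι → VF n) (p : Ser n) :
    VF.app (fun i => ∑ j, a j * X j i) p = ∑ j, a j * (X j).app p := by
  simp only [VF.app, Finset.sum_mul, Finset.mul_sum]
  rw [Finset.sum_comm]
  simp only [mul_assoc]

theorem app_X (Y : VF n) (i : Var n) : Y.app (X i) = Y i := by
  classical
  rw [VF.app, Finset.sum_eq_single i]
  · rw [pderiv_X_self, mul_one]
  · intro j _ h; rw [pderiv_X_of_ne h.symm, mul_zero]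
  · intro h; exact absurd (Finset.mem_univ i) h

end VF

namespace FormalACR

/-- The `(1,0)` field `X_ξ` for `ξ` the `j`-th basis vector. -/
def frame (L : FormalACR n) (j : Fin n) : VF n
  | Sum.inl i => if i = j then 1 else 0
  | Sum.inr (Sum.inl k) => L.zbar k j
  | Sum.inr (Sum.inr _) => L.w j

theorem field_eq (L : FormalACR n) (ξ : Fin n → ℂ) :
    L.field ξ = fun i => ∑ j, C (ξ j) * L.frame j i := by
  funext i
  rcases i with i | i | i
  · simp [field, frame]
  · rfl
  · rfl

theorem field_single (L : FormalACR n) (j : Fin n) : L.field (Pi.single j 1) = L.frame j := by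
  rw [field_eq]
  funext i
  rw [Finset.sum_eq_single j]
  · simp
  · intro k _ h; simp [h]
  · intro h; exact absurd (Finset.mem_univ j) h

theorem frame_app (L : FormalACR n) (j : Fin n) (p : Ser n) :
    (L.frame j).app p = pderiv ℂ (zv j) p + (∑ k, L.zbar k j * pderiv ℂ (zbv k) p +
      L.w j * pderiv ℂ uv p) := by
  rw [VF.app, sum_var]
  simp [frame]

end FormalACR

namespace FormalMap

theorem comp_zero (h : FormalMap n) (i : Var n) : constantCoeff (h.comp i) = 0 := by
  rcases i with i | i | i
  · exact h.f_zero i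
  · change constantCoeff (h.f i).bar = 0
    rw [constantCoeff_bar, h.f_zero, map_zero]
  · exact h.g_zero

theorem hasSubst (h : FormalMap n) : HasSubst h.comp := hasSubst_of_mem h.comp_zero

theorem bar_comp (h : FormalMap n) (i : Var n) : (h.comp i).bar = h.comp (conjVar n i) := by
  rcases i with i | i | i
  · rfl
  · exact bar_bar _
  · exact h.g_real

theorem bar_pull (h : FormalMap n) (p : Ser n) :
    Ser.bar (subst h.comp p) = subst h.comp p.bar := by
  rw [bar_subst h.comp_zero]
  congr 1
  funext i
  rw [bar_comp]
  simp

/-- The formal map with given components. -/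
def ofComp (k : Var n → Ser n) (h0 : ∀ i, constantCoeff (k i) = 0)
    (hb : ∀ i, (k i).bar = k (conjVar n i)) : FormalMap n where
  f l := k (zv l)
  g := k uv
  f_zero l := h0 _
  g_zero := h0 _
  g_real := hb uv

theorem comp_ofComp (k : Var n → Ser n) (h0 : ∀ i, constantCoeff (k i) = 0)
    (hb : ∀ i, (k i).bar = k (conjVar n i)) : (ofComp k h0 hb).comp = k := by
  funext i
  rcases i with i | i | i
  · rfl
  · exact hb (zv i)
  · rfl

theorem ext_comp {h k : FormalMap n} (H : h.comp = k.comp) : h = k := by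
  ext1
  · funext l; exact congrFun H (zv l)
  · exact congrFun H uv

/-- The composition `h ∘ k`. -/
def mul (h k : FormalMap n) : FormalMap n :=
  ofComp (fun i => subst k.comp (h.comp i))
    (fun i => by rw [constantCoeff_subst_of_zero k.comp_zero, h.comp_zero])
    (fun i => by rw [bar_pull, bar_comp])

theorem comp_mul (h k : FormalMap n) (i : Var n) :
    (h.mul k).comp i = subst k.comp (h.comp i) := by
  rw [mul, comp_ofComp]

theorem pull_comp (h k : FormalMap n) (p : Ser n) :
    subst (h.mul k).comp p = subst k.comp (subst h.comp p) := by
  rw [subst_comp_subst_apply h.hasSubst k.hasSubst]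
  congr 1
  funext i
  exact comp_mul h k i

/-- `h ∘ k` is the identity. -/
def IsInv (h k : FormalMap n) : Prop := ∀ i, subst k.comp (h.comp i) = X i

theorem IsInv.symm {h k : FormalMap n} (H : h.IsInv k) : k.IsInv h :=
  formal_inverse_symm k.comp_zero H

theorem IsInv.pull {h k : FormalMap n} (H : h.IsInv k) (p : Ser n) :
    subst k.comp (subst h.comp p) = p := by
  rw [subst_comp_subst_apply h.hasSubst k.hasSubst]
  simp only [H _]
  exact subst_X_self p

theorem IsInv.eq_mul {h k : FormalMap n} (H : h.IsInv k) (l : FormalMap n) :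
    (l.mul h).mul k = l := by
  refine ext_comp (funext fun i => ?_)
  rw [comp_mul, comp_mul, H.pull]

theorem IsInv.mul {h k h' k' : FormalMap n} (H : h.IsInv k) (H' : h'.IsInv k') :
    (h.mul h').IsInv (k'.mul k) := fun i => by
  rw [pull_comp, comp_mul, H'.pull, H]

theorem IsInv.unique {h h' k : FormalMap n} (H : h.IsInv k) (H' : h'.IsInv k) : h = h' :=
  ext_comp (formal_inverse_unique k.comp_zero h'.comp_zero h.comp_zero H'.symm H.symm)

/-- The family of maps has components with coefficients in `A`. -/
def IsFam (A : CoeffAlg 𝒳) (h : 𝒳 → FormalMap n) : Prop :=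
  (∀ l, A.IsSer fun x => (h x).f l) ∧ A.IsSer fun x => (h x).g

theorem IsFam.comp {h : 𝒳 → FormalMap n} (H : IsFam A h) (i : Var n) :
    A.IsSer fun x => (h x).comp i := by
  rcases i with i | i | i
  · exact H.1 i
  · exact (H.1 i).bar
  · exact H.2

theorem IsFam.mul {h k : 𝒳 → FormalMap n} (H : IsFam A h) (K : IsFam A k) :
    IsFam A fun x => (h x).mul (k x) :=
  ⟨fun l => .subst (fun x => (k x).comp_zero) K.comp (H.1 l),
    .subst (fun x => (k x).comp_zero) K.comp H.2⟩

theorem exists_isInv (k : 𝒳 → FormalMap n) (hk : IsFam A k)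
    (hdet : ∀ x, (jac (k x).comp).det ≠ 0) :
    ∃ h : 𝒳 → FormalMap n, IsFam A h ∧ ∀ x, (h x).IsInv (k x) := by
  obtain ⟨h, hs, hh⟩ := exists_formal_inverse (fun x => (k x).comp) (fun x => (k x).comp_zero)
    hdet hk.comp
  -- Since k respects conjugation, the conjugate of its inverse is again an inverse; uniqueness
  -- makes the inverse a formal map with real last component.
  have hb : ∀ x i, Ser.bar (h x i) = h x (conjVar n i) := by
    intro x i
    have h0 : ∀ i, constantCoeff (Ser.bar (h x (conjVar n i))) = 0 := fun i => by
      rw [constantCoeff_bar, (hh x).1, map_zero]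
    have e : (fun i => Ser.bar (h x (conjVar n i))) = h x := by
      refine formal_inverse_unique (k x).comp_zero (hh x).1 h0 (hh x).2 fun i => ?_
      have := bar_subst (hh x).1 ((k x).comp (conjVar n i))
      rw [(hh x).2, bar_X, bar_comp] at this
      simpa using this.symm
    conv_lhs => rw [← e]
    simp
  refine ⟨fun x => ofComp (h x) (hh x).1 (hb x), ⟨fun l => hs _, hs _⟩, fun x => ?_⟩
  refine IsInv.symm fun i => ?_
  rw [comp_ofComp]
  exact (hh x).2 i

/-- The field `h_* Y` is in the graph of `L' ∘ h`. -/
def Rel (h : FormalMap n) (Y : VF n) (L' : FormalACR n) : Prop :=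
  (∀ m, Y.app (h.f m).bar = ∑ l, subst h.comp (L'.zbar m l) * Y.app (h.f l)) ∧
    Y.app h.g = ∑ l, subst h.comp (L'.w l) * Y.app (h.f l)

theorem Rel.sum {ι : Type*} [Fintype ι] {h : FormalMap n} {L' : FormalACR n} {Y : ι → VF n}
    (H : ∀ j, h.Rel (Y j) L') (a : ι → Ser n) : h.Rel (fun i => ∑ j, a j * Y j i) L' := by
  have key : ∀ (p : Ser n) (q : Fin n → Ser n),
      (∀ j, (Y j).app p = ∑ l, q l * (Y j).app (h.f l)) →
      ∑ j, a j * (Y j).app p = ∑ l, q l * ∑ j, a j * (Y j).app (h.f l) := by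
    intro p q hpq
    simp only [hpq, Finset.mul_sum]
    rw [Finset.sum_comm]
    exact Finset.sum_congr rfl fun _ _ => Finset.sum_congr rfl fun _ _ => by ring
  refine ⟨fun m => ?_, ?_⟩
  · simp only [VF.app_sum_mul]; exact key _ _ fun j => (H j).1 m
  · simp only [VF.app_sum_mul]; exact key _ _ fun j => (H j).2

theorem transforms_iff {h : FormalMap n} {L L' : FormalACR n} :
    h.Transforms L L' ↔ ∀ j, h.Rel (L.frame j) L' := by
  refine ⟨fun H j => ?_, fun H ξ => ?_⟩
  · rw [← FormalACR.field_single]; exact H _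
  · rw [FormalACR.field_eq]; exact Rel.sum H _

theorem app_pull (h : FormalMap n) (Y : VF n) (q : Ser n) :
    Y.app (subst h.comp q) = ∑ i, subst h.comp (pderiv ℂ i q) * Y.app (h.comp i) := by
  simp only [VF.app, pderiv_subst h.comp_zero, Finset.mul_sum]
  rw [Finset.sum_comm]
  exact Finset.sum_congr rfl fun _ _ => Finset.sum_congr rfl fun _ _ => by ring

theorem pull_add (h : FormalMap n) (p q : Ser n) :
    subst h.comp (p + q) = subst h.comp p + subst h.comp q := subst_add h.hasSubst p q

theorem pull_mul (h : FormalMap n) (p q : Ser n) :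
    subst h.comp (p * q) = subst h.comp p * subst h.comp q := subst_mul h.hasSubst p q

theorem pull_sum {ι : Type*} (t : Finset ι) (h : FormalMap n) (P : ι → Ser n) :
    subst h.comp (∑ i ∈ t, P i) = ∑ i ∈ t, subst h.comp (P i) := by
  rw [← coe_substAlgHom h.hasSubst, map_sum]

/-- The relation says that the image of Y is the combination of the fields of L' ∘ h with
coefficients Y f_l; applied to any q this is the chain rule. -/
theorem Rel.app_pull {h : FormalMap n} {Y : VF n} {L' : FormalACR n} (H : h.Rel Y L') (q : Ser n) :
    Y.app (subst h.comp q) = ∑ l, subst h.comp ((L'.frame l).app q) * Y.app (h.f l) := by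
  rw [FormalMap.app_pull, sum_var]
  simp only [comp, H.1, H.2, FormalACR.frame_app, pull_add, pull_mul, pull_sum, add_mul,
    Finset.sum_add_distrib, Finset.mul_sum, Finset.sum_mul]
  congr 2
  · rw [Finset.sum_comm]
    exact Finset.sum_congr rfl fun _ _ => Finset.sum_congr rfl fun _ _ => by ring
  · exact Finset.sum_congr rfl fun _ _ => by ring

theorem Rel.mul {h k : FormalMap n} {Y : VF n} {L L' : FormalACR n} (H : k.Rel Y L)
    (H' : h.Transforms L L') : (h.mul k).Rel Y L' := by
  rw [transforms_iff] at H'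
  have key : ∀ (p : Ser n) (q : Fin n → Ser n),
      (∀ j, (L.frame j).app p = ∑ l, q l * (L.frame j).app (h.f l)) →
      Y.app (subst k.comp p) = ∑ l, subst k.comp (q l) * Y.app (subst k.comp (h.f l)) := by
    intro p q hpq
    simp only [H.app_pull, hpq, pull_sum, pull_mul, Finset.mul_sum, Finset.sum_mul]
    rw [Finset.sum_comm]
    exact Finset.sum_congr rfl fun _ _ => Finset.sum_congr rfl fun _ _ => by ring
  refine ⟨fun m => ?_, ?_⟩
  · simp only [pull_comp]
    change Y.app (Ser.bar (subst k.comp (h.f m))) = _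
    rw [bar_pull]
    exact key _ _ fun j => (H' j).1 m
  · simp only [pull_comp]
    exact key _ _ fun j => (H' j).2

theorem Transforms.mul {h k : FormalMap n} {L L' L'' : FormalACR n} (H : k.Transforms L L')
    (H' : h.Transforms L' L'') : (h.mul k).Transforms L L'' :=
  transforms_iff.2 fun j => (transforms_iff.1 H j).mul H'

/-- Transporting Y by k and then by h = k⁻¹ is the identity, so Y itself lies in the graph of L'.
This later reads off L' along the Euler field. -/
theorem Rel.inGraph {h k : FormalMap n} (hk : h.IsInv k) {Y : VF n} {L L' : FormalACR n}
    (H : k.Rel Y L) (H' : h.Transforms L L') :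
    (∀ m, Y (zbv m) = ∑ l, L'.zbar m l * Y (zv l)) ∧ Y uv = ∑ l, L'.w l * Y (zv l) := by
  have e : (h.mul k).comp = X := funext fun i => by rw [comp_mul, hk]
  have ef (l : Fin n) : (h.mul k).f l = X (zv l) := congrFun e (zv l)
  have eg : (h.mul k).g = X uv := congrFun e uv
  obtain ⟨h1, h2⟩ := H.mul H'
  simp only [e, ef, eg, subst_X_self, bar_X, VF.app_X, conjVar_zv] at h1 h2
  exact ⟨h1, h2⟩

/-- The matrix P of the derivatives X_j f_l has the right inverse formed by the derivatives of k
along the fields of L', pulled back by h. Over a commutative ring this is also a left inverse, so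
the defining relations can be solved for the fields of L'. -/
theorem Transforms.symm {h k : FormalMap n} (hk : h.IsInv k) {L L' : FormalACR n}
    (H : h.Transforms L L') : k.Transforms L' L := by
  have H' := transforms_iff.1 H
  set P : Matrix (Fin n) (Fin n) (Ser n) := Matrix.of fun j l => (L.frame j).app (h.f l) with hP
  set Q : Matrix (Fin n) (Fin n) (Ser n) :=
    Matrix.of fun l m => subst h.comp ((L'.frame l).app (k.f m)) with hQ
  have app_eq (j : Fin n) (i : Var n) :
      ∑ l, subst h.comp ((L'.frame l).app (k.comp i)) * (L.frame j).app (h.f l) =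
        L.frame j i := by
    rw [← (H' j).app_pull, hk.symm, VF.app_X]
  have hPQ : P * Q = 1 := by
    ext1 j m
    rw [Matrix.mul_apply, Matrix.one_apply]
    have := app_eq j (zv m)
    simp only [FormalACR.frame] at this
    simp only [hP, hQ, Matrix.of_apply, mul_comm ((L.frame j).app _), eq_comm (a := j)]
    exact this
  have hQP : Q * P = 1 := mul_eq_one_comm.1 hPQ
  have solve (i : Var n) (c : Fin n → Ser n) (hc : ∀ j, L.frame j i = c j) (l : Fin n) :
      (L'.frame l).app (k.comp i) = ∑ j, subst k.comp (c j) * (L'.frame l).app (k.f j) := by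
    have e1 : P.mulVec (fun l => subst h.comp ((L'.frame l).app (k.comp i))) = c := by
      funext j
      rw [← hc, ← app_eq, Matrix.mulVec, dotProduct]
      exact Finset.sum_congr rfl fun _ _ => mul_comm _ _
    have e2 := congrArg Q.mulVec e1
    rw [Matrix.mulVec_mulVec, hQP, Matrix.one_mulVec] at e2
    have e3 := congrArg (subst k.comp) (congrFun e2 l)
    simp only [hk.pull, Matrix.mulVec, dotProduct, pull_sum, pull_mul, hQ, Matrix.of_apply] at e3
    rw [e3]
    exact Finset.sum_congr rfl fun _ _ => mul_comm _ _
  exact transforms_iff.2 fun j =>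
    ⟨fun m => solve (zbv m) (fun l => L.zbar m l) (fun _ => rfl) j,
      solve uv (fun l => L.w l) (fun _ => rfl) j⟩

theorem Transforms.unique {h k : FormalMap n} (hk : h.IsInv k) {L L' L'' : FormalACR n}
    (H : h.Transforms L L') (H' : h.Transforms L L'') : L' = L'' := by
  have key (j : Fin n) := (transforms_iff.1 (H.symm hk) j).inGraph hk H'
  simp only [FormalACR.frame, mul_ite, mul_one, mul_zero, Finset.sum_ite_eq', Finset.mem_univ,
    if_true] at key
  ext1
  · funext m j; exact (key j).1 m
  · funext j; exact (key j).2

end FormalMap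

/-- The family of structures has components with coefficients in `A`. -/
def FormalACR.IsFam (A : CoeffAlg 𝒳) (L : 𝒳 → FormalACR n) : Prop :=
  (∀ m l, A.IsSer fun x => (L x).zbar m l) ∧ ∀ l, A.IsSer fun x => (L x).w l

theorem FormalACR.IsFam.app {L : 𝒳 → FormalACR n} (H : FormalACR.IsFam A L) {P : 𝒳 → Ser n}
    (hP : A.IsSer P) (j : Fin n) : A.IsSer fun x => ((L x).frame j).app (P x) := by
  simp only [FormalACR.frame_app]
  exact (hP.pderiv _).add ((CoeffAlg.IsSer.sum fun k _ => (H.1 k j).mul (hP.pderiv _)).add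
    ((H.2 j).mul (hP.pderiv _)))

theorem exists_matrix_inv {P : 𝒳 → Matrix (Fin n) (Fin n) (Ser n)}
    (hPs : ∀ i j, A.IsSer fun x => P x i j) (hPd : ∀ x, constantCoeff (P x).det ≠ 0) :
    ∃ Q : 𝒳 → Matrix (Fin n) (Fin n) (Ser n), (∀ i j, A.IsSer fun x => Q x i j) ∧
      ∀ x, P x * Q x = 1 := by
  refine ⟨fun x => ((P x).det)⁻¹ • (P x).adjugate, fun i j => ?_, fun x => ?_⟩
  · exact ((CoeffAlg.IsSer.det (M := P) hPs).inv hPd).mul (CoeffAlg.IsSer.adjugate (M := P) hPs i j)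
  · rw [Matrix.mul_smul, Matrix.mul_adjugate, smul_smul, MvPowerSeries.inv_mul_cancel _ (hPd x),
      one_smul]

/-- The components of L' are forced by a linear system with matrix (X_j f_l), invertible because its
constant part is. The last two hypotheses make L' vanish at 0. -/
theorem FormalMap.exists_transforms {L : 𝒳 → FormalACR n} (hL : FormalACR.IsFam A L)
    {h k : 𝒳 → FormalMap n} (hh : FormalMap.IsFam A h) (hk : FormalMap.IsFam A k)
    (hkh : ∀ x, (k x).IsInv (h x))
    (hdet : ∀ x, (Matrix.of fun j l => constantCoeff (pderiv ℂ (zv j) ((h x).f l))).det ≠ 0)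
    (hzb : ∀ x m j, constantCoeff (pderiv ℂ (zv j) ((h x).f m).bar) = 0)
    (hg : ∀ x j, constantCoeff (pderiv ℂ (zv j) (h x).g) = 0) :
    ∃ L' : 𝒳 → FormalACR n, FormalACR.IsFam A L' ∧ ∀ x, (h x).Transforms (L x) (L' x) := by
  have capp (x : 𝒳) (j : Fin n) (p : Ser n) :
      constantCoeff (((L x).frame j).app p) = constantCoeff (pderiv ℂ (zv j) p) := by
    simp [FormalACR.frame_app, (L x).zbar_zero, (L x).w_zero]
  obtain ⟨P, hP⟩ : ∃ P : 𝒳 → Matrix (Fin n) (Fin n) (Ser n),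
      ∀ x j l, P x j l = ((L x).frame j).app ((h x).f l) :=
    ⟨fun x => Matrix.of fun j l => ((L x).frame j).app ((h x).f l), fun _ _ _ => rfl⟩
  have hPd (x : 𝒳) : constantCoeff (P x).det ≠ 0 := by
    rw [RingHom.map_det]
    convert hdet x using 2
    ext j l
    simp [hP, capp]
  obtain ⟨Q, hQs, hPQ⟩ := exists_matrix_inv (A := A) (P := P)
    (fun j l => by simp only [hP]; exact hL.app (hh.1 l) j) hPd
  obtain ⟨push, hpush⟩ : ∃ push : (𝒳 → Ser n) → Fin n → 𝒳 → Ser n, ∀ p l x,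
      push p l x = subst (k x).comp (∑ j, Q x l j * ((L x).frame j).app (p x)) :=
    ⟨_, fun _ _ _ => rfl⟩
  have pushs {p : 𝒳 → Ser n} (hp : A.IsSer p) (l : Fin n) : A.IsSer (push p l) := by
    unfold CoeffAlg.IsSer
    simp only [hpush]
    exact CoeffAlg.IsSer.subst (fun x => (k x).comp_zero) hk.comp (.sum fun j _ => (hQs l j).mul (hL.app hp j))
  have push0 {p : 𝒳 → Ser n} (hp : ∀ x j, constantCoeff (pderiv ℂ (zv j) (p x)) = 0) (l : Fin n)
      (x : 𝒳) : constantCoeff (push p l x) = 0 := by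
    rw [hpush, constantCoeff_subst_of_zero (k x).comp_zero, map_sum]
    exact Finset.sum_eq_zero fun j _ => by rw [map_mul, capp, hp, mul_zero]
  have pushe (p : 𝒳 → Ser n) (x : 𝒳) (j : Fin n) : ((L x).frame j).app (p x) =
      ∑ l, subst (h x).comp (push p l x) * ((L x).frame j).app ((h x).f l) := by
    simp only [hpush, (hkh x).pull]
    have e := congrFun (congrArg (fun R => R.mulVec fun j => ((L x).frame j).app (p x)) (hPQ x)) j
    simp only [← Matrix.mulVec_mulVec, Matrix.one_mulVec] at e
    rw [← e, Matrix.mulVec, dotProduct]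
    simp only [hP]
    exact Finset.sum_congr rfl fun _ _ => mul_comm _ _
  refine ⟨fun x => ⟨fun m l => push (fun x => ((h x).f m).bar) l x, fun l => push (fun x => (h x).g) l x,
    fun m l => push0 (fun x j => hzb x m j) l x, fun l => push0 (fun x j => hg x j) l x⟩,
    ⟨fun m l => pushs (hh.1 m).bar l, fun l => pushs hh.2 l⟩, fun x => ?_⟩
  exact FormalMap.transforms_iff.2 fun j => ⟨fun m => pushe (fun x => ((h x).f m).bar) x j, pushe (fun x => (h x).g) x j⟩

end

/-! ### Jets at the origin and frames -/

section

variable {n s : ℕ} {𝒳 : Type*} {A : CoeffAlg 𝒳}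

/-! ### Derivatives at the origin -/

/-- The first derivatives at `0`. -/
def D1 (i : Var n) (p : Ser n) : ℂ := constantCoeff (pderiv ℂ i p)

/-- The second derivatives at `0`. -/
def D2 (i j : Var n) (p : Ser n) : ℂ := constantCoeff (pderiv ℂ i (pderiv ℂ j p))

theorem D2_comm (i j : Var n) (p : Ser n) : D2 i j p = D2 j i p := by rw [D2, pderiv_comm, D2]

theorem D1_bar (i : Var n) (p : Ser n) : D1 i p.bar = conj (D1 (conjVar n i) p) := by
  rw [D1, D1, ← constantCoeff_bar, bar_pderiv]; simp

theorem D2_bar (i j : Var n) (p : Ser n) :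
    D2 i j p.bar = conj (D2 (conjVar n i) (conjVar n j) p) := by
  rw [D2, D2, ← constantCoeff_bar, bar_pderiv, bar_pderiv]; simp

theorem D1_add (i : Var n) (p q : Ser n) : D1 i (p + q) = D1 i p + D1 i q := by simp [D1]

theorem D1_sum {ι : Type*} (t : Finset ι) (i : Var n) (P : ι → Ser n) :
    D1 i (∑ j ∈ t, P j) = ∑ j ∈ t, D1 i (P j) := by simp [D1]

theorem D1_C_mul (i : Var n) (c : ℂ) (p : Ser n) : D1 i (C c * p) = c * D1 i p := by
  rw [D1, pderiv_C_mul, map_mul, constantCoeff_C, D1]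

theorem D1_X (i j : Var n) : D1 i (X j : Ser n) = if i = j then 1 else 0 := by
  rw [D1]
  split_ifs with h
  · rw [h, pderiv_X_self, map_one]
  · rw [pderiv_X_ne h, map_zero]

theorem D1_mul (i : Var n) (p q : Ser n) :
    D1 i (p * q) = D1 i p * constantCoeff q + constantCoeff p * D1 i q := by
  rw [D1, pderiv_mul, map_add, map_mul, map_mul, D1, D1]

theorem D2_add (i j : Var n) (p q : Ser n) : D2 i j (p + q) = D2 i j p + D2 i j q := by simp [D2]

theorem D2_sum {ι : Type*} (t : Finset ι) (i j : Var n) (P : ι → Ser n) :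
    D2 i j (∑ k ∈ t, P k) = ∑ k ∈ t, D2 i j (P k) := by simp [D2]

theorem D2_C_mul (i j : Var n) (c : ℂ) (p : Ser n) : D2 i j (C c * p) = c * D2 i j p := by
  rw [D2, pderiv_C_mul, pderiv_C_mul, map_mul, constantCoeff_C, D2]

theorem D2_mul (i j : Var n) (p q : Ser n) :
    D2 i j (p * q) = D2 i j p * constantCoeff q + D1 j p * D1 i q +
      (D1 i p * D1 j q + constantCoeff p * D2 i j q) := by
  rw [D2, pderiv_mul, map_add, map_add, ← D1, ← D1, D1_mul, D1_mul]; rfl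

theorem D2_X (i j k : Var n) : D2 i j (X k : Ser n) = 0 := by
  rw [D2]
  by_cases h : j = k
  · rw [h, pderiv_X_self]; simp
  · rw [pderiv_X_ne h, map_zero, map_zero]

theorem D1_eq_coeff (i : Var n) (p : Ser n) : D1 i p = coeff (Finsupp.single i 1) p :=
  constantCoeff_pderiv i p

theorem coeff_eq_zero_of_D2 {i j : Var n} {p : Ser n} (h : D2 i j p = 0) :
    coeff (Finsupp.single j 1 + Finsupp.single i 1) p = 0 := by
  rw [D2, constantCoeff_pderiv, coeff_pderiv, mul_eq_zero] at h
  rw [add_comm]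
  exact h.resolve_right (Nat.cast_add_one_ne_zero _)

namespace FormalMap

theorem D1_pull (h : FormalMap n) (i : Var n) (p : Ser n) :
    D1 i (subst h.comp p) = ∑ a, D1 a p * D1 i (h.comp a) := by
  simp only [D1, pderiv_subst h.comp_zero, map_sum, map_mul,
    constantCoeff_subst_of_zero h.comp_zero]

theorem D2_pull (h : FormalMap n) (i j : Var n) (p : Ser n) :
    D2 i j (subst h.comp p) = ∑ a, ((∑ b, D2 b a p * D1 i (h.comp b)) * D1 j (h.comp a) +
      D1 a p * D2 i j (h.comp a)) := by
  rw [D2, pderiv_subst h.comp_zero, map_sum, map_sum]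
  refine Finset.sum_congr rfl fun a _ => ?_
  rw [← D1, D1_mul, D1_pull, constantCoeff_subst_of_zero h.comp_zero]
  rfl

theorem D1_comp_zbv (h : FormalMap n) (i : Var n) (l : Fin n) :
    D1 i (h.comp (zbv l)) = conj (D1 (conjVar n i) (h.f l)) := D1_bar _ _

theorem D1_g_conj (h : FormalMap n) (i : Var n) : D1 (conjVar n i) h.g = conj (D1 i h.g) := by
  have := D1_bar (conjVar n i) h.g
  rw [h.g_real] at this
  simpa using this

theorem D2_g_conj (h : FormalMap n) (i j : Var n) :
    D2 (conjVar n i) (conjVar n j) h.g = conj (D2 i j h.g) := by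
  have := D2_bar (conjVar n i) (conjVar n j) h.g
  rw [h.g_real] at this
  simpa using this

/-- The derivatives of `k` at `0` that correspond to an extended adapted frame. -/
structure HasJet (k : FormalMap n) (V : Fin n → Fin n → ℂ) (v : Tangent n) (r : ℝ) : Prop where
  f_z : ∀ l j, D1 (zv j) (k.f l) = V j l
  f_zb : ∀ l j, D1 (zbv j) (k.f l) = 0
  f_u : ∀ l, D1 uv (k.f l) = v.1 l
  g_z : ∀ j, D1 (zv j) k.g = 0
  g_u : D1 uv k.g = v.2
  g_uu : D2 uv uv k.g = r

variable {h k : FormalMap n} {V : Fin n → Fin n → ℂ} {v : Tangent n} {r : ℝ}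

theorem HasJet.g_zb (H : k.HasJet V v r) (j : Fin n) : D1 (zbv j) k.g = 0 := by
  have := k.D1_g_conj (zv j)
  rwa [H.g_z, map_zero, conjVar_zv] at this

theorem HasJet.comp_u (H : k.HasJet V v r) (i : Var n) : D1 uv (k.comp i) = v.coords i := by
  rcases i with i | i | i
  · exact H.f_u i
  · exact (D1_comp_zbv _ _ _).trans (congrArg conj (H.f_u i))
  · exact H.g_u

theorem eq_zero_of_linearIndependent (hV : LinearIndependent ℂ V) {w : Fin n → ℂ}
    (hw : ∀ j, ∑ i, w i * V j i = 0) : w = 0 := by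
  have hu : IsUnit (Matrix.of V) := by
    rw [← Matrix.linearIndependent_rows_iff_isUnit]; exact hV
  refine Matrix.mulVec_injective_of_isUnit hu ?_
  funext j
  simpa [Matrix.mulVec, dotProduct, mul_comm] using hw j

theorem HasJet.det_ne_zero (H : k.HasJet V v r) (hV : LinearIndependent ℂ V) (ht : v.2 ≠ 0) :
    (jac k.comp).det ≠ 0 := by
  intro h0
  obtain ⟨x, hx, hx0⟩ := Matrix.exists_mulVec_eq_zero_iff.2 h0
  refine hx ?_
  have row (i : Var n) : ∑ j, D1 j (k.comp i) * x j = 0 := congrFun hx0 i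
  have hu : x uv = 0 := by
    have := row uv
    rw [sum_var] at this
    simp only [comp, H.g_z, H.g_zb, H.g_u, zero_mul, Finset.sum_const_zero, zero_add] at this
    exact (mul_eq_zero.1 this).resolve_left (by exact_mod_cast ht)
  have hz : ∀ w : Fin n → ℂ, (∀ l, ∑ j, V j l * w j = 0) → ∀ j, w j = 0 := fun w hw =>
    Fintype.linearIndependent_iff.1 hV w (by
      funext l
      simpa [mul_comm] using hw l)
  have hzv := hz (fun j => x (zv j)) fun l => by
    have := row (zv l)
    rw [sum_var] at this
    simpa only [comp, H.f_z, H.f_zb, hu, zero_mul, mul_zero, Finset.sum_const_zero, add_zero]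
      using this
  have hzbv := hz (fun j => conj (x (zbv j))) fun l => by
    have := congrArg conj (row (zbv l))
    rw [sum_var] at this
    simpa only [D1_comp_zbv, conjVar_zv, conjVar_zbv, H.f_z, H.f_zb, hu, map_zero, zero_mul,
      mul_zero, Finset.sum_const_zero, add_zero, zero_add, map_sum, map_mul, Complex.conj_conj]
      using this
  funext i
  rcases i with i | i | i
  · exact hzv i
  · simpa using hzbv i
  · exact hu

/-- The derivatives of `h` at `0` if it transforms a frame to the standard one. -/
structure HasDualJet (h : FormalMap n) (V : Fin n → Fin n → ℂ) (v : Tangent n) (r : ℝ) :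
    Prop where
  f_z : ∀ l j, ∑ i, D1 (zv i) (h.f l) * V j i = if j = l then 1 else 0
  f_zb : ∀ l j, D1 (zbv j) (h.f l) = 0
  f_u : ∀ l, ∑ i, D1 (zv i) (h.f l) * v.1 i + D1 uv (h.f l) * v.2 = 0
  g_z : ∀ j, D1 (zv j) h.g = 0
  g_u : (D1 uv h.g).re * v.2 = 1
  g_uu : (d2 h.g v).re + (D1 uv h.g).re * r = 0

/-- The derivatives at `0` of the maps that preserve the standard frame. -/
abbrev IsStd (k : FormalMap n) : Prop := k.HasJet (fun j l => if j = l then 1 else 0) (0, 1) 0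

theorem re_D1_uv (h : FormalMap n) : ((D1 uv h.g).re : ℂ) = D1 uv h.g :=
  Complex.conj_eq_iff_re.1 (h.D1_g_conj uv).symm

theorem re_D2_uv (h : FormalMap n) : ((D2 uv uv h.g).re : ℂ) = D2 uv uv h.g :=
  Complex.conj_eq_iff_re.1 (h.D2_g_conj uv uv).symm

theorem D2_uu_mul (H : k.HasJet V v r) (hg : ∀ j, D1 (zv j) h.g = 0) :
    D2 uv uv (h.mul k).g = d2 h.g v + D1 uv h.g * r := by
  change D2 uv uv (subst k.comp h.g) = _
  have hgb : ∀ j, D1 (zbv j) h.g = 0 := fun j => by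
    have := h.D1_g_conj (zv j)
    rwa [hg, map_zero, conjVar_zv] at this
  rw [D2_pull, Finset.sum_add_distrib]
  congr 1
  · simp only [H.comp_u, d2, Finset.sum_mul]
    rw [Finset.sum_comm]
    rfl
  · rw [sum_var]
    simp only [hg, hgb, zero_mul, Finset.sum_const_zero, zero_add]
    rw [← H.g_uu]; rfl

/-- The jet of k is the frame, so by the chain rule h sends the frame to the standard one exactly
when h ∘ k has the jet of the identity, as far as `IsStd` records it. -/
theorem isStd_mul_iff (H : k.HasJet V v r) (hV : LinearIndependent ℂ V) :
    (h.mul k).IsStd ↔ h.HasDualJet V v r := by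
  have D (i : Var n) (p : Ser n) : D1 i (subst k.comp p) = ∑ j, D1 (zv j) p * D1 i (k.f j) +
      (∑ j, D1 (zbv j) p * D1 i (k.comp (zbv j)) + D1 uv p * D1 i k.g) := by
    rw [D1_pull, sum_var]; rfl
  have Dz (j : Fin n) (p : Ser n) : D1 (zv j) (subst k.comp p) = ∑ i, D1 (zv i) p * V j i := by
    rw [D]; simp [H.f_z, D1_comp_zbv, H.f_zb, H.g_z]
  have Dzb (j : Fin n) (p : Ser n) :
      D1 (zbv j) (subst k.comp p) = ∑ i, D1 (zbv i) p * conj (V j i) := by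
    rw [D]; simp [H.f_z, D1_comp_zbv, H.f_zb, H.g_zb]
  have Du (p : Ser n) : D1 uv (subst k.comp p) = ∑ i, D1 (zv i) p * v.1 i +
      (∑ i, D1 (zbv i) p * conj (v.1 i) + D1 uv p * v.2) := by
    rw [D]; simp [H.f_u, D1_comp_zbv, H.g_u]
  constructor
  · intro S
    have fzb (l : Fin n) : ∀ j, D1 (zbv j) (h.f l) = 0 := by
      have := eq_zero_of_linearIndependent hV (w := fun i => conj (D1 (zbv i) (h.f l))) fun j => by
        have := congrArg conj ((Dzb j (h.f l)).symm.trans (S.f_zb l j))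
        simpa using this
      intro j
      simpa using congrFun this j
    have gz : ∀ j, D1 (zv j) h.g = 0 := congrFun (eq_zero_of_linearIndependent hV fun j =>
      (Dz j h.g).symm.trans (S.g_z j))
    have gzb (j : Fin n) : D1 (zbv j) h.g = 0 := by
      have := h.D1_g_conj (zv j)
      rwa [gz, map_zero, conjVar_zv] at this
    refine ⟨fun l j => (Dz j (h.f l)).symm.trans (S.f_z l j), fzb, fun l => ?_, gz, ?_, ?_⟩
    · have := (Du (h.f l)).symm.trans (S.f_u l)
      simpa [fzb] using this
    · have := (Du h.g).symm.trans S.g_u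
      simp only [gz, gzb, zero_mul, Finset.sum_const_zero, zero_add] at this
      rw [← re_D1_uv] at this
      exact_mod_cast this
    · have := (D2_uu_mul H gz).symm.trans S.g_uu
      rw [← re_D1_uv] at this
      have := congrArg Complex.re this
      simpa using this
  · intro S
    have gzb (j : Fin n) : D1 (zbv j) h.g = 0 := by
      have := h.D1_g_conj (zv j)
      rwa [S.g_z, map_zero, conjVar_zv] at this
    refine ⟨fun l j => (Dz j (h.f l)).trans (S.f_z l j), fun l j => ?_, fun l => ?_, fun j => ?_,
      ?_, ?_⟩
    · refine (Dzb j (h.f l)).trans ?_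
      simp [S.f_zb]
    · refine (Du (h.f l)).trans ?_
      simpa [S.f_zb] using S.f_u l
    · refine (Dz j h.g).trans ?_
      simp [S.g_z]
    · refine (Du h.g).trans ?_
      simp only [S.g_z, gzb, zero_mul, Finset.sum_const_zero, zero_add]
      rw [← re_D1_uv]
      exact_mod_cast S.g_u
    · have := D2_uu_mul H S.g_z
      rw [← re_D1_uv] at this
      rw [← re_D2_uv]
      have := congrArg Complex.re this
      rw [this]
      have := S.g_uu
      simp only [Complex.add_re, Complex.re_mul_ofReal, Complex.ofReal_re]
      rw [this]

theorem isStd_iff : k.IsStd ↔ (∀ i a, D1 i (k.comp a) = if i = a then 1 else 0) ∧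
    D2 uv uv k.g = 0 := by
  constructor
  · intro S
    refine ⟨fun i a => ?_, by simpa using S.g_uu⟩
    rcases a with a | a | a
    · rcases i with i | i | i
      · simpa [comp] using S.f_z a i
      · simpa [comp] using S.f_zb a i
      · simpa [comp] using S.f_u a
    · rw [show (Sum.inr (Sum.inl a) : Var n) = zbv a from rfl, D1_comp_zbv]
      rcases i with i | i | i
      · have := S.f_zb a i
        simpa using this
      · have := S.f_z a i
        have e : (conjVar n) (Sum.inr (Sum.inl i)) = zv i := rfl
        rw [e, this]
        simp [apply_ite conj]
      · have := S.f_u a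
        have e : (conjVar n) (Sum.inr (Sum.inr i)) = uv := rfl
        rw [e, this]
        simp
    · rcases i with i | i | i
      · simpa [comp] using S.g_z i
      · simpa [comp] using S.g_zb i
      · simpa [comp] using S.g_u
  · rintro ⟨S, S'⟩
    refine ⟨fun l j => ?_, fun l j => ?_, fun l => ?_, fun j => ?_, ?_, by simpa using S'⟩
    · simpa [comp] using S (zv j) (zv l)
    · simpa [comp] using S (zbv j) (zv l)
    · simpa [comp] using S uv (zv l)
    · simpa [comp] using S (zv j) uv
    · simpa [comp] using S uv uv

theorem IsStd.inv (S : h.IsStd) (hk : h.IsInv k) : k.IsStd := by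
  obtain ⟨S1, S2⟩ := isStd_iff.1 S
  have K1 : ∀ i a, D1 i (k.comp a) = if i = a then 1 else 0 := fun i a => by
    have := D1_pull k i (h.comp a)
    rw [hk, D1_X] at this
    simp only [S1, ite_mul, one_mul, zero_mul, Finset.sum_ite_eq', Finset.mem_univ, if_true] at this
    exact this.symm
  refine isStd_iff.2 ⟨K1, ?_⟩
  have := D2_pull k uv uv (h.comp uv)
  rw [hk, D2_X] at this
  simp only [K1, S1, ite_mul, one_mul, zero_mul, mul_ite, mul_one, mul_zero, Finset.sum_ite_eq,
    Finset.mem_univ, if_true, Finset.sum_add_distrib, Finset.sum_ite_eq'] at this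
  have e : D2 uv uv (h.comp uv) = 0 := S2
  rw [e, zero_add] at this
  exact this.symm

/-- `MapsToStandard` tests the v_j but not the vectors i v_j. The two additional conditions make dh
complex-linear on H₀ and H₀ invariant; they hold for every map transforming one structure into
another. The jet class then enters only through the u-component of its acceleration. -/
theorem mapsToStandard_iff {L : FormalACR n} (F : ExtFrame L s) :
    (h.MapsToStandard F ∧ (∀ l j, D1 (zbv j) (h.f l) = 0) ∧ ∀ j, D1 (zv j) h.g = 0) ↔
      h.HasDualJet F.v F.last F.cls.accU := by
  have d1_eq (p : Ser n) (w : Tangent n) : d1 p w = ∑ i, D1 (zv i) p * w.1 i +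
      (∑ i, D1 (zbv i) p * conj (w.1 i) + D1 uv p * w.2) := by
    rw [d1, sum_var]; rfl
  have gzb_of (hg : ∀ j, D1 (zv j) h.g = 0) (j : Fin n) : D1 (zbv j) h.g = 0 := by
    have := h.D1_g_conj (zv j)
    rwa [hg, map_zero, conjVar_zv] at this
  have d1g (hg : ∀ j, D1 (zv j) h.g = 0) (w : Tangent n) : (d1 h.g w).re = (D1 uv h.g).re * w.2 := by
    rw [d1_eq]; simp [hg, gzb_of hg]
  have cls_iff (Λ Λ' : CurveJet n) : Λ.toClass = Λ'.toClass ↔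
      Λ.vel = Λ'.vel ∧ Λ.acc.2 = Λ'.acc.2 := by
    rw [CurveJet.toClass, CurveJet.toClass, Quotient.eq]
    change _ ∧ (Λ.acc - Λ'.acc).2 = 0 ↔ _
    rw [Prod.snd_sub, sub_eq_zero]
  obtain ⟨Λ₀, hΛ₀⟩ := Quotient.exists_rep F.cls
  have hvel : Λ₀.vel = F.last := by rw [← F.cls_vel, ← hΛ₀]; rfl
  have hacc : Λ₀.acc.2 = F.cls.accU := by rw [← hΛ₀]; rfl
  have jet_iff (hg : ∀ j, D1 (zv j) h.g = 0) (hl : h.push F.last = (0, 1)) :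
      (∀ Λ : CurveJet n, Λ.toClass = F.cls →
        (h.pushJet Λ).toClass = (CurveJet.mk (0, 1) 0).toClass) ↔
      (d2 h.g F.last).re + (D1 uv h.g).re * F.cls.accU = 0 := by
    have acc (Λ : CurveJet n) : (h.pushJet Λ).acc.2 =
        (d2 h.g Λ.vel).re + (D1 uv h.g).re * Λ.acc.2 := by
      rw [← d1g hg]; rfl
    constructor
    · intro H
      have := ((cls_iff _ _).1 (H Λ₀ hΛ₀)).2
      rw [acc, hvel, hacc] at this
      exact this
    · intro H Λ hΛ
      rw [← hΛ₀] at hΛ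
      obtain ⟨e1, e2⟩ := (cls_iff _ _).1 hΛ
      refine (cls_iff _ _).2 ⟨?_, ?_⟩
      · change h.push Λ.vel = _
        rw [e1, hvel, hl]
      · rw [acc, e1, e2, hvel, hacc, H]; rfl
  constructor
  · rintro ⟨⟨H1, H2, H3⟩, hf, hg⟩
    refine ⟨fun l j => ?_, hf, fun l => ?_, hg, ?_, (jet_iff hg H2).1 H3⟩
    · have := congrFun (congrArg Prod.fst (H1 j)) l
      change d1 _ _ = _ at this
      rw [d1_eq] at this
      simp only [hf, zero_mul, Finset.sum_const_zero, Complex.ofReal_zero, mul_zero,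
        add_zero] at this
      rw [this, Pi.single_apply]
      simp only [eq_comm]
    · have := congrFun (congrArg Prod.fst H2) l
      change d1 _ _ = _ at this
      rw [d1_eq] at this
      simp only [hf, zero_mul, Finset.sum_const_zero, zero_add] at this
      exact this
    · have := congrArg Prod.snd H2
      change (d1 _ _).re = _ at this
      rwa [d1g hg] at this
  · intro H
    have H2 : h.push F.last = (0, 1) := by
      refine Prod.ext (funext fun l => ?_) ?_
      · change d1 _ _ = _
        rw [d1_eq]
        simp only [H.f_zb, zero_mul, Finset.sum_const_zero, zero_add]
        exact H.f_u l
      · change (d1 _ _).re = _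
        rw [d1g H.g_z]
        exact H.g_u
    refine ⟨⟨fun j => Prod.ext (funext fun l => ?_) ?_, H2, (jet_iff H.g_z H2).2 H.g_uu⟩, H.f_zb,
      H.g_z⟩
    · change d1 _ _ = _
      rw [d1_eq]
      simp only [H.f_zb, zero_mul, Finset.sum_const_zero, Complex.ofReal_zero, mul_zero,
        add_zero]
      rw [H.f_z, Pi.single_apply]
      simp only [eq_comm]
    · change (d1 _ _).re = _
      rw [d1g H.g_z]
      simp

end FormalMap

end

/-! ### Reduction to a normalized linear part -/

section

variable {n s : ℕ} {𝒳 : Type*} {A : CoeffAlg 𝒳}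

/-! ### The linear part of a structure and adapted frames -/

theorem constantCoeff_app (Y : VF n) (p : Ser n) :
    constantCoeff (Y.app p) = ∑ i, constantCoeff (Y i) * D1 i p := by
  simp [VF.app, D1]

namespace FormalACR

theorem levi_eq (L : FormalACR n) (ξ η : Fin n → ℂ) : L.levi ξ η = 1 / (2 * Complex.I) *
    ∑ k, ∑ l, conj (ξ k) * η l * (D1 (zbv k) (L.w l) - conj (D1 (zbv l) (L.w k))) := by
  rw [levi, VF.bracket, map_sub, constantCoeff_app, constantCoeff_app, sum_var, sum_var]
  congr 1
  simp [VF.bar, field, constantCoeff_bar, L.zbar_zero, L.w_zero, D1_sum, D1_C_mul, bar_sum, bar_mul,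
    bar_C, D1_bar, Finset.mul_sum, mul_sub, Finset.sum_sub_distrib]
  congr 1
  · exact Finset.sum_congr rfl fun _ _ => Finset.sum_congr rfl fun _ _ => by ring
  · rw [Finset.sum_comm]
    exact Finset.sum_congr rfl fun _ _ => Finset.sum_congr rfl fun _ _ => by ring

theorem nonintW_eq (L : FormalACR n) (ξ η : Fin n → ℂ) : L.nonintW ξ η =
    ∑ k, ∑ l, ξ k * η l * (D1 (zv k) (L.w l) - D1 (zv l) (L.w k)) := by
  rw [nonintW, VF.bracket, map_sub, constantCoeff_app, constantCoeff_app, sum_var, sum_var]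
  simp [field, L.zbar_zero, L.w_zero, D1_sum, D1_C_mul, Finset.mul_sum, mul_sub,
    Finset.sum_sub_distrib]
  congr 1
  · exact Finset.sum_congr rfl fun _ _ => Finset.sum_congr rfl fun _ _ => by ring
  · rw [Finset.sum_comm]
    exact Finset.sum_congr rfl fun _ _ => Finset.sum_congr rfl fun _ _ => by ring

theorem levi_single (L : FormalACR n) (m j : Fin n) : L.levi (Pi.single m 1) (Pi.single j 1) =
    1 / (2 * Complex.I) * (D1 (zbv m) (L.w j) - conj (D1 (zbv j) (L.w m))) := by
  rw [levi_eq, Finset.sum_eq_single m, Finset.sum_eq_single j]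
  · simp
  · intro l _ h; simp [h]
  · simp
  · intro l _ h; simp [h]
  · simp

theorem constantCoeff_frame_app (L : FormalACR n) (j : Fin n) (p : Ser n) :
    constantCoeff ((L.frame j).app p) = D1 (zv j) p := by
  simp [FormalACR.frame_app, L.zbar_zero, L.w_zero, D1]

theorem D1_frame_app (L : FormalACR n) (i : Var n) (j : Fin n) (p : Ser n) :
    D1 i ((L.frame j).app p) = D2 i (zv j) p + (∑ k, D1 i (L.zbar k j) * D1 (zbv k) p +
      D1 i (L.w j) * D1 uv p) := by
  rw [frame_app, D1_add, D1_add, D1_sum, D1_mul, L.w_zero, zero_mul, add_zero]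
  simp only [D1_mul, L.zbar_zero, zero_mul, add_zero]
  rfl

end FormalACR

namespace FormalMap

variable {h k : FormalMap n} {V : Fin n → Fin n → ℂ} {v : Tangent n} {r : ℝ} {L L' : FormalACR n}

theorem Transforms.D1_zbv (H : h.Transforms L L') (l j : Fin n) : D1 (zbv j) (h.f l) = 0 := by
  have := congrArg constantCoeff ((transforms_iff.1 H j).1 l)
  rw [L.constantCoeff_frame_app, map_sum, D1_bar] at this
  simp only [map_mul, constantCoeff_subst_of_zero h.comp_zero, L'.zbar_zero, zero_mul,
    Finset.sum_const_zero] at this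
  simpa using this

theorem Transforms.D1_zv (H : h.Transforms L L') (j : Fin n) : D1 (zv j) h.g = 0 := by
  have := congrArg constantCoeff (transforms_iff.1 H j).2
  rw [L.constantCoeff_frame_app, map_sum] at this
  simpa only [map_mul, constantCoeff_subst_of_zero h.comp_zero, L'.w_zero, zero_mul,
    Finset.sum_const_zero] using this

/-- The first derivative at 0 of the transformation rule. The second derivatives of k.g enter
symmetrically in (z, z) and Hermitian symmetrically in (z̄, z), so they alter only these parts of
the linear part. The complementary parts are the invariants in `HasJet.nonintW` and `HasJet.levi`.
-/
theorem HasJet.D1_w (H : k.HasJet V v r) (T : k.Transforms L' L) (i : Var n) (j : Fin n) :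
    D1 i (L'.w j) * v.2 = ∑ l, D1 i (subst k.comp (L.w l)) * V j l - D2 i (zv j) k.g := by
  have := congrArg (D1 i) (transforms_iff.1 T j).2
  rw [L'.D1_frame_app, D1_sum] at this
  simp only [D1_mul, L'.constantCoeff_frame_app, constantCoeff_subst_of_zero k.comp_zero, L.w_zero,
    zero_mul, add_zero, H.g_zb, mul_zero, Finset.sum_const_zero, zero_add, H.g_u, H.f_z] at this
  linear_combination this

theorem HasJet.D1_zv_pull (H : k.HasJet V v r) (m : Fin n) (p : Ser n) :
    D1 (zv m) (subst k.comp p) = ∑ i, D1 (zv i) p * V m i := by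
  rw [D1_pull, sum_var]
  simp only [D1_comp_zbv, conjVar_zv, H.f_zb, map_zero, mul_zero, Finset.sum_const_zero, zero_add]
  simp [comp, H.f_z, H.g_z]

theorem HasJet.D1_zbv_pull (H : k.HasJet V v r) (m : Fin n) (p : Ser n) :
    D1 (zbv m) (subst k.comp p) = ∑ i, D1 (zbv i) p * conj (V m i) := by
  rw [D1_pull, sum_var]
  simp only [D1_comp_zbv, conjVar_zbv, H.f_z]
  simp [comp, H.f_zb, H.g_zb]

theorem HasJet.levi (H : k.HasJet V v r) (T : k.Transforms L' L) (m j : Fin n) :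
    (D1 (zbv m) (L'.w j) - conj (D1 (zbv j) (L'.w m))) * v.2 =
      2 * Complex.I * L.levi (V m) (V j) := by
  have hD : conj (D2 (zbv j) (zv m) k.g) = D2 (zbv m) (zv j) k.g := by
    rw [← D2_g_conj, D2_comm]; rfl
  have e1 := H.D1_w T (zbv m) j
  have e2 := congrArg conj (H.D1_w T (zbv j) m)
  rw [map_mul, Complex.conj_ofReal, map_sub, hD, map_sum] at e2
  rw [sub_mul, e1, e2, L.levi_eq, ← _root_.mul_assoc, mul_one_div_cancel (by simp), one_mul,
    sub_sub_sub_cancel_right]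
  simp only [H.D1_zbv_pull, map_mul, map_sum, Complex.conj_conj, Finset.sum_mul, mul_sub,
    Finset.sum_sub_distrib]
  congr 1
  · rw [Finset.sum_comm]
    exact Finset.sum_congr rfl fun _ _ => Finset.sum_congr rfl fun _ _ => by ring
  · exact Finset.sum_congr rfl fun _ _ => Finset.sum_congr rfl fun _ _ => by ring

theorem HasJet.nonintW (H : k.HasJet V v r) (T : k.Transforms L' L) (m j : Fin n) :
    (D1 (zv m) (L'.w j) - D1 (zv j) (L'.w m)) * v.2 = L.nonintW (V m) (V j) := by
  have e1 := H.D1_w T (zv m) j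
  have e2 := H.D1_w T (zv j) m
  rw [D2_comm] at e2
  rw [sub_mul, e1, e2, L.nonintW_eq, sub_sub_sub_cancel_right]
  simp only [H.D1_zv_pull, Finset.sum_mul, mul_sub, Finset.sum_sub_distrib]
  congr 1
  · rw [Finset.sum_comm]
    exact Finset.sum_congr rfl fun _ _ => Finset.sum_congr rfl fun _ _ => by ring
  · exact Finset.sum_congr rfl fun _ _ => Finset.sum_congr rfl fun _ _ => by ring

theorem isStd_of_comp_eq (hk : k.comp = X) : k.IsStd := by
  refine isStd_iff.2 ⟨fun i a => by rw [hk, D1_X], ?_⟩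
  have : k.g = X uv := congrFun hk uv
  rw [this, D2_X]

theorem IsInv.hasDualJet (hk : h.IsInv k) (H : k.HasJet V v r) (hV : LinearIndependent ℂ V) :
    h.HasDualJet V v r :=
  (isStd_mul_iff H hV).1 (isStd_of_comp_eq (funext fun i => by rw [comp_mul, hk]))

theorem exists_transforms_of_dualJet {L : 𝒳 → FormalACR n} (hL : FormalACR.IsFam A L)
    {h k : 𝒳 → FormalMap n} (hh : IsFam A h) (hk : IsFam A k) (hkh : ∀ x, (k x).IsInv (h x))
    {V : 𝒳 → Fin n → Fin n → ℂ} {v : 𝒳 → Tangent n} {r : 𝒳 → ℝ}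
    (H : ∀ x, (h x).HasDualJet (V x) (v x) (r x)) :
    ∃ L' : 𝒳 → FormalACR n, FormalACR.IsFam A L' ∧ ∀ x, (h x).Transforms (L x) (L' x) := by
  refine exists_transforms hL hh hk hkh (fun x h0 => ?_) (fun x m j => ?_) fun x j => (H x).g_z j
  · have e : Matrix.of (V x) * (Matrix.of fun j l => constantCoeff (pderiv ℂ (zv j) ((h x).f l))) =
        1 := by
      ext j l
      rw [Matrix.mul_apply, Matrix.one_apply, ← (H x).f_z l j]
      exact Finset.sum_congr rfl fun _ _ => mul_comm _ _
    have := congrArg Matrix.det e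
    rw [Matrix.det_mul, h0, mul_zero, Matrix.det_one] at this
    exact zero_ne_one this
  · have := D1_bar (zv j) ((h x).f m)
    rw [conjVar_zv, (H x).f_zb, map_zero] at this
    exact this

end FormalMap

/-- The structures whose linear part is normalized. -/
structure IsModel (s : ℕ) (M : FormalACR n) (B : Fin n → Fin n → ℂ) : Prop where
  w_zv : ∀ m l, D1 (zv m) (M.w l) = B m l
  w_zbv : ∀ m l, D1 (zbv m) (M.w l) = if m = l then Complex.I * sg s l else 0
  antisymm : ∀ m l, B m l = -B l m

theorem D2_X_mul_X (i j k l : Var n) : D2 i j (X k * X l : Ser n) =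
    (if j = k then 1 else 0) * (if i = l then 1 else 0) +
      (if i = k then 1 else 0) * (if j = l then 1 else 0) := by
  rw [D2_mul, D2_X, D2_X, D1_X, D1_X, D1_X, D1_X]
  simp

theorem D1_X_mul_X (i k l : Var n) : D1 i (X k * X l : Ser n) = 0 := by
  rw [D1_mul]; simp

/-- The components of the polynomial map with prescribed derivatives at `0`. -/
def polyF (V : Fin n → Fin n → ℂ) (v : Tangent n) (l : Fin n) : Ser n :=
  ∑ j, C (V j l) * X (zv j) + C (v.1 l) * X uv

/-- The real function with prescribed derivatives at `0`. -/
def polyG (v : Tangent n) (r : ℝ) (P Q : Fin n → Fin n → ℂ) : Ser n :=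
  C (v.2 : ℂ) * X uv + C ((r : ℂ) / 2) * (X uv * X uv) +
    ∑ m, ∑ j, (C (P m j / 2) * (X (zv m) * X (zv j)) +
      C (conj (P m j) / 2) * (X (zbv m) * X (zbv j)) +
      (C (Q m j / 2) * (X (zbv m) * X (zv j)) + C (conj (Q m j) / 2) * (X (zv m) * X (zbv j))))

theorem bar_polyG (v : Tangent n) (r : ℝ) (P Q : Fin n → Fin n → ℂ) :
    (polyG v r P Q).bar = polyG v r P Q := by
  simp only [polyG, bar_add, bar_mul, bar_sum, bar_C, bar_X, conjVar_zv, conjVar_zbv, map_div₀,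
    Complex.conj_conj, Complex.conj_ofReal, map_ofNat]
  refine congrArg (_ + ·) (Finset.sum_congr rfl fun m _ => Finset.sum_congr rfl fun j _ => ?_)
  rw [add_comm (C (P m j / 2) * _), add_comm (C (Q m j / 2) * _)]

/-- The polynomial map with prescribed derivatives at `0`. -/
def polyMap (V : Fin n → Fin n → ℂ) (v : Tangent n) (r : ℝ) (P Q : Fin n → Fin n → ℂ) :
    FormalMap n where
  f := polyF V v
  g := polyG v r P Q
  f_zero l := by simp [polyF]
  g_zero := by simp [polyG]
  g_real := bar_polyG v r P Q

theorem sum_sum_delta (a : Fin n → Fin n → ℂ) (i k : Fin n) :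
    ∑ m, ∑ j, a m j * ((if i = m then 1 else 0) * (if k = j then 1 else 0)) = a i k := by
  rw [Finset.sum_eq_single i, Finset.sum_eq_single k]
  · simp
  · intro j _ h; simp [h.symm]
  · simp
  · intro j _ h; simp [h.symm]
  · simp

theorem D2_zv_polyG (v : Tangent n) (r : ℝ) (P Q : Fin n → Fin n → ℂ) (m j : Fin n) :
    D2 (zv m) (zv j) (polyG v r P Q) = (P m j + P j m) / 2 := by
  have e := sum_sum_delta (fun m j => P m j / 2) j m
  have e' := sum_sum_delta (fun m j => P m j / 2) m j
  simp only [polyG, D2_add, D2_sum, D2_C_mul, D2_X, D2_X_mul_X, Sum.inl.injEq, reduceCtorEq,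
    if_false, mul_zero, zero_mul, add_zero, zero_add, mul_add, Finset.sum_add_distrib,
    Finset.sum_const_zero]
  rw [e, e']; ring

theorem D2_zbv_polyG (v : Tangent n) (r : ℝ) (P Q : Fin n → Fin n → ℂ) (m j : Fin n) :
    D2 (zbv m) (zv j) (polyG v r P Q) = (Q m j + conj (Q j m)) / 2 := by
  have e := sum_sum_delta (fun m j => Q m j / 2) m j
  have e' := sum_sum_delta (fun m j => conj (Q m j) / 2) j m
  simp only [polyG, D2_add, D2_sum, D2_C_mul, D2_X, D2_X_mul_X, Sum.inl.injEq, Sum.inr.injEq,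
    reduceCtorEq, if_false, mul_zero, zero_mul, add_zero, zero_add, Finset.sum_add_distrib,
    Finset.sum_const_zero]
  simp only [mul_comm (if j = _ then (1 : ℂ) else 0) (if m = _ then (1 : ℂ) else 0)] at *
  rw [e, e']; ring

theorem hasJet_polyMap (V : Fin n → Fin n → ℂ) (v : Tangent n) (r : ℝ)
    (P Q : Fin n → Fin n → ℂ) : (polyMap V v r P Q).HasJet V v r where
  f_z l j := by simp [polyMap, polyF, D1_add, D1_sum, D1_C_mul, D1_X]
  f_zb l j := by simp [polyMap, polyF, D1_add, D1_sum, D1_C_mul, D1_X]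
  f_u l := by simp [polyMap, polyF, D1_add, D1_sum, D1_C_mul, D1_X]
  g_z j := by simp [polyMap, polyG, D1_add, D1_sum, D1_C_mul, D1_X, D1_X_mul_X]
  g_u := by simp [polyMap, polyG, D1_add, D1_sum, D1_C_mul, D1_X, D1_X_mul_X]
  g_uu := by
    change D2 uv uv (polyG v r P Q) = r
    simp only [polyG, D2_add, D2_sum, D2_C_mul, D2_X, D2_X_mul_X, Sum.inr.injEq, reduceCtorEq, if_true, if_false,
      mul_zero, add_zero, Finset.sum_const_zero, zero_add]
    ring

theorem ExtFrame.last_ne_zero {L : FormalACR n} (F : ExtFrame L s) : F.last.2 ≠ 0 :=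
  fun h => F.last_notMem h

theorem sum_bilin_left (β : Fin n → Fin n → ℂ) (x b : Fin n → ℂ) (v : Fin n → Fin n → ℂ) :
    ∑ k, ∑ l, (∑ m, x m * v m k) * b l * β k l = ∑ m, x m * ∑ k, ∑ l, v m k * b l * β k l := by
  simp only [Finset.mul_sum, Finset.sum_mul]
  rw [Finset.sum_comm]
  simp only [fun l => Finset.sum_comm (s := Finset.univ) (t := Finset.univ)
    (f := fun k m => x m * v m k * b l * β k l)]
  rw [Finset.sum_comm]
  refine Finset.sum_congr rfl fun m _ => ?_
  rw [Finset.sum_comm]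
  exact Finset.sum_congr rfl fun _ _ => Finset.sum_congr rfl fun _ _ => by ring

theorem sum_bilin_right (β : Fin n → Fin n → ℂ) (a ζ : Fin n → ℂ) :
    ∑ k, ∑ l, a k * ζ l * β k l =
      ∑ l, ζ l * ∑ k, ∑ j, a k * (Pi.single l 1 : Fin n → ℂ) j * β k j := by
  rw [Finset.sum_comm]
  refine Finset.sum_congr rfl fun l _ => ?_
  rw [Finset.mul_sum]
  refine Finset.sum_congr rfl fun k _ => ?_
  rw [Finset.sum_eq_single l]
  · rw [Pi.single_eq_same]; ring
  · intro j _ h; simp [h]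
  · simp

/-- For η = Σ ξ_m v_m, the form 6i𝓛 + 𝓝^w evaluated on (η, v_j) is twice the u-component of v_{n+1}
times 3iε_j ξ̄_j - Σ B_jl ξ_l, because 𝓝^w(v_m, v_j) is 2B_mj times this u-component. -/
theorem nondeg_of_stronglyNondegenerate {L M : FormalACR n} (hL : L.StronglyNondegenerate)
    (F : ExtFrame L s) {q : FormalMap n} (hq : q.HasJet F.v F.last F.cls.accU)
    (hT : q.Transforms M L) {B : Fin n → Fin n → ℂ} (hM : IsModel s M B) : Nondeg s B := by
  intro ξ hξ
  have t0 : (F.last.2 : ℂ) ≠ 0 := by exact_mod_cast F.last_ne_zero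
  set η : Fin n → ℂ := ∑ m, ξ m • F.v m with hη
  have hηk (k : Fin n) : η k = ∑ m, ξ m * F.v m k := by simp [hη]
  have levi_sum (j : Fin n) : L.levi η (F.v j) = ∑ m, conj (ξ m) * L.levi (F.v m) (F.v j) := by
    simp only [L.levi_eq, hηk, map_sum, map_mul, sum_bilin_left]
    rw [Finset.mul_sum]
    exact Finset.sum_congr rfl fun _ _ => by ring
  have nonint_sum (j : Fin n) : L.nonintW η (F.v j) = ∑ m, ξ m * L.nonintW (F.v m) (F.v j) := by
    simp only [L.nonintW_eq, hηk, sum_bilin_left]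
  have basis (j : Fin n) : 6 * Complex.I * L.levi η (F.v j) + L.nonintW η (F.v j) = 0 := by
    have e (m : Fin n) : L.nonintW (F.v m) (F.v j) = 2 * B m j * F.last.2 := by
      rw [← hq.nonintW hT, hM.w_zv, hM.w_zv, hM.antisymm j m]; ring
    rw [levi_sum, nonint_sum, Finset.sum_eq_single j (by
      intro m _ h; rw [F.levi_orthonormal, if_neg h]; simp) (by simp), F.levi_orthonormal,
      if_pos rfl]
    simp only [e]
    have := hξ j
    rw [sub_eq_zero] at this
    have e2 : ∑ m, ξ m * (2 * B m j * F.last.2) = -(2 * F.last.2 * ∑ l, B j l * ξ l) := by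
      rw [Finset.mul_sum, ← Finset.sum_neg_distrib]
      exact Finset.sum_congr rfl fun m _ => by rw [hM.antisymm j m]; ring
    rw [e2, ← this, Complex.ofReal_mul]
    change 6 * Complex.I * (conj (ξ j) * (sg s j * _)) + _ = _
    ring
  have key (ζ : Fin n → ℂ) : 6 * Complex.I * L.levi η ζ + L.nonintW η ζ =
      ∑ l, ζ l * (6 * Complex.I * L.levi η (Pi.single l 1) + L.nonintW η (Pi.single l 1)) := by
    simp only [mul_add, Finset.sum_add_distrib]
    congr 1
    · rw [L.levi_eq, sum_bilin_right, Finset.mul_sum, Finset.mul_sum]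
      exact Finset.sum_congr rfl fun l _ => by rw [L.levi_eq]; ring
    · rw [L.nonintW_eq, sum_bilin_right]
      exact Finset.sum_congr rfl fun l _ => by rw [L.nonintW_eq]
  have hz := FormalMap.eq_zero_of_linearIndependent F.linearIndependent (w := fun l =>
    6 * Complex.I * L.levi η (Pi.single l 1) + L.nonintW η (Pi.single l 1)) fun j => by
      rw [← basis j, key (F.v j)]
      exact Finset.sum_congr rfl fun _ _ => mul_comm _ _
  have h0 := hL.2 η fun ζ => by
    rw [key]
    exact Finset.sum_eq_zero fun l _ => by rw [show _ = _ from congrFun hz l]; simp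
  exact funext (Fintype.linearIndependent_iff.1 F.linearIndependent ξ h0)

/-- The polynomial map realizes the frame as its jet, and its quadratic terms remove the part of the
first derivatives of L^w that is not invariant. What remains is half of 𝓝^w and the diagonalized
Levi form. -/
theorem exists_model {L : 𝒳 → FormalACR n} (hL : FormalACR.IsFam A L)
    (hS : ∀ x, (L x).StronglyNondegenerate) (F : ∀ x, ExtFrame (L x) s)
    (hV : ∀ j l, A.Sc fun x => (F x).v j l) (hv : ∀ l, A.Sc fun x => (F x).last.1 l)
    (ht : A.Sc fun x => ((F x).last.2 : ℂ)) (hr : A.Sc fun x => ((F x).cls.accU : ℂ)) :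
    ∃ (q q' : 𝒳 → FormalMap n) (M : 𝒳 → FormalACR n) (B : 𝒳 → Fin n → Fin n → ℂ),
      FormalMap.IsFam A q ∧ FormalMap.IsFam A q' ∧ FormalACR.IsFam A M ∧
      (∀ k l, A.Sc fun x => B x k l) ∧ ∀ x, (q' x).IsInv (q x) ∧
        (q x).HasJet (F x).v (F x).last (F x).cls.accU ∧ (q' x).Transforms (L x) (M x) ∧
        IsModel s (M x) (B x) ∧ Nondeg s (B x) := by
  -- P and Q are the first derivatives of L^w in z and z̄, expressed in the frame. `polyG` has the
  -- symmetric part of P and the Hermitian part of Q as second derivatives, so `HasJet.D1_w` leaves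
  -- the antisymmetric and skew-Hermitian parts.
  let P : 𝒳 → Fin n → Fin n → ℂ := fun x m j =>
    ∑ l, (∑ i, D1 (zv i) ((L x).w l) * (F x).v m i) * (F x).v j l
  let Q : 𝒳 → Fin n → Fin n → ℂ := fun x m j =>
    ∑ l, (∑ i, D1 (zbv i) ((L x).w l) * conj ((F x).v m i)) * (F x).v j l
  have hP (m j : Fin n) : A.Sc fun x => P x m j :=
    .sum fun l _ => (CoeffAlg.Sc.sum fun i _ =>
      (((hL.2 l).pderiv _).constantCoeff).mul (hV m i)).mul (hV j l)
  have hQ (m j : Fin n) : A.Sc fun x => Q x m j :=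
    .sum fun l _ => (CoeffAlg.Sc.sum fun i _ =>
      (((hL.2 l).pderiv _).constantCoeff).mul (hV m i).conj).mul (hV j l)
  let q : 𝒳 → FormalMap n := fun x => polyMap (F x).v (F x).last (F x).cls.accU (P x) (Q x)
  have half {f : 𝒳 → ℂ} (hf : A.Sc f) : A.Sc fun x => f x / 2 :=
    hf.div (.const 2) fun _ => two_ne_zero
  have hq : FormalMap.IsFam A q := by
    refine ⟨fun l => ?_, ?_⟩
    · exact (CoeffAlg.IsSer.sum fun j _ => .C_mul (hV j l) (.const _)).add (.C_mul (hv l) (.const _))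
    · refine ((CoeffAlg.IsSer.C_mul ht (.const _)).add (.C_mul (half hr) (.const _))).add
        (.sum fun m _ => .sum fun j _ => ?_)
      exact ((CoeffAlg.IsSer.C_mul (half (hP m j)) (.const _)).add
        (.C_mul (half (hP m j).conj) (.const _))).add
        ((CoeffAlg.IsSer.C_mul (half (hQ m j)) (.const _)).add
          (.C_mul (half (hQ m j).conj) (.const _)))
  have jet (x : 𝒳) : (q x).HasJet (F x).v (F x).last (F x).cls.accU := hasJet_polyMap ..
  obtain ⟨q', hq', hinv⟩ := FormalMap.exists_isInv q hq fun x =>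
    (jet x).det_ne_zero (F x).linearIndependent (F x).last_ne_zero
  obtain ⟨M, hM, hT⟩ := FormalMap.exists_transforms_of_dualJet hL hq' hq (fun x => (hinv x).symm)
    fun x => (hinv x).hasDualJet (jet x) (F x).linearIndependent
  have hmodel (x : 𝒳) : IsModel s (M x) fun m l => D1 (zv m) ((M x).w l) := by
    have hT' := (hT x).symm (hinv x)
    have t0 : ((F x).last.2 : ℂ) ≠ 0 := by exact_mod_cast (F x).last_ne_zero
    have ha (m l : Fin n) : D1 (zv m) ((M x).w l) * (F x).last.2 = (P x m l - P x l m) / 2 := by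
      rw [(jet x).D1_w hT']
      simp only [(jet x).D1_zv_pull]
      rw [show (q x).g = polyG (F x).last (F x).cls.accU (P x) (Q x) from rfl, D2_zv_polyG]
      change P x m l - _ = _
      ring
    refine ⟨fun _ _ => rfl, fun m l => mul_right_cancel₀ t0 ?_, fun m l => mul_right_cancel₀ t0 ?_⟩
    · have e1 : D1 (zbv m) ((M x).w l) * (F x).last.2 = (Q x m l - conj (Q x l m)) / 2 := by
        rw [(jet x).D1_w hT']
        simp only [(jet x).D1_zbv_pull]
        rw [show (q x).g = polyG (F x).last (F x).cls.accU (P x) (Q x) from rfl, D2_zbv_polyG]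
        change Q x m l - _ = _
        ring
      have e2 : conj (D1 (zbv l) ((M x).w m)) * (F x).last.2 = (conj (Q x l m) - Q x m l) / 2 := by
        rw [← Complex.conj_ofReal ((F x).last.2), ← map_mul, (jet x).D1_w hT']
        simp only [(jet x).D1_zbv_pull]
        rw [show (q x).g = polyG (F x).last (F x).cls.accU (P x) (Q x) from rfl, D2_zbv_polyG]
        change conj (Q x l m - _) = _
        rw [map_sub, map_div₀, map_add, Complex.conj_conj, map_ofNat]
        ring
      have e3 := (jet x).levi hT' m l
      rw [(F x).levi_orthonormal] at e3
      split_ifs at e3 ⊢ with hml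
      · subst hml
        rw [Complex.ofReal_mul] at e3
        change _ = _ * (sg s m * _) at e3
        linear_combination (1 / 2 : ℂ) * e3 + (1 / 2 : ℂ) * (e1 + e2)
      · rw [Complex.ofReal_zero] at e3
        linear_combination (1 / 2 : ℂ) * e3 + (1 / 2 : ℂ) * (e1 + e2)
    · linear_combination ha m l + ha l m
  exact ⟨q, q', M, _, hq, hq', hM, fun k l => ((hM.2 l).pderiv _).constantCoeff, fun x =>
    ⟨hinv x, jet x, hT x, hmodel x, nondeg_of_stronglyNondegenerate (hS x) (F x) (jet x)
      ((hT x).symm (hinv x)) (hmodel x)⟩⟩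

end

/-! ### From transport along the Euler field to the fixed-point equations -/

section

variable {n s : ℕ} {𝒳 : Type*} {A : CoeffAlg 𝒳}

/-! ### The nonlinear equations and transformations of structures -/

/-- The field with components `(z, 0, p)`. -/
def eulField (p : Ser n) : VF n
  | Sum.inl j => X (zv j)
  | Sum.inr (Sum.inl _) => 0
  | Sum.inr (Sum.inr _) => p

theorem eulField_app (p q : Ser n) : (eulField p).app q = eul n q + p * ∂ᵤ q := by
  rw [VF.app, sum_var, eul_apply]
  simp [eulField]

/-- The quadratic part of the `w`-component of a structure with normalized linear part. -/
def quadW (s : ℕ) (M : FormalACR n) (B : Fin n → Fin n → ℂ) (l : Fin n) : Ser n :=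
  M.w l - linW s B (fun k => X (zv k)) (fun k => X (zbv k)) l

theorem mem_wIdeal_two {p : Ser n} (h0 : constantCoeff p = 0) (hz : ∀ j, D1 (zv j) p = 0)
    (hzb : ∀ j, D1 (zbv j) p = 0) : p ∈ wIdeal (hwt n) 2 := by
  intro m hm
  by_cases hm0 : m = 0
  · rw [hm0, coeff_zero_eq_constantCoeff_apply, h0]
  obtain ⟨i, hi⟩ := Finsupp.ne_iff.1 hm0
  obtain ⟨m', rfl⟩ := exists_add_of_le (Finsupp.single_le_iff.2 (Nat.one_le_iff_ne_zero.2 hi))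
  rw [map_add, Finsupp.weight_single, one_smul] at hm
  have hm' : m' = 0 := by
    by_contra h
    obtain ⟨j, hj⟩ := Finsupp.ne_iff.1 h
    obtain ⟨m'', rfl⟩ := exists_add_of_le (Finsupp.single_le_iff.2 (Nat.one_le_iff_ne_zero.2 hj))
    rw [map_add, Finsupp.weight_single, one_smul] at hm
    have := one_le_hwt i; have := one_le_hwt j; omega
  rw [hm', add_zero, ← D1_eq_coeff]
  have hu : ∀ t, hwt n (Sum.inr (Sum.inr t)) = 2 := fun _ => rfl
  rcases i with i | i | i
  · exact hz i
  · exact hzb i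
  · rw [hu] at hm; omega

theorem mem_wIdeal_three {p : Ser n} (h0 : constantCoeff p = 0) (h1 : ∀ i, D1 i p = 0)
    (hz : ∀ i j, D2 (zv i) (zv j) p = 0) (hzb : ∀ i j, D2 (zbv i) (zv j) p = 0)
    (hb : ∀ i j, D2 (zbv i) (zbv j) p = 0) : p ∈ wIdeal (hwt n) 3 := by
  intro m hm
  by_cases hm0 : m = 0
  · rw [hm0, coeff_zero_eq_constantCoeff_apply, h0]
  obtain ⟨i, hi⟩ := Finsupp.ne_iff.1 hm0
  obtain ⟨m', rfl⟩ := exists_add_of_le (Finsupp.single_le_iff.2 (Nat.one_le_iff_ne_zero.2 hi))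
  rw [map_add, Finsupp.weight_single, one_smul] at hm
  by_cases hm' : m' = 0
  · rw [hm', add_zero, ← D1_eq_coeff, h1]
  obtain ⟨j, hj⟩ := Finsupp.ne_iff.1 hm'
  obtain ⟨m'', rfl⟩ := exists_add_of_le (Finsupp.single_le_iff.2 (Nat.one_le_iff_ne_zero.2 hj))
  rw [map_add, Finsupp.weight_single, one_smul] at hm
  have hi1 := one_le_hwt i
  have hj1 := one_le_hwt j
  have hm'' : m'' = 0 := by
    by_contra h
    obtain ⟨k, hk⟩ := Finsupp.ne_iff.1 h
    obtain ⟨m₃, rfl⟩ := exists_add_of_le (Finsupp.single_le_iff.2 (Nat.one_le_iff_ne_zero.2 hk))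
    rw [map_add, Finsupp.weight_single, one_smul] at hm
    have := one_le_hwt k; omega
  rw [hm'', add_zero]
  refine coeff_eq_zero_of_D2 ?_
  have hu : ∀ t, hwt n (Sum.inr (Sum.inr t)) = 2 := fun _ => rfl
  rcases i with i | i | i <;> rcases j with j | j | j
  · exact hz j i
  · exact hzb j i
  · rw [hu] at hm; omega
  · rw [D2_comm]; exact hzb i j
  · exact hb j i
  all_goals rw [hu] at hm; omega

/-- Bidegrees (a, 0), (0, b) and (1, 1) are absent, and any other monomial has weight at least 3. -/
theorem IsNF.mem_three {ψ : Ser n} (h : IsNF n s ψ) : ψ ∈ wIdeal (hwt n) 3 := by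
  intro m hm
  rw [weight_hwt] at hm
  have hc : coeff m ψ = coeff m (bi (∑ j, m (zv j)) (∑ j, m (zbv j)) ψ) := by
    rw [coeff_bi, if_pos ⟨rfl, rfl⟩]
  rw [hc]
  have hl (b : ℕ) : bi 0 b ψ = 0 := AlmostCR.mem_zIdeal.1 h.mem_zIdeal b
  generalize (∑ j, m (zv j)) = a at *
  generalize (∑ j, m (zbv j)) = b at *
  rcases a with _ | _ | a
  · rw [hl, map_zero]
  · rcases b with _ | _ | b
    · rw [h.right_zero, map_zero]
    · rw [h.one_one, map_zero]
    · omega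
  · rcases b with _ | b
    · rw [h.right_zero, map_zero]
    · omega

/-- Only the linear terms in z and z̄ have weight less than 2; a linear term in u may remain. -/
theorem IsModel.quadW_mem {M : FormalACR n} {B : Fin n → Fin n → ℂ} (H : IsModel s M B) (l : Fin n) :
    quadW s M B l ∈ wIdeal (hwt n) 2 := by
  have D (i : Var n) : D1 i (quadW s M B l) =
      D1 i (M.w l) - D1 i (linW s B (fun k => X (zv k)) (fun k => X (zbv k)) l) := by
    simp [quadW, D1]
  refine mem_wIdeal_two ?_ (fun j => ?_) fun j => ?_
  · simp [quadW, linW, M.w_zero]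
  · rw [D, H.w_zv]
    simp [linW, D1_add, D1_sum, D1_C_mul, D1_X, -map_mul]
  · rw [D, H.w_zbv]
    simp [linW, D1_add, D1_sum, D1_C_mul, D1_X, -map_mul]

section Equations

variable {M : FormalACR n} {B : Fin n → Fin n → ℂ} {f : Fin n → Ser n} {g ψ : Ser n}
  {k : FormalMap n} {T : Bool}

theorem eulField_app_pdev (q : Ser n) :
    (eulField (cI * rho n s + pdev n s T ψ)).app q = DD n s q + pdev n s T ψ * ∂ᵤ q := by
  rw [eulField_app, DD_apply]; ring

theorem DD_X_zv (l : Fin n) : DD n s (X (zv l)) = X (zv l) := by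
  simp [DD_apply, eul_apply, pderiv_zv_zv]

theorem eulField_app_zv (l : Fin n) :
    (eulField (cI * rho n s + pdev n s T ψ)).app (X (zv l) + f l) = eulMap s T f ψ l := by
  rw [eulField_app_pdev, map_add, map_add, DD_X_zv, pderiv_uv_zv, eulMap]; ring

theorem sum_linW_mul (hB : ∀ m l, B m l = -B l m) :
    ∑ l, linW s B (fun k => X (zv k)) (fun k => X (zbv k)) l * X (zv l) = cI * rho n s := by
  have e1 : ∑ l, ∑ k, C (B k l) * X (zv k) * X (zv l) = (0 : Ser n) := by
    have h : ∑ l, ∑ k, C (B k l) * X (zv k) * X (zv l) =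
        -∑ l, ∑ k, C (B k l) * X (zv k) * (X (zv l) : Ser n) := by
      conv_lhs => rw [Finset.sum_comm]
      simp only [← Finset.sum_neg_distrib]
      refine Finset.sum_congr rfl fun l _ => Finset.sum_congr rfl fun k _ => ?_
      rw [hB l k, map_neg]; ring
    ext m
    have := congrArg (coeff m) h
    rw [map_neg] at this
    exact self_eq_neg.1 this
  simp only [linW, add_mul, Finset.sum_mul, Finset.sum_add_distrib]
  rw [e1, zero_add, rho, Finset.mul_sum]
  refine Finset.sum_congr rfl fun l _ => ?_
  rw [map_mul, cI]; ring

theorem sum_linW_mul_left (a : Fin n → Ser n) :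
    ∑ l, linW s B (fun k => X (zv k)) (fun k => X (zbv k)) l * a l = nz B a + cI * herm s a := by
  simp only [linW, add_mul, Finset.sum_mul, Finset.sum_add_distrib, nz, herm, Finset.mul_sum]
  congr 1
  · rw [Finset.sum_comm]
    exact Finset.sum_congr rfl fun _ _ => Finset.sum_congr rfl fun _ _ => by ring
  · refine Finset.sum_congr rfl fun l _ => ?_
    rw [map_mul, cI]; ring

theorem sum_linW_mul_right (hB : ∀ m l, B m l = -B l m) (a : Fin n → Ser n) :
    ∑ l, linW s B a (fun k => (a k).bar) l * X (zv l) = -nz B a + cI * (herm s a).bar := by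
  simp only [linW, add_mul, Finset.sum_mul, Finset.sum_add_distrib, nz, herm, bar_sum, bar_mul,
    bar_C, bar_X, conj_sg, conjVar_zbv, Finset.mul_sum, ← Finset.sum_neg_distrib]
  congr 1
  · refine Finset.sum_congr rfl fun l _ => Finset.sum_congr rfl fun k _ => ?_
    rw [hB k l, map_neg]; ring
  · refine Finset.sum_congr rfl fun l _ => ?_
    rw [map_mul, cI]; ring

theorem nz_sub (a b : Fin n → Ser n) : nz B (fun l => a l - b l) = nz B a - nz B b := by
  simp only [nz, mul_sub, Finset.sum_sub_distrib]

/-- The first equation is the z̄-component, conjugated. In the w-component, antisymmetry of B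
removes Σ B_kl z_k z_l, the terms of order zero cancel as iρ, the terms linear in f make up `qop`,
and everything else is `rhsG`. -/
theorem rel_iff (hM : IsModel s M B) (hk : k.comp = nearId f g) :
    k.Rel (eulField (cI * rho n s + pdev n s T ψ)) M ↔
      (∀ m, DDb n s (f m) = rhsF s T M.zbar f g ψ m) ∧
        DD n s g + cI * modeOp n s T ψ = qop s B f + rhsG s T B (quadW s M B) f g ψ := by
  have kf (l : Fin n) : k.f l = X (zv l) + f l := congrFun hk (zv l)
  have kg : k.g = X uv + g := congrFun hk uv
  refine and_congr (forall_congr' fun m => ?_) ?_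
  · rw [kf, bar_add, bar_X, conjVar_zv, eulField_app_pdev, hk]
    simp only [kf, eulField_app_zv]
    have e1 : DD n s (X (zbv m) + (f m).bar) = DD n s (f m).bar := by
      rw [map_add, DD_apply, eul_apply]
      simp
    rw [e1, map_add, pderiv_X_ne (by simp), zero_add, rhsF, ← eq_sub_iff_add_eq]
    constructor
    · intro h
      rw [← h, bar_DD, bar_bar]
    · intro h
      rw [← bar_bar (DD n s _), bar_DD, bar_bar, h, bar_bar]
  · rw [kg, eulField_app_pdev, hk]
    simp only [kf, eulField_app_zv]
    have e1 : DD n s (X uv) = cI * rho n s := by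
      rw [DD_apply, eul_apply, pderiv_X_self]
      simp
    have e2 (l : Fin n) : subst (nearId f g) (M.w l) = subst (nearId f g) (quadW s M B l) +
        (linW s B (fun k => X (zv k)) (fun k => X (zbv k)) l + linW s B f (fun k => (f k).bar) l) := by
      have hs : HasSubst (nearId f g) := hk ▸ k.hasSubst
      have h : M.w l = quadW s M B l + linW s B (fun k => X (zv k)) (fun k => X (zbv k)) l := by
        rw [quadW]; ring
      conv_lhs => rw [h]
      rw [subst_add hs, linW, ← coe_substAlgHom hs]
      simp only [map_add, map_sum, map_mul]
      rw [coe_substAlgHom hs]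
      simp only [subst_C_eq hs, subst_X hs, nearId, linW, mul_add, Finset.sum_add_distrib, map_mul]
      ring
    rw [map_add, map_add, e1, pderiv_X_self]
    have e3 : ∑ l, subst (nearId f g) (M.w l) * eulMap s T f ψ l = cI * rho n s + qop s B f +
        (rhsG s T B (quadW s M B) f g ψ + pdev n s T ψ * ∂ᵤ g +
          (pdev n s T ψ - cI * modeOp n s T ψ)) := by
      have q1 := sum_linW_mul (s := s) hM.antisymm
      have q2 := sum_linW_mul_left (s := s) (B := B) fun l => DD n s (f l)
      have q3 := sum_linW_mul_right (s := s) hM.antisymm f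
      have q4 : ∑ l, subst (nearId f g) (M.w l) * eulMap s T f ψ l =
          ∑ l, linW s B (fun k => X (zv k)) (fun k => X (zbv k)) l * X (zv l) +
          ∑ l, linW s B (fun k => X (zv k)) (fun k => X (zbv k)) l * DD n s (f l) +
          ∑ l, linW s B f (fun k => (f k).bar) l * X (zv l) +
          ∑ l, (subst (nearId f g) (quadW s M B l) * eulMap s T f ψ l +
            linW s B (fun k => X (zv k)) (fun k => X (zbv k)) l * (pdev n s T ψ * ∂ᵤ (f l)) +
            linW s B f (fun k => (f k).bar) l * (DD n s (f l) + pdev n s T ψ * ∂ᵤ (f l))) := by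
        simp only [← Finset.sum_add_distrib]
        refine Finset.sum_congr rfl fun l _ => ?_
        rw [e2, eulMap]; ring
      rw [q4, q1, q2, q3, rhsG, qop, nz_sub]
      ring
    rw [e3]
    constructor
    · intro h; linear_combination h
    · intro h; linear_combination h

end Equations

end

/-! ### The normal form in terms of bihomogeneous components -/

section

variable {n s : ℕ} {𝒳 : Type*} {A : CoeffAlg 𝒳}

/-! ### The normal form -/

/-- The weights counting the degree in `u`. -/
def uwt (n : ℕ) : Var n → ℕ
  | Sum.inr (Sum.inr _) => 1
  | _ => 0

theorem weight_uwt (m : Var n →₀ ℕ) : Finsupp.weight (uwt n) m = m uv := by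
  rw [Finsupp.weight_eq_sum, sum_var]
  simp [uwt]

/-- The factor `a! b! c!`. -/
def facts (a b c : ℕ) : ℂ := ((Nat.factorial a * Nat.factorial b * Nat.factorial c : ℕ) : ℂ)

theorem facts_ne_zero (a b c : ℕ) : facts a b c ≠ 0 := by
  rw [facts, Nat.cast_ne_zero]
  exact mul_ne_zero (mul_ne_zero a.factorial_ne_zero b.factorial_ne_zero) c.factorial_ne_zero

theorem hder_eq (a b c : ℕ) (p : Ser n) :
    p.hder a b c = C (facts a b c) * gr (uwt n) c (bi a b p) := by
  ext m
  rw [coeff_C_mul, coeff_gr, coeff_bi, weight_uwt]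
  change (if _ then _ else _) = _
  by_cases h1 : m uv = c <;> by_cases h2 : (∑ j, m (zv j)) = a <;>
    by_cases h3 : (∑ j, m (zbv j)) = b <;> simp [h1, h2, h3, facts]

theorem C_mul_gr_eq_zero {a b : ℕ} {p : Ser n} :
    (∀ c, C (facts a b c) * gr (uwt n) c p = 0) ↔ p = 0 := by
  refine ⟨fun h => ?_, fun h => by simp [h]⟩
  ext m
  have := congrArg (coeff m) (h (m uv))
  rw [coeff_C_mul, coeff_gr, weight_uwt, if_pos rfl, map_zero] at this
  exact (mul_eq_zero.1 this).resolve_left (facts_ne_zero _ _ _)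

theorem hder_eq_zero_iff {a b : ℕ} {p : Ser n} : (∀ c, p.hder a b c = 0) ↔ bi a b p = 0 := by
  simp only [hder_eq, C_mul_gr_eq_zero]

theorem trc_C_mul_gr (c : ℕ) (x : ℂ) (p : Ser n) :
    trc n s (C x * gr (uwt n) c p) = C x * gr (uwt n) c (trc n s p) := by
  simp only [trc_apply, map_sum, gr_C_mul, Finset.mul_sum, pderiv_C_mul]
  refine Finset.sum_congr rfl fun j _ => ?_
  have e1 := gr_pderiv (w := uwt n) (d := c) (p := p) (zv j)
  have e2 := gr_pderiv (w := uwt n) (d := c) (p := pderiv ℂ (zv j) p) (zbv j)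
  simp only [uwt, add_zero] at e1 e2
  rw [e2, e1]; ring

theorem bi_rho_of_ne {a b : ℕ} (h : ¬(a = 1 ∧ b = 1)) : bi a b (rho n s) = 0 := by
  have : rho n s = bi 1 1 (rho n s) := by
    have := bi_rho_mul_of (n := n) (s := s) (a := 0) (b := 0) (q := 1) (by
      ext m
      rw [coeff_bi, coeff_one]
      by_cases hm : m = 0
      · simp [hm]
      · simp [hm])
    simpa using this.symm
  rw [this, bi_bi_of_ne h]

theorem bi_one_one_rho : bi 1 1 (rho n s) = rho n s := by
  refine ext_bi fun a b => ?_
  by_cases h : a = 1 ∧ b = 1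
  · rw [h.1, h.2, bi_bi_self]
  · rw [bi_rho_of_ne h, bi_bi_of_ne h]

theorem hder_rho (a b c : ℕ) : (rho n s).hder a b (c + 1) = 0 := by
  ext m
  rw [hder_eq, coeff_C_mul, coeff_gr, coeff_bi, weight_uwt, map_zero]
  split_ifs with h1 h2
  · obtain ⟨m', rfl⟩ := exists_add_of_le
      ((Finsupp.single_le_iff.2 (by omega) : Finsupp.single (uv : Var n) 1 ≤ m))
    have := congrArg (coeff m') (pderiv_uv_rho (n := n) (s := s))
    rw [coeff_pderiv, add_comm, map_zero] at this
    rw [(mul_eq_zero.1 this).resolve_right (Nat.cast_add_one_ne_zero _), mul_zero]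
  all_goals simp

theorem D2_rho (m j : Fin n) : D2 (zbv m) (zv j) (rho n s) = if m = j then sg s j else 0 := by
  rw [D2, pderiv_zv_rho, pderiv_C_mul, pderiv_zbv_zbv]
  split_ifs <;> simp

theorem isNF_iff {φ : Ser n} : IsNF n s (φ - rho n s) ↔ φ.bar = φ ∧ bi 1 1 φ = rho n s ∧
    (∀ a, bi a 0 φ = 0) ∧ (∀ a, bi (a + 2) 1 φ = 0) ∧ trc n s (bi 2 2 φ) = 0 ∧
    trc n s (trc n s (bi 3 2 φ)) = 0 ∧ trc n s (trc n s (trc n s (bi 3 3 φ))) = 0 := by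
  have e {a b : ℕ} (h : ¬(a = 1 ∧ b = 1)) : bi a b (φ - rho n s) = bi a b φ := by
    rw [map_sub, bi_rho_of_ne h, sub_zero]
  constructor
  · intro h
    refine ⟨?_, ?_, fun a => ?_, fun a => ?_, ?_, ?_, ?_⟩
    · have := h.real
      rwa [bar_sub, bar_rho, sub_left_inj] at this
    · have := h.one_one
      rwa [map_sub, bi_one_one_rho, sub_eq_zero] at this
    · rw [← h.right_zero a, e (by omega)]
    · rw [← h.right_one a, e (by omega)]
    · rw [← h.two_two, e (by omega)]
    · rw [← h.three_two, e (by omega)]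
    · rw [← h.three_three, e (by omega)]
  · rintro ⟨h1, h2, h3, h4, h5, h6, h7⟩
    refine ⟨?_, fun a => ?_, ?_, fun a => ?_, ?_, ?_, ?_⟩
    · rw [bar_sub, bar_rho, h1]
    · rw [e (by omega), h3]
    · rw [map_sub, bi_one_one_rho, h2, sub_self]
    · rw [e (by omega), h4]
    · rw [e (by omega), h5]
    · rw [e (by omega), h6]
    · rw [e (by omega), h7]

/-- The first hypothesis removes all positive powers of u in bidegree (1, 1), and the second fixes
the quadratic terms at the origin. -/
theorem bi_one_one_eq_rho {φ : Ser n} (h : ∀ c, φ.hder 1 1 (c + 1) = 0)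
    (hD : ∀ m j, D2 (zbv m) (zv j) φ = if m = j then sg s j else 0) : bi 1 1 φ = rho n s := by
  rw [← bi_one_one_rho, ← sub_eq_zero, ← map_sub]
  ext m
  rw [coeff_bi, map_zero]
  split_ifs with hm
  swap
  · rfl
  rcases Nat.eq_zero_or_pos (m uv) with hu | hu
  · have hm0 : m ≠ 0 := by rintro rfl; simp at hm
    obtain ⟨i, hi⟩ : ∃ i, m (zv i) ≠ 0 := by
      by_contra! hc
      simp [hc] at hm
    obtain ⟨j, hj⟩ : ∃ j, m (zbv j) ≠ 0 := by
      by_contra! hc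
      simp [hc] at hm
    have hle : Finsupp.single (zv i) 1 + Finsupp.single (zbv j) 1 ≤ m := by
      intro x
      rw [Finsupp.add_apply]
      by_cases hx : x = zv i
      · subst hx; simp; omega
      · by_cases hx' : x = zbv j
        · subst hx'; simp; omega
        · rw [Finsupp.single_eq_of_ne hx, Finsupp.single_eq_of_ne hx']; exact Nat.zero_le _
    obtain ⟨m', rfl⟩ := exists_add_of_le hle
    have hm' : m' = 0 := by
      obtain ⟨h1, h2⟩ := hm
      simp [Finset.sum_add_distrib, Finsupp.single_apply] at h1 h2 hu
      ext x
      rcases x with x | x | x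
      · exact h1 x
      · exact h2 x
      · exact hu
    rw [hm', add_zero]
    refine coeff_eq_zero_of_D2 ?_
    have := hD j i
    rw [← D2_rho (s := s)] at this
    simp only [D2, map_sub] at this ⊢
    rw [this, sub_self]
  · obtain ⟨c, hc⟩ := Nat.exists_eq_succ_of_ne_zero hu.ne'
    have e : ∀ p : Ser n, p.hder 1 1 (c + 1) = 0 → coeff m p = 0 := fun p hp => by
      rw [hder_eq] at hp
      have := congrArg (coeff m) hp
      rw [coeff_C_mul, coeff_gr, weight_uwt, if_pos hc, coeff_bi, if_pos hm, map_zero] at this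
      exact (mul_eq_zero.1 this).resolve_left (facts_ne_zero _ _ _)
    rw [map_sub, e φ (h c), zero_sub, neg_eq_zero]
    exact e _ (hder_rho 1 1 c)

namespace FormalACR

theorem tr_eq_trc {L : FormalACR n}
    (h : ∀ m j, L.levi (Pi.single m 1) (Pi.single j 1) = if m = j then sg s j else 0) (p : Ser n) :
    L.tr p = trc n s p := by
  have hm : L.leviMatrix = Matrix.diagonal (sg s) := by
    ext m j
    rw [leviMatrix, Matrix.of_apply, h, Matrix.diagonal_apply]
    split_ifs with hj
    · rw [hj]
    · rfl
  have hi : L.leviMatrix⁻¹ = Matrix.diagonal (sg s) := by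
    refine Matrix.inv_eq_right_inv ?_
    rw [hm, Matrix.diagonal_mul_diagonal]
    simp [sg_mul_self]
  rw [tr, trc_apply, hi]
  refine Finset.sum_congr rfl fun j _ => ?_
  rw [Finset.sum_eq_single j]
  · rw [Matrix.diagonal_apply_eq]
  · intro k _ hk; rw [Matrix.diagonal_apply_ne _ hk]; simp
  · simp

theorem isChernMoser_iff {L : FormalACR n} (h : ∀ p, L.tr p = trc n s p) {φ : Ser n} :
    L.IsChernMoser φ ↔ (∀ c, φ.hder 1 1 (c + 1) = 0) ∧
    (∀ a, bi a 0 φ = 0) ∧ (∀ a, bi (a + 2) 1 φ = 0) ∧ trc n s (bi 2 2 φ) = 0 ∧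
    trc n s (trc n s (bi 3 2 φ)) = 0 ∧ trc n s (trc n s (trc n s (bi 3 3 φ))) = 0 := by
  simp only [IsChernMoser, h, forall_and, forall_const]
  simp only [hder_eq_zero_iff]
  simp only [hder_eq 2 2, hder_eq 3 2, hder_eq 3 3, trc_C_mul_gr, C_mul_gr_eq_zero]
  tauto

theorem hder_bar (a b c : ℕ) (p : Ser n) : (p.hder b a c).bar = p.bar.hder a b c := by
  ext m
  rw [coeff_bar]
  change conj (if _ then _ else _) = if _ then _ else _
  simp only [conjExp_apply, conjVar_zv, conjVar_zbv, conjVar_uv]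
  by_cases h1 : m uv = c <;> by_cases h2 : (∑ j, m (zv j)) = a <;>
    by_cases h3 : (∑ j, m (zbv j)) = b <;> simp [h1, h2, h3, coeff_bar, mul_comm]

theorem hder_C_mul (a b c : ℕ) (x : ℂ) (p : Ser n) :
    Ser.hder a b c (C x * p) = C x * p.hder a b c := by
  rw [hder_eq, hder_eq, bi_C_mul, gr_C_mul]; ring

theorem hder_add (a b c : ℕ) (p q : Ser n) :
    (p + q).hder a b c = p.hder a b c + q.hder a b c := by
  rw [hder_eq, hder_eq, hder_eq, map_add, map_add]; ring

theorem eq_zero_of_hder {p : Ser n} (h : ∀ a b c, p.hder a b c = 0) : p = 0 :=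
  ext_bi fun a b => by rw [hder_eq_zero_iff.1 (h a b), map_zero]

theorem eulerW_mem_zIdeal (L : FormalACR n) : L.eulerW ∈ zIdeal n :=
  Submodule.sum_mem _ fun j _ => Ideal.mul_mem_right _ _ (X_zv_mem_zIdeal j)

theorem tr_C_mul (L : FormalACR n) (x : ℂ) (p : Ser n) : L.tr (C x * p) = C x * L.tr p := by
  simp only [tr, pderiv_C_mul, Finset.mul_sum]
  exact Finset.sum_congr rfl fun _ _ => Finset.sum_congr rfl fun _ _ => by ring

/-- With φ = -i L̃^w the intrinsic conditions are reality and Chern–Moser conditions for φ. The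
vanishing of φ in bidegree (a, 0) is not listed in the intrinsic form: it follows from reality
because L̃^w is divisible by z. -/
theorem isIntrinsicNormal_iff {L : FormalACR n} : L.IsIntrinsicNormal ↔
    (∀ k, L.eulerZbar k = 0) ∧ (-cI * L.eulerW).bar = -cI * L.eulerW ∧
      L.IsChernMoser (-cI * L.eulerW) := by
  have hc : (-cI : Ser n) = C (-Complex.I) := by rw [cI, map_neg]
  have zero_iff {p : Ser n} : C (-Complex.I) * p = 0 ↔ p = 0 := by
    refine ⟨fun h => ?_, fun h => by rw [h, mul_zero]⟩
    have := congrArg (C Complex.I * ·) h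
    simpa [← mul_assoc, ← map_mul] using this
  have hreal : (-cI * L.eulerW).bar = -cI * L.eulerW ↔
      ∀ a b c, L.eulerW.hder a b c + (L.eulerW.hder b a c).bar = 0 := by
    simp only [hder_bar, ← hder_add]
    rw [bar_mul, bar_neg, bar_cI]
    constructor
    · intro h a b c
      have : L.eulerW + L.eulerW.bar = 0 := by
        refine zero_iff.1 ?_
        rw [← hc]
        linear_combination -h
      rw [this, hder_eq]; simp
    · intro h
      have := eq_zero_of_hder h
      linear_combination cI * this
  rw [hreal]
  simp only [IsIntrinsicNormal, IsChernMoser, hc, FormalACR.hder_C_mul, tr_C_mul, zero_iff]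
  constructor
  · intro h
    refine ⟨fun k => eq_zero_of_hder fun a b c => (h a b c).1 k, fun a b c => (h a b c).2.1,
      fun a c => ⟨?_, (h 0 0 c).2.2.1, (h a 0 c).2.2.2.1, (h 0 0 c).2.2.2.2⟩⟩
    have h1 := (h a 0 c).2.1
    have h2 : L.eulerW.hder 0 a c = 0 := by
      rw [hder_eq, mem_zIdeal.1 L.eulerW_mem_zIdeal]; simp
    rwa [h2, bar_zero, add_zero] at h1
  · rintro ⟨h1, h2, h3⟩ a b c
    refine ⟨fun k => ?_, h2 a b c, (h3 0 c).2.1, (h3 a c).2.2.1, (h3 0 c).2.2.2⟩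
    rw [h1, hder_eq]; simp

end FormalACR

end

/-! ### Equivalence of the normalizations with the fixed-point problem -/

section

variable {n s : ℕ} {𝒳 : Type*} {A : CoeffAlg 𝒳}

/-! ### Normalizations -/

/-- The relation between a normalized structure and the function `φ`. -/
def Embeds (T : Bool) (L' : FormalACR n) (φ : Ser n) : Prop :=
  L'.eulerW * (bif T then 1 - cI * ∂ᵤ φ else 1) = cI * (bif T then eul n φ else φ)

/-- The intrinsic (`T = false`) and extrinsic (`T = true`) normalizations. -/
structure IsNorm (T : Bool) {L : FormalACR n} (F : ExtFrame L s) (h : FormalMap n)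
    (L' : FormalACR n) (φ : Ser n) : Prop where
  maps : h.MapsToStandard F
  trans : h.Transforms L L'
  zbar : ∀ k, L'.eulerZbar k = 0
  real : φ.bar = φ
  const : constantCoeff φ = 0
  lin : ∀ i, D1 i φ = 0
  emb : Embeds T L' φ
  cm : L'.IsChernMoser φ

theorem D2_zv_eq_zero {φ : Ser n} (h : bi 2 0 φ = 0) (m j : Fin n) : D2 (zv m) (zv j) φ = 0 := by
  have e1 : bi 1 0 (pderiv ℂ (zv j) φ) = pderiv ℂ (zv j) (bi 2 0 φ) :=
    gr_pderiv (w := bwt n) (d := (1, 0)) (zv j)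
  have e2 : bi 0 0 (pderiv ℂ (zv m) (pderiv ℂ (zv j) φ)) =
      pderiv ℂ (zv m) (bi 1 0 (pderiv ℂ (zv j) φ)) :=
    gr_pderiv (w := bwt n) (d := (0, 0)) (zv m)
  rw [e1, h, map_zero, map_zero] at e2
  have := congrArg (coeff 0) e2
  rw [coeff_bi] at this
  simpa [D2] using this

theorem D1_eulerW (L : FormalACR n) (i : Var n) : D1 i L.eulerW = 0 := by
  rw [FormalACR.eulerW, D1_sum]
  exact Finset.sum_eq_zero fun j _ => by rw [D1_mul, L.w_zero]; simp

theorem constantCoeff_eulerW (L : FormalACR n) : constantCoeff L.eulerW = 0 := by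
  simp [FormalACR.eulerW]

theorem D2_eulerW (L : FormalACR n) (i : Var n) (j : Fin n) : D2 i (zv j) L.eulerW =
    D1 i (L.w j) + ∑ k, D1 i (X (zv k) : Ser n) * D1 (zv j) (L.w k) := by
  rw [FormalACR.eulerW, D2_sum]
  simp only [D2_mul, D2_X, L.w_zero, zero_mul, zero_add, constantCoeff_X, add_zero,
    Finset.sum_add_distrib]
  congr 1
  simp [D1_X]

theorem D2_eul (φ : Ser n) (i : Var n) (j : Fin n) : D2 i (zv j) (eul n φ) =
    D2 i (zv j) φ + ∑ k, D1 i (X (zv k) : Ser n) * D2 (zv j) (zv k) φ := by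
  rw [eul_apply, D2_sum]
  simp only [D2_mul, D2_X, zero_mul, zero_add, constantCoeff_X, add_zero, Finset.sum_add_distrib]
  congr 1
  simp [D1_X]
  rfl

theorem D2_cI_mul (i j : Var n) (p : Ser n) : D2 i j (cI * p) = Complex.I * D2 i j p :=
  D2_C_mul i j _ p

/-- To second order at 0 both modes agree: L̃^w has the mixed derivatives of iφ and no pure
z-derivatives. The factor 1 - i ∂φ/∂u is invisible because L̃^w starts in order two. -/
theorem Embeds.D2_eulerW {T : Bool} {L' : FormalACR n} {φ : Ser n} (H : Embeds T L' φ)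
    (hl : ∀ i, D1 i φ = 0) (h2 : bi 2 0 φ = 0) (m j : Fin n) :
    D2 (zbv m) (zv j) L'.eulerW = Complex.I * D2 (zbv m) (zv j) φ ∧
      D2 (zv m) (zv j) L'.eulerW = 0 := by
  cases T
  · have e : L'.eulerW = cI * φ := by simpa [Embeds] using H
    rw [e, D2_cI_mul, D2_cI_mul, D2_zv_eq_zero h2]
    simp
  · have e : L'.eulerW * (1 - cI * ∂ᵤ φ) = cI * eul n φ := by simpa [Embeds] using H
    have h0 : constantCoeff (1 - cI * ∂ᵤ φ) = 1 := by
      rw [map_sub, map_mul, show constantCoeff (∂ᵤ φ) = 0 from hl uv]; simp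
    have key (i : Var n) : D2 i (zv j) L'.eulerW = Complex.I * D2 i (zv j) (eul n φ) := by
      rw [← D2_cI_mul, ← e, D2_mul, D1_eulerW, D1_eulerW, constantCoeff_eulerW, h0]; simp
    rw [key, key, D2_eul, D2_eul]
    constructor
    · simp [D1_X]
    · simp [D2_zv_eq_zero h2]

theorem IsNorm.D1_w {T : Bool} {L L' : FormalACR n} {F : ExtFrame L s} {h : FormalMap n} {φ : Ser n}
    (H : IsNorm T F h L' φ) (m j : Fin n) :
    D1 (zbv m) (L'.w j) = Complex.I * D2 (zbv m) (zv j) φ ∧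
      D1 (zv m) (L'.w j) = -D1 (zv j) (L'.w m) := by
  have h20 : bi 2 0 φ = 0 := hder_eq_zero_iff.1 fun c => (H.cm 2 c).1
  obtain ⟨e1, e2⟩ := H.emb.D2_eulerW H.lin h20 m j
  rw [D2_eulerW] at e1 e2
  simp only [D1_X, reduceCtorEq, if_false, zero_mul, Finset.sum_const_zero, add_zero] at e1
  simp only [D1_X, Sum.inl.injEq, ite_mul, one_mul, zero_mul, Finset.sum_ite_eq, Finset.mem_univ,
    if_true] at e2
  exact ⟨e1, eq_neg_of_add_eq_zero_left e2⟩

theorem D2_hermitian {φ : Ser n} (h : φ.bar = φ) (m j : Fin n) :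
    conj (D2 (zbv j) (zv m) φ) = D2 (zbv m) (zv j) φ := by
  have := D2_bar (zv j) (zbv m) φ
  rw [h] at this
  rw [D2_comm (zbv m), this]; rfl

theorem IsNorm.levi {T : Bool} {L L' : FormalACR n} {F : ExtFrame L s} {h : FormalMap n} {φ : Ser n}
    (H : IsNorm T F h L' φ) (m j : Fin n) :
    L'.levi (Pi.single m 1) (Pi.single j 1) = D2 (zbv m) (zv j) φ := by
  rw [L'.levi_single, (H.D1_w m j).1, (H.D1_w j m).1, map_mul, D2_hermitian H.real, Complex.conj_I]
  field_simp
  ring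

section Pointwise

variable {T : Bool} {L L' M : FormalACR n} {F : ExtFrame L s} {h q q' k : FormalMap n}
  {φ : Ser n} {B : Fin n → Fin n → ℂ} {f : Fin n → Ser n} {g ψ : Ser n}

/-- ρ does not depend on u and satisfies Eρ = ρ for E = Σ z_j ∂/∂z_j, so the embedding relation can
be solved for L̃^w by inverting 1 - i ∂ψ/∂u. -/
theorem eulerW_eq_iff (hψ : ψ ∈ wIdeal (hwt n) 3) :
    Embeds T L' (rho n s + ψ) ↔ L'.eulerW = cI * rho n s + pdev n s T ψ := by
  cases T
  · simp only [Embeds, pdev, modeOp, cond_false, mul_one, LinearMap.id_apply, mul_add]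
  · have e1 := pdev_eq (s := s) true hψ
    have e2 := one_sub_du_inv hψ
    have hI := cI_mul_self (n := n)
    have er : eul n (rho n s) = rho n s := by
      rw [eul_apply]
      simp only [pderiv_zv_rho]
      rw [rho]
      exact Finset.sum_congr rfl fun _ _ => by ring
    simp only [modeOp, cond_true, DD_apply] at e1
    simp only [Embeds, cond_true, map_add, pderiv_uv_rho, zero_add, er]
    constructor
    · intro h
      have h3 : (L'.eulerW - (cI * rho n s + pdev n s true ψ)) * (1 - cI * ∂ᵤ ψ) = 0 := by
        linear_combination h - e1 + (rho n s * ∂ᵤ ψ) * hI - (rho n s * ∂ᵤ ψ) * hI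
      have h4 := congrArg (· * (1 - cI * ∂ᵤ ψ)⁻¹) h3
      simp only [mul_assoc, e2, mul_one, zero_mul] at h4
      exact sub_eq_zero.1 h4
    · intro h
      rw [h]
      linear_combination e1

theorem FormalMap.IsStd.jac_eq_one (K : k.IsStd) : jac k.comp = 1 := by
  ext a i
  rw [jac, Matrix.of_apply, Matrix.one_apply]
  exact ((FormalMap.isStd_iff.1 K).1 i a).trans (by simp only [eq_comm])

theorem eq_single_of_sum {m : Var n →₀ ℕ} (h : (∑ j, m (zv j)) = 0) (h' : (∑ j, m (zbv j)) = 0) :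
    m = Finsupp.single uv (m uv) := by
  rw [Finset.sum_eq_zero_iff] at h h'
  ext x
  rcases x with x | x | x
  · simpa using h x (Finset.mem_univ _)
  · simpa using h' x (Finset.mem_univ _)
  · simp

/-- Weights already exclude most low-order terms; the jet is needed only for the term u in f and the
term u² in g. -/
theorem initZero_of_isStd (hk : k.comp = nearId f g) (S : k.IsStd)
    (hf : ∀ l, f l ∈ wIdeal (hwt n) 2) (hg : g ∈ wIdeal (hwt n) 3) : InitZero f g := by
  have kf (l : Fin n) : k.f l = X (zv l) + f l := congrFun hk (zv l)
  have kg : k.g = X uv + g := congrFun hk uv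
  refine ⟨fun l m hm => ?_, fun l m hm => ?_, fun m hm => ?_⟩
  · rw [coeff_bi]
    split_ifs with hs
    · rcases Nat.eq_zero_or_pos (m uv) with h0 | h0
      · exact hf l m (by rw [weight_hwt]; omega)
      · rw [eq_single_of_sum hs.1 hs.2, show m uv = 1 by omega, ← D1_eq_coeff]
        have := S.f_u l
        rw [kf, D1_add, D1_X] at this
        simpa using this
    · rfl
  · rw [coeff_bi]
    split_ifs with hs
    · exact hf l m (by rw [weight_hwt]; omega)
    · rfl
  · rw [coeff_bi]
    split_ifs with hs
    · by_cases h2 : m uv = 2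
      · rw [eq_single_of_sum hs.1 hs.2, h2, show (2 : ℕ) = 1 + 1 from rfl, Finsupp.single_add]
        refine coeff_eq_zero_of_D2 ?_
        have := S.g_uu
        rw [kg, D2_add, D2_X] at this
        simpa using this
      · exact hg m (by rw [weight_hwt]; omega)
    · rfl

theorem isStd_of_initZero (hk : k.comp = nearId f g) (hd : Dom f g ψ) (hi : InitZero f g) :
    k.IsStd := by
  have kf (l : Fin n) : k.f l = X (zv l) + f l := congrFun hk (zv l)
  have kg : k.g = X uv + g := congrFun hk uv
  have Df (i : Var n) (l : Fin n) : D1 i (f l) = 0 := by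
    rw [D1_eq_coeff]
    rcases i with i | i | i
    · exact hd.mem_f l _ (by rw [Finsupp.weight_single]; simp [hwt])
    · exact hd.mem_f l _ (by rw [Finsupp.weight_single]; simp [hwt])
    · have := hi.f00 l (Finsupp.single uv 1) (by simp)
      rw [coeff_bi, if_pos (by simp)] at this
      exact this
  have Dg (i : Var n) : D1 i g = 0 := by
    rw [D1_eq_coeff]
    refine hd.mem_g _ ?_
    rw [Finsupp.weight_single]
    rcases i with i | i | i <;> simp [hwt]
  refine ⟨fun l j => ?_, fun l j => ?_, fun l => ?_, fun j => ?_, ?_, ?_⟩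
  · rw [kf, D1_add, D1_X, Df]; simp
  · rw [kf, D1_add, D1_X, Df]; simp
  · rw [kf, D1_add, D1_X, Df]; simp
  · rw [kg, D1_add, D1_X, Dg]; simp
  · rw [kg, D1_add, D1_X, Dg]; simp
  · have := hi.g00.du.du 0 (by simp)
    rw [← bi_pderiv_uv, ← bi_pderiv_uv, coeff_bi, if_pos (by simp)] at this
    rw [kg, D2_add, D2_X, zero_add, D2]
    simpa using this

/-- A priori k = (h ∘ q)⁻¹ only has the standard jet. The normalization of the linear parts of both
L' and M forces the second derivatives of its last component in (z, z̄) to vanish, which puts (f, g,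
ψ) in the domain where the fixed point is unique. -/
theorem IsNorm.exists_nonlinSol (hinv : q'.IsInv q) (hjet : q.HasJet F.v F.last F.cls.accU)
    (hT : q'.Transforms L M) (hM : IsModel s M B) (H : IsNorm T F h L' φ) :
    ∃ (k : FormalMap n) (f : Fin n → Ser n) (g ψ : Ser n), (h.mul q).IsInv k ∧
      k.comp = nearId f g ∧ φ = rho n s + ψ ∧ Dom f g ψ ∧
      NonlinSol s T B M.zbar (quadW s M B) f g ψ := by
  have S : (h.mul q).IsStd := (FormalMap.isStd_mul_iff hjet F.linearIndependent).2
    ((FormalMap.mapsToStandard_iff F).1 ⟨H.maps, H.trans.D1_zbv, H.trans.D1_zv⟩)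
  obtain ⟨k₀, -, hk₀⟩ := FormalMap.exists_isInv (A := CoeffAlg.all Unit) (fun _ => h.mul q)
    ⟨fun _ _ => trivial, fun _ => trivial⟩ fun _ => by rw [S.jac_eq_one, Matrix.det_one]; exact one_ne_zero
  obtain ⟨k, hk⟩ : ∃ k, (h.mul q).IsInv k := ⟨k₀ (), (hk₀ ()).symm⟩
  have K : k.IsStd := S.inv hk
  have hkT : k.Transforms L' M :=
    ((hT.symm hinv).mul H.trans).symm hk
  set f : Fin n → Ser n := fun l => k.f l - X (zv l) with hf
  set g : Ser n := k.g - X uv with hg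
  have hcomp : k.comp = nearId f g := by
    funext i
    rcases i with i | i | i
    · simp [FormalMap.comp, nearId, hf]
    · simp [FormalMap.comp, nearId, hf, bar_sub, bar_X]
    · simp [FormalMap.comp, nearId, hg]
  have kg : k.g = X uv + g := congrFun hcomp uv
  have kf (l : Fin n) : k.f l = X (zv l) + f l := congrFun hcomp (zv l)
  have w_rel (i : Var n) (j : Fin n) :
      D1 i (L'.w j) = D1 i (subst k.comp (M.w j)) - D2 i (zv j) k.g := by
    have := K.D1_w hkT i j
    simpa using this
  have w_zv (m j : Fin n) : D1 (zv m) (L'.w j) = B m j - D2 (zv m) (zv j) k.g := by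
    rw [w_rel, K.D1_zv_pull]; simp [hM.w_zv]
  have w_zbv (m j : Fin n) : D1 (zbv m) (L'.w j) =
      (if m = j then Complex.I * sg s j else 0) - D2 (zbv m) (zv j) k.g := by
    rw [w_rel, K.D1_zbv_pull]; simp [apply_ite conj, hM.w_zbv]
  -- The z-linear parts of L' and M are both antisymmetric, while their difference is a symmetric
  -- matrix of second derivatives.
  have g_zz (m j : Fin n) : D2 (zv m) (zv j) k.g = 0 := by
    have e1 := (H.D1_w m j).2
    rw [w_zv, w_zv, hM.antisymm j m, D2_comm (zv j)] at e1
    linear_combination (-1 / 2 : ℂ) * e1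
  -- The Hermitian second derivatives of k.g, still unknown here, cancel in the Levi form. This
  -- identifies `tr` of L' with `trc` and the mixed second derivatives of φ, which in turn makes
  -- those of k.g vanish.
  have levi (m j : Fin n) : L'.levi (Pi.single m 1) (Pi.single j 1) =
      if m = j then sg s j else 0 := by
    rw [L'.levi_single, w_zbv, w_zbv, map_sub, D2_hermitian k.g_real, sub_sub_sub_cancel_right]
    by_cases hmj : m = j
    · subst hmj
      simp only [if_true, map_mul, Complex.conj_I, conj_sg]
      field_simp
      ring
    · simp [hmj, Ne.symm hmj]
  have D2φ (m j : Fin n) : D2 (zbv m) (zv j) φ = if m = j then sg s j else 0 := by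
    rw [← H.levi, levi]
  have g_zbz (m j : Fin n) : D2 (zbv m) (zv j) k.g = 0 := by
    have e := (H.D1_w m j).1
    rw [w_zbv, D2φ] at e
    split_ifs at e with hmj
    · linear_combination -e
    · linear_combination -e
  have g_zbzb (m j : Fin n) : D2 (zbv m) (zbv j) k.g = 0 := by
    have := k.D2_g_conj (zv m) (zv j)
    rw [g_zz, map_zero] at this
    exact this
  obtain ⟨K1, -⟩ := FormalMap.isStd_iff.1 K
  have f_mem (l : Fin n) : f l ∈ wIdeal (hwt n) 2 := by
    refine mem_wIdeal_two ?_ (fun j => ?_) fun j => ?_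
    · simp [hf, k.f_zero]
    · have := K.f_z l j
      rw [kf, D1_add, D1_X] at this
      simpa using this
    · have := K.f_zb l j
      rw [kf, D1_add, D1_X] at this
      simpa using this
  have D2g (i j : Var n) : D2 i j g = D2 i j k.g := by rw [kg, D2_add, D2_X, zero_add]
  have g_mem : g ∈ wIdeal (hwt n) 3 := by
    refine mem_wIdeal_three ?_ (fun i => ?_) (fun i j => ?_) (fun i j => ?_) fun i j => ?_
    · simp [hg, k.g_zero]
    · have := K1 i uv
      change D1 i k.g = _ at this
      rw [kg, D1_add, D1_X] at this
      simpa using this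
    · rw [D2g, g_zz]
    · rw [D2g, g_zbz]
    · rw [D2g, g_zbzb]
  have nf : IsNF n s (φ - rho n s) := by
    have cm := (FormalACR.isChernMoser_iff (FormalACR.tr_eq_trc levi)).1 H.cm
    exact isNF_iff.2 ⟨H.real, bi_one_one_eq_rho cm.1 D2φ, cm.2⟩
  have hφ : φ = rho n s + (φ - rho n s) := by ring
  have hW : L'.eulerW = cI * rho n s + pdev n s T (φ - rho n s) := by
    rw [← eulerW_eq_iff nf.mem_three, ← hφ]; exact H.emb
  -- The field (z, 0, L̃'^w) is Σ z_j X'_j for the fields X'_j of L', all of which k maps into the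
  -- graph of M.
  have rel : k.Rel (eulField (cI * rho n s + pdev n s T (φ - rho n s))) M := by
    have := FormalMap.Rel.sum (fun j => FormalMap.transforms_iff.1 hkT j) fun j => X (zv j)
    convert this using 1
    funext i
    rcases i with i | i | i
    · simp [eulField, FormalACR.frame]
    · exact (H.zbar i).symm
    · exact hW.symm
  obtain ⟨eqf, eqg⟩ := (rel_iff hM hcomp).1 rel
  refine ⟨k, f, g, φ - rho n s, hk, hcomp, hφ, ⟨f_mem, g_mem, nf.mem_three, nf.mem_zIdeal⟩,
    ⟨eqf, eqg, ?_, nf, initZero_of_isStd hcomp K f_mem g_mem⟩⟩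
  rw [hg, bar_sub, k.g_real, bar_X]; rfl

/-- Both maps give the same fixed point, hence the same k and the same h. Then L' is determined as
the transport of L by h. -/
theorem IsNorm.unique (hn : 1 ≤ n) (hinv : q'.IsInv q) (hjet : q.HasJet F.v F.last F.cls.accU)
    (hT : q'.Transforms L M) (hM : IsModel s M B) (hB : Nondeg s B) (H : IsNorm T F h L' φ)
    {h₂ : FormalMap n} {L₂ : FormalACR n} {φ₂ : Ser n} (H₂ : IsNorm T F h₂ L₂ φ₂) :
    h = h₂ ∧ L' = L₂ ∧ φ = φ₂ := by
  obtain ⟨k, f, g, ψ, hk, hc, hφ, hd, hs⟩ := H.exists_nonlinSol hinv hjet hT hM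
  obtain ⟨k₂, f₂, g₂, ψ₂, hk₂, hc₂, hφ₂, hd₂, hs₂⟩ := H₂.exists_nonlinSol hinv hjet hT hM
  obtain ⟨rfl, rfl, rfl⟩ := hs.unique hn hB
    (fun m l => mem_wIdeal_one one_le_hwt (M.zbar_zero m l)) hM.quadW_mem hs₂ hd hd₂
  obtain rfl : k = k₂ := FormalMap.ext_comp (hc.trans hc₂.symm)
  have e := hk.unique hk₂
  obtain rfl : h = h₂ := by
    rw [← hinv.symm.eq_mul h, e, hinv.symm.eq_mul]
  refine ⟨rfl, ?_, hφ.trans hφ₂.symm⟩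
  have hh : h.IsInv (q.mul k) := fun i => by
    rw [FormalMap.pull_comp, ← FormalMap.comp_mul]; exact hk i
  exact H.trans.unique hh H₂.trans

/-- By `rel_iff`, k sends the field (z, 0, iρ + pdev) into the graph of M, and h₁ = k⁻¹ transforms M
into L'. So this field lies in the graph of L', which identifies L' along the Euler field; the other
components of L' are unconstrained. -/
theorem isNorm_of_nonlinSol (hinv : q'.IsInv q) (hjet : q.HasJet F.v F.last F.cls.accU)
    (hT : q'.Transforms L M) (hM : IsModel s M B) (hc : k.comp = nearId f g) (hd : Dom f g ψ)
    (hs : NonlinSol s T B M.zbar (quadW s M B) f g ψ) {h₁ : FormalMap n} (hk : h₁.IsInv k)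
    (hL' : (h₁.mul q').Transforms L L') : IsNorm T F (h₁.mul q') L' (rho n s + ψ) := by
  have K : k.IsStd := isStd_of_initZero hc hd hs.init
  have S : h₁.IsStd := K.inv hk.symm
  have e : (h₁.mul q').mul q = h₁ := hinv.eq_mul h₁
  have hdual : (h₁.mul q').HasDualJet F.v F.last F.cls.accU :=
    (FormalMap.isStd_mul_iff hjet F.linearIndependent).1 (by rw [e]; exact S)
  have h₁T : h₁.Transforms M L' := by
    have := (hT.symm hinv).mul hL'
    rwa [e] at this
  obtain ⟨gz, gw⟩ := ((rel_iff hM hc).2 ⟨hs.eq_f, hs.eq_g⟩).inGraph hk h₁T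
  have hnf := hs.nf
  have nf : IsNF n s ((rho n s + ψ) - rho n s) := by rwa [add_sub_cancel_left]
  obtain ⟨i1, i2, i3⟩ := isNF_iff.1 nf
  have hW : L'.eulerW = cI * rho n s + pdev n s T ψ :=
    (Finset.sum_congr rfl fun _ _ => mul_comm _ _).trans gw.symm
  have emb : Embeds T L' (rho n s + ψ) := (eulerW_eq_iff hd.mem_ψ).2 hW
  have mem2 : rho n s + ψ ∈ wIdeal (hwt n) 2 := by
    refine add_mem ?_ (wIdeal_mono (by omega) hd.mem_ψ)
    refine Submodule.sum_mem _ fun j _ => const_mul_mem _ ?_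
    exact mul_mem_wIdeal (k := 1) (l := 1) (X_mem_wIdeal (w := hwt n) (zv j))
      (X_mem_wIdeal (w := hwt n) (zbv j))
  have lin (i : Var n) : D1 i (rho n s + ψ) = 0 := by
    rcases i with i | i | i
    · rw [D1_eq_coeff]; exact mem2 _ (by rw [Finsupp.weight_single]; simp [hwt])
    · rw [D1_eq_coeff]; exact mem2 _ (by rw [Finsupp.weight_single]; simp [hwt])
    · rw [D1_add]
      have e1 : D1 (Sum.inr (Sum.inr i)) (rho n s) = 0 := by
        change constantCoeff (∂ᵤ (rho n s)) = 0
        rw [pderiv_uv_rho, map_zero]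
      rw [e1, zero_add, D1_eq_coeff]
      exact hd.mem_ψ _ (by rw [Finsupp.weight_single]; simp [hwt])
  have D2φ (m j : Fin n) : D2 (zbv m) (zv j) (rho n s + ψ) = if m = j then sg s j else 0 := by
    rw [D2_add, D2_rho]
    have : D2 (zbv m) (zv j) ψ = 0 := by
      rw [D2, constantCoeff_pderiv, coeff_pderiv, hd.mem_ψ, zero_mul]
      rw [map_add, Finsupp.weight_single, Finsupp.weight_single]; simp [hwt]
    rw [this, add_zero]
  have h20 : bi 2 0 (rho n s + ψ) = 0 := i3.1 2
  have levi (m j : Fin n) : L'.levi (Pi.single m 1) (Pi.single j 1) =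
      if m = j then sg s j else 0 := by
    have w (m j : Fin n) : D1 (zbv m) (L'.w j) = Complex.I * if m = j then sg s j else 0 := by
      have e1 := (emb.D2_eulerW lin h20 m j).1
      rw [D2_eulerW, D2φ] at e1
      simpa [D1_X] using e1
    rw [L'.levi_single, w, w]
    by_cases hmj : m = j
    · subst hmj
      simp only [if_true, map_mul, Complex.conj_I, conj_sg]
      field_simp
      ring
    · simp [hmj, Ne.symm hmj]
  refine ⟨((FormalMap.mapsToStandard_iff F).2 hdual).1, hL', fun m => ?_, i1, ?_, lin, emb, ?_⟩
  · exact (Finset.sum_congr rfl fun _ _ => mul_comm _ _).trans (gz m).symm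
  · rw [← coeff_zero_eq_constantCoeff_apply]
    exact mem2 _ (by simp)
  · refine (FormalACR.isChernMoser_iff (FormalACR.tr_eq_trc levi)).2 ⟨fun c => ?_, i3⟩
    rw [hder_eq, i2, ← bi_one_one_rho, ← hder_eq, hder_rho]

end Pointwise

theorem exists_isNorm (hn : 1 ≤ n) (T : Bool) {L : 𝒳 → FormalACR n} (hL : FormalACR.IsFam A L)
    (hS : ∀ x, (L x).StronglyNondegenerate) (F : ∀ x, ExtFrame (L x) s)
    (hV : ∀ j l, A.Sc fun x => (F x).v j l) (hv : ∀ l, A.Sc fun x => (F x).last.1 l)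
    (ht : A.Sc fun x => ((F x).last.2 : ℂ)) (hr : A.Sc fun x => ((F x).cls.accU : ℂ)) :
    ∃ (h : 𝒳 → FormalMap n) (L' : 𝒳 → FormalACR n) (φ : 𝒳 → Ser n), FormalMap.IsFam A h ∧
      FormalACR.IsFam A L' ∧ A.IsSer φ ∧ ∀ x, IsNorm T (F x) (h x) (L' x) (φ x) ∧
        ∀ h₂ L₂ φ₂, IsNorm T (F x) h₂ L₂ φ₂ → h x = h₂ ∧ L' x = L₂ ∧ φ x = φ₂ := by
  obtain ⟨q, q', M, B, hq, hq', hM, hB, H⟩ := exists_model hL hS F hV hv ht hr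
  obtain ⟨f, g, ψ, hf, hg, hψ, hsol⟩ := exists_nonlinSol hn T hB (fun x => (H x).2.2.2.2)
    (Mz := fun m l x => (M x).zbar m l) (N := fun l x => quadW s (M x) (B x) l) hM.1
    (fun l => (hM.2 l).sub (isSer_linW hB (fun _ => .const _) (fun _ => .const _) l))
    (fun m l x => mem_wIdeal_one one_le_hwt ((M x).zbar_zero m l))
    (fun l x => (H x).2.2.2.1.quadW_mem l)
  let k : 𝒳 → FormalMap n := fun x => FormalMap.ofComp (nearId (fun l => f l x) (g x))
    (nearId_zero (hsol x).1) fun i => by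
      rcases i with i | i | i
      · simp [nearId, bar_add, bar_X, conjVar]
      · simp [nearId, bar_add, bar_X, conjVar]
      · simp [nearId, bar_add, bar_X, conjVar, (hsol x).2.real]
  have hkc (x : 𝒳) : (k x).comp = nearId (fun l => f l x) (g x) := FormalMap.comp_ofComp ..
  have hk : FormalMap.IsFam A k :=
    ⟨fun l => isSer_nearId hf hg (zv l), isSer_nearId hf hg uv⟩
  have K (x : 𝒳) : (k x).IsStd := isStd_of_initZero (hkc x) (hsol x).1 (hsol x).2.init
  obtain ⟨h₁, hh₁, hinv⟩ := FormalMap.exists_isInv k hk fun x => by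
    rw [(K x).jac_eq_one, Matrix.det_one]; exact one_ne_zero
  have hdual (x : 𝒳) : ((h₁ x).mul (q' x)).HasDualJet (F x).v (F x).last (F x).cls.accU := by
    refine (FormalMap.isStd_mul_iff (H x).2.1 (F x).linearIndependent).1 ?_
    rw [(H x).1.eq_mul]
    exact (K x).inv (hinv x).symm
  obtain ⟨L', hL', hT⟩ := FormalMap.exists_transforms_of_dualJet hL (hh₁.mul hq') (hq.mul hk)
    (fun x => ((hinv x).mul (H x).1).symm) hdual
  refine ⟨_, L', fun x => rho n s + ψ x, hh₁.mul hq', hL', (CoeffAlg.IsSer.const _).add hψ,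
    fun x => ?_⟩
  have hx := isNorm_of_nonlinSol (H x).1 (H x).2.1 (H x).2.2.1 (H x).2.2.2.1 (hkc x) (hsol x).1
    (hsol x).2 (hinv x) (hT x)
  exact ⟨hx, fun h₂ L₂ φ₂ h2 => hx.unique hn (H x).1 (H x).2.1 (H x).2.2.1 (H x).2.2.2.1
    (H x).2.2.2.2 h2⟩

end

/-! ### The stated normalizations and universal analytic dependence -/

section

variable {n s : ℕ}

/-! ### Intrinsic and extrinsic normalizations -/

theorem isIntrinsicNormalization_iff {L : FormalACR n} {F : ExtFrame L s} {h : FormalMap n}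
    {L' : FormalACR n} : IsIntrinsicNormalization F h L' ↔ ∃ φ, IsNorm false F h L' φ := by
  have hI := cI_mul_self (n := n)
  constructor
  · rintro ⟨h1, h2, h3⟩
    obtain ⟨h4, h5, h6⟩ := FormalACR.isIntrinsicNormal_iff.1 h3
    refine ⟨-cI * L'.eulerW, h1, h2, h4, h5, ?_, fun i => ?_, ?_, h6⟩
    · rw [map_mul, constantCoeff_eulerW, mul_zero]
    · rw [D1_mul, D1_eulerW, constantCoeff_eulerW]; simp
    · simp only [Embeds, cond_false]
      linear_combination L'.eulerW * hI
  · rintro ⟨φ, H⟩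
    have e : φ = -cI * L'.eulerW := by
      have := H.emb
      simp only [Embeds, cond_false, mul_one] at this
      rw [this]
      linear_combination φ * hI
    refine ⟨H.maps, H.trans, FormalACR.isIntrinsicNormal_iff.2 ⟨H.zbar, ?_, ?_⟩⟩
    · rw [← e]; exact H.real
    · rw [← e]; exact H.cm

/-- The conditions are obtained by applying the fields of L to z̄_k and to w̄ = u - iφ. -/
theorem isInducedByGraph_iff {L : FormalACR n} {φ : Ser n} (hφ : φ.bar = φ) :
    L.IsInducedByGraph φ ↔ (∀ k j, L.zbar k j = 0) ∧
      ∀ j, L.w j * (1 - cI * ∂ᵤ φ) = cI * pderiv ℂ (zv j) φ := by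
  have hb : Ser.bar (X uv + C Complex.I * φ) = X uv - cI * φ := by
    rw [bar_add, bar_mul, bar_C, bar_X, hφ, Complex.conj_I, map_neg, ← cI]
    change X uv + _ = _
    ring
  have frame_w (hz : ∀ k j, L.zbar k j = 0) (j : Fin n) : (L.frame j).app (X uv - cI * φ) =
      L.w j * (1 - cI * ∂ᵤ φ) - cI * pderiv ℂ (zv j) φ := by
    rw [L.frame_app, map_sub, map_sub, pderiv_X_self, pderiv_X_ne (by simp), cI, pderiv_C_mul,
      pderiv_C_mul]
    simp only [hz, zero_mul, Finset.sum_const_zero]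
    ring
  have frame_zb (k j : Fin n) : (L.frame j).app (X (zbv k)) = L.zbar k j := VF.app_X _ _
  constructor
  · intro H
    have hz (k j : Fin n) : L.zbar k j = 0 := by
      have := (H (Pi.single j 1)).1 k
      rwa [L.field_single, bar_X, conjVar_zv, frame_zb] at this
    refine ⟨hz, fun j => ?_⟩
    have := (H (Pi.single j 1)).2
    rwa [L.field_single, hb, frame_w hz, sub_eq_zero] at this
  · rintro ⟨hz, hw⟩ ξ
    rw [L.field_eq, hb]
    simp only [VF.app_sum_mul, bar_X, conjVar_zv, frame_zb, frame_w hz, hz, hw, sub_self, mul_zero,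
      Finset.sum_const_zero, implies_true, and_self]

/-- Summing the equations of the induced structure against z_j gives the relation `Embeds`.
Conversely the induced structure exists because 1 - i ∂φ/∂u is invertible, and it coincides with L'
along the Euler field after cancelling this factor. -/
theorem isExtrinsicNormalization_iff {L : FormalACR n} {F : ExtFrame L s} {h : FormalMap n}
    {L' : FormalACR n} {φ : Ser n} :
    IsExtrinsicNormalization F h L' φ ↔ IsNorm true F h L' φ := by
  have sum_eq (Lφ : FormalACR n) (hw : ∀ j, Lφ.w j * (1 - cI * ∂ᵤ φ) = cI * pderiv ℂ (zv j) φ) :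
      Lφ.eulerW * (1 - cI * ∂ᵤ φ) = cI * eul n φ := by
    rw [FormalACR.eulerW, Finset.sum_mul, eul_apply, Finset.mul_sum]
    exact Finset.sum_congr rfl fun j _ => by rw [mul_assoc, hw]; ring
  constructor
  · rintro ⟨h1, h2, h3, h4, h5, ⟨Lφ, h6, h7⟩, h8⟩
    obtain ⟨hz, hw⟩ := (isInducedByGraph_iff h3).1 h6
    refine ⟨h1, h2, fun k => ?_, h3, h4, fun i => (D1_eq_coeff i φ).trans (h5 i), ?_, h8⟩
    · rw [h7.1, FormalACR.eulerZbar]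
      simp [hz]
    · simp only [Embeds, cond_true]
      rw [h7.2, sum_eq Lφ hw]
  · intro H
    have hc : constantCoeff (1 - cI * ∂ᵤ φ) ≠ 0 := by
      rw [map_sub, map_mul, show constantCoeff (∂ᵤ φ) = 0 from H.lin uv]; simp
    have hu := MvPowerSeries.mul_inv_cancel _ hc
    let Lφ : FormalACR n :=
      { zbar := fun _ _ => 0
        w := fun j => cI * pderiv ℂ (zv j) φ * (1 - cI * ∂ᵤ φ)⁻¹
        zbar_zero := fun _ _ => map_zero _
        w_zero := fun j => by
          rw [map_mul, map_mul, show constantCoeff (pderiv ℂ (zv j) φ) = 0 from H.lin (zv j)]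
          simp }
    have hw (j : Fin n) : Lφ.w j * (1 - cI * ∂ᵤ φ) = cI * pderiv ℂ (zv j) φ := by
      change cI * pderiv ℂ (zv j) φ * (1 - cI * ∂ᵤ φ)⁻¹ * _ = _
      linear_combination (cI * pderiv ℂ (zv j) φ) * hu
    refine ⟨H.maps, H.trans, H.real, H.const, fun i => (D1_eq_coeff i φ).symm.trans (H.lin i),
      ⟨Lφ, (isInducedByGraph_iff H.real).2 ⟨fun _ _ => rfl, hw⟩, ?_, ?_⟩, H.cm⟩
    · funext k
      rw [H.zbar]
      simp [FormalACR.eulerZbar, Lφ]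
    · have e : L'.eulerW * (1 - cI * ∂ᵤ φ) = Lφ.eulerW * (1 - cI * ∂ᵤ φ) := by
        rw [sum_eq Lφ hw]
        simpa [Embeds] using H.emb
      have := congrArg (· * (1 - cI * ∂ᵤ φ)⁻¹) e
      simpa only [mul_assoc, hu, mul_one] using this

/-! ### Universal analytic functions of the data -/

/-- The strongly nondegenerate structures with an extended adapted frame of signature `s`. -/
structure Framed (n s : ℕ) where
  L : FormalACR n
  nondeg : L.StronglyNondegenerate
  F : ExtFrame L s

/-- The values of the data of a structure with a frame. -/
abbrev Framed.data (x : Framed n s) (S : Finset (Var n →₀ ℕ)) : DataSpace n S := dataOf S x.F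

/-- The functions given by a universal real-analytic function of finitely many data. -/
def IsUniv {E : Type*} [NormedAddCommGroup E] [NormedSpace ℝ E] (Q : Framed n s → E) : Prop :=
  ∃ (S : Finset (Var n →₀ ℕ)) (Φ : DataSpace n S → E),
    AnalyticOnNhd ℝ Φ (admissibleData n s S) ∧ ∀ x, Q x = Φ (x.data S)

theorem analyticOnNhd_of_isLinearMap {E E' : Type*} [NormedAddCommGroup E] [NormedSpace ℝ E]
    [FiniteDimensional ℝ E] [NormedAddCommGroup E'] [NormedSpace ℝ E'] {f : E → E'}
    (hf : IsLinearMap ℝ f) (t : Set E) : AnalyticOnNhd ℝ f t :=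
  (LinearMap.toContinuousLinearMap (hf.mk' f)).analyticOnNhd t

/-- The restriction of the data to fewer derivatives. -/
def resData {S S' : Finset (Var n →₀ ℕ)} (h : S ⊆ S') (y : DataSpace n S') : DataSpace n S :=
  ((fun m => y.1.1 ⟨m, h m.2⟩, fun m => y.1.2 ⟨m, h m.2⟩), y.2)

theorem isLinearMap_resData {S S' : Finset (Var n →₀ ℕ)} (h : S ⊆ S') :
    IsLinearMap ℝ (resData (n := n) h) := ⟨fun _ _ => rfl, fun _ _ => rfl⟩

/-- Restriction maps admissible data to admissible data of the same framed structure, so functions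
of different finite sets of derivatives can be combined over the union. -/
theorem analyticOnNhd_comp_resData {E : Type*} [NormedAddCommGroup E] [NormedSpace ℝ E]
    {S S' : Finset (Var n →₀ ℕ)} (h : S ⊆ S') {Φ : DataSpace n S → E}
    (hΦ : AnalyticOnNhd ℝ Φ (admissibleData n s S)) :
    AnalyticOnNhd ℝ (fun y => Φ (resData h y)) (admissibleData n s S') := by
  refine hΦ.comp (analyticOnNhd_of_isLinearMap (isLinearMap_resData h) _) ?_
  rintro _ ⟨L, hL, F, rfl⟩
  exact ⟨L, hL, F, rfl⟩

section Univ

variable {E E' : Type*} [NormedAddCommGroup E] [NormedSpace ℝ E] [NormedAddCommGroup E']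
  [NormedSpace ℝ E']

/-- Every admissible point is the data of a framed structure, so control of the values of Q suffices
to compose near the whole admissible set. -/
theorem IsUniv.comp {Q : Framed n s → E} (hQ : IsUniv Q) (G : E → E') (t : Set E)
    (hG : AnalyticOnNhd ℝ G t) (ht : ∀ x, Q x ∈ t) : IsUniv fun x => G (Q x) := by
  obtain ⟨S, Φ, hΦ, h⟩ := hQ
  refine ⟨S, fun y => G (Φ y), hG.comp hΦ ?_, fun x => congrArg G (h x)⟩
  rintro _ ⟨L, hL, F, rfl⟩
  have := h ⟨L, hL, F⟩
  change Φ (dataOf S F) ∈ t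
  rw [← this]
  exact ht _

theorem IsUniv.prod {Q : Framed n s → E} {R : Framed n s → E'} (hQ : IsUniv Q) (hR : IsUniv R) :
    IsUniv fun x => (Q x, R x) := by
  classical
  obtain ⟨S, Φ, hΦ, h⟩ := hQ
  obtain ⟨S', Ψ, hΨ, h'⟩ := hR
  exact ⟨S ∪ S', fun y => (Φ (resData Finset.subset_union_left y),
    Ψ (resData Finset.subset_union_right y)),
    (analyticOnNhd_comp_resData _ hΦ).prod (analyticOnNhd_comp_resData _ hΨ),
    fun x => Prod.ext (h x) (h' x)⟩

theorem IsUniv.pi {ι : Type*} [Fintype ι] {Q : ι → Framed n s → E} (hQ : ∀ i, IsUniv (Q i)) :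
    IsUniv fun x i => Q i x := by
  classical
  choose S Φ hΦ h using hQ
  have hs (i : ι) : S i ⊆ Finset.univ.biUnion S :=
    Finset.subset_biUnion_of_mem S (Finset.mem_univ i)
  exact ⟨Finset.univ.biUnion S, fun y i => Φ i (resData (hs i) y),
    AnalyticOnNhd.pi fun i => analyticOnNhd_comp_resData _ (hΦ i),
    fun x => funext fun i => h i x⟩

end Univ

/-- The algebra of the universal analytic functions. -/
def univAlg (n s : ℕ) : CoeffAlg (Framed n s) where
  carrier :=
    { carrier := {Q | IsUniv Q}
      mul_mem' := fun {P Q} hP hQ => (hP.prod hQ).comp (fun y => y.1 * y.2) Set.univ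
        (analyticOnNhd_fst.mul analyticOnNhd_snd) fun _ => trivial
      add_mem' := fun {P Q} hP hQ => (hP.prod hQ).comp (fun y => y.1 + y.2) Set.univ
        (analyticOnNhd_fst.add analyticOnNhd_snd) fun _ => trivial
      algebraMap_mem' := fun c => ⟨∅, fun _ => c, analyticOnNhd_const, fun _ => rfl⟩ }
  -- Conjugation is only real-linear; this is why the analyticity is over ℝ.
  conj_mem := fun hQ => IsUniv.comp hQ _ Set.univ
    (analyticOnNhd_of_isLinearMap (f := fun z : ℂ => conj z)
      ⟨fun _ _ => map_add _ _ _, fun c z => by simp⟩ _) fun _ => trivial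
  inv_mem := fun hQ h => IsUniv.comp hQ _ {z | z ≠ 0}
    (analyticOnNhd_id.inv fun _ hz => hz) h

theorem isUniv_of_isLinearMap (S : Finset (Var n →₀ ℕ)) {f : DataSpace n S → ℂ}
    (hf : IsLinearMap ℝ f) : (univAlg n s).Sc fun x => f (x.data S) :=
  ⟨S, f, analyticOnNhd_of_isLinearMap hf _, fun _ => rfl⟩

theorem Sc_coeff_of_partialAt {P : Framed n s → Ser n} {m : Var n →₀ ℕ}
    (h : (univAlg n s).Sc fun x => (P x).partialAt m) : (univAlg n s).Sc fun x => coeff m (P x) := by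
  have h0 : (m.prod fun _ k => (Nat.factorial k : ℂ)) ≠ 0 :=
    Finset.prod_ne_zero_iff.2 fun i _ => Nat.cast_ne_zero.2 (m i).factorial_ne_zero
  have := (CoeffAlg.Sc.const (m.prod fun _ k => (Nat.factorial k : ℂ))⁻¹).mul h
  simpa [Ser.partialAt, h0] using this

theorem isFam_L : FormalACR.IsFam (univAlg n s) fun x => x.L :=
  ⟨fun k j m => Sc_coeff_of_partialAt (isUniv_of_isLinearMap {m}
    (f := fun y => y.1.1 ⟨m, Finset.mem_singleton_self m⟩ k j) ⟨fun _ _ => rfl, fun _ _ => rfl⟩),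
  fun j m => Sc_coeff_of_partialAt (isUniv_of_isLinearMap {m}
    (f := fun y => y.1.2 ⟨m, Finset.mem_singleton_self m⟩ j) ⟨fun _ _ => rfl, fun _ _ => rfl⟩)⟩

/-- The parameters are all framed structures of signature s. The partial derivatives of L and the
frame components are real-linear functions of the data, so the family version of existence yields
the universal functions. -/
theorem exists_univ_isNorm (hn : 1 ≤ n) (s : ℕ) (T : Bool) :
    ∃ (h : Framed n s → FormalMap n) (L' : Framed n s → FormalACR n) (φ : Framed n s → Ser n),
      (∀ m, IsUniv fun x => ((h x).partials m, (L' x).partials m)) ∧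
      (∀ m, IsUniv fun x => (φ x).partialAt m) ∧ ∀ x, IsNorm T x.F (h x) (L' x) (φ x) ∧
        ∀ h₂ L₂ φ₂, IsNorm T x.F h₂ L₂ φ₂ → h x = h₂ ∧ L' x = L₂ ∧ φ x = φ₂ := by
  obtain ⟨h, L', φ, hh, hL', hφ, H⟩ := exists_isNorm hn T isFam_L (fun x => x.nondeg) (fun x => x.F)
    (fun j l => isUniv_of_isLinearMap ∅ (f := fun y => y.2.1 j l) ⟨fun _ _ => rfl, fun _ _ => rfl⟩)
    (fun l => isUniv_of_isLinearMap ∅ (f := fun y => y.2.2.1.1 l) ⟨fun _ _ => rfl, fun _ _ => rfl⟩)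
    (isUniv_of_isLinearMap ∅ (f := fun y => (y.2.2.1.2 : ℂ))
      ⟨fun _ _ => Complex.ofReal_add _ _, fun _ _ => by simp⟩)
    (isUniv_of_isLinearMap ∅ (f := fun y => (y.2.2.2 : ℂ))
      ⟨fun _ _ => Complex.ofReal_add _ _, fun _ _ => by simp⟩)
  have part {P : Framed n s → Ser n} (hP : (univAlg n s).IsSer P) (m : Var n →₀ ℕ) :
      IsUniv fun x => (P x).partialAt m := (CoeffAlg.Sc.const _).mul (hP m)
  exact ⟨h, L', φ, fun m => ((IsUniv.pi fun l => part (hh.1 l) m).prod (part hh.2 m)).prod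
    ((IsUniv.pi fun k => IsUniv.pi fun j => part (hL'.1 k j) m).prod
      (IsUniv.pi fun j => part (hL'.2 j) m)), fun m => part hφ m, H⟩

end

end AlmostCR

end

open AlmostCR in
theorem theorem9p1 (n s : ℕ) (hn : 1 ≤ n) :
    -- existence and uniqueness, in the intrinsic and in the extrinsic form
    (∀ L : FormalACR n, L.StronglyNondegenerate → ∀ F : ExtFrame L s,
      (∃! h : FormalMap n, ∃ L' : FormalACR n, IsIntrinsicNormalization F h L') ∧
      (∃! h : FormalMap n, ∃ (L' : FormalACR n) (φ : Ser n),
        IsExtrinsicNormalization F h L' φ)) ∧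
    -- universal real-analytic dependence of all partial derivatives, in the intrinsic form
    (∀ m : Var n →₀ ℕ, ∃ (S : Finset (Var n →₀ ℕ))
      (Φ : DataSpace n S → ((Fin n → ℂ) × ℂ) × ((Fin n → Fin n → ℂ) × (Fin n → ℂ))),
      AnalyticOnNhd ℝ Φ (admissibleData n s S) ∧
      ∀ L : FormalACR n, L.StronglyNondegenerate → ∀ (F : ExtFrame L s)
        (h : FormalMap n) (L' : FormalACR n), IsIntrinsicNormalization F h L' →
        (h.partials m, L'.partials m) = Φ (dataOf S F)) ∧
    -- and in the extrinsic form
    (∀ m : Var n →₀ ℕ, ∃ (S : Finset (Var n →₀ ℕ))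
      (Φ : DataSpace n S → ((Fin n → ℂ) × ℂ) × ((Fin n → Fin n → ℂ) × (Fin n → ℂ)) × ℂ),
      AnalyticOnNhd ℝ Φ (admissibleData n s S) ∧
      ∀ L : FormalACR n, L.StronglyNondegenerate → ∀ (F : ExtFrame L s)
        (h : FormalMap n) (L' : FormalACR n) (φ : Ser n), IsExtrinsicNormalization F h L' φ →
        (h.partials m, L'.partials m, φ.partialAt m) = Φ (dataOf S F)) := by
  simp only [isIntrinsicNormalization_iff, isExtrinsicNormalization_iff]
  obtain ⟨h, L', φ, hu, -, H⟩ := exists_univ_isNorm hn s false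
  obtain ⟨h', L'', φ', hu', hφ', H'⟩ := exists_univ_isNorm hn s true
  refine ⟨fun L hL F => ⟨⟨h ⟨L, hL, F⟩, ⟨_, _, (H ⟨L, hL, F⟩).1⟩, ?_⟩,
    ⟨h' ⟨L, hL, F⟩, ⟨_, _, (H' ⟨L, hL, F⟩).1⟩, ?_⟩⟩, fun m => ?_, fun m => ?_⟩
  · rintro h₂ ⟨L₂, φ₂, h2⟩
    exact ((H ⟨L, hL, F⟩).2 _ _ _ h2).1.symm
  · rintro h₂ ⟨L₂, φ₂, h2⟩
    exact ((H' ⟨L, hL, F⟩).2 _ _ _ h2).1.symm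
  · obtain ⟨S, Φ, hΦ, e⟩ := hu m
    refine ⟨S, Φ, hΦ, ?_⟩
    -- The universal function was found for one family of normalizations; by uniqueness any
    -- normalization is the member of that family.
    rintro L hL F h₂ L₂ ⟨φ₂, h2⟩
    obtain ⟨rfl, rfl, -⟩ := (H ⟨L, hL, F⟩).2 _ _ _ h2
    exact e ⟨L, hL, F⟩
  · have hup : IsUniv fun x => ((h' x).partials m, (L'' x).partials m, (φ' x).partialAt m) :=
      ((hu' m).prod (hφ' m)).comp (fun y => (y.1.1, y.1.2, y.2)) Set.univ
        (analyticOnNhd_of_isLinearMap ⟨fun _ _ => rfl, fun _ _ => rfl⟩ _) fun _ => trivial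
    obtain ⟨S, Φ, hΦ, e⟩ := hup
    refine ⟨S, Φ, hΦ, ?_⟩
    rintro L hL F h₂ L₂ φ₂ h2
    obtain ⟨rfl, rfl, rfl⟩ := (H' ⟨L, hL, F⟩).2 _ _ _ h2
    exact e ⟨L, hL, F⟩
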